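/- **Setting.** Fix $T,P>0$ and $I\in\mathbb N$; let $\mathbb T_P=[-P/2,P/2]^3$; "periodic" means $P$-periodic in each coordinate of $x\in\mathbb R^3$. The data are periodic: a force $f\in L^2((0,T)\times\mathbb T_P;\mathbb R^3)$, an initial velocity $u_0\in L^2(\mathbb T_P;\mathbb R^3)$, and measurable initial concentrations $\chi_{i0}\ge 0$ ($1\le i\le I$) with $\sum_i\chi_{i0}=1$ a.e. For $\mu=(\mu_0,\dots,\mu_I)$ with $\mu_j\ge0$ consider $$\partial_t u+\nabla\cdot(u\otimes u)+\nabla p=\mu_0\Delta u+f,\qquad \partial_t\chi_i+\nabla\cdot(\chi_i u)=\mu_i\Delta\chi_i\ (1\le i\le I),\qquad \nabla\cdot u=0, \tag{$S_\mu$}$$ with $(u,\chi_1,\dots,\chi_I)|_{t=0}=(u_0,\chi_{10},\dots,\chi_{I0})$. Equations and inequalities "in the sense of distributions on $[0,T)\times\mathbb R^3$" are tested with $\varphi\in C_c^\infty([0,T)\times\mathbb R^3)$ ($\varphi\ge0$ for inequalities) and include the contribution of the initial values at $t=0$. A *weak solution* of $(S_\mu)$ is a periodic triple $(u,p,\chi)$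 with $u,\chi_i\in L^2((0,T)\times\mathbb T_P)$ and $p\in L^1((0,T)\times\mathbb T_P)$ that satisfies $(S_\mu)$ with its Cauchy data in this sense. When all $\mu_j>0$, it is called *admissible* if moreover $u,\chi_i\in L^2(0,T;H^1(\mathbb T_P))$, $u(\tfrac12|u|^2+p)\in L^1((0,T)\times\mathbb T_P)$, and, in the sense of distributions on $[0,T)\times\mathbb R^3$, $$\partial_t\tfrac{|u|^2}{2}+\nabla\cdot\big(u(\tfrac{|u|^2}{2}+p)\big)+\mu_0|\nabla u|^2-\mu_0\Delta\tfrac{|u|^2}{2}\le f\cdot u\quad\text{(initial value } \tfrac12|u_0|^2),$$ $$\partial_t\beta(\chi_i)+\nabla\cdot(u\,\beta(\chi_i))\le\mu_i\Delta\beta(\chi_i)\quad\text{(initial value } \beta(\chi_{i0}))$$ for every $i$ and every $\beta\in C^2(\mathbb R)$ with $\beta''\ge0$ for which $\beta(\chi_i)$ and $u\,\beta(\chi_i)$ are integrable on $(0,T)\times\mathbb T_P$. Let $\mu^n=(\mu^n_0,\dots,\mu^n_I)$ with all $\mu^n_j>0$ and $\mu^n\to0$, and let $(u^n,p^n,\chi^n)$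 be admissible weak solutions of $(S_{\mu^n})$ with the same data $f,u_0,\chi_{i0}$. **Assumption (K41w).** There are $\gamma>0$, $C>0$ and $k_*$, independent of $n$, such that for all $n$ and all $k\in\frac{2\pi}{P}\mathbb Z^3$ with $|k|\ge k_*$, $$|k|^{3+\gamma}\int_0^T|\hat u^n(t,k)|^2\,dt\le C,\qquad \hat u^n(t,k)=\frac1{P^3}\int_{\mathbb T_P}u^n(t,x)e^{-ik\cdot x}\,dx .$$ **Theorem.** Under (K41w), $0\le\chi_i^n\le1$ a.e. on $(0,T)\times\mathbb T_P$ for all $n$ and $i$, and there are $q>2$, one subsequence (not relabelled), functions $u\in L^2\cap L^q((0,T)\times\mathbb T_P)$, $p\in L^1((0,T)\times\mathbb T_P)$ and $\chi_1,\dots,\chi_I$ with $0\le\chi_i\le1$ a.e., and measurable, periodic families $\nu^i_{t,x}$ of probability measures carried by $[0,1]$ such that: 1. $u^n\to u$ in $L^2((0,T)\times\mathbb T_P)$ and in $L^q((0,T)\times\mathbb T_P)$; 2. $\chi_i^n\to\chi_i$ weak-$*$ in $L^\infty((0,T)\times\mathbb T_P)$ for each $i$; 3. $(u,p,\chi)$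 is a weak solution of the inviscid system $(S_0)$ with Cauchy data $(u_0,\chi_{10},\dots,\chi_{I0})$; 4. (for a suitable representative of $u$) for every $t\in[0,T)$, $u(t,\cdot)\in L^2(\mathbb T_P)$ and $$\int_{\mathbb T_P}|u(t,x)|^2dx\le\int_{\mathbb T_P}|u_0(x)|^2dx+2\int_0^t\!\int_{\mathbb T_P}u(s,x)\cdot f(s,x)\,dx\,ds;$$ 5. for each $i$, $\nu^i$ is the Young measure of $(\chi_i^n)_n$: for every continuous $\beta:\mathbb R\to\mathbb R$ (in particular every $C^2$ one), $\beta(\chi_i^n)\to\overline{\beta(\chi_i)}:=\langle\nu^i_{t,x},\beta\rangle$ weak-$*$ in $L^\infty((0,T)\times\mathbb T_P)$; 6. for each $i$ and each $\beta\in C^2(\mathbb R)$ with $\beta''\ge0$, $$\partial_t\overline{\beta(\chi_i)}+\nabla\cdot\big(\overline{\beta(\chi_i)}\,u\big)\le0$$ in the sense of distributions on $[0,T)\times\mathbb R^3$, with initial value $\beta(\chi_{i0})$. -/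

import Mathlib

open MeasureTheory ProbabilityTheory Set Filter Topology
open scoped ContDiff

noncomputable section

namespace PassiveScalar

/-- Physical space with the Euclidean norm. Space-time is `ℝ × E3`, time first. -/
abbrev E3 := EuclideanSpace ℝ (Fin 3)

/-- The canonical basis vector of `E3`. -/
def e (i : Fin 3) : E3 := EuclideanSpace.single i (1 : ℝ)

/-- The period cell `[-P/2, P/2]³`. -/
def cell (P : ℝ) : Set E3 := {x | ∀ i, x i ∈ Icc (-P / 2) (P / 2)}

/-- Lebesgue measure on the cell. -/
def cellMeasure (P : ℝ) : Measure E3 := volume.restrict (cell P)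

/-- Lebesgue measure on `(0,T) ×` cell; the spaces `L^r([0,T) × 𝕋_P)` are taken for it. -/
def cylMeasure (T P : ℝ) : Measure (ℝ × E3) := volume.restrict (Ioo 0 T ×ˢ cell P)

/-- Lebesgue measure on `(0,T) × ℝ³`. -/
def slabMeasure (T : ℝ) : Measure (ℝ × E3) := volume.restrict (Ioo 0 T ×ˢ univ)

/-- Periodicity of a function of `x` with period `P` in each coordinate. -/
def PeriodicX {α : Type*} (P : ℝ) (g : E3 → α) : Prop :=
  ∀ x i, g (x + P • e i) = g x

/-- Periodicity in `x` of a function of `(t,x)`. -/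
def PeriodicTX {α : Type*} (P : ℝ) (g : ℝ × E3 → α) : Prop :=
  ∀ t, PeriodicX P fun x => g (t, x)

/-- Test functions `C_c^∞([0,T) × ℝ³)`: restrictions to `t ≥ 0` of smooth functions with compact
support contained in `{t < T}`. They need not vanish at `t = 0`. -/
structure IsTest (T : ℝ) (φ : ℝ × E3 → ℝ) : Prop where
  smooth : ContDiff ℝ ∞ φ
  compact : HasCompactSupport φ
  support : tsupport φ ⊆ Iio T ×ˢ univ

/-- Time derivative. -/
def dt (φ : ℝ × E3 → ℝ) (z : ℝ × E3) : ℝ := fderiv ℝ φ z (1, 0)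

/-- Space derivative in direction `i`. -/
def dx (i : Fin 3) (φ : ℝ × E3 → ℝ) (z : ℝ × E3) : ℝ := fderiv ℝ φ z (0, e i)

/-- Laplacian in the space variables. -/
def lap (φ : ℝ × E3 → ℝ) (z : ℝ × E3) : ℝ := ∑ i, dx i (dx i φ) z

/-- `∂ₜu + ∇·(u ⊗ u) + ∇p = ν Δu + f`, `u|ₜ₌₀ = u₀`, in the sense of distributions on
`[0,T) × ℝ³`. -/
def MomentumEq (T ν : ℝ) (f : ℝ × E3 → E3) (u₀ : E3 → E3)
    (u : ℝ × E3 → E3) (p : ℝ × E3 → ℝ) : Prop :=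
  ∀ (j : Fin 3) (φ : ℝ × E3 → ℝ), IsTest T φ →
    (∫ z, (u z j * dt φ z + (∑ i, u z i * u z j * dx i φ z) + p z * dx j φ z
        + ν * (u z j * lap φ z) + f z j * φ z) ∂(slabMeasure T))
      + ∫ x, u₀ x j * φ (0, x) = 0

/-- `∇·u = 0` in the sense of distributions. -/
def DivFree (T : ℝ) (u : ℝ × E3 → E3) : Prop :=
  ∀ φ : ℝ × E3 → ℝ, IsTest T φ → ∫ z, (∑ i, u z i * dx i φ z) ∂(slabMeasure T) = 0

/-- `∂ₜc + ∇·(c u) = κ Δc`, `c|ₜ₌₀ = c₀`, in the sense of distributions on `[0,T) × ℝ³`. -/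
def ScalarEq (T κ : ℝ) (u : ℝ × E3 → E3) (c₀ : E3 → ℝ) (c : ℝ × E3 → ℝ) : Prop :=
  ∀ φ : ℝ × E3 → ℝ, IsTest T φ →
    (∫ z, (c z * dt φ z + (∑ j, c z * u z j * dx j φ z) + κ * (c z * lap φ z)) ∂(slabMeasure T))
      + ∫ x, c₀ x * φ (0, x) = 0

/-- `∂ₜb + ∇·(b u) ≤ κ Δb`, `b|ₜ₌₀ = b₀`, in the sense of distributions on `[0,T) × ℝ³`. -/
def ScalarIneq (T κ : ℝ) (u : ℝ × E3 → E3) (b₀ : E3 → ℝ) (b : ℝ × E3 → ℝ) : Prop :=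
  ∀ φ : ℝ × E3 → ℝ, IsTest T φ → (∀ z, 0 ≤ φ z) →
    0 ≤ (∫ z, (b z * dt φ z + (∑ j, b z * u z j * dx j φ z) + κ * (b z * lap φ z))
          ∂(slabMeasure T))
      + ∫ x, b₀ x * φ (0, x)

/-- `G` is the weak space gradient of `g`, and is periodic and in `L²((0,T) × 𝕋_P)`. -/
structure HasL2Gradient (T P : ℝ) (g : ℝ × E3 → ℝ) (G : Fin 3 → ℝ × E3 → ℝ) : Prop where
  periodic : ∀ i, PeriodicTX P (G i)
  memLp : ∀ i, MemLp (G i) 2 (cylMeasure T P)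
  weak : ∀ (i : Fin 3) (φ : ℝ × E3 → ℝ), IsTest T φ →
    ∫ z, g z * dx i φ z ∂(slabMeasure T) = -∫ z, G i z * φ z ∂(slabMeasure T)

/-- The local energy inequality
`∂ₜ(|u|²/2) + ∇·(u(|u|²/2 + p)) + ν|∇u|² - ν Δ(|u|²/2) ≤ f·u`, with initial value `|u₀|²/2`,
in the sense of distributions on `[0,T) × ℝ³`. Here `D j i = ∂ᵢuⱼ`. -/
def LocalEnergyIneq (T ν : ℝ) (f : ℝ × E3 → E3) (u₀ : E3 → E3)
    (u : ℝ × E3 → E3) (D : Fin 3 → Fin 3 → ℝ × E3 → ℝ) (p : ℝ × E3 → ℝ) : Prop :=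
  ∀ φ : ℝ × E3 → ℝ, IsTest T φ → (∀ z, 0 ≤ φ z) →
    0 ≤ (∫ z, (‖u z‖ ^ 2 / 2 * dt φ z + (∑ i, (‖u z‖ ^ 2 / 2 + p z) * u z i * dx i φ z)
          - ν * ((∑ j, ∑ i, D j i z ^ 2) * φ z) + ν * (‖u z‖ ^ 2 / 2 * lap φ z)
          + inner ℝ (f z) (u z) * φ z) ∂(slabMeasure T))
      + ∫ x, ‖u₀ x‖ ^ 2 / 2 * φ (0, x)

/-- Periodic data: a square-integrable initial velocity and force, and initial concentrations
`χ_{i0} ≥ 0` with `∑ᵢ χ_{i0} = 1`. -/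
structure IsData (T P : ℝ) {I : ℕ} (f : ℝ × E3 → E3) (u₀ : E3 → E3)
    (χ₀ : Fin I → E3 → ℝ) : Prop where
  force_periodic : PeriodicTX P f
  force_memLp : MemLp f 2 (cylMeasure T P)
  vel_periodic : PeriodicX P u₀
  vel_memLp : MemLp u₀ 2 (cellMeasure P)
  scalar_periodic : ∀ i, PeriodicX P (χ₀ i)
  scalar_measurable : ∀ i, AEStronglyMeasurable (χ₀ i) (cellMeasure P)
  scalar_nonneg : ∀ i, ∀ᵐ x ∂(cellMeasure P), 0 ≤ χ₀ i x
  scalar_sum : ∀ᵐ x ∂(cellMeasure P), ∑ i, χ₀ i x = 1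

/-- `(u, p, χ)` is a periodic weak solution on `[0,T)` of
`∂ₜu + ∇·(u ⊗ u) + ∇p = μ₀ Δu + f`, `∂ₜχᵢ + ∇·(χᵢ u) = μᵢ Δχᵢ` (`i = 1, …, I`), `∇·u = 0`
with Cauchy data `(u₀, χ₀)`. The case `μ = 0` is the inviscid system.
The entry `μ 0` is the viscosity, and `μ i.succ` is the diffusivity of the scalar `χ i`. -/
structure IsWeakSolution (T P : ℝ) {I : ℕ} (μ : Fin (I + 1) → ℝ) (f : ℝ × E3 → E3)
    (u₀ : E3 → E3) (χ₀ : Fin I → E3 → ℝ)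
    (u : ℝ × E3 → E3) (p : ℝ × E3 → ℝ) (χ : Fin I → ℝ × E3 → ℝ) : Prop where
  vel_periodic : PeriodicTX P u
  vel_memLp : MemLp u 2 (cylMeasure T P)
  pressure_periodic : PeriodicTX P p
  pressure_integrable : Integrable p (cylMeasure T P)
  scalar_periodic : ∀ i, PeriodicTX P (χ i)
  scalar_memLp : ∀ i, MemLp (χ i) 2 (cylMeasure T P)
  momentum : MomentumEq T (μ 0) f u₀ u p
  divFree : DivFree T u
  scalar : ∀ i, ScalarEq T (μ i.succ) u (χ₀ i) (χ i)

/-- The weak solutions of the viscous system that are considered: `u` and `χᵢ` lie in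
`L²(0,T; H¹)`, the local energy inequality holds, and
`∂ₜβ(χᵢ) + ∇·(u β(χᵢ)) ≤ μᵢ Δβ(χᵢ)` holds for the convex `C²` functions `β` for which the
terms are locally integrable (all of them, once `χᵢ` is bounded). The bounds `0 ≤ χᵢ ≤ 1` are not
part of the definition. -/
structure IsViscousSolution (T P : ℝ) {I : ℕ} (μ : Fin (I + 1) → ℝ) (f : ℝ × E3 → E3)
    (u₀ : E3 → E3) (χ₀ : Fin I → E3 → ℝ)
    (u : ℝ × E3 → E3) (p : ℝ × E3 → ℝ) (χ : Fin I → ℝ × E3 → ℝ) : Prop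
    extends IsWeakSolution T P μ f u₀ χ₀ u p χ where
  scalar_gradient : ∀ i, ∃ G, HasL2Gradient T P (χ i) G
  flux_integrable : ∀ i, Integrable (fun z => (‖u z‖ ^ 2 / 2 + p z) * u z i) (cylMeasure T P)
  energy : ∃ D : Fin 3 → Fin 3 → ℝ × E3 → ℝ,
    (∀ j, HasL2Gradient T P (fun z => u z j) (D j)) ∧ LocalEnergyIneq T (μ 0) f u₀ u D p
  entropy : ∀ (i : Fin I) (β : ℝ → ℝ), ContDiff ℝ 2 β → (∀ s, 0 ≤ iteratedDeriv 2 β s) →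
    Integrable (fun z => β (χ i z)) (cylMeasure T P) →
    (∀ j, Integrable (fun z => β (χ i z) * u z j) (cylMeasure T P)) →
    ScalarIneq T (μ i.succ) u (fun x => β (χ₀ i x)) (fun z => β (χ i z))

/-- The wavevector `(2π/P) m`, `m ∈ ℤ³`. -/
def wave (P : ℝ) (m : Fin 3 → ℤ) : E3 := WithLp.toLp 2 fun i => 2 * Real.pi / P * (m i : ℝ)

/-- The Fourier coefficient `|𝕋_P|⁻¹ ∫_{𝕋_P} g(x) exp(-i k·x) dx`. -/
def fourierCoef (P : ℝ) (g : E3 → ℝ) (k : E3) : ℂ :=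
  ((P ^ 3)⁻¹ : ℝ) * ∫ x, (g x : ℂ) * Complex.exp (-(Complex.I * ((inner ℝ k x : ℝ) : ℂ)))
    ∂(cellMeasure P)

/-- `|û(t,k)|²`. -/
def modeEnergy (P : ℝ) (u : ℝ × E3 → E3) (k : E3) (t : ℝ) : ℝ :=
  ∑ j, ‖fourierCoef P (fun x => u (t, x) j) k‖ ^ 2

/-- The weak pathwise Kolmogorov hypothesis on `[0,T]` for a sequence of velocities: the exponent
`β > 0`, the bound `C` and the threshold `kstar` do not depend on the member of the sequence. -/
def K41w (T P : ℝ) (u : ℕ → ℝ × E3 → E3) : Prop :=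
  ∃ β > (0 : ℝ), ∃ C > (0 : ℝ), ∃ kstar : ℝ, ∀ (n : ℕ) (m : Fin 3 → ℤ), kstar ≤ ‖wave P m‖ →
    ‖wave P m‖ ^ (3 + β) * (∫ t in Ioo 0 T, modeEnergy P (u n) (wave P m) t) ≤ C

/-- Weak-star convergence in `L^∞(m)`, as the dual of `L¹(m)`. -/
def TendstoWeakStar (m : Measure (ℝ × E3)) (g : ℕ → ℝ × E3 → ℝ) (g' : ℝ × E3 → ℝ) : Prop :=
  ∀ h : ℝ × E3 → ℝ, Integrable h m →
    Tendsto (fun n => ∫ z, g n z * h z ∂m) atTop (𝓝 (∫ z, g' z * h z ∂m))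

/-- `ν` is the Young measure of the `[0,1]`-valued periodic sequence `v`: a measurable periodic
family of probability measures carried by `[0,1]` such that `β(v n)` converges weak-star to
`⟨ν, β⟩` for every continuous `β`. -/
structure IsYoungMeasure (T P : ℝ) (v : ℕ → ℝ × E3 → ℝ) (ν : Kernel (ℝ × E3) ℝ) : Prop where
  markov : IsMarkovKernel ν
  periodic : PeriodicTX P fun z => ν z
  carried : ∀ z, ν z (Icc 0 1)ᶜ = 0
  tendsto : ∀ β : ℝ → ℝ, Continuous β →
    TendstoWeakStar (cylMeasure T P) (fun n z => β (v n z)) (fun z => ∫ s, β s ∂(ν z))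

end PassiveScalar

end

open PassiveScalar

noncomputable section

open scoped ENNReal Pointwise

namespace PassiveScalar

/-! The spectral hypothesis is a compactness statement in space. By Parseval on the cell, the
squared L² distance between a velocity and its translate by y is the sum over modes k of |exp(ik·y)
- 1|² times the mode energy. Bounding the first factor by 4|k|^(2s)|y|^(2s) and the second by
C|k|^(-3-γ) for large |k|, the sum over the three-dimensional dual lattice converges as soon as 2s <
γ, and the low modes are controlled by the energy. So `K41w.exists_translate_le` gives a modulus
C|y|^(2s) that is uniform in the viscosity.

Global estimates come from testing with a function of time times the mollified indicator of the cell
(`exists_cell_cutoff`): for periodic functions this cutoff integrates exactly like the cell, and its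
derivatives integrate to zero, so fluxes and Laplacians disappear. The local energy inequality
becomes the global one, since the dissipation has a sign, and bounds the energy uniformly in time.
The inequalities for convex functions of the concentrations give the maximum principle, with β a
smooth ramp vanishing on [0,1] and growing linearly.

The pressure solves -Δp = ∂ₐ∂_b(uₐu_b) - ∇·f, and the force cancels in the difference of two
pressures. The products are only in L¹, where singular integrals are unbounded, but the modulus
makes them Dini continuous in space. `exists_laplacian_kernel` gives compactly supported Θ and H for
which -ΔH is Θ minus its dilation by two. A mean-zero pressure is then telescoped over dyadic
scales: each increment is a convolution of the products with a kernel of integral zero, bounded by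
the modulus at that scale, and the largest scale contributes at most half of the norm and is
absorbed. The outcome, `exists_lintegral_pressure_sub_le`, bounds the L¹ distance of two pressures
by a series of minima of the modulus at scale 2^(-i) and the L² distance of the velocities. It first
bounds the pressures, and later makes them converge.

Compactness in time is an Aubin-Lions argument done by hand. Mollified velocities have time
derivatives bounded in L¹, so they are close to their averages over short time windows; those
averages converge pointwise along a weakly convergent subsequence; and mollification costs little,
by the modulus. Thus `exists_subseq_cauchy` yields L² convergence. For some q > 2, a decomposition
into levels 8^j, each compared with the mollification at scale 4^(-j), bounds the velocities in
L^(2+s) (`exists_lintegral_rpow_le`), and interpolation with L² convergence finishes.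

The concentrations, with values in [0,1], have a Young measure: take a weak limit of the measures
carried by their graphs and disintegrate it. Strong convergence of the velocities passes to the
limit in u ⊗ u and in the products β(χ)u, and the diffusive terms vanish with their coefficients.
The energy inequality passes to the limit at almost every time. At the exceptional times the limit
velocity is redefined to be zero, which is harmless because the right-hand side is continuous in
time and therefore nonnegative everywhere. -/

/-! ### The period cell -/

/-- The half-open period cell. -/
def halfCell (P : ℝ) : Set E3 := {x | ∀ i, x i ∈ Ico (-P / 2) (P / 2)}

lemma measurableSet_cell (P : ℝ) : MeasurableSet (cell P) := by
  have : cell P = ⋂ i : Fin 3, (fun x : E3 => x i) ⁻¹' Icc (-P / 2) (P / 2) := by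
    ext x; simp [cell]
  rw [this]
  exact MeasurableSet.iInter fun i => (by fun_prop : Measurable fun x : E3 => x i) measurableSet_Icc

lemma measurableSet_halfCell (P : ℝ) : MeasurableSet (halfCell P) := by
  have : halfCell P = ⋂ i : Fin 3, (fun x : E3 => x i) ⁻¹' Ico (-P / 2) (P / 2) := by
    ext x; simp [halfCell]
  rw [this]
  exact MeasurableSet.iInter fun i => (by fun_prop : Measurable fun x : E3 => x i) measurableSet_Ico

lemma cell_eq_preimage (P : ℝ) : cell P = (MeasurableEquiv.toLp 2 (Fin 3 → ℝ)).symm ⁻¹'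
    (Set.pi univ fun _ => Icc (-P / 2) (P / 2)) := by
  ext x; simp only [cell, mem_ofPred_eq, mem_preimage, mem_univ_pi]; rfl

lemma halfCell_eq_preimage (P : ℝ) : halfCell P = (MeasurableEquiv.toLp 2 (Fin 3 → ℝ)).symm ⁻¹'
    (Set.pi univ fun _ => Ico (-P / 2) (P / 2)) := by
  ext x; simp [halfCell]

lemma volume_cell {P : ℝ} (hP : 0 < P) : volume (cell P) = ENNReal.ofReal (P ^ 3) := by
  rw [cell_eq_preimage, (EuclideanSpace.volume_preserving_symm_measurableEquiv_toLp
    (Fin 3)).measure_preimage_equiv, volume_pi_pi]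
  simp only [Real.volume_Icc, Finset.prod_const, Finset.card_univ, Fintype.card_fin]
  rw [← ENNReal.ofReal_pow (by linarith)]
  congr 2; ring

lemma halfCell_ae_eq_cell (P : ℝ) : halfCell P =ᵐ[volume] cell P := by
  rw [cell_eq_preimage, halfCell_eq_preimage]
  exact (EuclideanSpace.volume_preserving_symm_measurableEquiv_toLp
    (Fin 3)).quasiMeasurePreserving.preimage_ae_eq (by
      rw [pi_univ_Icc]
      exact Measure.univ_pi_Ico_ae_eq_Icc)

instance (P : ℝ) : IsFiniteMeasure (cellMeasure P) := by
  refine ⟨?_⟩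
  rw [cellMeasure, Measure.restrict_apply_univ, cell_eq_preimage,
    (EuclideanSpace.volume_preserving_symm_measurableEquiv_toLp
    (Fin 3)).measure_preimage_equiv]
  exact (isCompact_univ_pi fun _ => isCompact_Icc).measure_lt_top

lemma isCompact_cell (P : ℝ) : IsCompact (cell P) := by
  rw [cell_eq_preimage]
  have : ⇑(MeasurableEquiv.toLp 2 (Fin 3 → ℝ)).symm = (EuclideanSpace.equiv (Fin 3) ℝ) := rfl
  rw [this]
  exact (EuclideanSpace.equiv (Fin 3) ℝ).toHomeomorph.isCompact_preimage.2
    (isCompact_univ_pi fun _ => isCompact_Icc)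

lemma cylMeasure_eq_prod (T P : ℝ) :
    cylMeasure T P = (volume.restrict (Ioo 0 T)).prod (cellMeasure P) := by
  rw [cylMeasure, cellMeasure, Measure.prod_restrict]; rfl

lemma slabMeasure_eq_prod (T : ℝ) :
    slabMeasure T = (volume.restrict (Ioo 0 T)).prod (volume : Measure E3) := by
  rw [slabMeasure, ← Measure.restrict_univ (μ := (volume : Measure E3)), Measure.prod_restrict]
  simp [Measure.volume_eq_prod]

instance (T P : ℝ) : IsFiniteMeasure (cylMeasure T P) := by
  rw [cylMeasure_eq_prod]; infer_instance

instance (T : ℝ) : SFinite (slabMeasure T) := by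
  rw [slabMeasure]; infer_instance

/-- The basis of the period lattice. -/
def latticeBasis {P : ℝ} (hP : 0 < P) : Module.Basis (Fin 3) ℝ E3 :=
  Module.Basis.isUnitSMul (w := fun _ => P) (EuclideanSpace.basisFun (Fin 3) ℝ).toBasis
    fun _ => isUnit_iff_ne_zero.2 hP.ne'

lemma latticeBasis_apply {P : ℝ} (hP : 0 < P) (i : Fin 3) : latticeBasis hP i = P • e i := by
  simp [latticeBasis, Module.Basis.isUnitSMul_apply, e]

lemma latticeBasis_repr {P : ℝ} (hP : 0 < P) (x : E3) (i : Fin 3) :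
    (latticeBasis hP).repr x i = x i / P := by
  have h : x = ∑ j, (x j / P) • latticeBasis hP j := by
    ext k
    simp only [latticeBasis_apply, e, WithLp.ofLp_sum, WithLp.ofLp_smul, Finset.sum_apply,
      Pi.smul_apply, PiLp.ofLp_single, Pi.single_apply, smul_eq_mul]
    simp [hP.ne']
  conv_lhs => rw [h]
  simp [map_sum, Finsupp.single_apply]

/-- The period lattice. -/
abbrev lattice {P : ℝ} (hP : 0 < P) : AddSubgroup E3 :=
  (Submodule.span ℤ (range (latticeBasis hP))).toAddSubgroup

instance {P : ℝ} (hP : 0 < P) : Countable (lattice hP) :=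
  inferInstanceAs (Countable (Submodule.span ℤ (range (latticeBasis hP))))

lemma PeriodicX.add_lattice {α : Type*} {P : ℝ} (hP : 0 < P) {g : E3 → α} (hg : PeriodicX P g)
    {v : E3} (hv : v ∈ lattice hP) (x : E3) : g (x + v) = g x := by
  have hv' : v ∈ Submodule.span ℤ (range (latticeBasis hP)) := hv
  clear hv
  induction hv' using Submodule.span_induction generalizing x with
  | mem y hy =>
    obtain ⟨i, rfl⟩ := hy
    rw [latticeBasis_apply]; exact hg x i
  | zero => simp
  | add y z _ _ hy hz => rw [← add_assoc, hz, hy]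
  | smul a y _ hy =>
    induction a using Int.induction_on generalizing x with
    | zero => simp
    | succ n ih => rw [add_smul, one_smul, ← add_assoc, hy, ih]
    | pred n ih =>
      rw [sub_smul, one_smul, ← hy (x + _), add_assoc, sub_add_cancel, ih]

/-- Shifting by half a period in each coordinate carries this cell to the parallelepiped
`ZSpan.fundamentalDomain`, for which existence and uniqueness of the lattice representative are
known. -/
lemma isAddFundamentalDomain_halfCell {P : ℝ} (hP : 0 < P) :
    IsAddFundamentalDomain (lattice hP) (halfCell P) (volume : Measure E3) := by
  refine IsAddFundamentalDomain.mk' (measurableSet_halfCell P).nullMeasurableSet fun x => ?_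
  set c : E3 := WithLp.toLp 2 fun _ => P / 2
  have key : ∀ v : lattice hP, v +ᵥ x ∈ halfCell P ↔
      v +ᵥ (x + c) ∈ ZSpan.fundamentalDomain (latticeBasis hP) := by
    intro v
    simp only [halfCell, ZSpan.mem_fundamentalDomain, mem_ofPred_eq, latticeBasis_repr, mem_Ico]
    refine forall_congr' fun i => ?_
    have : (v +ᵥ (x + c)) i = (v +ᵥ x) i + P / 2 := by
      simp [AddSubgroup.vadd_def, c, add_assoc]
    rw [this, le_div_iff₀ hP, div_lt_iff₀ hP]
    constructor <;> rintro ⟨h1, h2⟩ <;> constructor <;> linarith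
  simp_rw [key]
  exact ZSpan.exist_unique_vadd_mem_fundamentalDomain _ _

/-- Translates of the closed cell overlap on faces, so the tiling holds only almost everywhere; it
is inherited from the half-open cell, which differs by a null set. -/
lemma isAddFundamentalDomain_cell {P : ℝ} (hP : 0 < P) :
    IsAddFundamentalDomain (lattice hP) (cell P) (volume : Measure E3) := by
  have h := isAddFundamentalDomain_halfCell hP
  have hv : ∀ g : lattice hP, (g +ᵥ halfCell P : Set E3) =ᵐ[volume] (g +ᵥ cell P : Set E3) := by
    intro g
    have := (measurePreserving_vadd (-g) (volume : Measure E3)).quasiMeasurePreserving.preimage_ae_eq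
      (halfCell_ae_eq_cell P)
    rwa [preimage_vadd_neg, preimage_vadd_neg] at this
  refine ⟨(measurableSet_cell P).nullMeasurableSet, ?_, ?_⟩
  · have hsub : halfCell P ⊆ cell P := fun x hx i => Ico_subset_Icc_self (hx i)
    filter_upwards [h.ae_covers] with x ⟨g, hg⟩
    exact ⟨g, hsub hg⟩
  · intro g g' hgg
    exact (h.aedisjoint hgg).congr (hv g).symm (hv g').symm

lemma isAddFundamentalDomain_vadd_cell {P : ℝ} (hP : 0 < P) (w : E3) :
    IsAddFundamentalDomain (lattice hP) (w +ᵥ cell P) (volume : Measure E3) :=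
  (isAddFundamentalDomain_cell hP).vadd_of_comm w

lemma PeriodicX.vadd {α : Type*} {P : ℝ} (hP : 0 < P) {g : E3 → α} (hg : PeriodicX P g)
    (v : lattice hP) (x : E3) : g (v +ᵥ x) = g x := by
  rw [AddSubgroup.vadd_def, vadd_eq_add, add_comm]; exact hg.add_lattice hP v.2 x

/-- The translated cell is another fundamental domain of the same lattice, and a periodic function
has the same integral over any two of them. -/
lemma lintegral_cell_add {P : ℝ} (hP : 0 < P) {g : E3 → ℝ≥0∞} (hg : PeriodicX P g) (w : E3) :
    ∫⁻ x, g (x + w) ∂(cellMeasure P) = ∫⁻ x, g x ∂(cellMeasure P) := by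
  rw [cellMeasure, ← (isAddFundamentalDomain_vadd_cell hP w).setLIntegral_eq
    (isAddFundamentalDomain_cell hP) g (fun v x => hg.vadd hP v x)]
  have h := (measurePreserving_add_right (volume : Measure E3) w).setLIntegral_comp_preimage_emb
    (measurableEmbedding_addRight w) g (w +ᵥ cell P)
  rw [← h]
  congr 2
  ext x
  simp [mem_vadd_set_iff_neg_vadd_mem]

lemma integral_cell_add {F : Type*} [NormedAddCommGroup F] [NormedSpace ℝ F] {P : ℝ} (hP : 0 < P)
    {g : E3 → F} (hg : PeriodicX P g) (w : E3) :
    ∫ x, g (x + w) ∂(cellMeasure P) = ∫ x, g x ∂(cellMeasure P) := by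
  rw [cellMeasure, ← (isAddFundamentalDomain_vadd_cell hP w).setIntegral_eq
    (isAddFundamentalDomain_cell hP) (fun v x => hg.vadd hP v x)]
  have h := (measurePreserving_add_right (volume : Measure E3) w).setIntegral_preimage_emb
    (measurableEmbedding_addRight w) g (w +ᵥ cell P)
  rw [← h]
  congr 2
  ext x
  simp [mem_vadd_set_iff_neg_vadd_mem]

lemma lintegral_cyl_eq {T P : ℝ} {g : ℝ × E3 → ℝ≥0∞} (hg : Measurable g) :
    ∫⁻ z, g z ∂(cylMeasure T P) = ∫⁻ t in Ioo 0 T, ∫⁻ x, g (t, x) ∂(cellMeasure P) := by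
  rw [cylMeasure_eq_prod, lintegral_prod _ hg.aemeasurable]

lemma lintegral_cyl_add {T P : ℝ} (hP : 0 < P) {g : ℝ × E3 → ℝ≥0∞} (hm : Measurable g)
    (hg : PeriodicTX P g) (w : E3) :
    ∫⁻ z, g (z.1, z.2 + w) ∂(cylMeasure T P) = ∫⁻ z, g z ∂(cylMeasure T P) := by
  rw [lintegral_cyl_eq hm, lintegral_cyl_eq (by fun_prop)]
  simp only [lintegral_cell_add hP (hg _) w]

/-- A periodic function integrates over a bounded set to at most a fixed multiple of its integral
over the cell. -/
lemma exists_setLIntegral_le_cell {P : ℝ} (hP : 0 < P) {B : Set E3} (hB : Bornology.IsBounded B) :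
    ∃ C : ℝ≥0∞, C ≠ ⊤ ∧ ∀ g : E3 → ℝ≥0∞, Measurable g → PeriodicX P g →
      ∫⁻ x in B, g x ≤ C * ∫⁻ x, g x ∂(cellMeasure P) := by
  obtain ⟨R, hR⟩ := hB.subset_closedBall 0
  obtain ⟨R', hR'⟩ := (isCompact_cell P).isBounded.subset_closedBall 0
  set B' : Set E3 := Metric.closedBall 0 (R + R')
  have hc0 : volume (cell P) ≠ 0 := by rw [volume_cell hP]; simp; positivity
  have hc1 : volume (cell P) ≠ ⊤ := by rw [volume_cell hP]; simp
  refine ⟨(volume (cell P))⁻¹ * volume B', ENNReal.mul_ne_top (by simp [hc0])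
    (isCompact_closedBall _ _).measure_lt_top.ne, fun g hm hg => ?_⟩
  -- Averaging instead of covering by cells: for each w in the cell, the integral over B is at most
  -- that of the shifted function over the enlarged ball B'. Integrating in w and exchanging the
  -- integrals leaves a cell integral independent of the shift.
  have h1 : volume (cell P) * ∫⁻ x in B, g x ≤ volume B' * ∫⁻ x, g x ∂(cellMeasure P) := by
    calc volume (cell P) * ∫⁻ x in B, g x
        = ∫⁻ w, (∫⁻ x in B, g x * 1) ∂(cellMeasure P) := by
          simp [cellMeasure, mul_comm]
      _ ≤ ∫⁻ w, (∫⁻ x in B', g (x + w)) ∂(cellMeasure P) := by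
          unfold cellMeasure
          refine setLIntegral_mono' (measurableSet_cell P) fun w hw => ?_
          have h := (measurePreserving_add_right (volume : Measure E3) w).setLIntegral_comp_preimage_emb
            (measurableEmbedding_addRight w) g B
          simp only [mul_one]
          rw [← h]
          refine lintegral_mono_set fun x hx => ?_
          have h1 := hR hx
          have h2 := hR' hw
          simp only [mem_closedBall_zero_iff, B'] at h1 h2 ⊢
          calc ‖x‖ = ‖(x + w) - w‖ := by simp
            _ ≤ ‖x + w‖ + ‖w‖ := norm_sub_le _ _
            _ ≤ _ := add_le_add h1 h2
      _ = ∫⁻ x in B', ∫⁻ w, g (w + x) ∂(cellMeasure P) := by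
          rw [lintegral_lintegral_swap (by fun_prop)]
          simp only [add_comm]
      _ = volume B' * ∫⁻ x, g x ∂(cellMeasure P) := by
          simp [lintegral_cell_add hP hg, mul_comm]
  calc ∫⁻ x in B, g x = (volume (cell P))⁻¹ * (volume (cell P) * ∫⁻ x in B, g x) := by
        rw [← mul_assoc, ENNReal.inv_mul_cancel hc0 hc1, one_mul]
    _ ≤ _ := by rw [mul_assoc]; gcongr

lemma exists_setLIntegral_le_cyl {P : ℝ} (hP : 0 < P) {B : Set E3} (hB : Bornology.IsBounded B) :
    ∃ C : ℝ≥0∞, C ≠ ⊤ ∧ ∀ T, ∀ g : ℝ × E3 → ℝ≥0∞, Measurable g → PeriodicTX P g →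
      ∫⁻ z in univ ×ˢ B, g z ∂(slabMeasure T) ≤ C * ∫⁻ z, g z ∂(cylMeasure T P) := by
  obtain ⟨C, hC, h⟩ := exists_setLIntegral_le_cell hP hB
  refine ⟨C, hC, fun T g hm hg => ?_⟩
  rw [slabMeasure_eq_prod, ← Measure.prod_restrict, lintegral_prod _ hm.aemeasurable,
    lintegral_cyl_eq hm, ← lintegral_const_mul' _ _ hC, Measure.restrict_univ]
  exact lintegral_mono fun t => h _ (by fun_prop) (hg t)

lemma cellMeasure_le (P : ℝ) : cellMeasure P ≤ volume := Measure.restrict_le_self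

lemma cylMeasure_le_slab (T P : ℝ) : cylMeasure T P ≤ slabMeasure T :=
  Measure.restrict_mono (prod_mono le_rfl (subset_univ _)) le_rfl

/-- The indicator of the complement is periodic with zero integral over the cylinder, hence over
every bounded part of the slab; balls of integer radius exhaust space. -/
lemma ae_slab_of_ae_cyl_of_measurable {T P : ℝ} (hP : 0 < P) {s : Set (ℝ × E3)}
    (hs : MeasurableSet s) (hper : PeriodicTX P fun z => z ∈ s)
    (h : ∀ᵐ z ∂(cylMeasure T P), z ∈ s) : ∀ᵐ z ∂(slabMeasure T), z ∈ s := by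
  set g : ℝ × E3 → ℝ≥0∞ := sᶜ.indicator 1
  have hm : Measurable g := measurable_one.indicator hs.compl
  have hg : PeriodicTX P g := by
    intro t x i
    have := hper t x i
    simp only [eq_iff_iff] at this
    by_cases h : (t, x) ∈ s
    · simp [g, h, this.2 h]
    · simp [g, h, mt this.1 h]
  have h0 : ∫⁻ z, g z ∂(cylMeasure T P) = 0 := by
    rw [lintegral_indicator_one hs.compl]; exact h
  have hu : (slabMeasure T) = (slabMeasure T).restrict
      (⋃ n : ℕ, (univ : Set ℝ) ×ˢ Metric.closedBall (0 : E3) n) := by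
    rw [← prod_iUnion, Metric.iUnion_closedBall_nat, univ_prod_univ, Measure.restrict_univ]
  rw [hu, ae_restrict_iUnion_iff]
  intro n
  obtain ⟨C, hC, h2⟩ := exists_setLIntegral_le_cyl hP (Metric.isBounded_closedBall (x := (0:E3)) (r := n))
  have h3 := h2 T g hm hg
  rw [h0, mul_zero, nonpos_iff_eq_zero, lintegral_indicator_one hs.compl] at h3
  exact h3

/-! ### Reduction to the cell and measurable representatives -/

/-- Reduction of a point to the half-open cell. -/
def red (P : ℝ) (x : E3) : E3 := WithLp.toLp 2 fun i => x i - P * ⌊(x i + P / 2) / P⌋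

lemma measurable_red (P : ℝ) : Measurable (red P) := by
  unfold red
  refine (MeasurableEquiv.toLp 2 (Fin 3 → ℝ)).measurable.comp (measurable_pi_lambda _ fun i => ?_)
  have h : Measurable fun x : E3 => x i := by fun_prop
  exact h.sub (((measurable_from_top (f := fun n : ℤ => (n : ℝ))).comp
    ((h.add_const _).div_const _).floor).const_mul P)

lemma red_periodic {P : ℝ} (hP : 0 < P) : PeriodicX P (red P) := by
  intro x i
  ext j
  by_cases h : j = i
  · subst h
    have h1 : ((x + P • e j) j + P / 2) / P = (x j + P / 2) / P + 1 := by
      simp [e]; field_simp; ring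
    simp only [red, h1, Int.floor_add_one]
    simp [e]; ring
  · have h1 : (x + P • e i) j = x j := by simp [e, h]
    simp only [red, h1]

lemma red_eq_self {P : ℝ} (hP : 0 < P) {x : E3} (hx : x ∈ halfCell P) : red P x = x := by
  ext j
  have : ⌊(x j + P / 2) / P⌋ = 0 := by
    rw [Int.floor_eq_zero_iff]
    have := hx j
    simp only [mem_Ico] at this ⊢
    exact ⟨by apply div_nonneg <;> linarith, by rw [div_lt_one hP]; linarith⟩
  simp [red, this]

lemma exists_sub_red_mem {P : ℝ} (hP : 0 < P) (x : E3) : red P x - x ∈ lattice hP := by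
  have : red P x - x = ∑ i, (-⌊(x i + P / 2) / P⌋) • latticeBasis hP i := by
    ext j
    simp only [red, latticeBasis_apply, e, WithLp.ofLp_sum, WithLp.ofLp_smul, Finset.sum_apply,
      Pi.smul_apply, PiLp.ofLp_single, Pi.single_apply, smul_eq_mul, WithLp.ofLp_sub, Pi.sub_apply]
    simp [mul_comm]
  rw [this]
  exact Submodule.sum_mem _ fun i _ => Submodule.smul_mem _ _ (Submodule.subset_span ⟨i, rfl⟩)

lemma PeriodicX.comp_red {α : Type*} {P : ℝ} (hP : 0 < P) {g : E3 → α} (hg : PeriodicX P g)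
    (x : E3) : g (red P x) = g x := by
  have := hg.add_lattice hP (exists_sub_red_mem hP x) x
  simpa using this

lemma ae_cell_mem_halfCell (P : ℝ) : ∀ᵐ x ∂(cellMeasure P), x ∈ halfCell P := by
  have h := halfCell_ae_eq_cell P
  rw [cellMeasure, ae_restrict_iff' (measurableSet_cell P)]
  filter_upwards [h] with x hx h'
  exact hx.mpr h'

lemma ae_cyl_mem_halfCell (T P : ℝ) : ∀ᵐ z ∂(cylMeasure T P), z.2 ∈ halfCell P := by
  rw [cylMeasure_eq_prod]
  exact Measure.quasiMeasurePreserving_snd.ae (ae_cell_mem_halfCell P)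

/-- Statements about periodic functions that hold a.e. on the cylinder hold a.e. on the slab. -/
lemma ae_slab_of_ae_cyl {T P : ℝ} (hP : 0 < P) {p : ℝ × E3 → Prop} (hper : PeriodicTX P p)
    (h : ∀ᵐ z ∂(cylMeasure T P), p z) : ∀ᵐ z ∂(slabMeasure T), p z := by
  -- The predicate need not be measurable. The measurable null superset s need not be periodic, so
  -- it is pulled back along the reduction to the half-open cell.
  obtain ⟨s, hs, hsm, hs0⟩ := exists_measurable_superset_of_null (ae_iff.1 h)
  have hr : Measurable fun z : ℝ × E3 => (z.1, red P z.2) :=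
    measurable_fst.prodMk ((measurable_red P).comp measurable_snd)
  have key := ae_slab_of_ae_cyl_of_measurable (T := T) hP
    (s := (fun z : ℝ × E3 => (z.1, red P z.2)) ⁻¹' sᶜ) (hr hsm.compl)
    (by intro t x i; simp [red_periodic hP x i])
    (by
      have h1 : ∀ᵐ z ∂(cylMeasure T P), z ∈ sᶜ := by
        rw [ae_iff]; simpa using hs0
      filter_upwards [h1, ae_cyl_mem_halfCell T P] with z hz hz2
      rw [mem_preimage, red_eq_self hP hz2]; exact hz)
  filter_upwards [key] with z hz
  by_contra hc
  apply hz
  apply hs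
  have := (hper z.1).comp_red hP z.2
  show ¬ p _
  intro h'
  exact hc (this.mp h')

/-- A dummy time interval (0,1) turns this into the space-time statement. -/
lemma ae_volume_of_ae_cell {P : ℝ} (hP : 0 < P) {p : E3 → Prop} (hper : PeriodicX P p)
    (h : ∀ᵐ x ∂(cellMeasure P), p x) : ∀ᵐ x, p x := by
  have h1 : ∀ᵐ z ∂(cylMeasure 1 P), p z.2 := by
    rw [cylMeasure_eq_prod]
    exact Measure.quasiMeasurePreserving_snd.ae h
  have h2 := ae_slab_of_ae_cyl (T := 1) hP (p := fun z => p z.2) (fun t => hper) h1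
  rw [slabMeasure_eq_prod] at h2
  have h3 := Measure.ae_ae_of_ae_prod h2
  have : (volume.restrict (Ioo (0:ℝ) 1)) ≠ 0 := by simp
  have : (ae (volume.restrict (Ioo (0:ℝ) 1))).NeBot := ae_neBot.2 this
  exact h3.exists.choose_spec

/-- Composing a measurable representative on the cylinder with the reduction to the half-open cell
makes it Borel and exactly periodic at the same time. It lets all later estimates assume genuine
measurability. -/
lemma exists_measurable_periodicTX {T P : ℝ} (hP : 0 < P) {F : Type*} [TopologicalSpace F]
    [TopologicalSpace.PseudoMetrizableSpace F] [MeasurableSpace F] [BorelSpace F]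
    {g : ℝ × E3 → F} (hg : PeriodicTX P g)
    (hm : AEStronglyMeasurable g (cylMeasure T P)) :
    ∃ g' : ℝ × E3 → F, Measurable g' ∧ PeriodicTX P g' ∧ g =ᵐ[slabMeasure T] g' := by
  have hr : Measurable fun z : ℝ × E3 => (z.1, red P z.2) :=
    measurable_fst.prodMk ((measurable_red P).comp measurable_snd)
  have hper : PeriodicTX P fun z : ℝ × E3 => hm.mk g (z.1, red P z.2) := by
    intro t x i; simp [red_periodic hP x i]
  refine ⟨fun z => hm.mk g (z.1, red P z.2), hm.stronglyMeasurable_mk.measurable.comp hr, hper, ?_⟩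
  refine ae_slab_of_ae_cyl hP (P := P) ?_ ?_
  · intro t x i
    simp only [hg t x i, red_periodic hP x i]
  · filter_upwards [hm.ae_eq_mk, ae_cyl_mem_halfCell T P] with z h1 h2
    simp only [red_eq_self hP h2]; exact h1

lemma exists_measurable_periodicX {P : ℝ} (hP : 0 < P) {F : Type*} [TopologicalSpace F]
    [TopologicalSpace.PseudoMetrizableSpace F] [MeasurableSpace F] [BorelSpace F]
    {g : E3 → F} (hg : PeriodicX P g)
    (hm : AEStronglyMeasurable g (cellMeasure P)) :
    ∃ g' : E3 → F, Measurable g' ∧ PeriodicX P g' ∧ g =ᵐ[volume] g' := by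
  have hper : PeriodicX P fun x : E3 => hm.mk g (red P x) := by
    intro x i; simp [red_periodic hP x i]
  refine ⟨fun x => hm.mk g (red P x), hm.stronglyMeasurable_mk.measurable.comp (measurable_red P),
    hper, ?_⟩
  refine ae_volume_of_ae_cell hP (P := P) ?_ ?_
  · intro x i
    simp only [hg x i, red_periodic hP x i]
  · filter_upwards [hm.ae_eq_mk, ae_cell_mem_halfCell P] with z h1 h2
    simp only [red_eq_self hP h2]; exact h1

/-! ### Derivatives and test functions -/

/-- Partial derivative in space. -/
def pd (i : Fin 3) (k : E3 → ℝ) (x : E3) : ℝ := fderiv ℝ k x (e i)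

lemma contDiff_pd {i : Fin 3} {k : E3 → ℝ} (hk : ContDiff ℝ ∞ k) : ContDiff ℝ ∞ (pd i k) :=
  (hk.fderiv_right (m := ∞) (by simp)).clm_apply contDiff_const

lemma hasCompactSupport_pd {i : Fin 3} {k : E3 → ℝ} (hk : HasCompactSupport k) :
    HasCompactSupport (pd i k) :=
  hk.fderiv_apply (𝕜 := ℝ) (e i)

lemma contDiff_dx {i : Fin 3} {φ : ℝ × E3 → ℝ} (h : ContDiff ℝ ∞ φ) : ContDiff ℝ ∞ (dx i φ) :=
  (h.fderiv_right (m := ∞) (by simp)).clm_apply contDiff_const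

lemma contDiff_dt {φ : ℝ × E3 → ℝ} (h : ContDiff ℝ ∞ φ) : ContDiff ℝ ∞ (dt φ) :=
  (h.fderiv_right (m := ∞) (by simp)).clm_apply contDiff_const

lemma IsTest.dx {T : ℝ} {φ : ℝ × E3 → ℝ} (h : IsTest T φ) (i : Fin 3) : IsTest T (dx i φ) where
  smooth := contDiff_dx h.smooth
  compact := h.compact.fderiv_apply (𝕜 := ℝ) _
  support := (tsupport_fderiv_apply_subset ℝ _).trans h.support

lemma IsTest.dt {T : ℝ} {φ : ℝ × E3 → ℝ} (h : IsTest T φ) : IsTest T (dt φ) where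
  smooth := contDiff_dt h.smooth
  compact := h.compact.fderiv_apply (𝕜 := ℝ) _
  support := (tsupport_fderiv_apply_subset ℝ _).trans h.support

lemma IsTest.add {T : ℝ} {φ ψ : ℝ × E3 → ℝ} (h : IsTest T φ) (h' : IsTest T ψ) :
    IsTest T (fun z => φ z + ψ z) where
  smooth := h.smooth.add h'.smooth
  compact := h.compact.add h'.compact
  support := (tsupport_add φ ψ).trans (union_subset h.support h'.support)

lemma IsTest.lap {T : ℝ} {φ : ℝ × E3 → ℝ} (h : IsTest T φ) : IsTest T (lap φ) := by
  have : PassiveScalar.lap φ = fun z => (PassiveScalar.dx 0 (PassiveScalar.dx 0 φ) z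
      + PassiveScalar.dx 1 (PassiveScalar.dx 1 φ) z)
      + PassiveScalar.dx 2 (PassiveScalar.dx 2 φ) z := by
    ext z; simp [PassiveScalar.lap, Fin.sum_univ_three]
  rw [this]
  exact (((h.dx 0).dx 0).add ((h.dx 1).dx 1)).add ((h.dx 2).dx 2)

lemma fderiv_fderiv_apply_comm {F : Type*} [NormedAddCommGroup F] [NormedSpace ℝ F] {φ : F → ℝ}
    (h : ContDiff ℝ ∞ φ) (v w x : F) :
    fderiv ℝ (fun y => fderiv ℝ φ y v) x w = fderiv ℝ (fun y => fderiv ℝ φ y w) x v := by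
  have hd : DifferentiableAt ℝ (fderiv ℝ φ) x :=
    ((h.fderiv_right (m := ∞) (by simp)).differentiable (by simp)) x
  have hs : IsSymmSndFDerivAt ℝ φ x :=
    h.contDiffAt.isSymmSndFDerivAt (by
      simp only [minSmoothness_of_isRCLikeNormedField]; exact WithTop.coe_le_coe.2 (le_top (a := (2 : ℕ∞))))
  have key : ∀ a b : F, fderiv ℝ (fun y => fderiv ℝ φ y a) x b = fderiv ℝ (fderiv ℝ φ) x b a := by
    intro a b
    rw [fderiv_clm_apply hd (differentiableAt_const a)]
    simp
  rw [key, key]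
  exact hs w v

/-- Tensor products of cutoffs in time and in space are test functions. -/
lemma isTest_mul {T : ℝ} {ψ : ℝ → ℝ} {k : E3 → ℝ} (hψ : ContDiff ℝ ∞ ψ)
    (hψc : HasCompactSupport ψ) (hψT : tsupport ψ ⊆ Iio T) (hk : ContDiff ℝ ∞ k)
    (hkc : HasCompactSupport k) : IsTest T (fun z => ψ z.1 * k z.2) := by
  have hsub : tsupport (fun z : ℝ × E3 => ψ z.1 * k z.2) ⊆ tsupport ψ ×ˢ tsupport k := by
    refine closure_minimal ?_ ((isClosed_tsupport _).prod (isClosed_tsupport _))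
    intro z hz
    simp only [Function.mem_support, ne_eq, mul_eq_zero, not_or] at hz
    exact ⟨subset_tsupport _ hz.1, subset_tsupport _ hz.2⟩
  refine ⟨by fun_prop, ?_, ?_⟩
  · exact (hψc.isCompact.prod hkc.isCompact).of_isClosed_subset (isClosed_tsupport _) hsub
  · exact hsub.trans (prod_mono hψT (subset_univ _))

lemma dx_mul {ψ : ℝ → ℝ} {k : E3 → ℝ} (hψ : ContDiff ℝ ∞ ψ) (hk : ContDiff ℝ ∞ k) (i : Fin 3) :
    dx i (fun z => ψ z.1 * k z.2) = fun z => ψ z.1 * pd i k z.2 := by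
  ext z
  have h1 : HasFDerivAt (fun z : ℝ × E3 => ψ z.1)
      ((fderiv ℝ ψ z.1).comp (ContinuousLinearMap.fst ℝ ℝ E3)) z :=
    (hψ.differentiable (by simp) z.1).hasFDerivAt.comp z hasFDerivAt_fst
  have h2 : HasFDerivAt (fun z : ℝ × E3 => k z.2)
      ((fderiv ℝ k z.2).comp (ContinuousLinearMap.snd ℝ ℝ E3)) z :=
    (hk.differentiable (by simp) z.2).hasFDerivAt.comp z hasFDerivAt_snd
  unfold dx
  rw [show (fun z : ℝ × E3 => ψ z.1 * k z.2) = (fun z => ψ z.1) * fun z => k z.2 from rfl,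
    (h1.mul h2).fderiv]
  simp [pd]

lemma dt_mul {ψ : ℝ → ℝ} {k : E3 → ℝ} (hψ : ContDiff ℝ ∞ ψ) (hk : ContDiff ℝ ∞ k) :
    dt (fun z => ψ z.1 * k z.2) = fun z => deriv ψ z.1 * k z.2 := by
  ext z
  have h1 : HasFDerivAt (fun z : ℝ × E3 => ψ z.1)
      ((fderiv ℝ ψ z.1).comp (ContinuousLinearMap.fst ℝ ℝ E3)) z :=
    (hψ.differentiable (by simp) z.1).hasFDerivAt.comp z hasFDerivAt_fst
  have h2 : HasFDerivAt (fun z : ℝ × E3 => k z.2)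
      ((fderiv ℝ k z.2).comp (ContinuousLinearMap.snd ℝ ℝ E3)) z :=
    (hk.differentiable (by simp) z.2).hasFDerivAt.comp z hasFDerivAt_snd
  unfold dt
  rw [show (fun z : ℝ × E3 => ψ z.1 * k z.2) = (fun z => ψ z.1) * fun z => k z.2 from rfl,
    (h1.mul h2).fderiv]
  simp [mul_comm]

/-- The Laplacian of a function on space. -/
def lapX (k : E3 → ℝ) (x : E3) : ℝ := ∑ i, pd i (pd i k) x

lemma contDiff_lapX {k : E3 → ℝ} (hk : ContDiff ℝ ∞ k) : ContDiff ℝ ∞ (lapX k) :=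
  ContDiff.sum fun _ _ => contDiff_pd (contDiff_pd hk)

lemma hasCompactSupport_lapX {k : E3 → ℝ} (hk : HasCompactSupport k) :
    HasCompactSupport (lapX k) := by
  have : lapX k = fun x => (pd 0 (pd 0 k) x + pd 1 (pd 1 k) x) + pd 2 (pd 2 k) x := by
    ext z; simp [lapX, Fin.sum_univ_three]
  have h : ∀ i, HasCompactSupport (pd i (pd i k)) := fun i =>
    hasCompactSupport_pd (hasCompactSupport_pd hk)
  rw [this]
  exact ((h 0).add (h 1)).add (h 2)

lemma lap_mul {ψ : ℝ → ℝ} {k : E3 → ℝ} (hψ : ContDiff ℝ ∞ ψ) (hk : ContDiff ℝ ∞ k) :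
    lap (fun z => ψ z.1 * k z.2) = fun z => ψ z.1 * lapX k z.2 := by
  ext z
  simp only [lap, lapX, dx_mul hψ hk, dx_mul hψ (contDiff_pd hk), Finset.mul_sum]

/-! ### Integrability against compactly supported functions -/

lemma lintegral_slab_eq {T : ℝ} {g : ℝ × E3 → ℝ≥0∞} (hg : Measurable g) :
    ∫⁻ z, g z ∂(slabMeasure T) = ∫⁻ t in Ioo 0 T, ∫⁻ x, g (t, x) := by
  rw [slabMeasure_eq_prod, lintegral_prod _ hg.aemeasurable]

lemma exists_lintegral_mul_le_cyl {P : ℝ} (hP : 0 < P) {h : ℝ × E3 → ℝ} (hc : Continuous h)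
    (hs : HasCompactSupport h) :
    ∃ C : ℝ≥0∞, C ≠ ⊤ ∧ ∀ T, ∀ g : ℝ × E3 → ℝ, Measurable g → PeriodicTX P g →
      ∫⁻ z, ‖g z * h z‖ₑ ∂(slabMeasure T) ≤ C * ∫⁻ z, ‖g z‖ₑ ∂(cylMeasure T P) := by
  set B : Set E3 := Prod.snd '' tsupport h
  have hB : Bornology.IsBounded B := (hs.isCompact.image continuous_snd).isBounded
  have hBm : MeasurableSet B := (hs.isCompact.image continuous_snd).isClosed.measurableSet
  obtain ⟨C, hC, hCg⟩ := exists_setLIntegral_le_cyl hP hB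
  obtain ⟨M, hM⟩ := hs.exists_bound_of_continuous hc
  refine ⟨ENNReal.ofReal M * C, ENNReal.mul_ne_top (by simp) hC, fun T g hg hper => ?_⟩
  calc ∫⁻ z, ‖g z * h z‖ₑ ∂(slabMeasure T)
      = ∫⁻ z in univ ×ˢ B, ‖g z * h z‖ₑ ∂(slabMeasure T) := by
        symm
        refine setLIntegral_eq_of_support_subset ?_
        intro z hz
        refine ⟨mem_univ _, z, subset_tsupport _ ?_, rfl⟩
        intro h0
        simp [h0] at hz
    _ ≤ ∫⁻ z in univ ×ˢ B, ENNReal.ofReal M * ‖g z‖ₑ ∂(slabMeasure T) := by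
        refine lintegral_mono fun z => ?_
        rw [enorm_mul, mul_comm]
        gcongr
        rw [← ofReal_norm]
        exact ENNReal.ofReal_le_ofReal (hM z)
    _ = ENNReal.ofReal M * ∫⁻ z in univ ×ˢ B, ‖g z‖ₑ ∂(slabMeasure T) := by
        rw [lintegral_const_mul _ (by fun_prop)]
    _ ≤ _ := by
        rw [mul_assoc]
        gcongr
        exact hCg T _ (by fun_prop) (fun t x i => by simp only [hper t x i])

lemma integrable_slab_mul {T P : ℝ} (hP : 0 < P) {g : ℝ × E3 → ℝ} (hg : Measurable g)
    (hper : PeriodicTX P g) (hi : Integrable g (cylMeasure T P)) {h : ℝ × E3 → ℝ}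
    (hc : Continuous h) (hs : HasCompactSupport h) :
    Integrable (fun z => g z * h z) (slabMeasure T) := by
  obtain ⟨C, hC, hCg⟩ := exists_lintegral_mul_le_cyl hP hc hs
  refine ⟨(by fun_prop : Measurable fun z => g z * h z).aestronglyMeasurable, ?_⟩
  exact (hCg T g hg hper).trans_lt (ENNReal.mul_lt_top hC.lt_top hi.hasFiniteIntegral)

lemma exists_lintegral_mul_le_cell {P : ℝ} (hP : 0 < P) {k : E3 → ℝ} (hc : Continuous k)
    (hs : HasCompactSupport k) :
    ∃ C : ℝ≥0∞, C ≠ ⊤ ∧ ∀ g : E3 → ℝ, Measurable g → PeriodicX P g →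
      ∫⁻ x, ‖g x * k x‖ₑ ≤ C * ∫⁻ x, ‖g x‖ₑ ∂(cellMeasure P) := by
  obtain ⟨C, hC, hCg⟩ := exists_setLIntegral_le_cell hP hs.isCompact.isBounded
  obtain ⟨M, hM⟩ := hs.exists_bound_of_continuous hc
  refine ⟨ENNReal.ofReal M * C, ENNReal.mul_ne_top (by simp) hC, fun g hg hper => ?_⟩
  calc ∫⁻ z, ‖g z * k z‖ₑ
      = ∫⁻ z in tsupport k, ‖g z * k z‖ₑ := by
        symm
        refine setLIntegral_eq_of_support_subset ?_
        intro z hz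
        refine subset_tsupport _ ?_
        intro h0
        simp [h0] at hz
    _ ≤ ∫⁻ z in tsupport k, ENNReal.ofReal M * ‖g z‖ₑ := by
        refine lintegral_mono fun z => ?_
        rw [enorm_mul, mul_comm]
        gcongr
        rw [← ofReal_norm]
        exact ENNReal.ofReal_le_ofReal (hM z)
    _ = ENNReal.ofReal M * ∫⁻ z in tsupport k, ‖g z‖ₑ := by
        rw [lintegral_const_mul _ (by fun_prop)]
    _ ≤ _ := by
        rw [mul_assoc]
        gcongr
        exact hCg _ (by fun_prop) (fun x i => by simp only [hper x i])

lemma integrable_mul_of_cell {P : ℝ} (hP : 0 < P) {g : E3 → ℝ} (hg : Measurable g)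
    (hper : PeriodicX P g) (hi : Integrable g (cellMeasure P)) {k : E3 → ℝ}
    (hc : Continuous k) (hs : HasCompactSupport k) :
    Integrable (fun z => g z * k z) := by
  obtain ⟨C, hC, hCg⟩ := exists_lintegral_mul_le_cell hP hc hs
  refine ⟨(by fun_prop : Measurable fun z => g z * k z).aestronglyMeasurable, ?_⟩
  exact (hCg g hg hper).trans_lt (ENNReal.mul_lt_top hC.lt_top hi.hasFiniteIntegral)

/-- Pairing of the section at time `t` with a function of `x`. -/
def pair (g : ℝ × E3 → ℝ) (k : E3 → ℝ) (t : ℝ) : ℝ := ∫ x, g (t, x) * k x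

lemma ae_integrable_section {T P : ℝ} {g : ℝ × E3 → ℝ} (hi : Integrable g (cylMeasure T P)) :
    ∀ᵐ t ∂(volume.restrict (Ioo 0 T)), Integrable (fun x => g (t, x)) (cellMeasure P) := by
  rw [cylMeasure_eq_prod] at hi
  exact hi.prod_right_ae

lemma integrable_prod_mul {T P : ℝ} (hP : 0 < P) {g : ℝ × E3 → ℝ} (hg : Measurable g)
    (hper : PeriodicTX P g) (hi : Integrable g (cylMeasure T P)) {k : E3 → ℝ}
    (hc : Continuous k) (hs : HasCompactSupport k) :
    Integrable (fun z : ℝ × E3 => g z * k z.2) (slabMeasure T) := by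
  obtain ⟨C, hC, hCg⟩ := exists_lintegral_mul_le_cell hP hc hs
  refine ⟨(by fun_prop : Measurable fun z : ℝ × E3 => g z * k z.2).aestronglyMeasurable, ?_⟩
  have hkm := hc.measurable
  rw [hasFiniteIntegral_iff_enorm, lintegral_slab_eq (by fun_prop)]
  calc _ ≤ ∫⁻ t in Ioo 0 T, C * ∫⁻ x, ‖g (t, x)‖ₑ ∂(cellMeasure P) :=
        lintegral_mono fun t => hCg _ (by fun_prop) (hper t)
    _ = C * ∫⁻ z, ‖g z‖ₑ ∂(cylMeasure T P) := by
        rw [lintegral_const_mul' _ _ hC, lintegral_cyl_eq (by fun_prop)]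
    _ < ⊤ := ENNReal.mul_lt_top hC.lt_top hi.hasFiniteIntegral

lemma integrable_pair {T P : ℝ} (hP : 0 < P) {g : ℝ × E3 → ℝ} (hg : Measurable g)
    (hper : PeriodicTX P g) (hi : Integrable g (cylMeasure T P)) {k : E3 → ℝ}
    (hc : Continuous k) (hs : HasCompactSupport k) :
    Integrable (pair g k) (volume.restrict (Ioo 0 T)) := by
  have := integrable_prod_mul hP hg hper hi hc hs
  rw [slabMeasure_eq_prod] at this
  exact this.integral_prod_left

/-- By Fubini, tensor-product test functions reduce every distributional equation on the slab to a
scalar one in the time variable for the functions `pair g k`. -/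
lemma integral_slab_mul {T P : ℝ} (hP : 0 < P) {g : ℝ × E3 → ℝ} (hg : Measurable g)
    (hper : PeriodicTX P g) (hi : Integrable g (cylMeasure T P)) {k : E3 → ℝ}
    (hc : Continuous k) (hs : HasCompactSupport k) {ψ : ℝ → ℝ} (hψ : Continuous ψ)
    (hψs : HasCompactSupport ψ) :
    ∫ z, g z * (ψ z.1 * k z.2) ∂(slabMeasure T) = ∫ t in Ioo 0 T, pair g k t * ψ t := by
  obtain ⟨M, hM⟩ := hψs.exists_bound_of_continuous hψ
  have h1 : Integrable (fun z : ℝ × E3 => ψ z.1 * (g z * k z.2)) (slabMeasure T) :=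
    (integrable_prod_mul hP hg hper hi hc hs).bdd_mul (c := M)
      (by fun_prop : Measurable fun z : ℝ × E3 => ψ z.1).aestronglyMeasurable
      (Eventually.of_forall fun z => hM z.1)
  have h2 : (fun z : ℝ × E3 => g z * (ψ z.1 * k z.2)) = fun z => ψ z.1 * (g z * k z.2) := by
    ext z; ring
  rw [h2, slabMeasure_eq_prod, integral_prod _ (by rwa [slabMeasure_eq_prod] at h1)]
  refine integral_congr_ae (Eventually.of_forall fun t => ?_)
  simp only [pair, integral_const_mul, mul_comm]

/-! ### A spatial cutoff adapted to the cell -/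

lemma integral_pd_eq_zero {k : E3 → ℝ} (hk : ContDiff ℝ ∞ k) (hs : HasCompactSupport k)
    (i : Fin 3) : ∫ x, pd i k x = 0 := by
  have := integral_mul_fderiv_eq_neg_fderiv_mul_of_integrable (μ := (volume : Measure E3))
    (f := fun _ => (1 : ℝ)) (g := k) (v := e i) (by simp)
    (by
      simp only [one_mul]
      exact (contDiff_pd hk).continuous.integrable_of_hasCompactSupport (hasCompactSupport_pd hs))
    (by simpa using hk.continuous.integrable_of_hasCompactSupport hs)
    (by fun_prop) (fun x _ => hk.differentiable (by simp) x)
  simpa [pd] using this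

/-- Substituting x = w + y moves the shift onto g; the inner integral of g(w + y) over w in the cell
does not depend on y by periodicity, and factors out. Most of the proof checks that Fubini applies
to both double integrals. -/
lemma integral_mul_cell_convolution {P : ℝ} (hP : 0 < P) {g : E3 → ℝ} (hg : Measurable g)
    (hper : PeriodicX P g) (hi : Integrable g (cellMeasure P)) {k : E3 → ℝ}
    (hc : Continuous k) (hs : HasCompactSupport k) :
    ∫ x, g x * ∫ w, k (x - w) ∂(cellMeasure P) = (∫ y, k y) * ∫ x, g x ∂(cellMeasure P) := by
  have hkm := hc.measurable
  have hI2 : Integrable (fun z : E3 × E3 => g (z.2 + z.1) * k z.1)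
      (volume.prod (cellMeasure P)) := by
    refine ⟨(by fun_prop : Measurable fun z : E3 × E3 => g (z.2 + z.1) * k z.1).aestronglyMeasurable,
      ?_⟩
    rw [hasFiniteIntegral_iff_enorm, lintegral_prod _ (Measurable.aemeasurable (by fun_prop))]
    simp only [enorm_mul]
    have : ∀ y, ∫⁻ x, ‖g (x + y)‖ₑ * ‖k y‖ₑ ∂(cellMeasure P)
        = (∫⁻ x, ‖g x‖ₑ ∂(cellMeasure P)) * ‖k y‖ₑ := by
      intro y
      rw [lintegral_mul_const _ (by fun_prop),
        lintegral_cell_add hP (g := fun x => ‖g x‖ₑ) (fun x i => by simp only [hper x i]) y]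
    simp only [this]
    rw [lintegral_const_mul _ (by fun_prop)]
    exact ENNReal.mul_lt_top hi.hasFiniteIntegral
      (hc.integrable_of_hasCompactSupport hs).hasFiniteIntegral
  have hI1 : Integrable (fun z : E3 × E3 => g z.1 * k (z.1 - z.2))
      (volume.prod (cellMeasure P)) := by
    obtain ⟨M, hM⟩ := hs.exists_bound_of_continuous hc
    set B : Set E3 := tsupport k + cell P
    have hBc : IsCompact B := hs.isCompact.add (isCompact_cell P)
    obtain ⟨C, hC, hCg⟩ := exists_setLIntegral_le_cell hP hBc.isBounded
    refine ⟨(by fun_prop : Measurable fun z : E3 × E3 => g z.1 * k (z.1 - z.2)).aestronglyMeasurable,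
      ?_⟩
    rw [hasFiniteIntegral_iff_enorm, lintegral_prod_symm _ (Measurable.aemeasurable (by fun_prop))]
    have hb : ∀ w ∈ cell P, ∫⁻ x, ‖g x * k (x - w)‖ₑ ≤
        ENNReal.ofReal M * (C * ∫⁻ x, ‖g x‖ₑ ∂(cellMeasure P)) := by
      intro w hw
      calc ∫⁻ x, ‖g x * k (x - w)‖ₑ = ∫⁻ x in B, ‖g x * k (x - w)‖ₑ := by
            symm
            refine setLIntegral_eq_of_support_subset fun x hx => ?_
            refine ⟨x - w, subset_tsupport _ ?_, w, hw, by simp⟩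
            intro h0; simp [h0] at hx
        _ ≤ ∫⁻ x in B, ENNReal.ofReal M * ‖g x‖ₑ := by
            refine lintegral_mono fun x => ?_
            rw [enorm_mul, mul_comm]
            gcongr
            rw [← ofReal_norm]
            exact ENNReal.ofReal_le_ofReal (hM _)
        _ = ENNReal.ofReal M * ∫⁻ x in B, ‖g x‖ₑ := lintegral_const_mul _ (by fun_prop)
        _ ≤ _ := by
            gcongr
            exact hCg _ (by fun_prop) (fun x i => by simp only [hper x i])
    calc _ ≤ ∫⁻ w, ENNReal.ofReal M * (C * ∫⁻ x, ‖g x‖ₑ ∂(cellMeasure P)) ∂(cellMeasure P) := by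
          conv_lhs => rw [cellMeasure]
          conv_rhs => rw [cellMeasure]
          exact setLIntegral_mono' (measurableSet_cell P) hb
      _ < ⊤ := by
          rw [lintegral_const]
          exact ENNReal.mul_lt_top (ENNReal.mul_lt_top (by simp)
            (ENNReal.mul_lt_top hC.lt_top hi.hasFiniteIntegral)) (measure_lt_top _ _)
  calc ∫ x, g x * ∫ w, k (x - w) ∂(cellMeasure P)
      = ∫ x, ∫ w, g x * k (x - w) ∂(cellMeasure P) := by simp only [integral_const_mul]
    _ = ∫ w, (∫ x, g x * k (x - w)) ∂(cellMeasure P) := integral_integral_swap hI1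
    _ = ∫ w, (∫ y, g (w + y) * k y) ∂(cellMeasure P) := by
        congr 1; ext w
        rw [← integral_add_right_eq_self (fun x => g x * k (x - w)) w]
        simp only [add_sub_cancel_right]
        congr 1; ext y; rw [add_comm]
    _ = ∫ y, ∫ w, g (w + y) * k y ∂(cellMeasure P) := (integral_integral_swap hI2).symm
    _ = ∫ y, (∫ x, g x ∂(cellMeasure P)) * k y := by
        simp only [integral_mul_const, integral_cell_add hP hper]
    _ = _ := by rw [integral_const_mul, mul_comm]

/-- The convolution of the indicator of the cell with `k`. -/
def cellConv (P : ℝ) (k : E3 → ℝ) (x : E3) : ℝ := ∫ w, k (x - w) ∂(cellMeasure P)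

lemma cellConv_eq (P : ℝ) (k : E3 → ℝ) : cellConv P k =
    convolution ((cell P).indicator fun _ => (1 : ℝ)) k (ContinuousLinearMap.lsmul ℝ ℝ) volume := by
  ext x
  rw [convolution_def, cellConv, cellMeasure, ← integral_indicator (measurableSet_cell P)]
  congr 1; ext w
  by_cases h : w ∈ cell P <;> simp [h]

lemma locallyIntegrable_indicator_cell (P : ℝ) :
    LocallyIntegrable ((cell P).indicator fun _ => (1 : ℝ)) (volume : Measure E3) :=
  ((integrable_indicator_iff (measurableSet_cell P)).2
    (integrableOn_const (isCompact_cell P).measure_lt_top.ne)).locallyIntegrable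

lemma contDiff_cellConv {P : ℝ} {k : E3 → ℝ} (hk : ContDiff ℝ ∞ k) (hs : HasCompactSupport k) :
    ContDiff ℝ ∞ (cellConv P k) := by
  rw [cellConv_eq]
  exact hs.contDiff_convolution_right _ (locallyIntegrable_indicator_cell P) hk

lemma pd_cellConv {P : ℝ} {k : E3 → ℝ} (hk : ContDiff ℝ ∞ k) (hs : HasCompactSupport k)
    (i : Fin 3) : pd i (cellConv P k) = cellConv P (pd i k) := by
  ext x
  have h := hs.hasFDerivAt_convolution_right (ContinuousLinearMap.lsmul ℝ ℝ)
    (locallyIntegrable_indicator_cell P) (hk.of_le (by simp)) x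
  rw [pd, cellConv_eq, h.fderiv, cellConv_eq]
  rw [convolution_def, convolution_def, ContinuousLinearMap.integral_apply]
  · rfl
  · exact ((hs.fderiv ℝ).convolutionExists_right _ (locallyIntegrable_indicator_cell P)
      (hk.continuous_fderiv (by simp)) x)

lemma hasCompactSupport_cellConv {P : ℝ} {k : E3 → ℝ} (hs : HasCompactSupport k) :
    HasCompactSupport (cellConv P k) := by
  rw [cellConv_eq]
  refine HasCompactSupport.convolution _ ?_ hs
  exact HasCompactSupport.intro (isCompact_cell P) fun x hx => by simp [hx]

/-- There is a smooth compactly supported function of `x` that turns integrals of periodic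
functions over space into integrals over the cell. -/
lemma exists_cell_cutoff {P : ℝ} (hP : 0 < P) : ∃ θ : E3 → ℝ, ContDiff ℝ ∞ θ ∧
    HasCompactSupport θ ∧ (∀ x, 0 ≤ θ x) ∧ ∀ g : E3 → ℝ, Measurable g → PeriodicX P g →
      Integrable g (cellMeasure P) → ∫ x, g x * θ x = ∫ x, g x ∂(cellMeasure P) ∧
        (∀ i, ∫ x, g x * pd i θ x = 0) ∧ ∫ x, g x * lapX θ x = 0 := by
  -- The cutoff is the indicator of the cell convolved with this normalized bump ρ. Derivatives fall
  -- on ρ, and derivatives of ρ have integral zero, which is why the last two identities vanish.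
  set b : ContDiffBump (0 : E3) := ⟨1, 2, by norm_num, by norm_num⟩
  set ρ : E3 → ℝ := b.normed volume
  have hρ : ContDiff ℝ ∞ ρ := b.contDiff_normed
  have hρs : HasCompactSupport ρ := b.hasCompactSupport_normed
  refine ⟨cellConv P ρ, contDiff_cellConv hρ hρs, hasCompactSupport_cellConv hρs,
    fun x => integral_nonneg fun w => b.nonneg_normed _, fun g hg hper hi => ⟨?_, fun i => ?_, ?_⟩⟩
  · rw [show (fun x => g x * cellConv P ρ x) = fun x => g x * ∫ w, ρ (x - w) ∂(cellMeasure P) from rfl,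
      integral_mul_cell_convolution hP hg hper hi hρ.continuous hρs, b.integral_normed, one_mul]
  · rw [pd_cellConv hρ hρs, show (fun x => g x * cellConv P (pd i ρ) x) =
        fun x => g x * ∫ w, pd i ρ (x - w) ∂(cellMeasure P) from rfl,
      integral_mul_cell_convolution hP hg hper hi (contDiff_pd hρ).continuous
        (hasCompactSupport_pd hρs), integral_pd_eq_zero hρ hρs, zero_mul]
  · have h2 : ∀ i : Fin 3, ∫ x, g x * cellConv P (pd i (pd i ρ)) x = 0 := by
      intro i
      rw [show (fun x => g x * cellConv P (pd i (pd i ρ)) x) =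
        fun x => g x * ∫ w, pd i (pd i ρ) (x - w) ∂(cellMeasure P) from rfl,
      integral_mul_cell_convolution hP hg hper hi (contDiff_pd (contDiff_pd hρ)).continuous
        (hasCompactSupport_pd (hasCompactSupport_pd hρs)),
        integral_pd_eq_zero (contDiff_pd hρ) (hasCompactSupport_pd hρs), zero_mul]
    simp only [lapX, pd_cellConv hρ hρs, pd_cellConv (contDiff_pd hρ) (hasCompactSupport_pd hρs),
      Finset.mul_sum]
    rw [integral_finsetSum]
    · simp [h2]
    · intro i _
      exact integrable_mul_of_cell hP hg hper hi
        (contDiff_cellConv (contDiff_pd (contDiff_pd hρ))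
          (hasCompactSupport_pd (hasCompactSupport_pd hρs))).continuous
        (hasCompactSupport_cellConv (hasCompactSupport_pd (hasCompactSupport_pd hρs)))

/-! ### Differential inequalities in the sense of distributions on an interval -/

/-- At almost every time h is the limit of its averages against shrinking bumps; once the bump
around an interior time fits inside (0,T) it is an admissible test function, so the averages are
nonnegative. -/
lemma ae_nonneg_of_forall_smooth {T : ℝ} {h : ℝ → ℝ} (hh : IntegrableOn h (Ioo 0 T))
    (H : ∀ κ : ℝ → ℝ, ContDiff ℝ ∞ κ → HasCompactSupport κ → tsupport κ ⊆ Ioo 0 T →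
      (∀ t, 0 ≤ κ t) → 0 ≤ ∫ t in Ioo 0 T, h t * κ t) :
    ∀ᵐ t ∂(volume.restrict (Ioo 0 T)), 0 ≤ h t := by
  set g : ℝ → ℝ := (Ioo 0 T).indicator h with hg
  have hgi : Integrable g := (integrable_indicator_iff measurableSet_Ioo).2 hh
  set φ : ℕ → ContDiffBump (0 : ℝ) := fun n =>
    ⟨1 / (n + 1), 2 * (1 / (n + 1)), by positivity, by
      have : (0 : ℝ) < 1 / (n + 1) := by positivity
      linarith⟩
  have hφ : Tendsto (fun n => (φ n).rOut) atTop (𝓝 0) := by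
    have := tendsto_one_div_add_atTop_nhds_zero_nat (𝕜 := ℝ)
    simpa [φ] using this.const_mul 2
  have key := ContDiffBump.ae_convolution_tendsto_right_of_locallyIntegrable (μ := volume)
    (φ := φ) (l := atTop) (K := 2) hφ (Eventually.of_forall fun n => le_rfl) hgi.locallyIntegrable
  rw [ae_restrict_iff' measurableSet_Ioo]
  filter_upwards [key] with t ht htT
  have hgt : g t = h t := by simp [hg, htT]
  rw [hgt] at ht
  refine ge_of_tendsto ht ?_
  have hpos : 0 < min t (T - t) := lt_min htT.1 (by linarith [htT.2])
  filter_upwards [hφ.eventually (gt_mem_nhds hpos)] with n hn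
  rw [convolution_def]
  have e1 : ∫ s, (ContinuousLinearMap.lsmul ℝ ℝ) ((φ n).normed volume s) (g (t - s))
      = ∫ s, (φ n).normed volume (t - s) * g s := by
    rw [← integral_sub_left_eq_self _ _ t]
    simp
  rw [e1]
  have e2 : ∫ s, (φ n).normed volume (t - s) * g s
      = ∫ s in Ioo 0 T, h s * (φ n).normed volume (t - s) := by
    rw [← integral_indicator measurableSet_Ioo]
    congr 1; ext s
    by_cases hs : s ∈ Ioo 0 T <;> simp [hg, hs, mul_comm]
  rw [e2]
  have hts : tsupport (fun s => (φ n).normed volume (t - s)) ⊆ Metric.closedBall t (φ n).rOut := by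
    refine closure_minimal (fun s hs => ?_) Metric.isClosed_closedBall
    have h1 : t - s ∈ Function.support ((φ n).normed volume) := hs
    rw [(φ n).support_normed_eq, mem_ball_zero_iff] at h1
    rw [Metric.mem_closedBall, dist_comm, dist_eq_norm]
    exact h1.le
  refine H _ ((φ n).contDiff_normed.comp (contDiff_const.sub contDiff_id)) ?_ ?_ fun s =>
    (φ n).nonneg_normed _
  · exact (isCompact_closedBall t _).of_isClosed_subset (isClosed_tsupport _) hts
  · refine hts.trans fun s hs => ?_
    rw [Metric.mem_closedBall, Real.dist_eq, abs_le] at hs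
    have := lt_min_iff.1 hn
    constructor <;> linarith [hs.1, hs.2, this.1, this.2]

/-- A distributional subsolution of `y' ≤ F`, `y(0) = y₀`, is a.e. below the primitive of `F`. -/
lemma ae_le_primitive {T : ℝ} {y F : ℝ → ℝ} (hy : IntegrableOn y (Ioo 0 T))
    (hF : IntegrableOn F (Ioo 0 T)) (y₀ : ℝ)
    (H : ∀ ψ : ℝ → ℝ, ContDiff ℝ ∞ ψ → HasCompactSupport ψ → tsupport ψ ⊆ Iio T →
      (∀ t, 0 ≤ ψ t) → 0 ≤ (∫ t in Ioo 0 T, (y t * deriv ψ t + F t * ψ t)) + y₀ * ψ 0) :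
    ∀ᵐ t ∂(volume.restrict (Ioo 0 T)), y t ≤ y₀ + ∫ s in (0 : ℝ)..t, F s := by
  rcases le_or_gt T 0 with hT | hT
  · simp [Ioo_eq_empty (not_lt.2 hT)]
  have hFi : IntegrableOn F (Ioc 0 T) := hF.congr_set_ae Ioo_ae_eq_Ioc.symm
  have hFint : IntervalIntegrable F volume 0 T :=
    (intervalIntegrable_iff_integrableOn_Ioc_of_le hT.le).2 hFi
  have hWc : ContinuousOn (fun t => ∫ s in (0 : ℝ)..t, F s) (Icc 0 T) := by
    have := intervalIntegral.continuousOn_primitive_interval (a := 0) (b := T) (f := F) (μ := volume)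
      (by rw [uIcc_of_le hT.le]; exact hFi.congr_set_ae Ioc_ae_eq_Icc.symm)
    rwa [uIcc_of_le hT.le] at this
  have hWi : IntegrableOn (fun t => ∫ s in (0 : ℝ)..t, F s) (Ioo 0 T) :=
    (hWc.integrableOn_Icc).mono_set Ioo_subset_Icc_self
  have hci : IntegrableOn (fun _ : ℝ => y₀) (Ioo 0 T) := integrableOn_const (by simp)
  suffices h : ∀ᵐ t ∂(volume.restrict (Ioo 0 T)), 0 ≤ y₀ + (∫ s in (0 : ℝ)..t, F s) - y t by
    filter_upwards [h] with t ht
    linarith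
  -- Duality: a nonnegative κ is written as minus the derivative of a nonnegative test function Ψ,
  -- so testing with Ψ produces the pairing of y with κ.
  refine ae_nonneg_of_forall_smooth ((hci.add hWi).sub hy) fun κ hκ hκc hκs hκ0 => ?_
  have hκi : Integrable κ := hκ.continuous.integrable_of_hasCompactSupport hκc
  obtain ⟨b, hbT, hb⟩ : ∃ b < T, tsupport κ ⊆ Iic b := by
    rcases (tsupport κ).eq_empty_or_nonempty with h | h
    · exact ⟨T - 1, by linarith, by simp [h]⟩
    · obtain ⟨b, hb⟩ := hκc.isCompact.exists_isGreatest h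
      exact ⟨b, (hκs hb.1).2, fun x hx => hb.2 hx⟩
  set Ψ : ℝ → ℝ := fun t => ∫ s in t..T, κ s with hΨ
  have hΨd : ∀ t, HasDerivAt Ψ (-κ t) t := fun t =>
    intervalIntegral.integral_hasDerivAt_left (hκ.continuous.intervalIntegrable _ _)
      hκ.continuous.stronglyMeasurable.stronglyMeasurableAtFilter hκ.continuous.continuousAt
  have hΨs : ContDiff ℝ ∞ Ψ := by
    rw [contDiff_infty_iff_deriv]
    refine ⟨fun t => (hΨd t).differentiableAt, ?_⟩
    rw [show deriv Ψ = fun t => -κ t from funext fun t => (hΨd t).deriv]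
    exact hκ.neg
  -- Ψ is constant, not zero, at negative times. This factor rises from 0 to 1 between -2 and -1,
  -- giving compact support without changing anything for t ≥ 0.
  set ζ : ℝ → ℝ := fun t => Real.smoothTransition (t + 2) with hζ
  have hζs : ContDiff ℝ ∞ ζ := Real.smoothTransition.contDiff.comp (contDiff_id.add contDiff_const)
  have hζ1 : ∀ t, -1 ≤ t → ζ t = 1 := fun t ht =>
    Real.smoothTransition.one_of_one_le (by linarith)
  have hκz : ∀ t, b < t → κ t = 0 := fun t ht => by
    by_contra hc
    exact absurd (hb (subset_tsupport _ hc)) (by simpa using ht)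
  have hΨ0 : ∀ t, b < t → Ψ t = 0 := by
    intro t ht
    simp only [hΨ]
    rw [intervalIntegral.integral_congr (g := fun _ => (0 : ℝ)), intervalIntegral.integral_zero]
    intro s hs
    refine hκz s ?_
    have := hs.1
    rcases le_total t T with h | h
    · rw [inf_eq_left.2 h] at this; linarith
    · rw [inf_eq_right.2 h] at this; linarith
  have hΨn : ∀ t, 0 ≤ Ψ t := by
    intro t
    rcases le_or_gt t T with h | h
    · exact intervalIntegral.integral_nonneg h fun s _ => hκ0 s
    · rw [hΨ0 t (by linarith)]
  have hsub : tsupport (fun t => ζ t * Ψ t) ⊆ Icc (-2) b := by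
    refine closure_minimal (fun t ht => ?_) isClosed_Icc
    simp only [Function.mem_support, ne_eq, mul_eq_zero, not_or] at ht
    constructor
    · by_contra hc
      exact ht.1 (Real.smoothTransition.zero_of_nonpos (by linarith))
    · by_contra hc
      exact ht.2 (hΨ0 t (by linarith))
  have key := H (fun t => ζ t * Ψ t) (hζs.mul hΨs)
    (isCompact_Icc.of_isClosed_subset (isClosed_tsupport _) hsub)
    (hsub.trans fun t ht => lt_of_le_of_lt ht.2 hbT)
    fun t => mul_nonneg (Real.smoothTransition.nonneg _) (hΨn t)
  have hz : ∀ t ∉ Ioo 0 T, κ t = 0 := fun t ht => by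
    by_contra hc
    exact ht (hκs (subset_tsupport _ hc))
  have hΨ00 : Ψ 0 = ∫ t in Ioo 0 T, κ t := by
    simp only [hΨ]
    rw [intervalIntegral.integral_of_le hT.le, integral_Ioc_eq_integral_Ioo]
  have hder : ∀ t ∈ Ioo 0 T, deriv (fun t => ζ t * Ψ t) t = -κ t := by
    intro t ht
    have : (fun t => ζ t * Ψ t) =ᶠ[𝓝 t] Ψ := by
      filter_upwards [lt_mem_nhds ht.1] with s hs
      rw [hζ1 s (by linarith), one_mul]
    rw [this.deriv_eq, (hΨd t).deriv]
  -- Both sides integrate F(s)κ(t) over the triangle s < t.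
  have hFub : ∫ s in Ioo 0 T, F s * Ψ s = ∫ t in Ioo 0 T, (∫ s in (0 : ℝ)..t, F s) * κ t := by
    set K : ℝ × ℝ → ℝ := {z : ℝ × ℝ | z.1 < z.2}.indicator fun z => F z.1 * κ z.2 with hK
    have hKi : Integrable K ((volume.restrict (Ioo 0 T)).prod (volume.restrict (Ioo 0 T))) :=
      (Integrable.mul_prod hF hκi.integrableOn).indicator
        (measurableSet_lt measurable_fst measurable_snd)
    have := integral_integral_swap (f := fun s t => K (s, t)) hKi
    convert this using 1
    · refine setIntegral_congr_fun measurableSet_Ioo fun s hs => ?_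
      have : ∀ t, K (s, t) = F s * (Ioi s).indicator κ t := by
        intro t
        by_cases h : s < t <;> simp [hK, h]
      simp only [this, integral_const_mul, hΨ]
      congr 1
      rw [setIntegral_indicator measurableSet_Ioi, intervalIntegral.integral_of_le hs.2.le,
        integral_Ioc_eq_integral_Ioo]
      congr 2
      ext t; simp only [mem_Ioo, mem_inter_iff, mem_Ioi]
      exact ⟨fun h => ⟨⟨hs.1.trans h.1, h.2⟩, h.1⟩, fun h => ⟨h.2, h.1.2⟩⟩
    · refine setIntegral_congr_fun measurableSet_Ioo fun t ht => ?_
      have : ∀ s, K (s, t) = (Iio t).indicator F s * κ t := by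
        intro s
        by_cases h : s < t <;> simp [hK, h]
      simp only [this, integral_mul_const]
      congr 1
      rw [setIntegral_indicator measurableSet_Iio, intervalIntegral.integral_of_le ht.1.le,
        integral_Ioc_eq_integral_Ioo]
      congr 2
      ext s; simp only [mem_Ioo, mem_inter_iff, mem_Iio]
      exact ⟨fun h => ⟨⟨h.1, h.2.trans ht.2⟩, h.2⟩, fun h => ⟨h.1.1, h.2⟩⟩
  obtain ⟨M, hM⟩ := hκc.exists_bound_of_continuous hκ.continuous
  have hbd : ∀ g : ℝ → ℝ, IntegrableOn g (Ioo 0 T) →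
      IntegrableOn (fun t => g t * κ t) (Ioo 0 T) := fun g hg =>
    Integrable.mul_bdd (c := M) hg hκ.continuous.aestronglyMeasurable
      (Eventually.of_forall fun t => hM t)
  have hFΨ : IntegrableOn (fun t => F t * Ψ t) (Ioo 0 T) := by
    obtain ⟨M', hM'⟩ := isCompact_Icc.exists_bound_of_continuousOn (s := Icc 0 T)
      hΨs.continuous.continuousOn
    refine Integrable.mul_bdd (c := M') hF hΨs.continuous.aestronglyMeasurable ?_
    rw [ae_restrict_iff' measurableSet_Ioo]
    exact Eventually.of_forall fun t ht => hM' t (Ioo_subset_Icc_self ht)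
  have e1 : ∫ t in Ioo 0 T, (y t * deriv (fun t => ζ t * Ψ t) t + F t * (ζ t * Ψ t))
      = ∫ t in Ioo 0 T, (-(y t * κ t) + F t * Ψ t) := by
    refine setIntegral_congr_fun measurableSet_Ioo fun t ht => ?_
    rw [hder t ht, hζ1 t (by linarith [ht.1])]
    ring
  have hyn : IntegrableOn (fun t => -(y t * κ t)) (Ioo 0 T) := (hbd y hy).neg
  rw [e1, hζ1 0 (by norm_num), one_mul, hΨ00,
    integral_add hyn hFΨ, hFub, integral_neg, ← integral_const_mul] at key
  have e2 : ∫ t in Ioo 0 T, (y₀ + (∫ s in (0 : ℝ)..t, F s) - y t) * κ t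
      = -(∫ t in Ioo 0 T, y t * κ t) + (∫ t in Ioo 0 T, (∫ s in (0 : ℝ)..t, F s) * κ t)
        + ∫ t in Ioo 0 T, y₀ * κ t := by
    simp only [sub_mul, add_mul]
    rw [integral_sub ((hbd _ hci).fun_add (hbd _ hWi)) (hbd y hy), integral_add (hbd _ hci) (hbd _ hWi)]
    ring
  rw [e2]
  exact key

/-- The one-sided comparison is applied to (y, F, y₀) and to its negative. -/
lemma ae_eq_primitive {T : ℝ} {y F : ℝ → ℝ} (hy : IntegrableOn y (Ioo 0 T))
    (hF : IntegrableOn F (Ioo 0 T)) (y₀ : ℝ)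
    (H : ∀ ψ : ℝ → ℝ, ContDiff ℝ ∞ ψ → HasCompactSupport ψ → tsupport ψ ⊆ Iio T →
      (∫ t in Ioo 0 T, (y t * deriv ψ t + F t * ψ t)) + y₀ * ψ 0 = 0) :
    ∀ᵐ t ∂(volume.restrict (Ioo 0 T)), y t = y₀ + ∫ s in (0 : ℝ)..t, F s := by
  have h1 := ae_le_primitive hy hF y₀ fun ψ a b c _ => (H ψ a b c).ge
  have h2 := ae_le_primitive (y := fun t => -y t) (F := fun t => -F t) hy.neg hF.neg (-y₀)
    fun ψ a b c _ => by
      have := H ψ a b c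
      have e : ∫ t in Ioo 0 T, (-y t * deriv ψ t + -F t * ψ t)
          = -∫ t in Ioo 0 T, (y t * deriv ψ t + F t * ψ t) := by
        rw [← integral_neg]; congr 1; ext t; ring
      rw [e]; linarith
  filter_upwards [h1, h2] with t h1 h2
  rw [intervalIntegral.integral_neg] at h2
  linarith

lemma ae_eq_zero_of_forall_smooth {T : ℝ} {h : ℝ → ℝ} (hh : IntegrableOn h (Ioo 0 T))
    (H : ∀ κ : ℝ → ℝ, ContDiff ℝ ∞ κ → HasCompactSupport κ → tsupport κ ⊆ Ioo 0 T →
      ∫ t in Ioo 0 T, h t * κ t = 0) :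
    ∀ᵐ t ∂(volume.restrict (Ioo 0 T)), h t = 0 := by
  have h1 := ae_nonneg_of_forall_smooth hh fun κ a b c _ => (H κ a b c).ge
  have h2 := ae_nonneg_of_forall_smooth (h := fun t => -h t) hh.neg fun κ a b c _ => by
    simp only [neg_mul, integral_neg, H κ a b c, neg_zero, le_refl]
  filter_upwards [h1, h2] with t h1 h2
  linarith

lemma integrable_slab_mul_of_integrable {T P : ℝ} (hP : 0 < P) {g : ℝ × E3 → ℝ}
    (hper : PeriodicTX P g) (hi : Integrable g (cylMeasure T P)) {h : ℝ × E3 → ℝ}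
    (hc : Continuous h) (hs : HasCompactSupport h) :
    Integrable (fun z => g z * h z) (slabMeasure T) := by
  obtain ⟨g', hm, hp, he⟩ := exists_measurable_periodicTX hP hper hi.aestronglyMeasurable
  have h1 : Integrable g' (cylMeasure T P) :=
    hi.congr (he.filter_mono (ae_mono (cylMeasure_le_slab T P)))
  refine (integrable_slab_mul hP hm hp h1 hc hs).congr ?_
  filter_upwards [he] with z hz
  rw [hz]

lemma integrable_fun_sub {α : Type*} [MeasurableSpace α] {m : Measure α} {f g : α → ℝ}
    (hf : Integrable f m) (hg : Integrable g m) : Integrable (fun z => f z - g z) m := hf.sub hg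

/-- The cutoff of `exists_cell_cutoff`. -/
def cutoff {P : ℝ} (hP : 0 < P) : E3 → ℝ := (exists_cell_cutoff hP).choose

lemma contDiff_cutoff {P : ℝ} (hP : 0 < P) : ContDiff ℝ ∞ (cutoff hP) := (exists_cell_cutoff hP).choose_spec.1

lemma hasCompactSupport_cutoff {P : ℝ} (hP : 0 < P) : HasCompactSupport (cutoff hP) :=
  (exists_cell_cutoff hP).choose_spec.2.1

lemma cutoff_nonneg {P : ℝ} (hP : 0 < P) (x : E3) : 0 ≤ cutoff hP x := (exists_cell_cutoff hP).choose_spec.2.2.1 x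

lemma cutoff_spec {P : ℝ} (hP : 0 < P) {g : E3 → ℝ} (hg : Measurable g) (hper : PeriodicX P g)
    (hi : Integrable g (cellMeasure P)) : ∫ x, g x * cutoff hP x = ∫ x, g x ∂(cellMeasure P) ∧
      (∀ i, ∫ x, g x * pd i (cutoff hP) x = 0) ∧ ∫ x, g x * lapX (cutoff hP) x = 0 :=
  (exists_cell_cutoff hP).choose_spec.2.2.2 g hg hper hi

lemma integral_slab_cutoff {T P : ℝ} (hP : 0 < P) {g : ℝ × E3 → ℝ} (hg : Measurable g)
    (hper : PeriodicTX P g) (hi : Integrable g (cylMeasure T P)) {ψ : ℝ → ℝ} (hψ : Continuous ψ)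
    (hψs : HasCompactSupport ψ) :
    ∫ z, g z * (ψ z.1 * cutoff hP z.2) ∂(slabMeasure T)
    = ∫ t in Ioo 0 T, (∫ x, g (t, x) ∂(cellMeasure P)) * ψ t := by
  rw [integral_slab_mul hP hg hper hi (contDiff_cutoff hP).continuous
    (hasCompactSupport_cutoff hP) hψ hψs]
  refine integral_congr_ae ?_
  filter_upwards [ae_integrable_section hi] with t ht
  rw [pair, (cutoff_spec hP (by fun_prop) (hper t) ht).1]

lemma integral_slab_pd_cutoff {T P : ℝ} (hP : 0 < P) {g : ℝ × E3 → ℝ} (hg : Measurable g)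
    (hper : PeriodicTX P g) (hi : Integrable g (cylMeasure T P)) {ψ : ℝ → ℝ} (hψ : Continuous ψ)
    (hψs : HasCompactSupport ψ) (i : Fin 3) :
    ∫ z, g z * (ψ z.1 * pd i (cutoff hP) z.2) ∂(slabMeasure T) = 0 := by
  rw [integral_slab_mul hP hg hper hi (contDiff_pd (contDiff_cutoff hP)).continuous
    (hasCompactSupport_pd (hasCompactSupport_cutoff hP)) hψ hψs]
  refine integral_eq_zero_of_ae ?_
  filter_upwards [ae_integrable_section hi] with t ht
  rw [pair, (cutoff_spec hP (by fun_prop) (hper t) ht).2.1]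
  simp

lemma integral_slab_lapX_cutoff {T P : ℝ} (hP : 0 < P) {g : ℝ × E3 → ℝ} (hg : Measurable g)
    (hper : PeriodicTX P g) (hi : Integrable g (cylMeasure T P)) {ψ : ℝ → ℝ} (hψ : Continuous ψ)
    (hψs : HasCompactSupport ψ) :
    ∫ z, g z * (ψ z.1 * lapX (cutoff hP) z.2) ∂(slabMeasure T) = 0 := by
  rw [integral_slab_mul hP hg hper hi (contDiff_lapX (contDiff_cutoff hP)).continuous
    (hasCompactSupport_lapX (hasCompactSupport_cutoff hP)) hψ hψs]
  refine integral_eq_zero_of_ae ?_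
  filter_upwards [ae_integrable_section hi] with t ht
  rw [pair, (cutoff_spec hP (by fun_prop) (hper t) ht).2.2]
  simp

lemma hasCompactSupport_mul_prod {ψ : ℝ → ℝ} {k : E3 → ℝ} (hψ : HasCompactSupport ψ)
    (hk : HasCompactSupport k) : HasCompactSupport fun z : ℝ × E3 => ψ z.1 * k z.2 := by
  refine HasCompactSupport.intro (hψ.isCompact.prod hk.isCompact) fun z hz => ?_
  by_contra hc
  simp only [mul_eq_zero, not_or] at hc
  exact hz ⟨subset_tsupport _ hc.1, subset_tsupport _ hc.2⟩

lemma integrable_cell_integral {T P : ℝ} {g : ℝ × E3 → ℝ} (hi : Integrable g (cylMeasure T P)) :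
    IntegrableOn (fun t => ∫ x, g (t, x) ∂(cellMeasure P)) (Ioo 0 T) := by
  rw [cylMeasure_eq_prod] at hi
  exact hi.integral_prod_left

lemma integral_cyl_eq {T P : ℝ} {g : ℝ × E3 → ℝ} (hi : Integrable g (cylMeasure T P)) :
    ∫ z, g z ∂(cylMeasure T P) = ∫ t in Ioo 0 T, ∫ x, g (t, x) ∂(cellMeasure P) := by
  rw [cylMeasure_eq_prod] at hi ⊢
  exact integral_prod _ hi

/-- The mean over the cell of a subsolution of an advection-diffusion equation does not grow. -/
lemma ScalarIneq.ae_integral_le {T P κ : ℝ} (hP : 0 < P) {u : ℝ × E3 → E3} {b₀ : E3 → ℝ}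
    {b : ℝ × E3 → ℝ} (hu : Measurable u) (hup : PeriodicTX P u) (hb : Measurable b)
    (hbp : PeriodicTX P b) (hbi : Integrable b (cylMeasure T P))
    (hbu : ∀ j, Integrable (fun z => b z * u z j) (cylMeasure T P))
    (h : ScalarIneq T κ u b₀ b) :
    ∀ᵐ t ∂(volume.restrict (Ioo 0 T)),
      ∫ x, b (t, x) ∂(cellMeasure P) ≤ ∫ x, b₀ x * cutoff hP x := by
  have hθ := contDiff_cutoff hP
  have hθs := hasCompactSupport_cutoff hP
  have key := ae_le_primitive (T := T) (F := fun _ => 0) (integrable_cell_integral hbi)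
    (by simp [IntegrableOn]) (∫ x, b₀ x * cutoff hP x) ?_
  · simpa using key
  intro ψ hψ hψs hψT hψ0
  -- With the cell cutoff in space, the advective and diffusive terms integrate to zero, leaving the
  -- distributional inequality "derivative of the cell mean ≤ 0" in time.
  have ht := h _ (isTest_mul hψ hψs hψT hθ hθs) fun z => mul_nonneg (hψ0 _) (cutoff_nonneg hP _)
  have hd : Continuous (deriv ψ) := hψ.continuous_deriv (by simp)
  have hds : HasCompactSupport (deriv ψ) := hψs.deriv
  have hbup : ∀ j, PeriodicTX P fun z => b z * u z j := fun j t x i => by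
    simp only [hbp t x i, hup t x i]
  have i1 : Integrable (fun z => b z * (deriv ψ z.1 * cutoff hP z.2)) (slabMeasure T) :=
    integrable_slab_mul_of_integrable hP hbp hbi
      ((hd.comp continuous_fst).mul (hθ.continuous.comp continuous_snd))
      (hasCompactSupport_mul_prod hds hθs)
  have i2 : ∀ j, Integrable (fun z => b z * u z j * (ψ z.1 * pd j (cutoff hP) z.2))
      (slabMeasure T) := fun j =>
    integrable_slab_mul_of_integrable hP (hbup j) (hbu j)
      ((hψ.continuous.comp continuous_fst).mul ((contDiff_pd hθ).continuous.comp continuous_snd))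
      (hasCompactSupport_mul_prod hψs (hasCompactSupport_pd hθs))
  have i3 : Integrable (fun z => κ * (b z * (ψ z.1 * lapX (cutoff hP) z.2))) (slabMeasure T) :=
    (integrable_slab_mul_of_integrable hP hbp hbi
      ((hψ.continuous.comp continuous_fst).mul ((contDiff_lapX hθ).continuous.comp continuous_snd))
      (hasCompactSupport_mul_prod hψs (hasCompactSupport_lapX hθs))).const_mul κ
  simp only [dt_mul hψ hθ, dx_mul hψ hθ, lap_mul hψ hθ] at ht
  rw [integral_add (i1.fun_add (integrable_finsetSum _ fun j _ => i2 j)) i3,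
    integral_add i1 (integrable_finsetSum _ fun j _ => i2 j),
    integral_finsetSum _ fun j _ => i2 j, integral_const_mul,
    integral_slab_cutoff hP hb hbp hbi hd hds,
    integral_slab_lapX_cutoff hP hb hbp hbi hψ.continuous hψs] at ht
  have hum : ∀ j, Measurable fun z => b z * u z j := fun j => by fun_prop
  simp only [integral_slab_pd_cutoff hP (hum _) (hbup _) (hbu _) hψ.continuous hψs,
    Finset.sum_const_zero, mul_zero, add_zero] at ht
  have e0 : ∫ x, b₀ x * (ψ 0 * cutoff hP x) = (∫ x, b₀ x * cutoff hP x) * ψ 0 := by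
    rw [← integral_mul_const]; congr 1; ext x; ring
  rw [e0] at ht
  simpa using ht

/-! ### A smooth convex ramp -/

/-- A smooth convex function vanishing exactly on `(-∞, 0]`, with slope at most one. -/
def ramp (s : ℝ) : ℝ := ∫ r in (0 : ℝ)..s, Real.smoothTransition r

lemma hasDerivAt_ramp (s : ℝ) : HasDerivAt ramp (Real.smoothTransition s) s :=
  intervalIntegral.integral_hasDerivAt_right
    (Real.smoothTransition.continuous.intervalIntegrable _ _)
    Real.smoothTransition.continuous.stronglyMeasurable.stronglyMeasurableAtFilter
    Real.smoothTransition.continuousAt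

lemma deriv_ramp : deriv ramp = Real.smoothTransition := funext fun s => (hasDerivAt_ramp s).deriv

lemma contDiff_ramp : ContDiff ℝ ∞ ramp := by
  rw [contDiff_infty_iff_deriv, deriv_ramp]
  exact ⟨fun s => (hasDerivAt_ramp s).differentiableAt, Real.smoothTransition.contDiff⟩

lemma ramp_of_nonpos {s : ℝ} (hs : s ≤ 0) : ramp s = 0 := by
  rw [ramp, intervalIntegral.integral_congr (g := fun _ => (0 : ℝ)), intervalIntegral.integral_zero]
  intro r hr
  rw [uIcc_of_ge hs] at hr
  exact Real.smoothTransition.zero_of_nonpos hr.2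

lemma ramp_pos {s : ℝ} (hs : 0 < s) : 0 < ramp s :=
  intervalIntegral.intervalIntegral_pos_of_pos_on
    (Real.smoothTransition.continuous.intervalIntegrable _ _)
    (fun _ hr => Real.smoothTransition.pos_of_pos hr.1) hs

lemma ramp_nonneg (s : ℝ) : 0 ≤ ramp s := by
  rcases le_or_gt s 0 with h | h
  · rw [ramp_of_nonpos h]
  · exact (ramp_pos h).le

lemma abs_ramp_le (s : ℝ) : |ramp s| ≤ |s| := by
  have := intervalIntegral.norm_integral_le_of_norm_le_const (a := 0) (b := s) (C := 1)
    (f := Real.smoothTransition) fun r _ => by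
      rw [Real.norm_of_nonneg (Real.smoothTransition.nonneg r)]
      exact Real.smoothTransition.le_one r
  simpa [ramp] using this

lemma deriv_smoothTransition_nonneg (s : ℝ) : 0 ≤ deriv Real.smoothTransition s :=
  Real.smoothTransition.monotone.deriv_nonneg

/-- The part of the maximum principle shared by the lower and the upper bound. -/
lemma ae_eq_zero_of_entropy {T P κ : ℝ} (hP : 0 < P) {u : ℝ × E3 → E3} {b₀ : E3 → ℝ}
    {b : ℝ × E3 → ℝ} (hu : Measurable u) (hup : PeriodicTX P u) (hb : Measurable b)
    (hbp : PeriodicTX P b) (hbi : Integrable b (cylMeasure T P))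
    (hbu : ∀ j, Integrable (fun z => b z * u z j) (cylMeasure T P)) (hb0 : ∀ z, 0 ≤ b z)
    (hz : b₀ =ᵐ[volume] 0) (h : ScalarIneq T κ u b₀ b) :
    ∀ᵐ z ∂(cylMeasure T P), b z = 0 := by
  have h1 := h.ae_integral_le hP hu hup hb hbp hbi hbu
  have h2 : ∫ x, b₀ x * cutoff hP x = 0 :=
    integral_eq_zero_of_ae (by filter_upwards [hz] with x hx; simp [hx])
  have h3 : ∫ z, b z ∂(cylMeasure T P) ≤ 0 := by
    rw [integral_cyl_eq hbi]
    refine integral_nonpos_of_ae ?_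
    filter_upwards [h1] with t ht
    rw [h2] at ht; exact ht
  have h4 := (integral_eq_zero_iff_of_nonneg hb0 hbi).1
    (le_antisymm h3 (integral_nonneg hb0))
  exact h4

/-- The maximum principle. -/
lemma IsViscousSolution.mem_Icc {T P : ℝ} (hP : 0 < P) {I : ℕ} {μ : Fin (I + 1) → ℝ}
    {f : ℝ × E3 → E3} {u₀ : E3 → E3} {χ₀ : Fin I → E3 → ℝ} {u : ℝ × E3 → E3} {p : ℝ × E3 → ℝ}
    {χ : Fin I → ℝ × E3 → ℝ} (hdata : IsData T P f u₀ χ₀)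
    (h : IsViscousSolution T P μ f u₀ χ₀ u p χ) (hu : Measurable u) (hχ : ∀ i, Measurable (χ i))
    (i : Fin I) : ∀ᵐ z ∂(cylMeasure T P), χ i z ∈ Icc (0 : ℝ) 1 := by
  have hχ0 : ∀ᵐ x, χ₀ i x ∈ Icc (0 : ℝ) 1 := by
    refine ae_volume_of_ae_cell hP (fun x j => by simp only [hdata.scalar_periodic i x j]) ?_
    have hall := ae_all_iff.2 hdata.scalar_nonneg
    filter_upwards [hall, hdata.scalar_sum] with x h1 h2
    refine ⟨h1 i, ?_⟩
    rw [← h2]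
    exact Finset.single_le_sum (f := fun i => χ₀ i x) (fun j _ => h1 j) (Finset.mem_univ i)
  have huj : ∀ j, MemLp (fun z => u z j) 2 (cylMeasure T P) := fun j =>
    MemLp.of_le h.vel_memLp (by fun_prop : Measurable fun z => u z j).aestronglyMeasurable
      (Eventually.of_forall fun z => PiLp.norm_apply_le (u z) j)
  -- The concentrations are not yet known to be bounded, so admissibility of β is secured by linear
  -- growth: β(χ) is then in L² and its product with u in L¹.
  have gen : ∀ β : ℝ → ℝ, ContDiff ℝ ∞ β → (∀ s, 0 ≤ iteratedDeriv 2 β s) → (∀ s, 0 ≤ β s) →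
      (∀ s ∈ Icc (0 : ℝ) 1, β s = 0) → (∀ s, |β s| ≤ 1 + |s|) →
      ∀ᵐ z ∂(cylMeasure T P), β (χ i z) = 0 := by
    intro β hβ hβ2 hβ0 hβz hβb
    have hm : Measurable fun z => β (χ i z) := hβ.continuous.measurable.comp (hχ i)
    have hL2 : MemLp (fun z => β (χ i z)) 2 (cylMeasure T P) := by
      have h1 : MemLp (fun _ : ℝ × E3 => (1 : ℝ)) 2 (cylMeasure T P) := memLp_const 1
      have h2 : MemLp (fun z => |χ i z|) 2 (cylMeasure T P) := (h.scalar_memLp i).abs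
      refine MemLp.of_le (h1.add h2) hm.aestronglyMeasurable (Eventually.of_forall fun z => ?_)
      rw [Pi.add_apply, Real.norm_eq_abs, Real.norm_eq_abs,
        abs_of_nonneg (add_nonneg zero_le_one (abs_nonneg (χ i z)))]
      exact hβb _
    have hI : Integrable (fun z => β (χ i z)) (cylMeasure T P) := hL2.integrable (by norm_num)
    have hIu : ∀ j, Integrable (fun z => β (χ i z) * u z j) (cylMeasure T P) := fun j =>
      hL2.integrable_mul (huj j)
    refine ae_eq_zero_of_entropy (b₀ := fun x => β (χ₀ i x)) (κ := μ i.succ) hP hu h.vel_periodic hm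
      (fun t x j => by simp only [h.scalar_periodic i t x j]) hI hIu (fun z => hβ0 _) ?_
      (h.entropy i β (hβ.of_le (WithTop.coe_le_coe.2 (le_top (a := (2 : ℕ∞))))) hβ2 hI hIu)
    filter_upwards [hχ0] with x hx
    exact hβz _ hx
  -- This ramp is positive exactly on s < 0; the next one exactly on s > 1.
  have hlo := gen (fun s => ramp (-s)) (contDiff_ramp.comp contDiff_neg) (fun s => by
      rw [iteratedDeriv_succ, iteratedDeriv_one]
      have : deriv (fun s => ramp (-s)) = fun s => -Real.smoothTransition (-s) := by
        ext s; rw [deriv_comp_neg, deriv_ramp]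
      rw [this, deriv.fun_neg, deriv_comp_neg, neg_neg]
      exact deriv_smoothTransition_nonneg _)
    (fun s => ramp_nonneg _) (fun s hs => ramp_of_nonpos (by linarith [hs.1]))
    (fun s => (abs_ramp_le _).trans (by rw [abs_neg]; linarith))
  have hhi := gen (fun s => ramp (s - 1)) (contDiff_ramp.comp (contDiff_id.sub contDiff_const))
    (fun s => by
      rw [iteratedDeriv_succ, iteratedDeriv_one]
      have : deriv (fun s => ramp (s - 1)) = fun s => Real.smoothTransition (s - 1) := by
        ext s; rw [deriv_comp_sub_const, deriv_ramp]
      rw [this, deriv_comp_sub_const]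
      exact deriv_smoothTransition_nonneg _)
    (fun s => ramp_nonneg _) (fun s hs => ramp_of_nonpos (by linarith [hs.2]))
    (fun s => (abs_ramp_le _).trans (by
      have := abs_sub s 1; simp only [abs_one] at this; linarith))
  filter_upwards [hlo, hhi] with z h1 h2
  constructor
  · by_contra hc
    exact (ramp_pos (by linarith : 0 < -χ i z)).ne' h1
  · by_contra hc
    exact (ramp_pos (by linarith : 0 < χ i z - 1)).ne' h2

/-! ### The energy inequality -/

lemma memLp_apply {u : ℝ × E3 → E3} {m : Measure (ℝ × E3)} {q : ℝ≥0∞} (h : MemLp u q m)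
    (j : Fin 3) : MemLp (fun z => u z j) q m :=
  MemLp.of_le h (((EuclideanSpace.proj (𝕜 := ℝ) j).continuous).comp_aestronglyMeasurable
    h.aestronglyMeasurable) (Eventually.of_forall fun z => PiLp.norm_apply_le (u z) j)

lemma integrable_inner {u f : ℝ × E3 → E3} {m : Measure (ℝ × E3)} (hu : MemLp u 2 m)
    (hf : MemLp f 2 m) : Integrable (fun z => inner ℝ (f z) (u z)) m := by
  simp only [PiLp.inner_apply, RCLike.inner_apply, conj_trivial]
  exact integrable_finsetSum _ fun j _ => (memLp_apply hu j).integrable_mul (memLp_apply hf j)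

/-- With the cell cutoff as spatial test function, the energy flux and the diffusion of |u|²/2
integrate to zero by periodicity, and the dissipation is discarded because ν and the test function
are nonnegative. What remains is a differential inequality in time, integrated by `ae_le_primitive`.
-/
lemma LocalEnergyIneq.ae_energy_le {T P ν : ℝ} (hP : 0 < P) (hν : 0 ≤ ν) {f : ℝ × E3 → E3}
    {u₀ : E3 → E3} {u : ℝ × E3 → E3} {D : Fin 3 → Fin 3 → ℝ × E3 → ℝ} {p : ℝ × E3 → ℝ}
    (hf : Measurable f) (hfp : PeriodicTX P f) (hf2 : MemLp f 2 (cylMeasure T P))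
    (hu : Measurable u) (hup : PeriodicTX P u) (hu2 : MemLp u 2 (cylMeasure T P))
    (hp : Measurable p) (hpp : PeriodicTX P p)
    (hflux : ∀ i, Integrable (fun z => (‖u z‖ ^ 2 / 2 + p z) * u z i) (cylMeasure T P))
    (hD : ∀ j, HasL2Gradient T P (fun z => u z j) (D j))
    (hu₀ : Measurable u₀) (hu₀p : PeriodicX P u₀) (hu₀2 : MemLp u₀ 2 (cellMeasure P))
    (h : LocalEnergyIneq T ν f u₀ u D p) :
    ∀ᵐ t ∂(volume.restrict (Ioo 0 T)), ∫ x, ‖u (t, x)‖ ^ 2 ∂(cellMeasure P) ≤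
      ∫ x, ‖u₀ x‖ ^ 2 ∂(cellMeasure P)
        + 2 * ∫ s in (0 : ℝ)..t, ∫ x, inner ℝ (u (s, x)) (f (s, x)) ∂(cellMeasure P) := by
  have hθ := contDiff_cutoff hP
  have hθs := hasCompactSupport_cutoff hP
  have hEi : Integrable (fun z => ‖u z‖ ^ 2 / 2) (cylMeasure T P) :=
    (hu2.integrable_norm_pow (by norm_num)).div_const 2
  have hEm : Measurable fun z => ‖u z‖ ^ 2 / 2 := by fun_prop
  have hEp : PeriodicTX P fun z => ‖u z‖ ^ 2 / 2 := fun t x i => by simp only [hup t x i]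
  have hWi := integrable_inner hu2 hf2
  have hWm : Measurable fun z => inner ℝ (f z) (u z) := by fun_prop
  have hWp : PeriodicTX P fun z => inner ℝ (f z) (u z) := fun t x i => by
    simp only [hup t x i, hfp t x i]
  have hFp : ∀ i, PeriodicTX P fun z => (‖u z‖ ^ 2 / 2 + p z) * u z i := fun i t x j => by
    simp only [hup t x j, hpp t x j]
  have hFm : ∀ i, Measurable fun z => (‖u z‖ ^ 2 / 2 + p z) * u z i := fun i => by fun_prop
  have hDi : Integrable (fun z => ∑ j, ∑ i, D j i z ^ 2) (cylMeasure T P) :=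
    integrable_finsetSum _ fun j _ => integrable_finsetSum _ fun i _ =>
      ((hD j).memLp i).integrable_sq
  have hDp : PeriodicTX P fun z => ∑ j, ∑ i, D j i z ^ 2 := fun t x k => by
    refine Finset.sum_congr rfl fun j _ => Finset.sum_congr rfl fun i _ => ?_
    have := (hD j).periodic i t x k
    simp only at this
    rw [this]
  have key := ae_le_primitive (T := T) (integrable_cell_integral hEi)
    (integrable_cell_integral hWi) (∫ x, ‖u₀ x‖ ^ 2 / 2 ∂(cellMeasure P)) ?_
  · filter_upwards [key] with t ht
    simp only [integral_div] at ht
    have : ∀ s, ∫ x, inner ℝ (u (s, x)) (f (s, x)) ∂(cellMeasure P)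
        = ∫ x, inner ℝ (f (s, x)) (u (s, x)) ∂(cellMeasure P) := fun s => by
      simp only [real_inner_comm]
    simp only [this]
    linarith
  intro ψ hψ hψs hψT hψ0
  have ht := h _ (isTest_mul hψ hψs hψT hθ hθs) fun z => mul_nonneg (hψ0 _) (cutoff_nonneg hP _)
  have hd : Continuous (deriv ψ) := hψ.continuous_deriv (by simp)
  have hds : HasCompactSupport (deriv ψ) := hψs.deriv
  have cψ := hψ.continuous.comp (continuous_fst (X := ℝ) (Y := E3))
  have cθ := hθ.continuous.comp (continuous_snd (X := ℝ) (Y := E3))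
  have i1 : Integrable (fun z => ‖u z‖ ^ 2 / 2 * (deriv ψ z.1 * cutoff hP z.2)) (slabMeasure T) :=
    integrable_slab_mul_of_integrable hP hEp hEi
      ((hd.comp continuous_fst).mul cθ) (hasCompactSupport_mul_prod hds hθs)
  have i2 : ∀ j, Integrable (fun z => (‖u z‖ ^ 2 / 2 + p z) * u z j *
      (ψ z.1 * pd j (cutoff hP) z.2)) (slabMeasure T) := fun j =>
    integrable_slab_mul_of_integrable hP (hFp j) (hflux j)
      (cψ.mul ((contDiff_pd hθ).continuous.comp continuous_snd))
      (hasCompactSupport_mul_prod hψs (hasCompactSupport_pd hθs))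
  have i3 : Integrable (fun z => ν * ((∑ j, ∑ i, D j i z ^ 2) * (ψ z.1 * cutoff hP z.2)))
      (slabMeasure T) :=
    (integrable_slab_mul_of_integrable hP hDp hDi (cψ.mul cθ)
      (hasCompactSupport_mul_prod hψs hθs)).const_mul ν
  have i4 : Integrable (fun z => ν * (‖u z‖ ^ 2 / 2 * (ψ z.1 * lapX (cutoff hP) z.2)))
      (slabMeasure T) :=
    (integrable_slab_mul_of_integrable hP hEp hEi
      (cψ.mul ((contDiff_lapX hθ).continuous.comp continuous_snd))
      (hasCompactSupport_mul_prod hψs (hasCompactSupport_lapX hθs))).const_mul ν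
  have i5 : Integrable (fun z => inner ℝ (f z) (u z) * (ψ z.1 * cutoff hP z.2)) (slabMeasure T) :=
    integrable_slab_mul_of_integrable hP hWp hWi (cψ.mul cθ) (hasCompactSupport_mul_prod hψs hθs)
  have i2' := integrable_finsetSum Finset.univ fun j _ => i2 j
  simp only [dt_mul hψ hθ, dx_mul hψ hθ, lap_mul hψ hθ] at ht
  rw [integral_add ((integrable_fun_sub (i1.fun_add i2') i3).fun_add i4) i5, integral_add (integrable_fun_sub (i1.fun_add i2') i3) i4,
    integral_sub (i1.fun_add i2') i3, integral_add i1 i2',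
    integral_finsetSum _ fun j _ => i2 j, integral_const_mul ν, integral_const_mul ν,
    integral_slab_cutoff hP hEm hEp hEi hd hds,
    integral_slab_cutoff hP hWm hWp hWi hψ.continuous hψs,
    integral_slab_lapX_cutoff hP hEm hEp hEi hψ.continuous hψs] at ht
  simp only [integral_slab_pd_cutoff hP (hFm _) (hFp _) (hflux _) hψ.continuous hψs,
    Finset.sum_const_zero, mul_zero, add_zero] at ht
  have hneg : 0 ≤ ν * ∫ z, (∑ j, ∑ i, D j i z ^ 2) * (ψ z.1 * cutoff hP z.2) ∂(slabMeasure T) :=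
    mul_nonneg hν (integral_nonneg fun z => mul_nonneg
      (Finset.sum_nonneg fun _ _ => Finset.sum_nonneg fun _ _ => sq_nonneg _)
      (mul_nonneg (hψ0 _) (cutoff_nonneg hP _)))
  have e0 : ∫ x, ‖u₀ x‖ ^ 2 / 2 * (ψ 0 * cutoff hP x)
      = (∫ x, ‖u₀ x‖ ^ 2 / 2 ∂(cellMeasure P)) * ψ 0 := by
    rw [← (cutoff_spec hP (g := fun x => ‖u₀ x‖ ^ 2 / 2) (by fun_prop)
      (fun x i => by simp only [hu₀p x i])
      ((hu₀2.integrable_norm_pow (by norm_num)).div_const 2)).1, ← integral_mul_const]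
    congr 1; ext x; ring
  rw [e0] at ht
  have j1 : IntegrableOn (fun t => (∫ x, ‖u (t, x)‖ ^ 2 / 2 ∂(cellMeasure P)) * deriv ψ t)
      (Ioo 0 T) := by
    obtain ⟨M, hM⟩ := hds.exists_bound_of_continuous hd
    exact Integrable.mul_bdd (c := M) (integrable_cell_integral hEi) hd.aestronglyMeasurable
      (Eventually.of_forall hM)
  have j2 : IntegrableOn (fun t => (∫ x, inner ℝ (f (t, x)) (u (t, x)) ∂(cellMeasure P)) * ψ t)
      (Ioo 0 T) := by
    obtain ⟨M, hM⟩ := hψs.exists_bound_of_continuous hψ.continuous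
    exact Integrable.mul_bdd (c := M) (integrable_cell_integral hWi)
      hψ.continuous.aestronglyMeasurable (Eventually.of_forall hM)
  rw [integral_add j1 j2]
  linarith

/-! ### Parseval's identity on the cell -/

section Parseval

attribute [local instance] instMeasureSpaceUnitAddCircle

/-- The representative in the cell of a point of the unit torus, rescaled to period `P`. -/
def torusLift (P : ℝ) (y : UnitAddTorus (Fin 3)) : E3 :=
  WithLp.toLp 2 fun i => P * (AddCircle.equivIoc 1 (-1 / 2 : ℝ) (y i)).1

lemma measurable_torusLift (P : ℝ) : Measurable (torusLift P) := by
  refine (MeasurableEquiv.toLp 2 (Fin 3 → ℝ)).measurable.comp (measurable_pi_lambda _ fun i => ?_)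
  have h : Measurable fun y : UnitAddTorus (Fin 3) =>
      (AddCircle.measurableEquivIoc 1 (-1 / 2 : ℝ) (y i)).1 :=
    measurable_subtype_coe.comp ((AddCircle.measurableEquivIoc 1 (-1 / 2 : ℝ)).measurable.comp
      (measurable_pi_apply i))
  exact h.const_mul P

/-- The cell that is open on the left and closed on the right. -/
def iocCell (P : ℝ) : Set E3 := {x | ∀ i, x i ∈ Ioc (-P / 2) (P / 2)}

lemma measurableSet_iocCell (P : ℝ) : MeasurableSet (iocCell P) := by
  have : iocCell P = ⋂ i : Fin 3, (fun x : E3 => x i) ⁻¹' Ioc (-P / 2) (P / 2) := by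
    ext x; simp [iocCell]
  rw [this]
  exact MeasurableSet.iInter fun i => (by fun_prop : Measurable fun x : E3 => x i) measurableSet_Ioc

lemma iocCell_ae_eq_cell (P : ℝ) : iocCell P =ᵐ[volume] cell P := by
  have : iocCell P = (MeasurableEquiv.toLp 2 (Fin 3 → ℝ)).symm ⁻¹'
      (Set.pi univ fun _ => Ioc (-P / 2) (P / 2)) := by
    ext x; simp [iocCell]
  rw [this, cell_eq_preimage]
  exact (EuclideanSpace.volume_preserving_symm_measurableEquiv_toLp
    (Fin 3)).quasiMeasurePreserving.preimage_ae_eq (by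
      rw [pi_univ_Icc]
      exact Measure.univ_pi_Ioc_ae_eq_Icc)

/-- The lift sends the unit torus bijectively to the cell closed on the right and scales volume by
P³; since the torus carries a probability measure, the image is the normalized measure of the cell.
This transports Parseval's identity. -/
lemma map_torusLift {P : ℝ} (hP : 0 < P) :
    Measure.map (torusLift P) volume = ENNReal.ofReal ((P ^ 3)⁻¹) • cellMeasure P := by
  ext s hs
  rw [Measure.map_apply (measurable_torusLift P) hs, ← lintegral_indicator_one
    (measurable_torusLift P hs), UnitAddTorus.lintegral_preimage _ (fun _ => (-1 / 2 : ℝ))]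
  have hpm : MeasurableSet {x : Fin 3 → ℝ | ∀ i, x i ∈ Ioc (-1 / 2 : ℝ) (-1 / 2 + 1)} :=
    MeasurableSet.univ_pi' fun i => measurableSet_Ioc
  have e1 : ∫⁻ x in {x : Fin 3 → ℝ | ∀ i, x i ∈ Ioc (-1 / 2 : ℝ) (-1 / 2 + 1)},
      (torusLift P ⁻¹' s).indicator 1 (fun i => (x i : UnitAddCircle))
      = ∫⁻ x : Fin 3 → ℝ, ((MeasurableEquiv.toLp 2 (Fin 3 → ℝ)) ⁻¹'
        ((fun x : E3 => P • x) ⁻¹' (s ∩ iocCell P))).indicator 1 x := by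
    rw [← lintegral_indicator hpm]
    congr 1; ext x
    by_cases hx : x ∈ {x : Fin 3 → ℝ | ∀ i, x i ∈ Ioc (-1 / 2 : ℝ) (-1 / 2 + 1)}
    · have h1 : torusLift P (fun i => (x i : UnitAddCircle)) = P • WithLp.toLp 2 x := by
        ext i
        have := AddCircle.equivIoc_coe_of_mem (p := 1) (a := (-1 / 2 : ℝ)) (hx i)
        simp [torusLift, this]
      have h2 : P • WithLp.toLp 2 x ∈ iocCell P := fun i => by
        have := hx i
        simp only [mem_Ioc] at this
        simp only [PiLp.smul_apply, smul_eq_mul, mem_Ioc]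
        constructor <;> nlinarith
      rw [indicator_of_mem hx]
      by_cases h3 : P • WithLp.toLp 2 x ∈ s
      · rw [indicator_of_mem (by rw [mem_preimage, h1]; exact h3), indicator_of_mem
          (show x ∈ MeasurableEquiv.toLp 2 (Fin 3 → ℝ) ⁻¹'
            ((fun x : E3 => P • x) ⁻¹' (s ∩ iocCell P)) from ⟨h3, h2⟩)]
        rfl
      · rw [indicator_of_notMem (by rw [mem_preimage, h1]; exact h3),
          indicator_of_notMem fun h => h3 h.1]
    · have h2 : P • WithLp.toLp 2 x ∉ iocCell P := fun h => hx fun i => by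
        have := h i
        simp only [PiLp.smul_apply, smul_eq_mul, mem_Ioc] at this
        simp only [mem_Ioc]
        constructor <;> nlinarith
      rw [indicator_of_notMem hx]
      rw [indicator_of_notMem fun h => h2 h.2]
  have hms : MeasurableSet ((fun x : E3 => P • x) ⁻¹' (s ∩ iocCell P)) :=
    (hs.inter (measurableSet_iocCell P)).preimage (measurable_const_smul P)
  rw [e1, lintegral_indicator_one (hms.preimage (MeasurableEquiv.measurable _)),
    ← MeasurableEquiv.symm_symm (MeasurableEquiv.toLp 2 (Fin 3 → ℝ)),
    (EuclideanSpace.volume_preserving_symm_measurableEquiv_toLp (Fin 3)).symm.measure_preimage_equiv,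
    Measure.addHaar_preimage_smul _ hP.ne', Measure.smul_apply, smul_eq_mul, finrank_euclideanSpace,
    Fintype.card_fin, abs_of_pos (by positivity), cellMeasure, Measure.restrict_apply hs]
  congr 1
  exact measure_congr ((ae_eq_refl s).inter (iocCell_ae_eq_cell P))

lemma mFourier_torusLift {P : ℝ} (hP : 0 < P) (m : Fin 3 → ℤ) (y : UnitAddTorus (Fin 3)) :
    UnitAddTorus.mFourier (-m) y =
      Complex.exp (-(Complex.I * ((inner ℝ (wave P m) (torusLift P y) : ℝ) : ℂ))) := by
  have h1 : ∀ i, y i = (((AddCircle.equivIoc 1 (-1 / 2 : ℝ) (y i)).1 : ℝ) : UnitAddCircle) :=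
    fun i => ((AddCircle.equivIoc 1 (-1 / 2 : ℝ)).symm_apply_apply (y i)).symm
  have h2 : ∀ i, fourier (-m i) (y i) =
      Complex.exp (-(Complex.I * ((wave P m i * torusLift P y i : ℝ) : ℂ))) := by
    intro i
    rw [h1 i, fourier_coe_apply]
    congr 1
    have hP' : (P : ℂ) ≠ 0 := by exact_mod_cast hP.ne'
    simp only [wave, torusLift]
    push_cast
    field_simp
  simp only [UnitAddTorus.mFourier, ContinuousMap.coe_mk, Pi.neg_apply, h2]
  rw [← Complex.exp_sum]
  congr 1
  simp only [PiLp.inner_apply, RCLike.inner_apply, conj_trivial, Finset.sum_neg_distrib,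
    ← Finset.mul_sum]
  push_cast
  simp only [mul_comm]

/-- Composition with `torusLift` preserves the normalized measures and matches the characters, so
this is Parseval on the unit torus for the composed function. -/
lemma hasSum_sq_fourierCoef {P : ℝ} (hP : 0 < P) {g : E3 → ℝ} (hg : Measurable g)
    (hg2 : MemLp g 2 (cellMeasure P)) :
    HasSum (fun m => ‖fourierCoef P g (wave P m)‖ ^ 2) ((P ^ 3)⁻¹ * ∫ x, g x ^ 2 ∂(cellMeasure P)) := by
  have hP3 : (0 : ℝ) < (P ^ 3)⁻¹ := by positivity
  have hmp : MeasurePreserving (torusLift P) volume (ENNReal.ofReal ((P ^ 3)⁻¹) • cellMeasure P) :=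
    ⟨measurable_torusLift P, map_torusLift hP⟩
  have hgC : MemLp (fun x => (g x : ℂ)) 2 (ENNReal.ofReal ((P ^ 3)⁻¹) • cellMeasure P) :=
    (MemLp.ofReal hg2).smul_measure (by simp)
  have hG : MemLp ((fun x => (g x : ℂ)) ∘ torusLift P) 2 volume := hgC.comp_measurePreserving hmp
  have key := UnitAddTorus.hasSum_sq_mFourierCoeff hG.toLp
  convert key using 1
  · ext m
    congr 2
    rw [UnitAddTorus.mFourierCoeff]
    have e1 : ∫ t, UnitAddTorus.mFourier (-m) t • (hG.toLp : UnitAddTorus (Fin 3) → ℂ) t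
        = ∫ t, (fun x : E3 => Complex.exp (-(Complex.I * ((inner ℝ (wave P m) x : ℝ) : ℂ))) * (g x : ℂ))
          (torusLift P t) := by
      refine integral_congr_ae ?_
      filter_upwards [hG.coeFn_toLp] with t ht
      rw [ht, mFourier_torusLift hP]; rfl
    have hsm : AEStronglyMeasurable (fun x : E3 =>
        Complex.exp (-(Complex.I * ((inner ℝ (wave P m) x : ℝ) : ℂ))) * (g x : ℂ))
        (Measure.map (torusLift P) volume) := by
      refine Measurable.aestronglyMeasurable ?_
      fun_prop
    rw [e1, ← integral_map hmp.measurable.aemeasurable hsm, map_torusLift hP, integral_smul_measure,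
      fourierCoef, ENNReal.toReal_ofReal hP3.le]
    simp only [mul_comm (g _ : ℂ)]
    rw [Complex.real_smul]
  · have e1 : ∫ t, ‖(hG.toLp : UnitAddTorus (Fin 3) → ℂ) t‖ ^ 2
        = ∫ t, (fun x : E3 => g x ^ 2) (torusLift P t) := by
      refine integral_congr_ae ?_
      filter_upwards [hG.coeFn_toLp] with t ht
      rw [ht]
      simp [Complex.norm_real]
    rw [e1, ← integral_map hmp.measurable.aemeasurable
      (by fun_prop : Measurable fun x : E3 => g x ^ 2).aestronglyMeasurable, map_torusLift hP,
      integral_smul_measure, ENNReal.toReal_ofReal hP3.le, smul_eq_mul]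

end Parseval

/-! ### Translations and the spectral bound -/

lemma wave_periodic {P : ℝ} (hP : 0 < P) (m : Fin 3 → ℤ) (x : E3) (i : Fin 3) :
    Complex.exp (-(Complex.I * ((inner ℝ (wave P m) (x + P • e i) : ℝ) : ℂ))) =
      Complex.exp (-(Complex.I * ((inner ℝ (wave P m) x : ℝ) : ℂ))) := by
  have h1 : inner ℝ (wave P m) (x + P • e i) = inner ℝ (wave P m) x + 2 * Real.pi * m i := by
    rw [inner_add_right, inner_smul_right, e, EuclideanSpace.inner_single_right]
    simp [wave]; field_simp
  rw [h1]
  have h2 : -(Complex.I * ((inner ℝ (wave P m) x + 2 * Real.pi * m i : ℝ) : ℂ)) =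
      -(Complex.I * ((inner ℝ (wave P m) x : ℝ) : ℂ)) + ((-m i : ℤ) : ℂ) * (2 * Real.pi * Complex.I) := by
    push_cast; ring
  rw [h2, Complex.exp_add, Complex.exp_int_mul_two_pi_mul_I, mul_one]

lemma fourierCoef_translate {P : ℝ} (hP : 0 < P) {g : E3 → ℝ} (hper : PeriodicX P g)
    (m : Fin 3 → ℤ) (y : E3) : fourierCoef P (fun x => g (x + y)) (wave P m) =
      Complex.exp (Complex.I * ((inner ℝ (wave P m) y : ℝ) : ℂ)) * fourierCoef P g (wave P m) := by
  have h := integral_cell_add hP (g := fun x => (g x : ℂ) *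
    Complex.exp (-(Complex.I * ((inner ℝ (wave P m) x : ℝ) : ℂ))))
    (fun x i => by simp only [hper x i, wave_periodic hP]) y
  simp only [fourierCoef]
  rw [← h, mul_left_comm, ← integral_const_mul
    (Complex.exp (Complex.I * ((inner ℝ (wave P m) y : ℝ) : ℂ)))]
  congr 1
  refine congrArg (fun F : E3 → ℂ => ∫ x, F x ∂(cellMeasure P)) (funext fun x => ?_)
  have : Complex.exp (-(Complex.I * ((inner ℝ (wave P m) x : ℝ) : ℂ))) =
      Complex.exp (Complex.I * ((inner ℝ (wave P m) y : ℝ) : ℂ)) *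
      Complex.exp (-(Complex.I * ((inner ℝ (wave P m) (x + y) : ℝ) : ℂ))) := by
    rw [← Complex.exp_add, inner_add_right]
    congr 1; push_cast; ring
  rw [this]; ring

lemma integrable_mul_exp {P : ℝ} {g : E3 → ℝ} (hi : Integrable g (cellMeasure P)) (k : E3) :
    Integrable (fun x => (g x : ℂ) * Complex.exp (-(Complex.I * ((inner ℝ k x : ℝ) : ℂ))))
      (cellMeasure P) := by
  refine Integrable.mul_bdd (c := 1) hi.ofReal (Continuous.aestronglyMeasurable (by fun_prop))
    (Eventually.of_forall fun x => ?_)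
  rw [show -(Complex.I * ((inner ℝ k x : ℝ) : ℂ)) = ((-(inner ℝ k x) : ℝ) : ℂ) * Complex.I by
    push_cast; ring, Complex.norm_exp_ofReal_mul_I]

lemma fourierCoef_sub {P : ℝ} {g h : E3 → ℝ} (hg : Integrable g (cellMeasure P))
    (hh : Integrable h (cellMeasure P)) (k : E3) :
    fourierCoef P (fun x => g x - h x) k = fourierCoef P g k - fourierCoef P h k := by
  simp only [fourierCoef]
  rw [← mul_sub, ← integral_sub (integrable_mul_exp hg k) (integrable_mul_exp hh k)]
  congr 2; ext x; push_cast; ring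

/-- The left side is at most both |θ| and 2; the first bound serves for |θ| ≤ 1, the second beyond.
A fractional power is what lets a small spectral excess γ suffice. -/
lemma norm_exp_sub_one_le {s : ℝ} (hs : 0 < s) (hs1 : s ≤ 1) (θ : ℝ) :
    ‖Complex.exp (Complex.I * (θ : ℂ)) - 1‖ ≤ 2 * |θ| ^ s := by
  have h1 : ‖Complex.exp (Complex.I * (θ : ℂ)) - 1‖ ≤ |θ| := by
    have := Real.norm_exp_I_mul_ofReal_sub_one_le (x := θ)
    simpa using this
  have h2 : ‖Complex.exp (Complex.I * (θ : ℂ)) - 1‖ ≤ 2 := by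
    refine (norm_sub_le _ _).trans ?_
    rw [mul_comm, Complex.norm_exp_ofReal_mul_I]; norm_num
  rcases le_or_gt |θ| 1 with h | h
  · have : |θ| ≤ |θ| ^ s := by
      conv_lhs => rw [← Real.rpow_one |θ|]
      rcases (abs_nonneg θ).eq_or_lt with h0 | h0
      · rw [← h0, Real.zero_rpow hs.ne', Real.zero_rpow one_ne_zero]
      · exact Real.rpow_le_rpow_of_exponent_ge h0 h hs1
    linarith [abs_nonneg θ]
  · have : 1 ≤ |θ| ^ s := Real.one_le_rpow h.le hs.le
    linarith

lemma memLp_section {P : ℝ} {g : E3 → ℝ} (hg : Measurable g)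
    (h : ∫⁻ x, ‖g x‖ₑ ^ 2 ∂(cellMeasure P) < ⊤) : MemLp g 2 (cellMeasure P) := by
  refine ⟨hg.aestronglyMeasurable, ?_⟩
  rw [eLpNorm_lt_top_iff_lintegral_rpow_enorm_lt_top (by norm_num) (by norm_num)]
  simpa using h

lemma memLp_two_iff {α : Type*} [MeasurableSpace α] {m : Measure α} {g : α → ℝ}
    (hg : AEStronglyMeasurable g m) : MemLp g 2 m ↔ ∫⁻ x, ‖g x‖ₑ ^ 2 ∂m < ⊤ := by
  rw [MemLp, and_iff_right hg, eLpNorm_lt_top_iff_lintegral_rpow_enorm_lt_top (by norm_num)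
    (by norm_num)]
  simp

lemma lintegral_sq_eq {α : Type*} [MeasurableSpace α] {m : Measure α} {g : α → ℝ}
    (hg : MemLp g 2 m) : ∫⁻ x, ‖g x‖ₑ ^ 2 ∂m = ENNReal.ofReal (∫ x, g x ^ 2 ∂m) := by
  rw [ofReal_integral_eq_lintegral_ofReal hg.integrable_sq (Eventually.of_forall fun x => sq_nonneg _)]
  congr 1; ext x
  rw [← ofReal_norm, ← ENNReal.ofReal_pow (norm_nonneg _), Real.norm_eq_abs, sq_abs]

lemma memLp_add_right {P : ℝ} (hP : 0 < P) {g : E3 → ℝ} (hg : Measurable g) (hper : PeriodicX P g)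
    (hg2 : MemLp g 2 (cellMeasure P)) (y : E3) : MemLp (fun x => g (x + y)) 2 (cellMeasure P) := by
  have hm : Measurable fun x => g (x + y) := by fun_prop
  rw [memLp_two_iff hm.aestronglyMeasurable, lintegral_cell_add hP (g := fun x => ‖g x‖ₑ ^ 2)
    (fun x i => by simp only [hper x i]) y]
  exact (memLp_two_iff hg.aestronglyMeasurable).1 hg2

/-- Parseval's identity for a difference of translates. -/
lemma lintegral_translate_sub_eq {P : ℝ} (hP : 0 < P) {g : E3 → ℝ} (hg : Measurable g)
    (hper : PeriodicX P g) (hg2 : MemLp g 2 (cellMeasure P)) (y : E3) :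
    ∫⁻ x, ‖g (x + y) - g x‖ₑ ^ 2 ∂(cellMeasure P) = ENNReal.ofReal (P ^ 3) *
      ∑' m, ENNReal.ofReal (‖Complex.exp (Complex.I * ((inner ℝ (wave P m) y : ℝ) : ℂ)) - 1‖ ^ 2 *
        ‖fourierCoef P g (wave P m)‖ ^ 2) := by
  have h1 := memLp_add_right hP hg hper hg2 y
  have h2 : MemLp (fun x => g (x + y) - g x) 2 (cellMeasure P) := h1.sub hg2
  have h3 := hasSum_sq_fourierCoef hP (g := fun x => g (x + y) - g x) (by fun_prop) h2
  have h4 : ∀ m, ‖fourierCoef P (fun x => g (x + y) - g x) (wave P m)‖ ^ 2 =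
      ‖Complex.exp (Complex.I * ((inner ℝ (wave P m) y : ℝ) : ℂ)) - 1‖ ^ 2 *
        ‖fourierCoef P g (wave P m)‖ ^ 2 := by
    intro m
    rw [fourierCoef_sub (h1.integrable (by norm_num)) (hg2.integrable (by norm_num)),
      fourierCoef_translate hP hper, ← mul_pow, ← norm_mul]
    congr 2; ring
  simp only [h4] at h3
  rw [lintegral_sq_eq h2, ← ENNReal.ofReal_tsum_of_nonneg (fun m => by positivity) h3.summable,
    h3.tsum_eq, ← ENNReal.ofReal_mul (by positivity), ← mul_assoc,
    mul_inv_cancel₀ (by positivity), one_mul]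

lemma tsum_sq_fourierCoef_le {P : ℝ} (hP : 0 < P) {g : E3 → ℝ} (hg : Measurable g)
    (hg2 : MemLp g 2 (cellMeasure P)) :
    ∑' m, ENNReal.ofReal (‖fourierCoef P g (wave P m)‖ ^ 2) =
      ENNReal.ofReal ((P ^ 3)⁻¹) * ∫⁻ x, ‖g x‖ₑ ^ 2 ∂(cellMeasure P) := by
  have h3 := hasSum_sq_fourierCoef hP hg hg2
  rw [lintegral_sq_eq hg2, ← ENNReal.ofReal_tsum_of_nonneg (fun m => by positivity) h3.summable,
    h3.tsum_eq, ENNReal.ofReal_mul (by positivity)]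

lemma measurable_fourierCoef {P : ℝ} {g : ℝ × E3 → ℝ} (hg : Measurable g) (k : E3) :
    Measurable fun t => fourierCoef P (fun x => g (t, x)) k := by
  simp only [fourierCoef]
  refine Measurable.const_mul ?_ _
  have : StronglyMeasurable (Function.uncurry fun (t : ℝ) (x : E3) => (g (t, x) : ℂ) *
      Complex.exp (-(Complex.I * ((inner ℝ k x : ℝ) : ℂ)))) :=
    Measurable.stronglyMeasurable (by unfold Function.uncurry; fun_prop)
  exact (this.integral_prod_right (ν := cellMeasure P)).measurable

/-- Integer coordinates in a basis index the points of a rank-three lattice injectively, so the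
general lattice criterion applies. -/
lemma summable_norm_sum_smul_rpow (b : Module.Basis (Fin 3) ℝ E3) {r : ℝ} (hr : r < -3) :
    Summable fun m : Fin 3 → ℤ => ‖∑ i, m i • b i‖ ^ r := by
  have hfr : Module.finrank ℤ (Submodule.span ℤ (range b)) = 3 := by
    rw [ZLattice.rank ℝ]; simp
  have hs := ZLattice.summable_norm_rpow (Submodule.span ℤ (range b)) r
    (by rw [hfr]; exact_mod_cast hr)
  have hmem : ∀ m : Fin 3 → ℤ, ∑ i, m i • b i ∈ Submodule.span ℤ (range b) := fun m =>
    Submodule.sum_mem _ fun i _ => Submodule.smul_mem _ _ (Submodule.subset_span ⟨i, rfl⟩)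
  have hinj : Function.Injective fun m : Fin 3 → ℤ =>
      (⟨∑ i, m i • b i, hmem m⟩ : Submodule.span ℤ (range b)) := by
    intro m m' h
    have h1 : ∑ i, m i • b i = ∑ i, m' i • b i := congrArg Subtype.val h
    ext i
    have h2 := congrArg (fun x => b.repr x i) h1
    simpa [Finsupp.single_apply] using h2
  refine (hs.comp_injective hinj).congr fun m => ?_
  simp only [Function.comp_apply, Submodule.coe_norm]

lemma summable_norm_wave_rpow {P : ℝ} (hP : 0 < P) {r : ℝ} (hr : r < -3) :
    Summable fun m : Fin 3 → ℤ => ‖wave P m‖ ^ r := by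
  -- The wavevectors form the cubic lattice of period 2π/P, so the construction of the period
  -- lattice is reused with that period.
  have hQ : 0 < 2 * Real.pi / P := by positivity
  convert summable_norm_sum_smul_rpow (latticeBasis hQ) hr using 4 with m
  ext j
  simp only [wave, latticeBasis_apply, e, WithLp.ofLp_sum, WithLp.ofLp_smul, Finset.sum_apply,
    Pi.smul_apply, PiLp.ofLp_single, Pi.single_apply, smul_eq_mul]
  simp [mul_comm]

lemma ae_memLp_section {T P : ℝ} {g : ℝ × E3 → ℝ} (hg : Measurable g)
    (h : ∫⁻ z, ‖g z‖ₑ ^ 2 ∂(cylMeasure T P) < ⊤) :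
    ∀ᵐ t ∂(volume.restrict (Ioo 0 T)), MemLp (fun x => g (t, x)) 2 (cellMeasure P) := by
  rw [lintegral_cyl_eq (by fun_prop)] at h
  have hm : Measurable fun t => ∫⁻ x, ‖g (t, x)‖ₑ ^ 2 ∂(cellMeasure P) :=
    Measurable.lintegral_prod_right' (f := fun z : ℝ × E3 => ‖g z‖ₑ ^ 2) (by fun_prop)
  filter_upwards [ae_lt_top hm h.ne] with t ht
  exact memLp_section (by fun_prop) ht

/-- The energy of a Fourier mode integrated in time. -/
def modeInt (T P : ℝ) (g : ℝ × E3 → ℝ) (m : Fin 3 → ℤ) : ℝ≥0∞ :=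
  ∫⁻ t in Ioo 0 T, ENNReal.ofReal (‖fourierCoef P (fun x => g (t, x)) (wave P m)‖ ^ 2)

lemma measurable_modeEnergy_aux {P : ℝ} {g : ℝ × E3 → ℝ} (hg : Measurable g) (m : Fin 3 → ℤ) :
    Measurable fun t => ‖fourierCoef P (fun x => g (t, x)) (wave P m)‖ ^ 2 :=
  (measurable_fourierCoef hg _).norm.pow_const 2

lemma tsum_modeInt {T P : ℝ} (hP : 0 < P) {g : ℝ × E3 → ℝ} (hg : Measurable g)
    (h : ∫⁻ z, ‖g z‖ₑ ^ 2 ∂(cylMeasure T P) < ⊤) :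
    ∑' m, modeInt T P g m = ENNReal.ofReal ((P ^ 3)⁻¹) * ∫⁻ z, ‖g z‖ₑ ^ 2 ∂(cylMeasure T P) := by
  unfold modeInt
  rw [← lintegral_tsum fun m => (measurable_modeEnergy_aux hg m).ennreal_ofReal.aemeasurable,
    lintegral_cyl_eq (by fun_prop), ← lintegral_const_mul' _ _ (by simp)]
  refine lintegral_congr_ae ?_
  filter_upwards [ae_memLp_section hg h] with t ht
  exact tsum_sq_fourierCoef_le hP (by fun_prop) ht

lemma lintegral_cyl_translate_sub {T P : ℝ} (hP : 0 < P) {g : ℝ × E3 → ℝ} (hg : Measurable g)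
    (hper : PeriodicTX P g) (h : ∫⁻ z, ‖g z‖ₑ ^ 2 ∂(cylMeasure T P) < ⊤) (y : E3) :
    ∫⁻ z, ‖g (z.1, z.2 + y) - g z‖ₑ ^ 2 ∂(cylMeasure T P) = ENNReal.ofReal (P ^ 3) *
      ∑' m, ENNReal.ofReal (‖Complex.exp (Complex.I * ((inner ℝ (wave P m) y : ℝ) : ℂ)) - 1‖ ^ 2) *
        modeInt T P g m := by
  unfold modeInt
  rw [lintegral_cyl_eq (by fun_prop)]
  simp_rw [← lintegral_const_mul' _ _ ENNReal.ofReal_ne_top]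
  rw [← lintegral_tsum fun m =>
    ((measurable_modeEnergy_aux hg m).ennreal_ofReal.const_mul _).aemeasurable,
    ← lintegral_const_mul' _ _ ENNReal.ofReal_ne_top]
  refine lintegral_congr_ae ?_
  filter_upwards [ae_memLp_section hg h] with t ht
  rw [lintegral_translate_sub_eq hP (by fun_prop) (hper t) ht y]
  simp_rw [← ENNReal.ofReal_mul (sq_nonneg _)]

/-- The spectral hypothesis is phrased with a Bochner integral, which would be zero for a
non-integrable function. Finite energy makes the mode energies integrable in time, so the bound
really controls the extended-real integral. -/
lemma modeInt_le {T P : ℝ} (hP : 0 < P) {u : ℝ × E3 → E3} (hu : Measurable u)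
    (h : ∀ j, ∫⁻ z, ‖u z j‖ₑ ^ 2 ∂(cylMeasure T P) < ⊤) (m : Fin 3 → ℤ) (j : Fin 3) :
    modeInt T P (fun z => u z j) m ≤
      ENNReal.ofReal (∫ t in Ioo 0 T, modeEnergy P u (wave P m) t) := by
  have hm : ∀ j, Measurable fun t => ‖fourierCoef P (fun x => u (t, x) j) (wave P m)‖ ^ 2 :=
    fun j => measurable_modeEnergy_aux (g := fun z => u z j) (by fun_prop) m
  have hfin : ∀ j, modeInt T P (fun z => u z j) m < ⊤ := fun j => by
    refine (ENNReal.le_tsum m).trans_lt ?_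
    rw [tsum_modeInt hP (by fun_prop) (h j)]
    exact ENNReal.mul_lt_top (by simp) (h j)
  have hi : ∀ j, IntegrableOn (fun t => ‖fourierCoef P (fun x => u (t, x) j) (wave P m)‖ ^ 2)
      (Ioo 0 T) := fun j => by
    refine ⟨(hm j).aestronglyMeasurable, ?_⟩
    rw [hasFiniteIntegral_iff_ofReal (Eventually.of_forall fun t => sq_nonneg _)]
    exact hfin j
  have hI : IntegrableOn (modeEnergy P u (wave P m)) (Ioo 0 T) :=
    integrable_finsetSum _ fun j _ => hi j
  rw [ofReal_integral_eq_lintegral_ofReal hI (Eventually.of_forall fun t =>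
    Finset.sum_nonneg fun _ _ => sq_nonneg _)]
  refine lintegral_mono fun t => ENNReal.ofReal_le_ofReal ?_
  exact Finset.single_le_sum
    (f := fun j => ‖fourierCoef P (fun x => u (t, x) j) (wave P m)‖ ^ 2)
    (fun _ _ => sq_nonneg _) (Finset.mem_univ j)

/-- The spectral hypothesis bounds the `L²` modulus of continuity in space uniformly. -/
lemma K41w.exists_translate_le {T P : ℝ} (hP : 0 < P) {u : ℕ → ℝ × E3 → E3}
    (hu : ∀ n, Measurable (u n)) (hper : ∀ n, PeriodicTX P (u n)) {M : ℝ≥0∞} (hM : M ≠ ⊤)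
    (hb : ∀ n j, ∫⁻ z, ‖u n z j‖ₑ ^ 2 ∂(cylMeasure T P) ≤ M) (hK : K41w T P u) :
    ∃ s > (0 : ℝ), ∃ C : ℝ, 0 ≤ C ∧ ∀ n j y,
      ∫⁻ z, ‖u n (z.1, z.2 + y) j - u n z j‖ₑ ^ 2 ∂(cylMeasure T P) ≤
        ENNReal.ofReal (C * ‖y‖ ^ (2 * s)) := by
  obtain ⟨γ, hγ, C, hC, kstar, hK⟩ := hK
  -- Two constraints: s ≤ 1 for the bound on the exponential, and 2s < γ, here 2s ≤ γ/2, so that the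
  -- exponent 2s - (3 + γ) lies below -3.
  set s : ℝ := min 1 (γ / 4)
  have hs : 0 < s := lt_min one_pos (by linarith)
  have hs1 : s ≤ 1 := min_le_left _ _
  have hs2 : s ≤ γ / 4 := min_le_right _ _
  -- The hypothesis places no sign on the threshold; the maximum with 1 makes high wavevectors
  -- nonzero.
  set k₁ : ℝ := max kstar 1
  have hk₁ : 0 < k₁ := lt_of_lt_of_le one_pos (le_max_right _ _)
  set M' : ℝ≥0∞ := ENNReal.ofReal ((P ^ 3)⁻¹) * M
  have hM' : M' ≠ ⊤ := ENNReal.mul_ne_top (by simp) hM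
  set r : ℝ := 2 * s - (3 + γ)
  have hr : r < -3 := by simp only [r]; linarith
  have hsum := summable_norm_wave_rpow hP hr
  set S : ℝ := ∑' m : Fin 3 → ℤ, ‖wave P m‖ ^ r
  have hS : 0 ≤ S := tsum_nonneg fun m => by positivity
  refine ⟨s, hs, P ^ 3 * (4 * (C * S + k₁ ^ (2 * s) * M'.toReal)), by positivity, fun n j y => ?_⟩
  have hfin : ∀ j, ∫⁻ z, ‖u n z j‖ₑ ^ 2 ∂(cylMeasure T P) < ⊤ := fun j =>
    (hb n j).trans_lt hM.lt_top
  have hgm : Measurable fun z => u n z j := by have := hu n; fun_prop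
  have hA := tsum_modeInt hP hgm (hfin j)
  rw [lintegral_cyl_translate_sub hP hgm (fun t x i => by simp only [hper n t x i]) (hfin j)]
  -- High modes use the spectral bound and give the summable first term; low modes use |k|^(2s) ≤
  -- k₁^(2s) and give the second, whose sum is the total energy. Adding both terms for every mode
  -- avoids splitting the series.
  have hterm : ∀ m : Fin 3 → ℤ,
      ENNReal.ofReal (‖Complex.exp (Complex.I * ((inner ℝ (wave P m) y : ℝ) : ℂ)) - 1‖ ^ 2) *
        modeInt T P (fun z => u n z j) m ≤
      ENNReal.ofReal (4 * ‖y‖ ^ (2 * s)) * (ENNReal.ofReal (C * ‖wave P m‖ ^ r) +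
        ENNReal.ofReal (k₁ ^ (2 * s)) * modeInt T P (fun z => u n z j) m) := by
    intro m
    have h1 : ‖Complex.exp (Complex.I * ((inner ℝ (wave P m) y : ℝ) : ℂ)) - 1‖ ^ 2 ≤
        4 * ‖y‖ ^ (2 * s) * ‖wave P m‖ ^ (2 * s) := by
      have h2 := norm_exp_sub_one_le hs hs1 (inner ℝ (wave P m) y)
      have h3 : |inner ℝ (wave P m) y| ^ s ≤ ‖wave P m‖ ^ s * ‖y‖ ^ s := by
        rw [← Real.mul_rpow (norm_nonneg _) (norm_nonneg _)]
        exact Real.rpow_le_rpow (abs_nonneg _) (abs_real_inner_le_norm _ _) hs.le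
      have h4 : ∀ a : ℝ, 0 ≤ a → a ^ (2 * s) = (a ^ s) ^ 2 := fun a ha => by
        rw [← Real.rpow_natCast, ← Real.rpow_mul ha]; norm_num [mul_comm]
      rw [h4 _ (norm_nonneg _), h4 _ (norm_nonneg _)]
      calc _ ≤ (2 * (‖wave P m‖ ^ s * ‖y‖ ^ s)) ^ 2 := by
            gcongr
            exact h2.trans (by gcongr)
        _ = _ := by ring
    rcases le_or_gt k₁ ‖wave P m‖ with hk | hk
    · have hkpos : 0 < ‖wave P m‖ := hk₁.trans_le hk
      have h2 : ∫ t in Ioo 0 T, modeEnergy P (u n) (wave P m) t ≤ C * ‖wave P m‖ ^ (-(3 + γ)) := by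
        have := hK n m ((le_max_left _ _).trans hk)
        rw [Real.rpow_neg hkpos.le, ← div_eq_mul_inv, le_div_iff₀ (Real.rpow_pos_of_pos hkpos _)]
        linarith
      have h3 := (modeInt_le hP (hu n) hfin m j).trans (ENNReal.ofReal_le_ofReal h2)
      calc _ ≤ ENNReal.ofReal (4 * ‖y‖ ^ (2 * s) * ‖wave P m‖ ^ (2 * s)) *
            ENNReal.ofReal (C * ‖wave P m‖ ^ (-(3 + γ))) := by gcongr
        _ = ENNReal.ofReal (4 * ‖y‖ ^ (2 * s)) * ENNReal.ofReal (C * ‖wave P m‖ ^ r) := by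
            rw [← ENNReal.ofReal_mul (by positivity), ← ENNReal.ofReal_mul (by positivity)]
            congr 1
            have : ‖wave P m‖ ^ r = ‖wave P m‖ ^ (2 * s) * ‖wave P m‖ ^ (-(3 + γ)) := by
              rw [← Real.rpow_add hkpos]; rfl
            rw [this]; ring
        _ ≤ _ := by gcongr; exact le_self_add
    · calc _ ≤ ENNReal.ofReal (4 * ‖y‖ ^ (2 * s) * k₁ ^ (2 * s)) *
            modeInt T P (fun z => u n z j) m := by
            gcongr
            exact h1.trans (by gcongr)
        _ = ENNReal.ofReal (4 * ‖y‖ ^ (2 * s)) * (ENNReal.ofReal (k₁ ^ (2 * s)) *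
            modeInt T P (fun z => u n z j) m) := by
            rw [ENNReal.ofReal_mul (by positivity), mul_assoc]
        _ ≤ _ := by gcongr; exact le_add_self
  calc _ ≤ ENNReal.ofReal (P ^ 3) * ∑' m, ENNReal.ofReal (4 * ‖y‖ ^ (2 * s)) *
        (ENNReal.ofReal (C * ‖wave P m‖ ^ r) +
        ENNReal.ofReal (k₁ ^ (2 * s)) * modeInt T P (fun z => u n z j) m) := by
        exact mul_le_mul' le_rfl (ENNReal.tsum_le_tsum hterm)
    _ = ENNReal.ofReal (P ^ 3) * (ENNReal.ofReal (4 * ‖y‖ ^ (2 * s)) *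
        (ENNReal.ofReal (C * S) + ENNReal.ofReal (k₁ ^ (2 * s)) *
          ∑' m, modeInt T P (fun z => u n z j) m)) := by
        rw [ENNReal.tsum_mul_left, ENNReal.tsum_add, ENNReal.tsum_mul_left,
          ← ENNReal.ofReal_tsum_of_nonneg (fun m => by positivity) (hsum.mul_left C),
          tsum_mul_left]
    _ ≤ ENNReal.ofReal (P ^ 3) * (ENNReal.ofReal (4 * ‖y‖ ^ (2 * s)) *
        (ENNReal.ofReal (C * S) + ENNReal.ofReal (k₁ ^ (2 * s)) * ENNReal.ofReal M'.toReal)) := by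
        rw [hA, ENNReal.ofReal_toReal hM']
        gcongr
        exact mul_le_mul' le_rfl (hb n j)
    _ = _ := by
        rw [← ENNReal.ofReal_mul (by positivity), ← ENNReal.ofReal_add (by positivity) (by positivity),
          ← ENNReal.ofReal_mul (by positivity), ← ENNReal.ofReal_mul (by positivity)]
        congr 1; ring

/-! ### A compactly supported resolution of the Laplacian -/

/-- A smooth function equal to `s ^ (-3/2)` for `s ≥ 1` and to `0` for `s ≤ 1/2`. -/
def profile (s : ℝ) : ℝ := Real.smoothTransition (2 * s - 1) * s ^ (-3 / 2 : ℝ)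

lemma profile_eventually_zero {s : ℝ} (hs : s < 1 / 2) : profile =ᶠ[𝓝 s] fun _ => 0 := by
  filter_upwards [gt_mem_nhds hs] with r hr
  rw [profile, Real.smoothTransition.zero_of_nonpos (by linarith), zero_mul]

lemma contDiff_profile : ContDiff ℝ ∞ profile := by
  rw [contDiff_iff_contDiffAt]
  intro s
  rcases lt_or_ge s (1 / 2) with hs | hs
  · exact contDiffAt_const.congr_of_eventuallyEq (profile_eventually_zero hs)
  · have h1 : ContDiffAt ℝ ∞ (fun s : ℝ => Real.smoothTransition (2 * s - 1)) s :=
      (Real.smoothTransition.contDiff.comp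
        ((contDiff_const.mul contDiff_id).sub contDiff_const)).contDiffAt
    exact h1.mul (Real.contDiffAt_rpow_const_of_ne (by linarith))

lemma profile_of_one_le {s : ℝ} (hs : 1 ≤ s) : profile s = s ^ (-3 / 2 : ℝ) := by
  rw [profile, Real.smoothTransition.one_of_one_le (by linarith), one_mul]

lemma deriv_profile_of_pos {s : ℝ} (hs : 0 < s) : deriv profile s =
    2 * deriv Real.smoothTransition (2 * s - 1) * s ^ (-3 / 2 : ℝ)
      - 3 / 2 * Real.smoothTransition (2 * s - 1) * s ^ (-5 / 2 : ℝ) := by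
  have h0 : HasDerivAt (fun s : ℝ => 2 * s - 1) 2 s := by
    simpa using ((hasDerivAt_id s).const_mul 2).sub_const 1
  have h1 : HasDerivAt (Real.smoothTransition ∘ fun s : ℝ => 2 * s - 1)
      (deriv Real.smoothTransition (2 * s - 1) * 2) s :=
    HasDerivAt.comp (h := fun s : ℝ => 2 * s - 1) s
      ((Real.smoothTransition.contDiff (n := 1)).differentiable (by simp) _).hasDerivAt h0
  have h2 : HasDerivAt (fun s : ℝ => s ^ (-3 / 2 : ℝ)) ((-3 / 2) * s ^ (-3 / 2 - 1 : ℝ)) s :=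
    Real.hasDerivAt_rpow_const (Or.inl hs.ne')
  have := (h1.mul h2).deriv
  have e : (-3 / 2 - 1 : ℝ) = -5 / 2 := by norm_num
  rw [show profile = (Real.smoothTransition ∘ fun s : ℝ => 2 * s - 1) *
    fun s => s ^ (-3 / 2 : ℝ) from rfl, this, e]
  simp only [Function.comp_apply]
  ring

/-- Radial profile of the mollifier in `exists_laplacian_kernel`. -/
def massProfile (s : ℝ) : ℝ := 4 * s * deriv profile s + 6 * profile s

lemma contDiff_deriv_profile : ContDiff ℝ ∞ (deriv profile) :=
  (contDiff_infty_iff_deriv.1 contDiff_profile).2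

lemma contDiff_massProfile : ContDiff ℝ ∞ massProfile :=
  ((contDiff_const.mul contDiff_id).mul contDiff_deriv_profile).add
    (contDiff_const.mul contDiff_profile)

/-- The operator 4s d/ds + 6 is the divergence of the field 2y·φ(|y|²) and annihilates s^(-3/2), the
derivative of the Newtonian potential in s = |y|² up to a factor. Only the derivative of the
transition function survives, which gives both the sign and the vanishing for s > 1. -/
lemma massProfile_of_pos {s : ℝ} (hs : 0 < s) :
    massProfile s = 8 * deriv Real.smoothTransition (2 * s - 1) * s ^ (-1 / 2 : ℝ) := by
  have h1 : s ^ (-3 / 2 : ℝ) = s ^ (-5 / 2 : ℝ) * s := by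
    conv_rhs => rw [← Real.rpow_add_one hs.ne']
    norm_num
  have h2 : s ^ (-1 / 2 : ℝ) = s ^ (-5 / 2 : ℝ) * s * s := by
    rw [← h1, ← Real.rpow_add_one hs.ne']; norm_num
  rw [massProfile, deriv_profile_of_pos hs, profile, h2, h1]
  ring

lemma massProfile_nonneg {s : ℝ} (hs : 0 ≤ s) : 0 ≤ massProfile s := by
  rcases hs.eq_or_lt with rfl | hs
  · have : profile 0 = 0 := (profile_eventually_zero (by norm_num : (0 : ℝ) < 1 / 2)).eq_of_nhds
    simp [massProfile, this]
  · rw [massProfile_of_pos hs]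
    have := deriv_smoothTransition_nonneg (2 * s - 1)
    positivity

lemma massProfile_of_one_lt {s : ℝ} (hs : 1 < s) : massProfile s = 0 := by
  rw [massProfile_of_pos (by linarith)]
  have : Real.smoothTransition =ᶠ[𝓝 (2 * s - 1)] fun _ => 1 := by
    filter_upwards [lt_mem_nhds (by linarith : 1 < 2 * s - 1)] with r hr
    exact Real.smoothTransition.one_of_one_le hr.le
  rw [this.deriv_eq]; simp

/-- Otherwise the transition function would have zero derivative everywhere and could not pass from
0 to 1. -/
lemma exists_massProfile_pos : ∃ s > 0, 0 < massProfile s := by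
  by_contra hc
  push Not at hc
  have h0 : ∀ x, deriv Real.smoothTransition x = 0 := by
    intro x
    rcases lt_or_ge x 0 with hx | hx
    · have : Real.smoothTransition =ᶠ[𝓝 x] fun _ => 0 := by
        filter_upwards [gt_mem_nhds hx] with r hr
        exact Real.smoothTransition.zero_of_nonpos hr.le
      rw [this.deriv_eq]; simp
    · have hs : 0 < (x + 1) / 2 := by linarith
      have h1 := hc _ hs
      rw [massProfile_of_pos hs, show 2 * ((x + 1) / 2) - 1 = x by ring] at h1
      have h2 := deriv_smoothTransition_nonneg x
      have h3 : 0 < ((x + 1) / 2) ^ (-1 / 2 : ℝ) := Real.rpow_pos_of_pos hs _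
      nlinarith
  have := is_const_of_deriv_eq_zero
    ((Real.smoothTransition.contDiff (n := 1)).differentiable (by simp)) h0 0 1
  simp [Real.smoothTransition.zero, Real.smoothTransition.one] at this

/-- Radial profile of the potential in `exists_laplacian_kernel`. -/
def potProfile (s : ℝ) : ℝ := -∫ r in (4 : ℝ)..s, (profile r - profile (r / 4) / 8)

lemma contDiff_potIntegrand : ContDiff ℝ ∞ fun r => profile r - profile (r / 4) / 8 :=
  contDiff_profile.sub ((contDiff_profile.comp (contDiff_id.div_const 4)).div_const 8)

lemma hasDerivAt_potProfile (s : ℝ) :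
    HasDerivAt potProfile (-(profile s - profile (s / 4) / 8)) s :=
  (intervalIntegral.integral_hasDerivAt_right
    (contDiff_potIntegrand.continuous.intervalIntegrable _ _)
    contDiff_potIntegrand.continuous.stronglyMeasurable.stronglyMeasurableAtFilter
    contDiff_potIntegrand.continuous.continuousAt).neg

lemma deriv_potProfile : deriv potProfile = fun s => -(profile s - profile (s / 4) / 8) :=
  funext fun s => (hasDerivAt_potProfile s).deriv

lemma contDiff_potProfile : ContDiff ℝ ∞ potProfile := by
  rw [contDiff_infty_iff_deriv, deriv_potProfile]
  exact ⟨fun s => (hasDerivAt_potProfile s).differentiableAt, contDiff_potIntegrand.neg⟩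

lemma deriv_deriv_potProfile (s : ℝ) : deriv (deriv potProfile) s =
    -(deriv profile s - deriv profile (s / 4) / 32) := by
  rw [deriv_potProfile]
  have h1 : HasDerivAt profile (deriv profile s) s :=
    (contDiff_profile.differentiable (by simp) s).hasDerivAt
  have h0 : HasDerivAt (fun s : ℝ => s / 4) (1 / 4) s := (hasDerivAt_id s).div_const 4
  have h2 : HasDerivAt (profile ∘ fun s : ℝ => s / 4) (deriv profile (s / 4) * (1 / 4)) s :=
    HasDerivAt.comp (h := fun s : ℝ => s / 4) s
      (contDiff_profile.differentiable (by simp) (s / 4)).hasDerivAt h0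
  have := (h1.sub (h2.div_const 8)).neg.deriv
  rw [show (fun s => -(profile s - profile (s / 4) / 8)) =
    -(profile - fun x => (profile ∘ fun s : ℝ => s / 4) x / 8) from rfl, this]
  ring

/-- For r ≥ 4 both r and r/4 lie where the profile is the pure power, and (r/4)^(-3/2)/8 = r^(-3/2):
the two Newtonian tails cancel. This is why the second term of the integrand carries the factor 1/8.
-/
lemma potProfile_of_four_le {s : ℝ} (hs : 4 ≤ s) : potProfile s = 0 := by
  rw [potProfile, intervalIntegral.integral_congr (g := fun _ => (0 : ℝ)),
    intervalIntegral.integral_zero, neg_zero]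
  intro r hr
  rw [uIcc_of_le hs] at hr
  have hr0 : 0 ≤ r := by linarith [hr.1]
  simp only
  rw [profile_of_one_le (by linarith [hr.1]), profile_of_one_le (by linarith [hr.1]),
    Real.div_rpow hr0 (by norm_num)]
  have : (4 : ℝ) ^ (-3 / 2 : ℝ) = 1 / 8 := by
    rw [show (4 : ℝ) = 2 ^ (2 : ℝ) by norm_num, ← Real.rpow_mul (by norm_num)]
    norm_num
  rw [this]; ring

lemma pd_radial {φ : ℝ → ℝ} (hφ : ContDiff ℝ ∞ φ) (i : Fin 3) :
    pd i (fun y : E3 => φ (‖y‖ ^ 2)) = fun y => y i * (2 * deriv φ (‖y‖ ^ 2)) := by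
  ext y
  have h1 : HasFDerivAt (fun y : E3 => ‖y‖ ^ 2) (2 • innerSL ℝ y) y :=
    (hasStrictFDerivAt_norm_sq y).hasFDerivAt
  have h2 := (hφ.differentiable (by simp) (‖y‖ ^ 2)).hasDerivAt.comp_hasFDerivAt y h1
  rw [pd, show (fun y : E3 => φ (‖y‖ ^ 2)) = φ ∘ fun y : E3 => ‖y‖ ^ 2 from rfl, h2.fderiv]
  simp [e, EuclideanSpace.inner_single_right]
  ring

lemma pd_pd_radial {φ : ℝ → ℝ} (hφ : ContDiff ℝ ∞ φ) (i : Fin 3) (y : E3) :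
    pd i (pd i (fun y : E3 => φ (‖y‖ ^ 2))) y =
      2 * deriv φ (‖y‖ ^ 2) + y i ^ 2 * (4 * deriv (deriv φ) (‖y‖ ^ 2)) := by
  have hd : ContDiff ℝ ∞ (deriv φ) := (contDiff_infty_iff_deriv.1 hφ).2
  have hd' : ContDiff ℝ ∞ fun s => 2 * deriv φ s := contDiff_const.mul hd
  rw [pd_radial hφ, pd]
  have h1 : HasFDerivAt (fun y : E3 => y i) (EuclideanSpace.proj (𝕜 := ℝ) i) y :=
    (EuclideanSpace.proj (𝕜 := ℝ) i).hasFDerivAt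
  have h2 : DifferentiableAt ℝ (fun y : E3 => 2 * deriv φ (‖y‖ ^ 2)) y :=
    (hd'.comp (contDiff_norm_sq ℝ)).differentiable (by simp) y
  have h3 := congrFun (pd_radial hd' i) y
  rw [pd, deriv_const_mul_field] at h3
  rw [show (fun y : E3 => y i * (2 * deriv φ (‖y‖ ^ 2)))
    = (fun y : E3 => y i) * fun y => 2 * deriv φ (‖y‖ ^ 2) from rfl, (h1.mul h2.hasFDerivAt).fderiv]
  simp only [add_apply, smul_apply, h3, smul_eq_mul]
  simp [e]
  ring

lemma lapX_radial {φ : ℝ → ℝ} (hφ : ContDiff ℝ ∞ φ) (y : E3) :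
    lapX (fun y : E3 => φ (‖y‖ ^ 2)) y =
      6 * deriv φ (‖y‖ ^ 2) + 4 * ‖y‖ ^ 2 * deriv (deriv φ) (‖y‖ ^ 2) := by
  have h : ‖y‖ ^ 2 = y 0 ^ 2 + y 1 ^ 2 + y 2 ^ 2 := by
    rw [EuclideanSpace.norm_sq_eq, Fin.sum_univ_three]; simp
  simp only [lapX, pd_pd_radial hφ, Fin.sum_univ_three]
  rw [h]; ring

/-- A smooth mollifier and a smooth potential, both supported in a ball, such that the Laplacian
of the potential is the difference of the mollifier and its rescaling. -/
lemma exists_laplacian_kernel : ∃ Θ H : E3 → ℝ, ContDiff ℝ ∞ Θ ∧ ContDiff ℝ ∞ H ∧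
    (∀ y, 2 < ‖y‖ → Θ y = 0) ∧ (∀ y, 2 < ‖y‖ → H y = 0) ∧ 0 < ∫ y, Θ y ∧
    ∀ y, -lapX H y = Θ y - 1 / 8 * Θ ((1 / 2 : ℝ) • y) := by
  have hΘ : ContDiff ℝ ∞ fun y : E3 => massProfile (‖y‖ ^ 2) :=
    contDiff_massProfile.comp (contDiff_norm_sq ℝ)
  have hΘ0 : ∀ y : E3, 2 < ‖y‖ → massProfile (‖y‖ ^ 2) = 0 := fun y hy =>
    massProfile_of_one_lt (by nlinarith)
  refine ⟨fun y => massProfile (‖y‖ ^ 2), fun y => potProfile (‖y‖ ^ 2), hΘ,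
    contDiff_potProfile.comp (contDiff_norm_sq ℝ), hΘ0,
    fun y hy => potProfile_of_four_le (by nlinarith), ?_, fun y => ?_⟩
  · obtain ⟨s, hs, hpos⟩ := exists_massProfile_pos
    have hcs : HasCompactSupport fun y : E3 => massProfile (‖y‖ ^ 2) :=
      HasCompactSupport.intro (isCompact_closedBall (0 : E3) 2) fun y hy =>
        hΘ0 y (by simpa using hy)
    -- The point √s e₀ has squared norm s, so it realizes the positive value of the radial profile.
    refine hΘ.continuous.integral_pos_of_hasCompactSupport_nonneg_nonzero hcs
      (fun y => massProfile_nonneg (by positivity)) (x := Real.sqrt s • e 0) ?_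
    have : ‖Real.sqrt s • e 0‖ ^ 2 = s := by
      rw [norm_smul, e]; simp [Real.sq_sqrt hs.le]
    simp only [this]
    exact hpos.ne'
  -- With s = |y|², the Laplacian acts on radial profiles as 6φ' + 4sφ''. Applied to the potential
  -- it gives minus the mass profile at s plus one eighth of it at s/4, and s/4 = |y/2|².
  · rw [lapX_radial contDiff_potProfile, deriv_deriv_potProfile, deriv_potProfile]
    have : ‖(1 / 2 : ℝ) • y‖ ^ 2 = ‖y‖ ^ 2 / 4 := by
      rw [norm_smul, mul_pow]; norm_num; ring
    simp only [massProfile, this]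
    ring

/-! ### Convolution in the space variable -/

/-- Convolution in the space variable. -/
def conv (g : ℝ × E3 → ℝ) (k : E3 → ℝ) (z : ℝ × E3) : ℝ := ∫ y, g (z.1, z.2 - y) * k y

lemma measurable_conv {g : ℝ × E3 → ℝ} (hg : Measurable g) {k : E3 → ℝ} (hk : Measurable k) :
    Measurable (conv g k) := by
  have h : Measurable fun q : (ℝ × E3) × E3 => g (q.1.1, q.1.2 - q.2) * k q.2 := by fun_prop
  exact (h.stronglyMeasurable.integral_prod_right').measurable

lemma conv_eq_pair (g : ℝ × E3 → ℝ) (k : E3 → ℝ) (t : ℝ) (x : E3) :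
    conv g k (t, x) = pair g (fun y => k (x - y)) t := by
  rw [conv, pair, ← integral_sub_left_eq_self _ volume x]
  simp

lemma periodicX_sub_left {α : Type*} {P : ℝ} {g : E3 → α} (hg : PeriodicX P g)
    (x : E3) : PeriodicX P fun y => g (x - y) := by
  intro y i
  have := hg (x - (y + P • e i)) i
  simp only
  rw [← this, show x - (y + P • e i) + P • e i = x - y by abel]

lemma continuous_comp_sub_left {k : E3 → ℝ} (hc : Continuous k) (x : E3) :
    Continuous fun y => k (x - y) := by fun_prop

lemma hasCompactSupport_comp_sub_left {k : E3 → ℝ} (hs : HasCompactSupport k) (x : E3) :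
    HasCompactSupport fun y => k (x - y) := by
  have := hs.comp_homeomorph (Homeomorph.subLeft x)
  exact this

lemma integrable_conv_integrand {P : ℝ} (hP : 0 < P) {g : ℝ × E3 → ℝ} (hg : Measurable g)
    (hper : PeriodicTX P g) {t : ℝ} (hi : Integrable (fun x => g (t, x)) (cellMeasure P))
    {k : E3 → ℝ} (hc : Continuous k) (hs : HasCompactSupport k) (x : E3) :
    Integrable fun y => g (t, x - y) * k y := by
  have h := (integrable_mul_of_cell hP (by fun_prop : Measurable fun y => g (t, y)) (hper t) hi
    (continuous_comp_sub_left hc x) (hasCompactSupport_comp_sub_left hs x)).comp_sub_left x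
  simpa using h

lemma ae_integrable_conv_integrand {T P : ℝ} (hP : 0 < P) {g : ℝ × E3 → ℝ} (hg : Measurable g)
    (hper : PeriodicTX P g) (hi : Integrable g (cylMeasure T P))
    {k : E3 → ℝ} (hc : Continuous k) (hs : HasCompactSupport k) :
    ∀ᵐ z ∂(cylMeasure T P), Integrable fun y => g (z.1, z.2 - y) * k y := by
  have h := ae_integrable_section hi
  rw [cylMeasure_eq_prod]
  have h' := (Measure.quasiMeasurePreserving_fst (μ := volume.restrict (Ioo 0 T))
    (ν := cellMeasure P)).ae h
  filter_upwards [h'] with z hz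
  exact integrable_conv_integrand hP hg hper hz hc hs z.2

lemma lintegral_integral_le {T P : ℝ} {F : (ℝ × E3) × E3 → ℝ} (hF : Measurable F) :
    ∫⁻ z, ‖∫ y, F (z, y)‖ₑ ∂(cylMeasure T P) ≤ ∫⁻ y, ∫⁻ z, ‖F (z, y)‖ₑ ∂(cylMeasure T P) := by
  rw [lintegral_lintegral_swap (Measurable.aemeasurable (by fun_prop))]
  exact lintegral_mono fun z => enorm_integral_le_lintegral_enorm _

lemma PeriodicTX.enorm {P : ℝ} {g : ℝ × E3 → ℝ} (hg : PeriodicTX P g) :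
    PeriodicTX P fun z => ‖g z‖ₑ := fun t x i => by
  have := hg t x i
  simp only at this ⊢
  rw [this]

/-- Young's inequality: after Tonelli, each translate of g has the same L¹ norm on the cylinder by
periodicity. -/
lemma lintegral_conv_le {T P : ℝ} (hP : 0 < P) {g : ℝ × E3 → ℝ} (hg : Measurable g)
    (hper : PeriodicTX P g) {k : E3 → ℝ} (hk : Measurable k) :
    ∫⁻ z, ‖conv g k z‖ₑ ∂(cylMeasure T P) ≤
      (∫⁻ y, ‖k y‖ₑ) * ∫⁻ z, ‖g z‖ₑ ∂(cylMeasure T P) := by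
  refine (lintegral_integral_le (F := fun q => g (q.1.1, q.1.2 - q.2) * k q.2)
    (by fun_prop)).trans ?_
  rw [← lintegral_mul_const _ (by fun_prop)]
  refine lintegral_mono fun y => ?_
  simp only [enorm_mul]
  rw [lintegral_mul_const _ (by fun_prop), mul_comm]
  have := lintegral_cyl_add (T := T) hP (by fun_prop : Measurable fun z => ‖g z‖ₑ) hper.enorm (-y)
  simp only [← sub_eq_add_neg] at this
  rw [this]

/-- Convolution with a kernel of integral `c` is close to multiplication by `c`. -/
lemma lintegral_conv_sub_le {T P : ℝ} (hP : 0 < P) {g : ℝ × E3 → ℝ} (hg : Measurable g)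
    (hper : PeriodicTX P g) (hi : Integrable g (cylMeasure T P)) {k : E3 → ℝ}
    (hc : Continuous k) {r : ℝ} (hr : ∀ y, r < ‖y‖ → k y = 0) {W : ℝ≥0∞}
    (hW : ∀ y, ‖y‖ ≤ r → ∫⁻ z, ‖g (z.1, z.2 + y) - g z‖ₑ ∂(cylMeasure T P) ≤ W) :
    ∫⁻ z, ‖conv g k z - (∫ y, k y) * g z‖ₑ ∂(cylMeasure T P) ≤ (∫⁻ y, ‖k y‖ₑ) * W := by
  have hs : HasCompactSupport k := HasCompactSupport.intro (isCompact_closedBall (0 : E3) r)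
    fun y hy => hr y (by simpa using hy)
  have hkm := hc.measurable
  have h1 : ∀ᵐ z ∂(cylMeasure T P), conv g k z - (∫ y, k y) * g z =
      ∫ y, (g (z.1, z.2 - y) - g z) * k y := by
    filter_upwards [ae_integrable_conv_integrand hP hg hper hi hc hs] with z hz
    simp only [sub_mul]
    rw [integral_sub hz ((hc.integrable_of_hasCompactSupport hs).const_mul _),
      integral_const_mul, conv]
    ring
  rw [lintegral_congr_ae (h1.mono fun z hz => by rw [hz])]
  refine (lintegral_integral_le (F := fun q => (g (q.1.1, q.1.2 - q.2) - g q.1) * k q.2)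
    (by fun_prop)).trans ?_
  rw [← lintegral_mul_const _ (by fun_prop)]
  refine lintegral_mono fun y => ?_
  simp only [enorm_mul]
  rw [lintegral_mul_const _ (by fun_prop), mul_comm]
  rcases le_or_gt ‖y‖ r with hy | hy
  · gcongr
    simpa [sub_eq_add_neg] using hW (-y) (by simpa using hy)
  · simp [hr y hy]

lemma conv_sub_kernel {g : ℝ × E3 → ℝ} {k l : E3 → ℝ} {z : ℝ × E3}
    (hk : Integrable fun y => g (z.1, z.2 - y) * k y)
    (hl : Integrable fun y => g (z.1, z.2 - y) * l y) :
    conv g (fun y => k y - l y) z = conv g k z - conv g l z := by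
  simp only [conv, mul_sub]
  exact integral_sub hk hl

/-! ### Rescaled kernels -/

/-- The `L¹`-normalized dilation of a kernel. -/
def scl (ε : ℝ) (k : E3 → ℝ) (y : E3) : ℝ := (ε ^ 3)⁻¹ * k (ε⁻¹ • y)

lemma contDiff_scl {ε : ℝ} {k : E3 → ℝ} (hk : ContDiff ℝ ∞ k) : ContDiff ℝ ∞ (scl ε k) :=
  contDiff_const.mul (hk.comp (contDiff_const_smul _))

lemma scl_eq_zero {ε : ℝ} (hε : 0 < ε) {k : E3 → ℝ} {r : ℝ} (hr : ∀ y, r < ‖y‖ → k y = 0) (y : E3)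
    (hy : r * ε < ‖y‖) : scl ε k y = 0 := by
  rw [scl, hr, mul_zero]
  rw [norm_smul, norm_inv, Real.norm_of_nonneg hε.le, inv_mul_eq_div, lt_div_iff₀ hε]
  exact hy

lemma integral_scl {ε : ℝ} (hε : 0 < ε) (k : E3 → ℝ) : ∫ y, scl ε k y = ∫ y, k y := by
  simp only [scl]
  rw [integral_const_mul, Measure.integral_comp_inv_smul]
  simp only [finrank_euclideanSpace, Fintype.card_fin, smul_eq_mul]
  rw [abs_of_pos (by positivity), ← mul_assoc, inv_mul_cancel₀ (by positivity), one_mul]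

lemma lintegral_scl {ε : ℝ} (hε : 0 < ε) {k : E3 → ℝ} (hc : Continuous k)
    (hs : HasCompactSupport k) : ∫⁻ y, ‖scl ε k y‖ₑ = ∫⁻ y, ‖k y‖ₑ := by
  have h1 : Integrable k := hc.integrable_of_hasCompactSupport hs
  have h2 : Integrable (scl ε k) := (h1.comp_smul (inv_ne_zero hε.ne')).const_mul _
  rw [← ofReal_integral_norm_eq_lintegral_enorm h1, ← ofReal_integral_norm_eq_lintegral_enorm h2,
    ← integral_scl hε fun y => ‖k y‖]
  congr 2
  ext y
  rw [scl, scl, norm_mul, Real.norm_of_nonneg (by positivity)]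

lemma pd_comp_smul {k : E3 → ℝ} (hk : ContDiff ℝ ∞ k) (c a : ℝ) (i : Fin 3) :
    pd i (fun y => c * k (a • y)) = fun y => (c * a) * pd i k (a • y) := by
  ext y
  have h1 : HasFDerivAt (fun y : E3 => a • y) (a • ContinuousLinearMap.id ℝ E3) y :=
    (hasFDerivAt_id y).const_smul a
  have h2 : HasFDerivAt (fun y : E3 => k (a • y)) ((fderiv ℝ k (a • y)).comp
      (a • ContinuousLinearMap.id ℝ E3)) y :=
    HasFDerivAt.comp (f := fun y : E3 => a • y) y
      (hk.differentiable (by simp) (a • y)).hasFDerivAt h1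
  rw [pd, (h2.const_mul c).fderiv, pd]
  simp
  ring

lemma pd_comp_sub_left {k : E3 → ℝ} (hk : ContDiff ℝ ∞ k) (x : E3) (i : Fin 3) :
    pd i (fun y => k (x - y)) = fun y => -pd i k (x - y) := by
  ext y
  have h1 : HasFDerivAt (fun y : E3 => x - y) (-ContinuousLinearMap.id ℝ E3) y :=
    (hasFDerivAt_id y).const_sub x
  have h2 : HasFDerivAt (fun y : E3 => k (x - y)) ((fderiv ℝ k (x - y)).comp
      (-ContinuousLinearMap.id ℝ E3)) y :=
    HasFDerivAt.comp (f := fun y : E3 => x - y) y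
      (hk.differentiable (by simp) (x - y)).hasFDerivAt h1
  rw [pd, h2.fderiv, pd]
  simp

lemma pd_neg (k : E3 → ℝ) (i : Fin 3) : pd i (fun y => -k y) = fun y => -pd i k y := by
  ext y
  simp [pd, fderiv_fun_neg]

lemma pd_pd_comp_sub_left {k : E3 → ℝ} (hk : ContDiff ℝ ∞ k) (x : E3) (i j : Fin 3) :
    pd i (pd j (fun y => k (x - y))) = fun y => pd i (pd j k) (x - y) := by
  rw [pd_comp_sub_left hk, pd_neg, pd_comp_sub_left (contDiff_pd hk)]
  simp

lemma lapX_comp_sub_left {k : E3 → ℝ} (hk : ContDiff ℝ ∞ k) (x : E3) :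
    lapX (fun y => k (x - y)) = fun y => lapX k (x - y) := by
  ext y
  simp only [lapX, pd_pd_comp_sub_left hk]

/-- Two derivatives of a dilation produce ε⁻², which the factor ε² compensates: the second
derivatives of the rescaled potential are again normalized in L¹, uniformly over all scales. -/
lemma pd_pd_scl {k : E3 → ℝ} (hk : ContDiff ℝ ∞ k) {ε : ℝ} (hε : 0 < ε) (i j : Fin 3) :
    pd i (pd j fun y => ε ^ 2 * scl ε k y) = scl ε (pd i (pd j k)) := by
  simp only [scl, ← mul_assoc]
  rw [pd_comp_smul hk, pd_comp_smul (contDiff_pd hk)]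
  ext y
  simp only [scl]
  congr 1
  field_simp

lemma contDiff_sq_scl {ε : ℝ} {k : E3 → ℝ} (hk : ContDiff ℝ ∞ k) :
    ContDiff ℝ ∞ fun y => ε ^ 2 * scl ε k y := contDiff_const.mul (contDiff_scl hk)

/-! ### Lebesgue points -/

/-- Lebesgue points of the time sections: the kernels are supported in shrinking balls and are
bounded by a fixed multiple of the inverse volume of those balls, which suffices for convergence at
such points even without positivity of the kernel. -/
lemma ae_tendsto_conv {T P : ℝ} (hP : 0 < P) {g : ℝ × E3 → ℝ} (hg : Measurable g)
    (hper : PeriodicTX P g) (hi : Integrable g (cylMeasure T P)) {k : E3 → ℝ}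
    (hc : Continuous k) {r : ℝ} (hr0 : 0 < r) (hr : ∀ y, r < ‖y‖ → k y = 0)
    (hk1 : ∫ y, k y = 1) {ε : ℕ → ℝ} (hε : ∀ n, 0 < ε n) (hε0 : Tendsto ε atTop (𝓝 0)) :
    ∀ᵐ z ∂(cylMeasure T P), Tendsto (fun n => conv g (scl (ε n) k) z) atTop (𝓝 (g z)) := by
  have hs : HasCompactSupport k := HasCompactSupport.intro (isCompact_closedBall (0 : E3) r)
    fun y hy => hr y (by simpa using hy)
  obtain ⟨M, hM⟩ := hs.exists_bound_of_continuous hc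
  have hkm := hc.measurable
  have hsm : ∀ n, Measurable (scl (ε n) k) := fun n => by unfold scl; fun_prop
  -- Measurability of the convergence set allows the product almost-everywhere statement to be
  -- checked section by section.
  have hmeas : MeasurableSet
      {z | Tendsto (fun n => conv g (scl (ε n) k) z) atTop (𝓝 (g z))} := by
    exact measurableSet_tendsto_fun (l := atTop) (fun n => measurable_conv hg (hsm n)) hg
  rw [cylMeasure_eq_prod, Measure.ae_prod_iff_ae_ae hmeas]
  filter_upwards [ae_integrable_section hi] with t ht
  have hloc : LocallyIntegrable (fun x => g (t, x)) volume := by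
    rw [locallyIntegrable_iff]
    intro K hK
    obtain ⟨C, hC, hCg⟩ := exists_setLIntegral_le_cell hP hK.isBounded
    refine ⟨(by fun_prop : Measurable fun x => g (t, x)).aestronglyMeasurable, ?_⟩
    rw [hasFiniteIntegral_iff_enorm]
    exact (hCg _ (by fun_prop) (hper.enorm t)).trans_lt
      (ENNReal.mul_lt_top hC.lt_top ht.hasFiniteIntegral)
  refine ae_restrict_of_ae ?_
  filter_upwards [(Besicovitch.vitaliFamily (volume : Measure E3)).ae_tendsto_average_norm_sub
    hloc] with x hx
  have hrε : Tendsto (fun n => r * ε n) atTop (𝓝[>] 0) := by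
    refine tendsto_nhdsWithin_iff.2 ⟨by simpa using hε0.const_mul r, ?_⟩
    exact Eventually.of_forall fun n => mul_pos hr0 (hε n)
  have h0 := (hx.comp (Besicovitch.tendsto_filterAt volume x)).comp hrε
  have h1 := tendsto_integral_smul_of_tendsto_average_norm_sub
    (g := fun n y => scl (ε n) k (x - y)) (M * (volume (Metric.closedBall (0 : E3) r)).toReal) h0
    (Eventually.of_forall fun n => hloc.integrableOn_isCompact (isCompact_closedBall _ _))
    ?_ ?_ ?_
  · refine h1.congr fun n => ?_
    rw [conv_eq_pair, pair]
    exact integral_congr_ae (Eventually.of_forall fun y => by simp [mul_comm])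
  · refine tendsto_const_nhds.congr fun n => ?_
    rw [integral_sub_left_eq_self (scl (ε n) k) volume x, integral_scl (hε n), hk1]
  · refine Eventually.of_forall fun n y hy => ?_
    by_contra hcon
    refine hy (scl_eq_zero (hε n) hr _ ?_)
    simpa [dist_comm, dist_eq_norm, not_le] using hcon
  · refine Eventually.of_forall fun n y => ?_
    have hv : volume.real (Metric.closedBall x (r * ε n)) =
        ε n ^ 3 * (volume (Metric.closedBall (0 : E3) r)).toReal := by
      rw [Measure.real, mul_comm r, Measure.addHaar_closedBall_mul volume x (hε n).le hr0.le]
      simp only [finrank_euclideanSpace, Fintype.card_fin]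
      rw [ENNReal.toReal_mul, ENNReal.toReal_ofReal (pow_nonneg (hε n).le 3)]
    have hv0 : 0 < (volume (Metric.closedBall (0 : E3) r)).toReal :=
      ENNReal.toReal_pos (Metric.measure_closedBall_pos _ _ hr0).ne' measure_closedBall_lt_top.ne
    have hε3 := pow_pos (hε n) 3
    rw [hv, mul_div_mul_right _ _ hv0.ne', scl, abs_mul, abs_of_pos (inv_pos.2 hε3),
      inv_mul_eq_div]
    gcongr
    exact hM _

/-! ### The `L¹` estimate for the pressure -/

lemma pd_const_mul {k : E3 → ℝ} (hk : ContDiff ℝ ∞ k) (c : ℝ) (i : Fin 3) :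
    pd i (fun y => c * k y) = fun y => c * pd i k y := by
  simpa using pd_comp_smul hk c 1 i

lemma lapX_const_mul {k : E3 → ℝ} (hk : ContDiff ℝ ∞ k) (c : ℝ) (y : E3) :
    lapX (fun y => c * k y) y = c * lapX k y := by
  simp only [lapX, pd_const_mul hk, pd_const_mul (contDiff_pd hk), Finset.mul_sum]

lemma exists_normalized_laplacian_kernel : ∃ Θ H : E3 → ℝ, ContDiff ℝ ∞ Θ ∧ ContDiff ℝ ∞ H ∧
    (∀ y, 2 < ‖y‖ → Θ y = 0) ∧ (∀ y, 2 < ‖y‖ → H y = 0) ∧ ∫ y, Θ y = 1 ∧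
    ∀ y, -lapX H y = Θ y - 1 / 8 * Θ ((1 / 2 : ℝ) • y) := by
  obtain ⟨Θ, H, hΘ, hH, hΘ0, hH0, hpos, hlap⟩ := exists_laplacian_kernel
  refine ⟨fun y => (∫ y, Θ y)⁻¹ * Θ y, fun y => (∫ y, Θ y)⁻¹ * H y, contDiff_const.mul hΘ,
    contDiff_const.mul hH, fun y hy => by simp [hΘ0 y hy],
    fun y hy => by simp [hH0 y hy], ?_, fun y => ?_⟩
  · rw [integral_const_mul, inv_mul_cancel₀ hpos.ne']
  · rw [lapX_const_mul hH, ← mul_neg, hlap]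
    ring

lemma hasCompactSupport_of_norm {k : E3 → ℝ} {r : ℝ} (hr : ∀ y, r < ‖y‖ → k y = 0) :
    HasCompactSupport k :=
  HasCompactSupport.intro (isCompact_closedBall (0 : E3) r) fun y hy => hr y (by simpa using hy)

lemma pd_eq_zero_of_norm {k : E3 → ℝ} {r : ℝ} (hr : ∀ y, r < ‖y‖ → k y = 0) (i : Fin 3) (y : E3)
    (hy : r < ‖y‖) : pd i k y = 0 := by
  have : k =ᶠ[𝓝 y] fun _ => 0 := by
    filter_upwards [continuous_norm.continuousAt.eventually (lt_mem_nhds hy)] with x hx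
    exact hr x hx
  rw [pd, this.fderiv_eq]; simp

/-- At scale R the kernel varies across one cell by O(R⁻⁴) and lives on a ball of volume O(R³), so
it differs in L¹ by O(1/R) from its average over cell translates. That average annihilates periodic
functions of mean zero. -/
lemma exists_lintegral_sub_mean_le {P : ℝ} (hP : 0 < P) {Θ : E3 → ℝ} (hΘ : ContDiff ℝ ∞ Θ)
    (h0 : ∀ y, 2 < ‖y‖ → Θ y = 0) {δ : ℝ} (hδ : 0 < δ) : ∃ R > (0 : ℝ),
    ∫⁻ y, ‖scl R Θ y - (P ^ 3)⁻¹ * cellConv P (scl R Θ) y‖ₑ ≤ ENNReal.ofReal δ := by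
  have hs := hasCompactSupport_of_norm h0
  obtain ⟨L, hL⟩ := hΘ.lipschitzWith_of_hasCompactSupport hs (by simp)
  obtain ⟨d, hd⟩ := (isCompact_cell P).isBounded.exists_norm_le
  have hd0 : 0 ≤ d := (norm_nonneg (0 : E3)).trans (hd 0 fun i => by
    simp only [PiLp.zero_apply, mem_Icc]; constructor <;> linarith)
  set V : ℝ := volume.real (Metric.closedBall (0 : E3) 3) with hV
  -- L is the Lipschitz constant of Θ and d bounds the cell. The last summand makes LdV/R at most δ;
  -- the summand d gives d ≤ R, so the difference is supported in radius 2R + d ≤ 3R.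
  set R : ℝ := d + 1 + L * d * V / δ with hR
  have hV0 : 0 ≤ V := measureReal_nonneg
  have hRd : d ≤ R := by
    have : 0 ≤ L * d * V / δ := by positivity
    linarith
  have hR0 : 0 < R := by positivity
  refine ⟨R, hR0, ?_⟩
  have hP3 : 0 < P ^ 3 := by positivity
  have hmass : (cellMeasure P).real univ = P ^ 3 := by
    rw [Measure.real, cellMeasure, Measure.restrict_apply_univ, volume_cell hP,
      ENNReal.toReal_ofReal hP3.le]
  have hsc : Continuous (scl R Θ) := (contDiff_scl hΘ).continuous
  have hdiff : ∀ y w, w ∈ cell P → ‖scl R Θ y - scl R Θ (y - w)‖ ≤ L * d / R ^ 4 := by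
    intro y w hw
    have h1 := hL.dist_le_mul (R⁻¹ • y) (R⁻¹ • (y - w))
    rw [dist_eq_norm, dist_eq_norm, ← smul_sub, sub_sub_cancel, norm_smul, norm_inv,
      Real.norm_of_nonneg hR0.le] at h1
    rw [scl, scl, ← mul_sub, norm_mul, norm_inv, norm_pow, Real.norm_of_nonneg hR0.le]
    calc (R ^ 3)⁻¹ * ‖Θ (R⁻¹ • y) - Θ (R⁻¹ • (y - w))‖
        ≤ (R ^ 3)⁻¹ * (L * (R⁻¹ * d)) := by
          gcongr
          exact h1.trans (by gcongr; exact hd w hw)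
      _ = L * d / R ^ 4 := by field_simp
  have hpt : ∀ y, ‖scl R Θ y - (P ^ 3)⁻¹ * cellConv P (scl R Θ) y‖ ≤ L * d / R ^ 4 := by
    intro y
    have hInt : Integrable (fun w => scl R Θ (y - w)) (cellMeasure P) :=
      (by fun_prop : Continuous fun w => scl R Θ (y - w)).continuousOn.integrableOn_compact
        (isCompact_cell P)
    have h1 : scl R Θ y - (P ^ 3)⁻¹ * cellConv P (scl R Θ) y =
        (P ^ 3)⁻¹ * ∫ w, (scl R Θ y - scl R Θ (y - w)) ∂(cellMeasure P) := by
      rw [integral_sub (integrable_const _) hInt, integral_const, hmass, smul_eq_mul, mul_sub,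
        inv_mul_cancel_left₀ hP3.ne']
      rfl
    rw [h1, norm_mul, norm_inv, Real.norm_of_nonneg hP3.le, inv_mul_le_iff₀ hP3]
    have h2 := norm_integral_le_of_norm_le_const (μ := cellMeasure P)
      (ae_restrict_of_forall_mem (measurableSet_cell P) (hdiff y))
    rw [hmass] at h2
    linarith
  have hz : ∀ y, 3 * R < ‖y‖ → scl R Θ y - (P ^ 3)⁻¹ * cellConv P (scl R Θ) y = 0 := by
    intro y hy
    have h1 : ∀ w ∈ cell P, scl R Θ (y - w) = 0 := fun w hw =>
      scl_eq_zero hR0 h0 _ (by have := norm_sub_norm_le y w; linarith [hd w hw])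
    rw [scl_eq_zero hR0 h0 y (by linarith), show cellConv P (scl R Θ) y =
      ∫ w, scl R Θ (y - w) ∂(cellMeasure P) from rfl,
      integral_eq_zero_of_ae (μ := cellMeasure P)
        (ae_restrict_of_forall_mem (measurableSet_cell P) h1)]
    simp
  calc ∫⁻ y, ‖scl R Θ y - (P ^ 3)⁻¹ * cellConv P (scl R Θ) y‖ₑ
      ≤ ∫⁻ y, (Metric.closedBall (0 : E3) (3 * R)).indicator
          (fun _ => ENNReal.ofReal (L * d / R ^ 4)) y := by
        refine lintegral_mono fun y => ?_
        rcases le_or_gt ‖y‖ (3 * R) with hy | hy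
        · rw [indicator_of_mem (by simpa using hy), ← ofReal_norm]
          exact ENNReal.ofReal_le_ofReal (hpt y)
        · simp only [hz y hy, enorm_zero, zero_le]
    _ = ENNReal.ofReal (L * d / R ^ 4 * (R ^ 3 * V)) := by
        rw [lintegral_indicator_const Metric.isClosed_closedBall.measurableSet, mul_comm 3 R,
          Measure.addHaar_closedBall_mul volume _ hR0.le (by norm_num)]
        simp only [finrank_euclideanSpace, Fintype.card_fin]
        rw [ENNReal.ofReal_mul (by positivity), ENNReal.ofReal_mul (by positivity), hV,
          ofReal_measureReal measure_closedBall_lt_top.ne]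
    _ ≤ ENNReal.ofReal δ := by
        refine ENNReal.ofReal_le_ofReal ?_
        have h1 : L * d / R ^ 4 * (R ^ 3 * V) = L * d * V / R := by field_simp
        rw [h1, div_le_iff₀ hR0, hR]
        have h2 : δ * (d + 1 + L * d * V / δ) = δ * (d + 1) + L * d * V := by field_simp
        rw [h2]
        have : 0 ≤ δ * (d + 1) := by positivity
        linarith

lemma measurePreserving_neg_cell (P : ℝ) :
    MeasurePreserving (fun x : E3 => -x) (cellMeasure P) (cellMeasure P) := by
  have h := (Measure.measurePreserving_neg (volume : Measure E3)).restrict_preimage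
    (measurableSet_cell P)
  have h2 : Neg.neg ⁻¹' cell P = cell P := by
    ext x
    simp only [cell, mem_preimage, mem_ofPred_eq, PiLp.neg_apply, mem_Icc]
    refine forall_congr' fun i => ?_
    constructor <;> rintro ⟨h1, h2⟩ <;> constructor <;> linarith
  rw [h2] at h
  exact h

lemma integral_cell_sub_left {P : ℝ} (hP : 0 < P) {g : E3 → ℝ} (hper : PeriodicX P g) (x : E3) :
    ∫ y, g (x - y) ∂(cellMeasure P) = ∫ y, g y ∂(cellMeasure P) := by
  rw [← integral_cell_add hP hper x, ← (measurePreserving_neg_cell P).integral_comp'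
    (f := MeasurableEquiv.neg E3) (fun y => g (y + x))]
  simp [sub_eq_neg_add]

lemma integrable_cell_sub_left {P : ℝ} (hP : 0 < P) {g : E3 → ℝ} (hg : Measurable g)
    (hper : PeriodicX P g) (hi : Integrable g (cellMeasure P)) (x : E3) :
    Integrable (fun y => g (x - y)) (cellMeasure P) := by
  refine ⟨(by fun_prop : Measurable fun y => g (x - y)).aestronglyMeasurable, ?_⟩
  rw [hasFiniteIntegral_iff_enorm]
  have h1 := (measurePreserving_neg_cell P).lintegral_comp
    (by fun_prop : Measurable fun y => ‖g (y + x)‖ₑ)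
  simp only [neg_add_eq_sub] at h1
  rw [h1, lintegral_cell_add hP (g := fun y => ‖g y‖ₑ) (fun y i => by simp only [hper y i]) x]
  exact hi.hasFiniteIntegral

/-- An equation tested with k(x - ·) holds outside a null set of times that depends on x; for a
measurable function, Tonelli turns this into one null set of space-time. -/
lemma ae_conv_eq_zero_of_forall {T P : ℝ} {F : ℝ × E3 → ℝ} (hF : Measurable F)
    (h : ∀ x, ∀ᵐ t ∂(volume.restrict (Ioo 0 T)), F (t, x) = 0) :
    ∀ᵐ z ∂(cylMeasure T P), F z = 0 := by
  have hm : MeasurableSet {z | F z = 0} := hF (measurableSet_singleton 0)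
  rw [cylMeasure_eq_prod, Measure.ae_prod_iff_ae_ae hm, Measure.ae_ae_comm hm]
  exact Eventually.of_forall h

/-- An `L¹` estimate for periodic mean-zero solutions of `ΔQ = -∂ₐ∂_b G_{ab}` in terms of the
translation modulus of `G` at dyadic scales. -/
theorem exists_lintegral_le_of_poisson {P : ℝ} (hP : 0 < P) : ∃ C : ℝ≥0∞, C ≠ ⊤ ∧ ∃ R > (0 : ℝ),
    ∀ (T : ℝ) (Q : ℝ × E3 → ℝ) (G : Fin 3 → Fin 3 → ℝ × E3 → ℝ) (W : ℕ → ℝ≥0∞),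
    Measurable Q → PeriodicTX P Q → Integrable Q (cylMeasure T P) →
    (∀ a b, Measurable (G a b)) → (∀ a b, PeriodicTX P (G a b)) →
    (∀ a b, Integrable (G a b) (cylMeasure T P)) →
    (∀ᵐ t ∂(volume.restrict (Ioo 0 T)), ∫ x, Q (t, x) ∂(cellMeasure P) = 0) →
    (∀ k : E3 → ℝ, ContDiff ℝ ∞ k → HasCompactSupport k → ∀ᵐ t ∂(volume.restrict (Ioo 0 T)),
      (∑ a, ∑ b, pair (G a b) (pd a (pd b k)) t) + pair Q (lapX k) t = 0) →
    (∀ j a b y, ‖y‖ ≤ R * (1 / 2) ^ j →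
      ∫⁻ z, ‖G a b (z.1, z.2 + y) - G a b z‖ₑ ∂(cylMeasure T P) ≤ W j) →
    ∫⁻ z, ‖Q z‖ₑ ∂(cylMeasure T P) ≤ C * ∑' j, W j := by
  obtain ⟨Θ, H, hΘ, hH, hΘ0, hH0, hΘ1, hlap⟩ := exists_normalized_laplacian_kernel
  obtain ⟨R, hR, hmean⟩ := exists_lintegral_sub_mean_le hP hΘ hΘ0 (δ := 1 / 2) (by norm_num)
  have hK : ∀ a b, ContDiff ℝ ∞ (pd a (pd b H)) := fun a b => contDiff_pd (contDiff_pd hH)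
  have hK0 : ∀ a b y, 2 < ‖y‖ → pd a (pd b H) y = 0 := fun a b =>
    pd_eq_zero_of_norm (pd_eq_zero_of_norm hH0 b) a
  have hKs : ∀ a b, HasCompactSupport (pd a (pd b H)) := fun a b =>
    hasCompactSupport_of_norm (hK0 a b)
  have hΘs := hasCompactSupport_of_norm hΘ0
  set S : ℝ≥0∞ := ∑ a, ∑ b, ∫⁻ y, ‖pd a (pd b H) y‖ₑ with hS
  have hStop : S ≠ ⊤ := by
    refine (ENNReal.sum_lt_top.2 fun a _ => ENNReal.sum_lt_top.2 fun b _ => ?_).ne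
    exact ((hK a b).continuous.integrable_of_hasCompactSupport (hKs a b)).hasFiniteIntegral
  refine ⟨2 * S, ENNReal.mul_ne_top (by simp) hStop, R, hR, ?_⟩
  intro T Q G W hQ hQp hQi hG hGp hGi hQ0 hPoi hW
  -- Dyadic scales starting at the large scale R. The kernels vanish beyond radius 2, so at scale
  -- ε_(j+1) they see only shifts of size at most 2ε_(j+1) = ε_j, which fixes the indexing of W.
  set ε : ℕ → ℝ := fun j => R * (1 / 2) ^ j with hεdef
  have hε : ∀ j, 0 < ε j := fun j => by positivity
  have hε2 : ∀ j, 2 * ε (j + 1) = ε j := fun j => by simp only [hεdef, pow_succ]; ring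
  have hε0 : Tendsto ε atTop (𝓝 0) := by
    simpa only [mul_zero] using (tendsto_pow_atTop_nhds_zero_of_lt_one
      (by norm_num : (0 : ℝ) ≤ 1 / 2) (by norm_num)).const_mul R
  have hsclΘ : ∀ j, ContDiff ℝ ∞ (scl (ε j) Θ) := fun j => contDiff_scl hΘ
  have hsclΘs : ∀ j, HasCompactSupport (scl (ε j) Θ) := fun j =>
    hasCompactSupport_of_norm (scl_eq_zero (hε j) hΘ0)
  have hsclK : ∀ j a b, Continuous (scl (ε j) (pd a (pd b H))) := fun j a b =>
    (contDiff_scl (hK a b)).continuous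
  have hmΘ : ∀ j, Measurable (conv Q (scl (ε j) Θ)) := fun j =>
    measurable_conv hQ (hsclΘ j).continuous.measurable
  have hmK : ∀ j a b, Measurable (conv (G a b) (scl (ε j) (pd a (pd b H)))) := fun j a b =>
    measurable_conv (hG a b) (hsclK j a b).measurable
  -- The kernel identity at scale ε_(j+1): the term (1/8)Θ(·/2) becomes Θ at the doubled scale ε_j,
  -- so successive identities telescope.
  have hlapscl : ∀ j, lapX (fun y => ε (j + 1) ^ 2 * scl (ε (j + 1)) H y) =
      fun y => scl (ε j) Θ y - scl (ε (j + 1)) Θ y := by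
    intro j
    ext y
    have hne := (hε (j + 1)).ne'
    simp only [lapX, pd_pd_scl hH (hε (j + 1))]
    have h1 := hlap ((ε (j + 1))⁻¹ • y)
    simp only [lapX] at h1
    have h2 : (1 / 2 : ℝ) • (ε (j + 1))⁻¹ • y = (ε j)⁻¹ • y := by
      rw [smul_smul, ← hε2 j]
      congr 1
      field_simp
    rw [h2] at h1
    simp only [scl, ← Finset.mul_sum]
    rw [neg_eq_iff_eq_neg.1 h1, ← hε2 j]
    field_simp
    ring
  -- The Poisson equation is tested with the rescaled potential reflected and centred at x.
  have hstep : ∀ j, ∀ᵐ z ∂(cylMeasure T P), conv Q (scl (ε (j + 1)) Θ) z =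
      conv Q (scl (ε j) Θ) z + ∑ a, ∑ b, conv (G a b) (scl (ε (j + 1)) (pd a (pd b H))) z := by
    intro j
    have h1 : ∀ᵐ z ∂(cylMeasure T P),
        (∑ a, ∑ b, conv (G a b) (scl (ε (j + 1)) (pd a (pd b H))) z) +
          conv Q (fun y => scl (ε j) Θ y - scl (ε (j + 1)) Θ y) z = 0 := by
      refine ae_conv_eq_zero_of_forall
        (F := fun z => (∑ a, ∑ b, conv (G a b) (scl (ε (j + 1)) (pd a (pd b H))) z) +
          conv Q (fun y => scl (ε j) Θ y - scl (ε (j + 1)) Θ y) z) ?_ fun x => ?_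
      · refine Measurable.add (Finset.measurable_sum _ fun a _ =>
          Finset.measurable_sum _ fun b _ => hmK _ a b) (measurable_conv hQ ?_)
        exact ((hsclΘ j).continuous.sub (hsclΘ (j + 1)).continuous).measurable
      · have hk : ContDiff ℝ ∞ fun y => ε (j + 1) ^ 2 * scl (ε (j + 1)) H y := contDiff_sq_scl hH
        have hks : HasCompactSupport fun y => ε (j + 1) ^ 2 * scl (ε (j + 1)) H y :=
          (hasCompactSupport_of_norm (scl_eq_zero (hε _) hH0)).mul_left
        filter_upwards [hPoi _ (hk.comp (contDiff_const.sub contDiff_id))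
          (hasCompactSupport_comp_sub_left hks x)] with t ht
        rw [← ht]
        simp only [conv_eq_pair]
        congr 1
        · refine Finset.sum_congr rfl fun a _ => Finset.sum_congr rfl fun b _ => ?_
          have := pd_pd_comp_sub_left hk x a b
          rw [pd_pd_scl hH (hε _)] at this
          exact congrArg (fun k => pair (G a b) k t) this.symm
        · have := lapX_comp_sub_left hk x
          rw [hlapscl] at this
          exact congrArg (fun k => pair Q k t) this.symm
    filter_upwards [h1, ae_integrable_conv_integrand hP hQ hQp hQi (hsclΘ j).continuous
      (hsclΘs j), ae_integrable_conv_integrand hP hQ hQp hQi (hsclΘ (j + 1)).continuous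
      (hsclΘs (j + 1))] with z hz h2 h3
    rw [conv_sub_kernel h2 h3] at hz
    linarith
  -- Second derivatives of H have integral zero, so the convolution only sees differences of
  -- translates of G; this replaces a Calderón-Zygmund bound, which is false in L¹.
  have hKbound : ∀ j a b, ∫⁻ z, ‖conv (G a b) (scl (ε (j + 1)) (pd a (pd b H))) z‖ₑ
      ∂(cylMeasure T P) ≤ (∫⁻ y, ‖pd a (pd b H) y‖ₑ) * W j := by
    intro j a b
    have h1 := lintegral_conv_sub_le (T := T) hP (hG a b) (hGp a b) (hGi a b) (hsclK (j + 1) a b)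
      (scl_eq_zero (hε (j + 1)) (hK0 a b)) (W := W j) (fun y hy => hW j a b y (by
        rw [hε2] at hy; exact hy))
    rw [integral_scl (hε _), integral_pd_eq_zero (contDiff_pd hH)
      (hasCompactSupport_of_norm (pd_eq_zero_of_norm hH0 b)),
      lintegral_scl (hε _) (hK a b).continuous (hKs a b)] at h1
    simpa using h1
  have hind : ∀ j, ∫⁻ z, ‖conv Q (scl (ε j) Θ) z‖ₑ ∂(cylMeasure T P) ≤
      (∫⁻ z, ‖conv Q (scl R Θ) z‖ₑ ∂(cylMeasure T P)) + ∑ i ∈ Finset.range j, S * W i := by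
    intro j
    induction j with
    | zero => simp [hεdef]
    | succ j ih =>
      rw [lintegral_congr_ae ((hstep j).mono fun z hz => by rw [hz])]
      calc ∫⁻ z, ‖conv Q (scl (ε j) Θ) z +
            ∑ a, ∑ b, conv (G a b) (scl (ε (j + 1)) (pd a (pd b H))) z‖ₑ ∂(cylMeasure T P)
          ≤ ∫⁻ z, (‖conv Q (scl (ε j) Θ) z‖ₑ +
            ∑ a, ∑ b, ‖conv (G a b) (scl (ε (j + 1)) (pd a (pd b H))) z‖ₑ) ∂(cylMeasure T P) := by
            refine lintegral_mono fun z => (enorm_add_le _ _).trans ?_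
            gcongr
            exact (enorm_sum_le _ _).trans (Finset.sum_le_sum fun a _ => enorm_sum_le _ _)
        _ = (∫⁻ z, ‖conv Q (scl (ε j) Θ) z‖ₑ ∂(cylMeasure T P)) + ∑ a, ∑ b, ∫⁻ z,
            ‖conv (G a b) (scl (ε (j + 1)) (pd a (pd b H))) z‖ₑ ∂(cylMeasure T P) := by
            rw [lintegral_add_left (hmΘ j).enorm, lintegral_finsetSum _ fun a _ =>
              Finset.measurable_sum _ fun b _ => (hmK _ a b).enorm]
            congr 1
            refine Finset.sum_congr rfl fun a _ => ?_
            rw [lintegral_finsetSum _ fun b _ => (hmK _ a b).enorm]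
        _ ≤ ((∫⁻ z, ‖conv Q (scl R Θ) z‖ₑ ∂(cylMeasure T P)) + ∑ i ∈ Finset.range j, S * W i) +
            S * W j := by
            refine add_le_add ih ?_
            rw [hS, Finset.sum_mul]
            refine Finset.sum_le_sum fun a _ => ?_
            rw [Finset.sum_mul]
            exact Finset.sum_le_sum fun b _ => hKbound j a b
        _ = _ := by rw [Finset.sum_range_succ, add_assoc]
  -- Since Q has mean zero at almost every time, the cell average of the kernel can be subtracted
  -- for free, and R was chosen so that the remainder has L¹ norm at most 1/2.
  have hlarge : ∫⁻ z, ‖conv Q (scl R Θ) z‖ₑ ∂(cylMeasure T P) ≤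
      ENNReal.ofReal (1 / 2) * ∫⁻ z, ‖Q z‖ₑ ∂(cylMeasure T P) := by
    have hR1 : ContDiff ℝ ∞ (scl R Θ) := contDiff_scl hΘ
    have hR1s : HasCompactSupport (scl R Θ) := hasCompactSupport_of_norm (scl_eq_zero hR hΘ0)
    have hcc : Continuous (cellConv P (scl R Θ)) := (contDiff_cellConv hR1 hR1s).continuous
    have hccs := hasCompactSupport_cellConv (P := P) hR1s
    have h1 : ∀ᵐ z ∂(cylMeasure T P), conv Q (scl R Θ) z =
        conv Q (fun y => scl R Θ y - (P ^ 3)⁻¹ * cellConv P (scl R Θ) y) z := by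
      have h2 : ∀ᵐ z ∂(cylMeasure T P), Integrable (fun x => Q (z.1, x)) (cellMeasure P) ∧
          ∫ x, Q (z.1, x) ∂(cellMeasure P) = 0 := by
        rw [cylMeasure_eq_prod]
        exact (Measure.quasiMeasurePreserving_fst (μ := volume.restrict (Ioo 0 T))
          (ν := cellMeasure P)).ae ((ae_integrable_section hQi).and hQ0)
      filter_upwards [h2] with z hz
      rw [conv_sub_kernel (integrable_conv_integrand hP hQ hQp hz.1 hR1.continuous hR1s z.2)
        (integrable_conv_integrand (k := fun y => (P ^ 3)⁻¹ * cellConv P (scl R Θ) y) hP hQ hQp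
          hz.1 (continuous_const.mul hcc) hccs.mul_left z.2)]
      have h3 : ∫ x, Q (z.1, z.2 - x) ∂(cellMeasure P) = 0 :=
        (integral_cell_sub_left hP (hQp z.1) z.2).trans hz.2
      have h4 : conv Q (fun y => (P ^ 3)⁻¹ * cellConv P (scl R Θ) y) z = 0 := by
        have h5 := integral_mul_cell_convolution hP
          (by fun_prop : Measurable fun y => Q (z.1, z.2 - y)) (periodicX_sub_left (hQp z.1) z.2)
          (integrable_cell_sub_left hP (by fun_prop : Measurable fun y => Q (z.1, y)) (hQp z.1)
            hz.1 z.2) hR1.continuous hR1s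
        rw [h3, mul_zero] at h5
        rw [conv, ← mul_zero (P ^ 3)⁻¹, ← h5, ← integral_const_mul]
        refine integral_congr_ae (Eventually.of_forall fun y => ?_)
        simp only [cellConv]
        ring
      rw [h4, sub_zero]
    rw [lintegral_congr_ae (h1.mono fun z hz => by rw [hz])]
    refine (lintegral_conv_le hP hQ hQp
      (hR1.continuous.sub (continuous_const.mul hcc)).measurable).trans ?_
    exact mul_le_mul_left hmean _
  -- As the scale tends to zero the mollifications converge to Q almost everywhere, and Fatou
  -- transfers the uniform bound.
  have hfatou : ∫⁻ z, ‖Q z‖ₑ ∂(cylMeasure T P) ≤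
      ENNReal.ofReal (1 / 2) * (∫⁻ z, ‖Q z‖ₑ ∂(cylMeasure T P)) + S * ∑' j, W j := by
    have hlim := ae_tendsto_conv hP hQ hQp hQi hΘ.continuous (by norm_num : (0 : ℝ) < 2) hΘ0 hΘ1
      hε hε0
    calc ∫⁻ z, ‖Q z‖ₑ ∂(cylMeasure T P)
        = ∫⁻ z, liminf (fun j => ‖conv Q (scl (ε j) Θ) z‖ₑ) atTop ∂(cylMeasure T P) := by
          refine lintegral_congr_ae (hlim.mono fun z hz => ?_)
          exact ((continuous_enorm.tendsto _).comp hz).liminf_eq.symm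
      _ ≤ liminf (fun j => ∫⁻ z, ‖conv Q (scl (ε j) Θ) z‖ₑ ∂(cylMeasure T P)) atTop :=
          lintegral_liminf_le fun j => (hmΘ j).enorm
      _ ≤ _ := by
          refine liminf_le_of_frequently_le' (Frequently.of_forall fun j => (hind j).trans ?_)
          refine add_le_add hlarge ?_
          rw [← ENNReal.tsum_mul_left]
          exact ENNReal.sum_le_tsum _
  -- The half of the norm on the right can be absorbed only because the norm is known to be finite.
  have hfin : ∫⁻ z, ‖Q z‖ₑ ∂(cylMeasure T P) ≠ ⊤ := hQi.hasFiniteIntegral.ne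
  set N := ∫⁻ z, ‖Q z‖ₑ ∂(cylMeasure T P)
  have h2N : N + N ≤ N + 2 * S * ∑' j, W j := by
    calc N + N = 2 * N := (two_mul N).symm
      _ ≤ 2 * (ENNReal.ofReal (1 / 2) * N + S * ∑' j, W j) := by gcongr
      _ = N + 2 * S * ∑' j, W j := by
        rw [mul_add, ← mul_assoc, ← mul_assoc]
        congr 1
        rw [show (2 : ℝ≥0∞) = ENNReal.ofReal 2 by simp, ← ENNReal.ofReal_mul (by norm_num)]
        norm_num
  exact (ENNReal.add_le_add_iff_left hfin).1 h2N

/-! ### The momentum equation tested with products -/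

/-- Measurable periodic square-integrable data for the momentum equation. -/
structure IsFlowData (T P : ℝ) (f : ℝ × E3 → E3) (u₀ : E3 → E3) : Prop where
  force_meas : Measurable f
  force_per : PeriodicTX P f
  force_memLp : MemLp f 2 (cylMeasure T P)
  vel_meas : Measurable u₀
  vel_per : PeriodicX P u₀
  vel_memLp : MemLp u₀ 2 (cellMeasure P)

/-- Measurable periodic weak solutions of the incompressible momentum equation. -/
structure IsFlow (T P ν : ℝ) (f : ℝ × E3 → E3) (u₀ : E3 → E3) (u : ℝ × E3 → E3)
    (p : ℝ × E3 → ℝ) : Prop where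
  vel_meas : Measurable u
  vel_per : PeriodicTX P u
  vel_memLp : MemLp u 2 (cylMeasure T P)
  pr_meas : Measurable p
  pr_per : PeriodicTX P p
  pr_int : Integrable p (cylMeasure T P)
  momentum : MomentumEq T ν f u₀ u p
  divFree : DivFree T u

lemma PeriodicTX.coord {P : ℝ} {u : ℝ × E3 → E3} (h : PeriodicTX P u) (j : Fin 3) :
    PeriodicTX P fun z => u z j := fun t x i => by
  have := h t x i
  simp only at this ⊢
  rw [this]

lemma PeriodicTX.coord_mul {P : ℝ} {u : ℝ × E3 → E3} (h : PeriodicTX P u) (i j : Fin 3) :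
    PeriodicTX P fun z => u z i * u z j := fun t x l => by
  have := h t x l
  simp only at this ⊢
  rw [this]

lemma integrable_coord {T P : ℝ} {u : ℝ × E3 → E3} (h : MemLp u 2 (cylMeasure T P)) (j : Fin 3) :
    Integrable (fun z => u z j) (cylMeasure T P) :=
  (memLp_apply h j).integrable (by norm_num)

lemma integrable_coord_mul {T P : ℝ} {u : ℝ × E3 → E3} (h : MemLp u 2 (cylMeasure T P))
    (i j : Fin 3) : Integrable (fun z => u z i * u z j) (cylMeasure T P) :=
  (memLp_apply h i).integrable_mul (memLp_apply h j)

lemma integrable_pair_mul {T P : ℝ} (hP : 0 < P) {g : ℝ × E3 → ℝ} (hg : Measurable g)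
    (hper : PeriodicTX P g) (hi : Integrable g (cylMeasure T P)) {k : E3 → ℝ}
    (hc : Continuous k) (hs : HasCompactSupport k) {ψ : ℝ → ℝ} (hψ : Continuous ψ)
    (hψs : HasCompactSupport ψ) :
    Integrable (fun t => pair g k t * ψ t) (volume.restrict (Ioo 0 T)) := by
  obtain ⟨M, hM⟩ := hψs.exists_bound_of_continuous hψ
  exact Integrable.mul_bdd (c := M) (integrable_pair hP hg hper hi hc hs)
    hψ.aestronglyMeasurable (Eventually.of_forall hM)

/-- The time derivative of `pair (u j) k` for a solution of the momentum equation. -/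
def rate (ν : ℝ) (f u : ℝ × E3 → E3) (p : ℝ × E3 → ℝ) (j : Fin 3) (k : E3 → ℝ) (t : ℝ) : ℝ :=
  (∑ i, pair (fun z => u z i * u z j) (pd i k) t) + pair p (pd j k) t
    + ν * pair (fun z => u z j) (lapX k) t + pair (fun z => f z j) k t

/-- Tensor-product test functions turn the momentum equation into a scalar equation in time for the
pairing with k, with the initial value still attached. -/
lemma IsFlow.integral_rate {T P ν : ℝ} (hP : 0 < P) {f : ℝ × E3 → E3} {u₀ : E3 → E3}
    {u : ℝ × E3 → E3} {p : ℝ × E3 → ℝ} (hd : IsFlowData T P f u₀) (h : IsFlow T P ν f u₀ u p)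
    (j : Fin 3) {k : E3 → ℝ} (hk : ContDiff ℝ ∞ k) (hks : HasCompactSupport k) {ψ : ℝ → ℝ}
    (hψ : ContDiff ℝ ∞ ψ) (hψs : HasCompactSupport ψ) (hψT : tsupport ψ ⊆ Iio T) :
    (∫ t in Ioo 0 T, (pair (fun z => u z j) k t * deriv ψ t + rate ν f u p j k t * ψ t))
      + (∫ x, u₀ x j * k x) * ψ 0 = 0 := by
  have hu := h.vel_meas
  have hf := hd.force_meas
  have hum : ∀ j, Measurable fun z => u z j := fun j => by fun_prop
  have huum : ∀ i j, Measurable fun z => u z i * u z j := fun i j => by fun_prop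
  have hfm : Measurable fun z => f z j := by fun_prop
  have hup := h.vel_per.coord
  have huup := h.vel_per.coord_mul
  have hui := integrable_coord h.vel_memLp
  have huui := integrable_coord_mul h.vel_memLp
  have hfp := hd.force_per.coord j
  have hfi := integrable_coord hd.force_memLp j
  have hc := hψ.continuous
  have hdc : Continuous (deriv ψ) := hψ.continuous_deriv (by simp)
  have hds : HasCompactSupport (deriv ψ) := hψs.deriv
  have cpd : ∀ i, Continuous (pd i k) := fun i => (contDiff_pd hk).continuous
  have spd : ∀ i, HasCompactSupport (pd i k) := fun i => hasCompactSupport_pd hks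
  have clap : Continuous (lapX k) := (contDiff_lapX hk).continuous
  have slap := hasCompactSupport_lapX hks
  have mk : ∀ {ψ : ℝ → ℝ} {k : E3 → ℝ}, Continuous ψ → Continuous k →
      Continuous fun z : ℝ × E3 => ψ z.1 * k z.2 := fun h1 h2 =>
    (h1.comp continuous_fst).mul (h2.comp continuous_snd)
  have i1 := integrable_slab_mul hP (hum j) (hup j) (hui j) (mk hdc hk.continuous)
    (hasCompactSupport_mul_prod hds hks)
  have i2 := fun i => integrable_slab_mul hP (huum i j) (huup i j) (huui i j) (mk hc (cpd i))
    (hasCompactSupport_mul_prod hψs (spd i))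
  have i2' := integrable_finsetSum Finset.univ fun i _ => i2 i
  have i3 := integrable_slab_mul hP h.pr_meas h.pr_per h.pr_int (mk hc (cpd j))
    (hasCompactSupport_mul_prod hψs (spd j))
  have i4 := (integrable_slab_mul hP (hum j) (hup j) (hui j) (mk hc clap)
    (hasCompactSupport_mul_prod hψs slap)).const_mul ν
  have i5 := integrable_slab_mul hP hfm hfp hfi (mk hc hk.continuous)
    (hasCompactSupport_mul_prod hψs hks)
  have ht := h.momentum j _ (isTest_mul hψ hψs hψT hk hks)
  simp only [dt_mul hψ hk, dx_mul hψ hk, lap_mul hψ hk] at ht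
  rw [integral_add (((i1.fun_add i2').fun_add i3).fun_add i4) i5,
    integral_add ((i1.fun_add i2').fun_add i3) i4, integral_add (i1.fun_add i2') i3,
    integral_add i1 i2', integral_finsetSum _ fun i _ => i2 i, integral_const_mul ν,
    integral_slab_mul hP (hum j) (hup j) (hui j) hk.continuous hks hdc hds,
    integral_slab_mul hP h.pr_meas h.pr_per h.pr_int (cpd j) (spd j) hc hψs,
    integral_slab_mul hP (hum j) (hup j) (hui j) clap slap hc hψs,
    integral_slab_mul hP hfm hfp hfi hk.continuous hks hc hψs] at ht
  simp only [fun i => integral_slab_mul hP (huum i j) (huup i j) (huui i j) (cpd i) (spd i) hc hψs]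
    at ht
  have j1 := integrable_pair_mul hP (hum j) (hup j) (hui j) hk.continuous hks hdc hds
  have j2 := fun i => integrable_pair_mul hP (huum i j) (huup i j) (huui i j) (cpd i) (spd i) hc hψs
  have j2' := integrable_finsetSum Finset.univ fun i _ => j2 i
  have j3 := integrable_pair_mul hP h.pr_meas h.pr_per h.pr_int (cpd j) (spd j) hc hψs
  have j4 := (integrable_pair_mul hP (hum j) (hup j) (hui j) clap slap hc hψs).const_mul ν
  have j5 := integrable_pair_mul hP hfm hfp hfi hk.continuous hks hc hψs
  have e0 : ∫ x, u₀ x j * (ψ 0 * k x) = (∫ x, u₀ x j * k x) * ψ 0 := by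
    rw [← integral_mul_const]; congr 1; ext x; ring
  rw [e0] at ht
  refine Eq.trans ?_ ht
  congr 1
  have e1 : ∀ t, pair (fun z => u z j) k t * deriv ψ t + rate ν f u p j k t * ψ t =
      pair (fun z => u z j) k t * deriv ψ t +
        (∑ i, pair (fun z => u z i * u z j) (pd i k) t * ψ t) + pair p (pd j k) t * ψ t
        + ν * (pair (fun z => u z j) (lapX k) t * ψ t) + pair (fun z => f z j) k t * ψ t := by
    intro t
    rw [rate, ← Finset.sum_mul]; ring
  simp only [e1]
  rw [integral_add (((j1.fun_add j2').fun_add j3).fun_add j4) j5,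
    integral_add ((j1.fun_add j2').fun_add j3) j4, integral_add (j1.fun_add j2') j3,
    integral_add j1 j2', integral_finsetSum _ fun i _ => j2 i, integral_const_mul ν]

lemma IsFlow.integrable_rate {T P ν : ℝ} (hP : 0 < P) {f : ℝ × E3 → E3} {u₀ : E3 → E3}
    {u : ℝ × E3 → E3} {p : ℝ × E3 → ℝ} (hd : IsFlowData T P f u₀) (h : IsFlow T P ν f u₀ u p)
    (j : Fin 3) {k : E3 → ℝ} (hk : ContDiff ℝ ∞ k) (hks : HasCompactSupport k) :
    IntegrableOn (rate ν f u p j k) (Ioo 0 T) := by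
  have hu := h.vel_meas
  have hf := hd.force_meas
  have j2 := integrable_finsetSum Finset.univ fun i _ => integrable_pair hP
    (by fun_prop : Measurable fun z => u z i * u z j) (h.vel_per.coord_mul i j)
    (integrable_coord_mul h.vel_memLp i j) (contDiff_pd (i := i) hk).continuous
    (hasCompactSupport_pd hks)
  have j3 := integrable_pair hP h.pr_meas h.pr_per h.pr_int (contDiff_pd (i := j) hk).continuous
    (hasCompactSupport_pd hks)
  have j4 := (integrable_pair hP (by fun_prop : Measurable fun z => u z j) (h.vel_per.coord j)
    (integrable_coord h.vel_memLp j) (contDiff_lapX hk).continuous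
    (hasCompactSupport_lapX hks)).const_mul ν
  have j5 := integrable_pair hP (by fun_prop : Measurable fun z => f z j) (hd.force_per.coord j)
    (integrable_coord hd.force_memLp j) hk.continuous hks
  exact ((j2.add j3).add j4).add j5

lemma IsFlow.ae_pair_eq {T P ν : ℝ} (hP : 0 < P) {f : ℝ × E3 → E3} {u₀ : E3 → E3}
    {u : ℝ × E3 → E3} {p : ℝ × E3 → ℝ} (hd : IsFlowData T P f u₀) (h : IsFlow T P ν f u₀ u p)
    (j : Fin 3) {k : E3 → ℝ} (hk : ContDiff ℝ ∞ k) (hks : HasCompactSupport k) :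
    ∀ᵐ t ∂(volume.restrict (Ioo 0 T)), pair (fun z => u z j) k t =
      (∫ x, u₀ x j * k x) + ∫ s in (0 : ℝ)..t, rate ν f u p j k s := by
  have hu := h.vel_meas
  exact ae_eq_primitive (integrable_pair hP (by fun_prop : Measurable fun z => u z j)
    (h.vel_per.coord j) (integrable_coord h.vel_memLp j) hk.continuous hks)
    (h.integrable_rate hP hd j hk hks) _ fun ψ hψ hψs hψT => h.integral_rate hP hd j hk hks hψ hψs hψT

lemma pd_pd_comm {k : E3 → ℝ} (hk : ContDiff ℝ ∞ k) (i j : Fin 3) :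
    pd i (pd j k) = pd j (pd i k) :=
  funext fun x => fderiv_fderiv_apply_comm hk (e j) (e i) x

lemma lapX_pd_comm {k : E3 → ℝ} (hk : ContDiff ℝ ∞ k) (j : Fin 3) :
    lapX (pd j k) = pd j (lapX k) := by
  ext x
  have hd : ∀ i, DifferentiableAt ℝ (pd i (pd i k)) x := fun i =>
    (contDiff_pd (contDiff_pd hk)).differentiable (by simp) x
  rw [pd, show lapX k = fun y => ∑ i, pd i (pd i k) y from rfl, fderiv_fun_sum fun i _ => hd i]
  rw [show lapX (pd j k) x = ∑ i, pd i (pd i (pd j k)) x from rfl]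
  simp only [sum_apply]
  refine Finset.sum_congr rfl fun i _ => ?_
  rw [pd_pd_comm hk i j, pd_pd_comm (contDiff_pd hk) i j]
  rfl

/-- Time cutoffs localize the constraint to almost every time, with an exceptional set that depends
on k. -/
lemma DivFree.ae_sum_pair {T P : ℝ} (hP : 0 < P) {u : ℝ × E3 → E3} (hu : Measurable u)
    (hup : PeriodicTX P u) (hu2 : MemLp u 2 (cylMeasure T P)) (h : DivFree T u) {k : E3 → ℝ}
    (hk : ContDiff ℝ ∞ k) (hks : HasCompactSupport k) :
    ∀ᵐ t ∂(volume.restrict (Ioo 0 T)), ∑ j, pair (fun z => u z j) (pd j k) t = 0 := by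
  have cpd : ∀ i, Continuous (pd i k) := fun i => (contDiff_pd hk).continuous
  have spd : ∀ i, HasCompactSupport (pd i k) := fun i => hasCompactSupport_pd hks
  have hum : ∀ j, Measurable fun z => u z j := fun j => by fun_prop
  refine ae_eq_zero_of_forall_smooth (integrable_finsetSum _ fun j _ => integrable_pair hP
    (hum j) (hup.coord j) (integrable_coord hu2 j) (cpd j) (spd j)) fun ψ hψ hψs hψT => ?_
  have ht := h _ (isTest_mul hψ hψs (hψT.trans Ioo_subset_Iio_self) hk hks)
  simp only [dx_mul hψ hk] at ht
  rw [integral_finsetSum _ fun j _ => integrable_slab_mul hP (hum j) (hup.coord j)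
    (integrable_coord hu2 j) (h := fun z => ψ z.1 * pd j k z.2)
    ((hψ.continuous.comp continuous_fst).mul ((cpd j).comp continuous_snd))
    (hasCompactSupport_mul_prod hψs (spd j))] at ht
  simp only [fun j => integral_slab_mul hP (hum j) (hup.coord j) (integrable_coord hu2 j) (cpd j)
    (spd j) hψ.continuous hψs] at ht
  simp only [Finset.sum_mul]
  rw [integral_finsetSum _ fun j _ => integrable_pair_mul hP (hum j) (hup.coord j)
    (integrable_coord hu2 j) (cpd j) (spd j) hψ.continuous hψs, ht]

/-- The equation for the pressure. -/
lemma IsFlow.ae_pressure {T P ν : ℝ} (hP : 0 < P) {f : ℝ × E3 → E3} {u₀ : E3 → E3}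
    {u : ℝ × E3 → E3} {p : ℝ × E3 → ℝ} (hd : IsFlowData T P f u₀) (h : IsFlow T P ν f u₀ u p)
    {k : E3 → ℝ} (hk : ContDiff ℝ ∞ k) (hks : HasCompactSupport k) :
    ∀ᵐ t ∂(volume.restrict (Ioo 0 T)),
      (∑ a, ∑ b, pair (fun z => u z a * u z b) (pd a (pd b k)) t) + (∑ b, pair p (pd b (pd b k)) t)
        + ∑ b, pair (fun z => f z b) (pd b k) t = 0 := by
  have hdiv := h.divFree.ae_sum_pair hP h.vel_meas h.vel_per h.vel_memLp hk hks
  have hdiv2 := h.divFree.ae_sum_pair hP h.vel_meas h.vel_per h.vel_memLp (contDiff_lapX hk)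
    (hasCompactSupport_lapX hks)
  have hu := h.vel_meas
  have hpd : ∀ j, ContDiff ℝ ∞ (pd j k) := fun j => contDiff_pd hk
  have hpds : ∀ j, HasCompactSupport (pd j k) := fun j => hasCompactSupport_pd hks
  have hi := fun j => h.integrable_rate hP hd j (hpd j) (hpds j)
  -- The j-th equation is tested with the j-th derivative of k and the results are summed. The term
  -- with the time derivative of ψ vanishes by incompressibility tested with k, the viscous one by
  -- incompressibility tested with the Laplacian of k.
  have key : ∀ᵐ t ∂(volume.restrict (Ioo 0 T)), ∑ j, rate ν f u p j (pd j k) t = 0 := by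
    refine ae_eq_zero_of_forall_smooth (integrable_finsetSum _ fun j _ => hi j)
      fun ψ hψ hψs hψT => ?_
    -- Time cutoffs supported away from 0 remove the initial velocity, so its divergence plays no
    -- role.
    have hψ0 : ψ 0 = 0 := image_eq_zero_of_notMem_tsupport fun h0 => lt_irrefl _ (hψT h0).1
    have hdc : Continuous (deriv ψ) := hψ.continuous_deriv (by simp)
    have hds : HasCompactSupport (deriv ψ) := hψs.deriv
    have j1 := fun j => integrable_pair_mul hP (by fun_prop : Measurable fun z => u z j)
      (h.vel_per.coord j) (integrable_coord h.vel_memLp j) (hpd j).continuous (hpds j) hdc hds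
    have j2 : ∀ j, Integrable (fun t => rate ν f u p j (pd j k) t * ψ t)
        (volume.restrict (Ioo 0 T)) := fun j => by
      obtain ⟨M, hM⟩ := hψs.exists_bound_of_continuous hψ.continuous
      exact Integrable.mul_bdd (c := M) (hi j) hψ.continuous.aestronglyMeasurable
        (Eventually.of_forall hM)
    have h1 : ∀ j, (∫ t in Ioo 0 T, pair (fun z => u z j) (pd j k) t * deriv ψ t)
        + ∫ t in Ioo 0 T, rate ν f u p j (pd j k) t * ψ t = 0 := by
      intro j
      have := h.integral_rate hP hd j (hpd j) (hpds j) hψ hψs (hψT.trans Ioo_subset_Iio_self)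
      rwa [hψ0, mul_zero, add_zero, integral_add (j1 j) (j2 j)] at this
    have h2 : ∑ j, ∫ t in Ioo 0 T, pair (fun z => u z j) (pd j k) t * deriv ψ t = 0 := by
      rw [← integral_finsetSum _ fun j _ => j1 j]
      refine integral_eq_zero_of_ae (hdiv.mono fun t ht => ?_)
      simp only [← Finset.sum_mul, ht, zero_mul, Pi.zero_apply]
    simp only [Finset.sum_mul]
    rw [integral_finsetSum _ fun j _ => j2 j]
    have h3 := Finset.sum_congr rfl fun j (_ : j ∈ Finset.univ) => h1 j
    rw [Finset.sum_add_distrib, h2, zero_add] at h3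
    simpa using h3
  filter_upwards [key, hdiv2] with t ht h2
  simp only [rate, Finset.sum_add_distrib, ← Finset.mul_sum, lapX_pd_comm hk, h2, mul_zero,
    add_zero] at ht
  rw [Finset.sum_comm] at ht
  exact ht

/-! ### Normalization of the pressure -/

/-- Subtraction of the spatial mean. -/
def meanZero (P : ℝ) (p : ℝ × E3 → ℝ) (z : ℝ × E3) : ℝ :=
  p z - (P ^ 3)⁻¹ * ∫ x, p (z.1, x) ∂(cellMeasure P)

lemma measurable_cell_integral {P : ℝ} {p : ℝ × E3 → ℝ} (hp : Measurable p) :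
    Measurable fun t => ∫ x, p (t, x) ∂(cellMeasure P) :=
  (hp.stronglyMeasurable.integral_prod_right').measurable

lemma measurable_meanZero {P : ℝ} {p : ℝ × E3 → ℝ} (hp : Measurable p) :
    Measurable (meanZero P p) :=
  hp.sub (measurable_const.mul ((measurable_cell_integral hp).comp measurable_fst))

lemma PeriodicTX.meanZero {P : ℝ} {p : ℝ × E3 → ℝ} (hp : PeriodicTX P p) :
    PeriodicTX P (meanZero P p) := fun t x i => by
  have := hp t x i
  simp only [PassiveScalar.meanZero] at this ⊢
  rw [this]

lemma integrable_mean {T P : ℝ} {p : ℝ × E3 → ℝ} (hi : Integrable p (cylMeasure T P)) :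
    Integrable (fun z : ℝ × E3 => (P ^ 3)⁻¹ * ∫ x, p (z.1, x) ∂(cellMeasure P))
      (cylMeasure T P) := by
  have h := (integrable_cell_integral hi).comp_fst (cellMeasure P)
  rw [← cylMeasure_eq_prod] at h
  exact h.const_mul _

lemma integrable_meanZero {T P : ℝ} {p : ℝ × E3 → ℝ} (hi : Integrable p (cylMeasure T P)) :
    Integrable (meanZero P p) (cylMeasure T P) := hi.sub (integrable_mean hi)

lemma ae_integral_meanZero {T P : ℝ} (hP : 0 < P) {p : ℝ × E3 → ℝ}
    (hi : Integrable p (cylMeasure T P)) : ∀ᵐ t ∂(volume.restrict (Ioo 0 T)),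
      ∫ x, meanZero P p (t, x) ∂(cellMeasure P) = 0 := by
  have hP3 : 0 < P ^ 3 := by positivity
  have hmass : (cellMeasure P).real univ = P ^ 3 := by
    rw [Measure.real, cellMeasure, Measure.restrict_apply_univ, volume_cell hP,
      ENNReal.toReal_ofReal hP3.le]
  filter_upwards [ae_integrable_section hi] with t ht
  simp only [meanZero]
  rw [integral_sub ht (integrable_const _), integral_const, hmass, smul_eq_mul,
    mul_inv_cancel_left₀ hP3.ne', sub_self]

lemma dx_eq_pd {φ : ℝ × E3 → ℝ} (hφ : ContDiff ℝ ∞ φ) (j : Fin 3) (t : ℝ) (x : E3) :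
    dx j φ (t, x) = pd j (fun y => φ (t, y)) x := by
  have h1 : HasFDerivAt (fun y : E3 => (t, y)) (ContinuousLinearMap.inr ℝ ℝ E3) x :=
    hasFDerivAt_prodMk_right t x
  have h2 : HasFDerivAt (fun y : E3 => φ (t, y))
      ((fderiv ℝ φ (t, x)).comp (ContinuousLinearMap.inr ℝ ℝ E3)) x :=
    HasFDerivAt.comp (f := fun y : E3 => (t, y)) x
      (hφ.differentiable (by simp) (t, x)).hasFDerivAt h1
  rw [pd, h2.fderiv, dx]
  simp

/-- A function of time alone has no space gradient, so it may be subtracted from a pressure; this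
justifies normalizing to mean zero. -/
lemma integral_slab_time_mul_dx {T P : ℝ} (hP : 0 < P) {c : ℝ → ℝ} (hc : Measurable c)
    (hi : Integrable (fun z : ℝ × E3 => c z.1) (cylMeasure T P)) {φ : ℝ × E3 → ℝ}
    (hφ : IsTest T φ) (j : Fin 3) :
    Integrable (fun z : ℝ × E3 => c z.1 * dx j φ z) (slabMeasure T) ∧
      ∫ z : ℝ × E3, c z.1 * dx j φ z ∂(slabMeasure T) = 0 := by
  have h1 : Integrable (fun z : ℝ × E3 => c z.1 * dx j φ z) (slabMeasure T) :=
    integrable_slab_mul hP (hc.comp measurable_fst) (fun t x i => rfl) hi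
      (hφ.dx j).smooth.continuous (hφ.dx j).compact
  refine ⟨h1, ?_⟩
  rw [slabMeasure_eq_prod] at h1 ⊢
  rw [integral_prod _ h1]
  refine integral_eq_zero_of_ae (Eventually.of_forall fun t => ?_)
  simp only [dx_eq_pd hφ.smooth, integral_const_mul, Pi.zero_apply]
  rw [integral_pd_eq_zero, mul_zero]
  · exact hφ.smooth.comp (contDiff_const.prodMk contDiff_id)
  · refine HasCompactSupport.intro (hφ.compact.isCompact.image continuous_snd) fun x hx => ?_
    refine image_eq_zero_of_notMem_tsupport fun h => hx ⟨(t, x), h, rfl⟩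

lemma IsFlow.meanZero {T P ν : ℝ} (hP : 0 < P) {f : ℝ × E3 → E3} {u₀ : E3 → E3}
    {u : ℝ × E3 → E3} {p : ℝ × E3 → ℝ} (hd : IsFlowData T P f u₀) (h : IsFlow T P ν f u₀ u p) :
    IsFlow T P ν f u₀ u (meanZero P p) where
  vel_meas := h.vel_meas
  vel_per := h.vel_per
  vel_memLp := h.vel_memLp
  pr_meas := measurable_meanZero h.pr_meas
  pr_per := h.pr_per.meanZero
  pr_int := integrable_meanZero h.pr_int
  divFree := h.divFree
  momentum := by
    intro j φ hφ
    have hu := h.vel_meas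
    have hf := hd.force_meas
    obtain ⟨h1, h2⟩ := integral_slab_time_mul_dx hP
      ((measurable_cell_integral (P := P) h.pr_meas).const_mul (P ^ 3)⁻¹) (integrable_mean h.pr_int)
      hφ j
    have i1 := integrable_slab_mul hP (by fun_prop : Measurable fun z => u z j)
      (h.vel_per.coord j) (integrable_coord h.vel_memLp j) hφ.dt.smooth.continuous hφ.dt.compact
    have i2 := integrable_finsetSum Finset.univ fun i _ => integrable_slab_mul hP
      (by fun_prop : Measurable fun z => u z i * u z j)
      (h.vel_per.coord_mul i j) (integrable_coord_mul h.vel_memLp i j)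
      (hφ.dx i).smooth.continuous (hφ.dx i).compact
    have i3 := integrable_slab_mul hP h.pr_meas h.pr_per h.pr_int
      (hφ.dx j).smooth.continuous (hφ.dx j).compact
    have i4 := (integrable_slab_mul hP (by fun_prop : Measurable fun z => u z j)
      (h.vel_per.coord j) (integrable_coord h.vel_memLp j) hφ.lap.smooth.continuous
      hφ.lap.compact).const_mul ν
    have i5 := integrable_slab_mul hP (by fun_prop : Measurable fun z => f z j)
      (hd.force_per.coord j) (integrable_coord hd.force_memLp j) hφ.smooth.continuous hφ.compact
    have ht := h.momentum j φ hφ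
    refine Eq.trans ?_ ht
    congr 1
    rw [← sub_zero (∫ z, (u z j * dt φ z + (∑ i, u z i * u z j * dx i φ z) + p z * dx j φ z
        + ν * (u z j * lap φ z) + f z j * φ z) ∂(slabMeasure T)), ← h2,
      ← integral_sub ((((i1.fun_add i2).fun_add i3).fun_add i4).fun_add i5) h1]
    congr 1
    ext z
    simp only [PassiveScalar.meanZero]
    ring

/-! ### Comparison of the pressures of two flows -/

lemma lintegral_mul_le_eLpNorm {α : Type*} [MeasurableSpace α] {m : Measure α} {g h : α → ℝ}
    (hg : Measurable g) (hh : Measurable h) :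
    ∫⁻ z, ‖g z * h z‖ₑ ∂m ≤ eLpNorm g 2 m * eLpNorm h 2 m := by
  have := eLpNorm_smul_le_mul_eLpNorm (p := 2) (q := 2) (r := 1) (μ := m)
    hh.aestronglyMeasurable hg.aestronglyMeasurable
  rw [eLpNorm_one_eq_lintegral_enorm] at this
  exact this

lemma eLpNorm_translate {T P : ℝ} (hP : 0 < P) {g : ℝ × E3 → ℝ} (hg : Measurable g)
    (hper : PeriodicTX P g) (y : E3) :
    eLpNorm (fun z => g (z.1, z.2 + y)) 2 (cylMeasure T P) = eLpNorm g 2 (cylMeasure T P) := by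
  rw [eLpNorm_eq_lintegral_rpow_enorm_toReal (by simp) (by simp),
    eLpNorm_eq_lintegral_rpow_enorm_toReal (by simp) (by simp)]
  congr 1
  refine lintegral_cyl_add (g := fun z => ‖g z‖ₑ ^ (2 : ℝ≥0∞).toReal) hP (by fun_prop)
    (fun t x i => ?_) y
  have := hper t x i
  simp only at this ⊢
  rw [this]

lemma lintegral_mul_sub_mul_le {α : Type*} [MeasurableSpace α] {m : Measure α} {a b c d : α → ℝ}
    (ha : Measurable a) (hb : Measurable b) (hc : Measurable c) (hd : Measurable d) :
    ∫⁻ z, ‖a z * b z - c z * d z‖ₑ ∂m ≤ eLpNorm (fun z => a z - c z) 2 m * eLpNorm b 2 m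
      + eLpNorm c 2 m * eLpNorm (fun z => b z - d z) 2 m := by
  calc ∫⁻ z, ‖a z * b z - c z * d z‖ₑ ∂m
      ≤ ∫⁻ z, (‖(a z - c z) * b z‖ₑ + ‖c z * (b z - d z)‖ₑ) ∂m := by
        refine lintegral_mono fun z => ?_
        rw [show a z * b z - c z * d z = (a z - c z) * b z + c z * (b z - d z) by ring]
        exact enorm_add_le _ _
    _ = (∫⁻ z, ‖(a z - c z) * b z‖ₑ ∂m) + ∫⁻ z, ‖c z * (b z - d z)‖ₑ ∂m :=
        lintegral_add_left (by fun_prop) _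
    _ ≤ _ := add_le_add (lintegral_mul_le_eLpNorm (ha.sub hc) hb)
        (lintegral_mul_le_eLpNorm hc (hb.sub hd))

lemma pair_sub {P : ℝ} (hP : 0 < P) {g h : ℝ × E3 → ℝ} (hg : Measurable g) (hh : Measurable h)
    (hgp : PeriodicTX P g) (hhp : PeriodicTX P h) {t : ℝ}
    (hgi : Integrable (fun x => g (t, x)) (cellMeasure P))
    (hhi : Integrable (fun x => h (t, x)) (cellMeasure P)) {k : E3 → ℝ} (hc : Continuous k)
    (hs : HasCompactSupport k) :
    pair (fun z => g z - h z) k t = pair g k t - pair h k t := by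
  simp only [pair, sub_mul]
  exact integral_sub (integrable_mul_of_cell hP (by fun_prop : Measurable fun x => g (t, x))
    (hgp t) hgi hc hs) (integrable_mul_of_cell hP (by fun_prop : Measurable fun x => h (t, x))
    (hhp t) hhi hc hs)

lemma pair_lapX {P : ℝ} (hP : 0 < P) {g : ℝ × E3 → ℝ} (hg : Measurable g)
    (hgp : PeriodicTX P g) {t : ℝ} (hgi : Integrable (fun x => g (t, x)) (cellMeasure P))
    {k : E3 → ℝ} (hk : ContDiff ℝ ∞ k) (hs : HasCompactSupport k) :
    pair g (lapX k) t = ∑ b, pair g (pd b (pd b k)) t := by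
  simp only [pair, lapX, Finset.mul_sum]
  exact integral_finsetSum _ fun b _ => integrable_mul_of_cell hP
    (by fun_prop : Measurable fun x => g (t, x)) (hgp t) hgi
    (contDiff_pd (contDiff_pd hk)).continuous (hasCompactSupport_pd (hasCompactSupport_pd hs))

/-- In the difference of the two pressure equations the common force cancels even if the viscosities
differ, and the Poisson estimate applies to the difference of the products. Its translation modulus
has two bounds: one from the moduli of the velocities, summable over scales, and one from their L²
distance, small but the same at every scale. -/
theorem exists_lintegral_pressure_sub_le {P : ℝ} (hP : 0 < P) :
    ∃ C : ℝ≥0∞, C ≠ ⊤ ∧ ∃ R > (0 : ℝ), ∀ (T ν ν' : ℝ) (f : ℝ × E3 → E3) (u₀ : E3 → E3)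
      (u u' : ℝ × E3 → E3) (p p' : ℝ × E3 → ℝ) (A D : ℝ≥0∞) (w : ℕ → ℝ≥0∞),
      IsFlowData T P f u₀ → IsFlow T P ν f u₀ u p → IsFlow T P ν' f u₀ u' p' →
      (∀ᵐ t ∂(volume.restrict (Ioo 0 T)), ∫ x, p (t, x) ∂(cellMeasure P) = 0) →
      (∀ᵐ t ∂(volume.restrict (Ioo 0 T)), ∫ x, p' (t, x) ∂(cellMeasure P) = 0) →
      (∀ j, eLpNorm (fun z => u z j) 2 (cylMeasure T P) ≤ A) →
      (∀ j, eLpNorm (fun z => u' z j) 2 (cylMeasure T P) ≤ A) →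
      (∀ j, eLpNorm (fun z => u z j - u' z j) 2 (cylMeasure T P) ≤ D) →
      (∀ i j y, ‖y‖ ≤ R * (1 / 2) ^ i →
        eLpNorm (fun z => u (z.1, z.2 + y) j - u z j) 2 (cylMeasure T P) ≤ w i) →
      (∀ i j y, ‖y‖ ≤ R * (1 / 2) ^ i →
        eLpNorm (fun z => u' (z.1, z.2 + y) j - u' z j) 2 (cylMeasure T P) ≤ w i) →
      ∫⁻ z, ‖p z - p' z‖ₑ ∂(cylMeasure T P) ≤ C * ∑' i, min (4 * A * w i) (4 * A * D) := by
  obtain ⟨C, hC, R, hR, H⟩ := exists_lintegral_le_of_poisson hP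
  refine ⟨C, hC, R, hR, ?_⟩
  intro T ν ν' f u₀ u u' p p' A D w hd h h' hp0 hp0' hA hA' hD hw hw'
  have hu := h.vel_meas
  have hu' := h'.vel_meas
  have hup := h.vel_per
  have hup' := h'.vel_per
  have hm : ∀ a b, Measurable fun z => u z a * u z b := fun a b => by fun_prop
  have hm' : ∀ a b, Measurable fun z => u' z a * u' z b := fun a b => by fun_prop
  have hi := integrable_coord_mul h.vel_memLp
  have hi' := integrable_coord_mul h'.vel_memLp
  -- Product rule for increments, with Cauchy-Schwarz and the translation invariance of the L² norm:
  -- each of the two factors contributes A times the modulus.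
  have hprod : ∀ (v : ℝ × E3 → E3), Measurable v → PeriodicTX P v →
      (∀ j, eLpNorm (fun z => v z j) 2 (cylMeasure T P) ≤ A) →
      (∀ i j y, ‖y‖ ≤ R * (1 / 2) ^ i →
        eLpNorm (fun z => v (z.1, z.2 + y) j - v z j) 2 (cylMeasure T P) ≤ w i) →
      ∀ i a b y, ‖y‖ ≤ R * (1 / 2) ^ i → ∫⁻ z, ‖v (z.1, z.2 + y) a * v (z.1, z.2 + y) b
        - v z a * v z b‖ₑ ∂(cylMeasure T P) ≤ 2 * A * w i := by
    intro v hv hvp hvA hvw i a b y hy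
    refine (lintegral_mul_sub_mul_le (a := fun z : ℝ × E3 => v (z.1, z.2 + y) a)
      (b := fun z : ℝ × E3 => v (z.1, z.2 + y) b) (c := fun z => v z a) (d := fun z => v z b)
      (by fun_prop) (by fun_prop) (by fun_prop) (by fun_prop)).trans ?_
    rw [eLpNorm_translate (g := fun z => v z b) hP (by fun_prop) (hvp.coord b)]
    calc _ ≤ w i * A + A * w i := by
          gcongr
          · exact hvw i a y hy
          · exact hvA b
          · exact hvA a
          · exact hvw i b y hy
      _ = 2 * A * w i := by ring
  refine H T (fun z => p z - p' z) (fun a b z => u z a * u z b - u' z a * u' z b)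
    (fun i => min (4 * A * w i) (4 * A * D)) (h.pr_meas.sub h'.pr_meas)
    (fun t x i => by
      have h1 := h.pr_per t x i
      have h2 := h'.pr_per t x i
      simp only at h1 h2 ⊢
      rw [h1, h2])
    (h.pr_int.sub h'.pr_int) (fun a b => (hm a b).sub (hm' a b))
    (fun a b t x i => by
      have h1 := hup t x i
      have h2 := hup' t x i
      simp only at h1 h2 ⊢
      rw [h1, h2])
    (fun a b => (hi a b).sub (hi' a b)) ?_ ?_ ?_
  · filter_upwards [hp0, hp0', ae_integrable_section h.pr_int, ae_integrable_section h'.pr_int]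
      with t h1 h2 h3 h4
    rw [integral_sub h3 h4, h1, h2, sub_zero]
  · intro k hk hks
    have hs : ∀ᵐ t ∂(volume.restrict (Ioo 0 T)), ∀ a b,
        Integrable (fun x => u (t, x) a * u (t, x) b) (cellMeasure P) ∧
        Integrable (fun x => u' (t, x) a * u' (t, x) b) (cellMeasure P) :=
      ae_all_iff.2 fun a => ae_all_iff.2 fun b =>
        (ae_integrable_section (hi a b)).and (ae_integrable_section (hi' a b))
    filter_upwards [h.ae_pressure hP hd hk hks, h'.ae_pressure hP hd hk hks, hs,
      ae_integrable_section h.pr_int, ae_integrable_section h'.pr_int] with t h1 h2 h3 h4 h5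
    have hcl := (contDiff_lapX hk).continuous
    rw [pair_sub hP h.pr_meas h'.pr_meas h.pr_per h'.pr_per h4 h5 hcl (hasCompactSupport_lapX hks),
      pair_lapX hP h.pr_meas h.pr_per h4 hk hks, pair_lapX hP h'.pr_meas h'.pr_per h5 hk hks]
    have h6 : ∀ a b, pair (fun z => u z a * u z b - u' z a * u' z b) (pd a (pd b k)) t =
        pair (fun z => u z a * u z b) (pd a (pd b k)) t -
          pair (fun z => u' z a * u' z b) (pd a (pd b k)) t := fun a b =>
      pair_sub hP (hm a b) (hm' a b) (hup.coord_mul a b) (hup'.coord_mul a b) (h3 a b).1 (h3 a b).2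
        (contDiff_pd (contDiff_pd hk)).continuous (hasCompactSupport_pd (hasCompactSupport_pd hks))
    simp only [h6, Finset.sum_sub_distrib]
    linarith
  · intro i a b y hy
    refine le_min ?_ ?_
    · calc _ ≤ ∫⁻ z, (‖u (z.1, z.2 + y) a * u (z.1, z.2 + y) b - u z a * u z b‖ₑ +
            ‖u' (z.1, z.2 + y) a * u' (z.1, z.2 + y) b - u' z a * u' z b‖ₑ) ∂(cylMeasure T P) := by
            refine lintegral_mono fun z => ?_
            rw [sub_sub_sub_comm]
            exact enorm_sub_le
        _ = (∫⁻ z, ‖u (z.1, z.2 + y) a * u (z.1, z.2 + y) b - u z a * u z b‖ₑ ∂(cylMeasure T P)) +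
            ∫⁻ z, ‖u' (z.1, z.2 + y) a * u' (z.1, z.2 + y) b - u' z a * u' z b‖ₑ
              ∂(cylMeasure T P) := lintegral_add_left (by fun_prop) _
        _ ≤ 2 * A * w i + 2 * A * w i :=
            add_le_add (hprod u hu hup hA hw i a b y hy) (hprod u' hu' hup' hA' hw' i a b y hy)
        _ = 4 * A * w i := by ring
    · have hG : ∫⁻ z, ‖u z a * u z b - u' z a * u' z b‖ₑ ∂(cylMeasure T P) ≤ 2 * A * D := by
        refine (lintegral_mul_sub_mul_le (a := fun z => u z a) (b := fun z => u z b)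
          (c := fun z => u' z a) (d := fun z => u' z b) (by fun_prop) (by fun_prop) (by fun_prop)
          (by fun_prop)).trans ?_
        calc _ ≤ D * A + A * D := by
              gcongr
              · exact hD a
              · exact hA b
              · exact hA' a
              · exact hD b
          _ = 2 * A * D := by ring
      have hG' := lintegral_cyl_add (T := T) hP
        (g := fun z => ‖u z a * u z b - u' z a * u' z b‖ₑ) (by fun_prop) (fun t x i => by
          have h1 := hup t x i
          have h2 := hup' t x i
          simp only at h1 h2 ⊢
          rw [h1, h2]) y
      calc _ ≤ ∫⁻ z, (‖u (z.1, z.2 + y) a * u (z.1, z.2 + y) b -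
              u' (z.1, z.2 + y) a * u' (z.1, z.2 + y) b‖ₑ +
            ‖u z a * u z b - u' z a * u' z b‖ₑ) ∂(cylMeasure T P) :=
            lintegral_mono fun z => enorm_sub_le
        _ = (∫⁻ z, ‖u (z.1, z.2 + y) a * u (z.1, z.2 + y) b -
              u' (z.1, z.2 + y) a * u' (z.1, z.2 + y) b‖ₑ ∂(cylMeasure T P)) +
            ∫⁻ z, ‖u z a * u z b - u' z a * u' z b‖ₑ ∂(cylMeasure T P) :=
            lintegral_add_left (by fun_prop) _
        _ ≤ 2 * A * D + 2 * A * D := by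
            rw [hG']
            exact add_le_add hG hG
        _ = 4 * A * D := by ring

/-- The first J terms are bounded by the constant, the rest by the tail of the series. -/
lemma tsum_min_le (w : ℕ → ℝ≥0∞) (b : ℝ≥0∞) (J : ℕ) :
    ∑' i, min (w i) b ≤ J * b + ∑' i, w (i + J) := by
  rw [← ENNReal.summable.sum_add_tsum_nat_add' (f := fun i => min (w i) b) (k := J)]
  refine add_le_add ?_ (ENNReal.tsum_le_tsum fun i => min_le_left _ _)
  calc ∑ i ∈ Finset.range J, min (w i) b ≤ ∑ _i ∈ Finset.range J, b :=
        Finset.sum_le_sum fun i _ => min_le_right _ _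
    _ = J * b := by simp

/-! ### The energy bound -/

/-- Absorption instead of Grönwall: u·f ≤ |u|²/(4T) + T|f|², so integrating the inequality over
(0,T) returns exactly half of the space-time energy Y, which is finite and moves to the left.
Inserting the bound for Y gives the pointwise bound. -/
lemma ae_energy_le_of_ae_le {T P : ℝ} (hT : 0 < T) {f u : ℝ × E3 → E3} {y₀ : ℝ}
    (hu : MemLp u 2 (cylMeasure T P)) (hf : MemLp f 2 (cylMeasure T P))
    (h : ∀ᵐ t ∂(volume.restrict (Ioo 0 T)), ∫ x, ‖u (t, x)‖ ^ 2 ∂(cellMeasure P) ≤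
      y₀ + 2 * ∫ s in (0 : ℝ)..t, ∫ x, inner ℝ (u (s, x)) (f (s, x)) ∂(cellMeasure P)) :
    ∀ᵐ t ∂(volume.restrict (Ioo 0 T)), ∫ x, ‖u (t, x)‖ ^ 2 ∂(cellMeasure P) ≤
      2 * y₀ + 4 * T * ∫ z, ‖f z‖ ^ 2 ∂(cylMeasure T P) := by
  set F := ∫ z, ‖f z‖ ^ 2 ∂(cylMeasure T P) with hF
  set Y := ∫ z, ‖u z‖ ^ 2 ∂(cylMeasure T P) with hY
  have hui : Integrable (fun z => ‖u z‖ ^ 2) (cylMeasure T P) :=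
    hu.integrable_norm_pow (by norm_num)
  have hfi : Integrable (fun z => ‖f z‖ ^ 2) (cylMeasure T P) :=
    hf.integrable_norm_pow (by norm_num)
  have hHi : Integrable (fun z => ‖u z‖ ^ 2 / (4 * T) + T * ‖f z‖ ^ 2) (cylMeasure T P) :=
    (hui.div_const _).add (hfi.const_mul _)
  have hwi : Integrable (fun z => inner ℝ (u z) (f z)) (cylMeasure T P) := integrable_inner hf hu
  have hHint : ∫ z, (‖u z‖ ^ 2 / (4 * T) + T * ‖f z‖ ^ 2) ∂(cylMeasure T P) =
      Y / (4 * T) + T * F := by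
    rw [integral_add (hui.div_const _) (hfi.const_mul _), integral_div, integral_const_mul]
  have hpt : ∀ z, inner ℝ (u z) (f z) ≤ ‖u z‖ ^ 2 / (4 * T) + T * ‖f z‖ ^ 2 := by
    intro z
    have h1 := real_inner_le_norm (u z) (f z)
    have h2 : ‖u z‖ ^ 2 / (4 * T) + T * ‖f z‖ ^ 2 - ‖u z‖ * ‖f z‖ =
        (‖u z‖ - 2 * T * ‖f z‖) ^ 2 / (4 * T) := by field_simp; ring
    have h3 : 0 ≤ (‖u z‖ - 2 * T * ‖f z‖) ^ 2 / (4 * T) := by positivity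
    linarith
  have hg := integrable_cell_integral hwi
  have hh := integrable_cell_integral hHi
  have hbound : ∀ t ∈ Ioo 0 T, ∫ s in (0 : ℝ)..t, ∫ x, inner ℝ (u (s, x)) (f (s, x))
      ∂(cellMeasure P) ≤ Y / (4 * T) + T * F := by
    intro t ht
    rw [intervalIntegral.integral_of_le ht.1.le, ← hHint, integral_cyl_eq hHi]
    have hsub : Ioc 0 t ⊆ Ioo 0 T := fun s hs => ⟨hs.1, hs.2.trans_lt ht.2⟩
    calc ∫ s in Ioc 0 t, ∫ x, inner ℝ (u (s, x)) (f (s, x)) ∂(cellMeasure P)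
        ≤ ∫ s in Ioc 0 t, ∫ x, (‖u (s, x)‖ ^ 2 / (4 * T) + T * ‖f (s, x)‖ ^ 2)
            ∂(cellMeasure P) := by
          refine integral_mono_ae (hg.mono_set hsub) (hh.mono_set hsub)
            (ae_restrict_of_ae_restrict_of_subset hsub ?_)
          filter_upwards [ae_integrable_section hwi, ae_integrable_section hHi] with s h1 h2
          exact integral_mono h1 h2 fun x => hpt _
      _ ≤ _ := setIntegral_mono_set hh (Eventually.of_forall fun s =>
          integral_nonneg fun x => by positivity) hsub.eventuallyLE
  have hae : ∀ᵐ t ∂(volume.restrict (Ioo 0 T)), ∫ x, ‖u (t, x)‖ ^ 2 ∂(cellMeasure P) ≤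
      y₀ + 2 * (Y / (4 * T) + T * F) := by
    filter_upwards [h, ae_restrict_mem measurableSet_Ioo] with t h1 h2
    linarith [hbound t h2]
  have hYle : Y ≤ T * (y₀ + 2 * (Y / (4 * T) + T * F)) := by
    calc Y = ∫ t in Ioo 0 T, ∫ x, ‖u (t, x)‖ ^ 2 ∂(cellMeasure P) := integral_cyl_eq hui
      _ ≤ ∫ _t in Ioo 0 T, (y₀ + 2 * (Y / (4 * T) + T * F)) :=
          integral_mono_ae (integrable_cell_integral hui) (integrable_const _) hae
      _ = _ := by simp [hT.le]
  have hY2 : Y / (4 * T) ≤ y₀ / 2 + T * F := by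
    rw [div_le_iff₀ (by positivity)]
    have : T * (y₀ + 2 * (Y / (4 * T) + T * F)) = T * y₀ + Y / 2 + 2 * T * (T * F) := by
      field_simp
      ring
    nlinarith
  filter_upwards [hae] with t ht
  linarith

/-! ### Weak sequential compactness -/

/-- Sequential Banach-Alaoglu in the dual of a separable space, transported through the Riesz
isometry. -/
lemma exists_weakly_convergent_subseq {H : Type*} [NormedAddCommGroup H] [InnerProductSpace ℝ H]
    [CompleteSpace H] [TopologicalSpace.SeparableSpace H] {x : ℕ → H} {M : ℝ}
    (hx : ∀ n, ‖x n‖ ≤ M) : ∃ σ : ℕ → ℕ, StrictMono σ ∧ ∃ x' : H, ∀ y,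
      Tendsto (fun n => inner ℝ (x (σ n)) y) atTop (𝓝 (inner ℝ x' y)) := by
  have hc := WeakDual.isSeqCompact_closedBall ℝ H (0 : StrongDual ℝ H) M
  obtain ⟨a, -, σ, hσ, ha⟩ := hc (x := fun n => StrongDual.toWeakDual
    (InnerProductSpace.toDual ℝ H (x n))) fun n => by
      rw [mem_preimage, mem_closedBall_zero_iff]
      refine Eq.trans_le ?_ (hx n)
      exact (InnerProductSpace.toDual ℝ H).norm_map (x n)
  refine ⟨σ, hσ, (InnerProductSpace.toDual ℝ H).symm (WeakDual.toStrongDual a), fun y => ?_⟩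
  have := (WeakDual.eval_continuous y).continuousAt.tendsto.comp ha
  rw [InnerProductSpace.toDual_symm_apply]
  exact this

/-! ### Compactness from a bound on the time derivative -/

/-- The difference is the average of v(t) - v(s) over the window, and each increment is an integral
of F inside the window. Times are kept below T - h so that the window stays in the domain. -/
lemma abs_sub_average_le {T h c : ℝ} (hh : 0 < h) {v F : ℝ → ℝ} (hv : IntegrableOn v (Ioo 0 T))
    (hF : IntegrableOn F (Ioo 0 T))
    (hvF : ∀ᵐ t ∂(volume.restrict (Ioo 0 T)), v t = c + ∫ s in (0 : ℝ)..t, F s) :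
    ∀ᵐ t ∂(volume.restrict (Ioo 0 (T - h))),
      |v t - h⁻¹ * ∫ s in Ioo t (t + h), v s| ≤ ∫ s in Ioo t (t + h), |F s| := by
  have hsub : Ioo 0 (T - h) ⊆ Ioo 0 T := Ioo_subset_Ioo_right (by linarith)
  filter_upwards [ae_restrict_of_ae_restrict_of_subset hsub hvF,
    ae_restrict_mem measurableSet_Ioo] with t ht htm
  have hsub2 : Ioo t (t + h) ⊆ Ioo 0 T := Ioo_subset_Ioo htm.1.le (by linarith [htm.2])
  have hvi := hv.mono_set hsub2
  have hFi := hF.mono_set hsub2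
  have hvol : (volume.restrict (Ioo t (t + h))).real univ = h := by simp [hh.le]
  have h1 : v t - h⁻¹ * ∫ s in Ioo t (t + h), v s = h⁻¹ * ∫ s in Ioo t (t + h), (v t - v s) := by
    rw [integral_sub (integrable_const _) hvi, integral_const, hvol, smul_eq_mul, mul_sub,
      inv_mul_cancel_left₀ hh.ne']
  rw [h1, abs_mul, abs_of_pos (inv_pos.2 hh), inv_mul_le_iff₀ hh]
  have h2 : ∀ᵐ s ∂(volume.restrict (Ioo t (t + h))),
      ‖v t - v s‖ ≤ ∫ s in Ioo t (t + h), |F s| := by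
    filter_upwards [ae_restrict_of_ae_restrict_of_subset hsub2 hvF,
      ae_restrict_mem measurableSet_Ioo] with s hs hsm
    have hFint : ∀ r ∈ Ioo 0 T, IntervalIntegrable F volume 0 r := fun r hr => by
      rw [intervalIntegrable_iff_integrableOn_Ioc_of_le hr.1.le]
      exact hF.mono_set fun q hq => ⟨hq.1, hq.2.trans_lt hr.2⟩
    rw [hs, ht, add_sub_add_left_eq_sub, norm_sub_rev,
      intervalIntegral.integral_interval_sub_left (hFint s (hsub2 hsm)) (hFint t (hsub htm)),
      intervalIntegral.integral_of_le hsm.1.le]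
    refine (norm_integral_le_integral_norm _).trans ?_
    have hsub3 : Ioc t s ⊆ Ioo t (t + h) := fun q hq => ⟨hq.1, hq.2.trans_lt hsm.2⟩
    exact setIntegral_mono_set hFi.norm (Eventually.of_forall fun _ => abs_nonneg _)
      hsub3.eventuallyLE
  have h3 := norm_integral_le_of_norm_le_const h2
  rw [hvol, mul_comm] at h3
  exact h3

/-- By Tonelli, each s is counted by the times t in (s - h, s), a set of length h. -/
lemma lintegral_lintegral_window_le {T h : ℝ} {F : ℝ → ℝ≥0∞} (hF : Measurable F) :
    ∫⁻ t in Ioo 0 (T - h), ∫⁻ s in Ioo t (t + h), F s ≤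
      ENNReal.ofReal h * ∫⁻ s in Ioo 0 T, F s := by
  have h1 : ∀ t ∈ Ioo 0 (T - h), ∫⁻ s in Ioo t (t + h), F s =
      ∫⁻ s in Ioo 0 T, {q : ℝ × ℝ | q.1 < q.2 ∧ q.2 < q.1 + h}.indicator (fun q => F q.2) (t, s) := by
    intro t ht
    have hsub2 : Ioo t (t + h) ⊆ Ioo 0 T := Ioo_subset_Ioo ht.1.le (by linarith [ht.2])
    rw [← lintegral_indicator measurableSet_Ioo, ← lintegral_indicator measurableSet_Ioo]
    refine lintegral_congr fun s => ?_
    by_cases hs : s ∈ Ioo t (t + h)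
    · rw [indicator_of_mem hs, indicator_of_mem (hsub2 hs), indicator_of_mem]
      exact hs
    · rw [indicator_of_notMem hs]
      by_cases hs2 : s ∈ Ioo 0 T
      · rw [indicator_of_mem hs2, indicator_of_notMem]
        exact hs
      · rw [indicator_of_notMem hs2]
  have hms : MeasurableSet {q : ℝ × ℝ | q.1 < q.2 ∧ q.2 < q.1 + h} :=
    (measurableSet_lt measurable_fst measurable_snd).inter
      (measurableSet_lt measurable_snd (measurable_fst.add_const h))
  rw [setLIntegral_congr_fun measurableSet_Ioo h1,
    lintegral_lintegral_swap (f := fun t s => {q : ℝ × ℝ | q.1 < q.2 ∧ q.2 < q.1 + h}.indicator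
      (fun q => F q.2) (t, s)) ((hF.comp measurable_snd).indicator hms).aemeasurable,
    ← lintegral_const_mul _ hF]
  refine lintegral_mono fun s => ?_
  calc ∫⁻ t in Ioo 0 (T - h), {q : ℝ × ℝ | q.1 < q.2 ∧ q.2 < q.1 + h}.indicator
          (fun q => F q.2) (t, s)
      ≤ ∫⁻ t, {q : ℝ × ℝ | q.1 < q.2 ∧ q.2 < q.1 + h}.indicator (fun q => F q.2) (t, s) :=
        setLIntegral_le_lintegral _ _
    _ ≤ ∫⁻ t, (Ioo (s - h) s).indicator (fun _ => F s) t := by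
        refine lintegral_mono fun t => ?_
        by_cases hs : t ∈ Ioo (s - h) s
        · rw [indicator_of_mem hs]
          exact indicator_le_self _ _ _
        · rw [indicator_of_notMem (s := {q : ℝ × ℝ | q.1 < q.2 ∧ q.2 < q.1 + h})]
          · exact zero_le
          · rintro ⟨h1, h2⟩
            exact hs ⟨by simp only at h2; linarith, h1⟩
    _ = ENNReal.ofReal h * F s := by
        rw [lintegral_indicator_const measurableSet_Ioo, Real.volume_Ioo, mul_comm]
        congr 2; ring

/-- The running average over a time window of length `h`. -/
def timeAvg (h : ℝ) (v : ℝ × E3 → ℝ) (z : ℝ × E3) : ℝ := h⁻¹ * ∫ s in Ioo z.1 (z.1 + h), v (s, z.2)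

lemma measurable_timeAvg {h : ℝ} (hh : 0 < h) {v : ℝ × E3 → ℝ} (hv : Measurable v) :
    Measurable (timeAvg h v) := by
  have h1 : timeAvg h v = fun z => h⁻¹ * ∫ r in Ioo 0 h, v (z.1 + r, z.2) := by
    ext z
    rw [timeAvg, ← integral_Ioc_eq_integral_Ioo, ← intervalIntegral.integral_of_le (by linarith),
      ← integral_Ioc_eq_integral_Ioo, ← intervalIntegral.integral_of_le hh.le,
      intervalIntegral.integral_comp_add_left (fun s => v (s, z.2)), add_zero]
  rw [h1]
  have h2 : Measurable fun q : (ℝ × E3) × ℝ => v (q.1.1 + q.2, q.1.2) := by fun_prop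
  exact measurable_const.mul (h2.stronglyMeasurable.integral_prod_right').measurable

lemma lintegral_sub_timeAvg_le {T P h : ℝ} (hh : 0 < h) {v S : ℝ × E3 → ℝ} (hv : Measurable v)
    (hS : Measurable S)
    (hvF : ∀ᵐ x ∂(cellMeasure P), IntegrableOn (fun t => v (t, x)) (Ioo 0 T) ∧
      IntegrableOn (fun t => S (t, x)) (Ioo 0 T) ∧ ∃ c : ℝ,
        ∀ᵐ t ∂(volume.restrict (Ioo 0 T)), v (t, x) = c + ∫ s in (0 : ℝ)..t, S (s, x)) :
    ∫⁻ z, ‖v z - timeAvg h v z‖ₑ ∂(cylMeasure (T - h) P) ≤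
      ENNReal.ofReal h * ∫⁻ z, ‖S z‖ₑ ∂(cylMeasure T P) := by
  have hma := measurable_timeAvg hh hv
  rw [cylMeasure_eq_prod, cylMeasure_eq_prod, lintegral_prod_symm _ (by fun_prop),
    lintegral_prod_symm _ (by fun_prop), ← lintegral_const_mul _ (by fun_prop)]
  refine lintegral_mono_ae (hvF.mono fun x hx => ?_)
  obtain ⟨h1, h2, c, h3⟩ := hx
  refine le_trans ?_ (lintegral_lintegral_window_le (F := fun s => ‖S (s, x)‖ₑ) (by fun_prop))
  refine lintegral_mono_ae ?_
  filter_upwards [abs_sub_average_le hh h1 h2 h3, ae_restrict_mem measurableSet_Ioo] with t ht htm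
  have hsub2 : Ioo t (t + h) ⊆ Ioo 0 T := Ioo_subset_Ioo htm.1.le (by linarith [htm.2])
  rw [← ofReal_integral_norm_eq_lintegral_enorm (h2.mono_set hsub2), ← ofReal_norm]
  exact ENNReal.ofReal_le_ofReal ht

/-- Functions with bounded time derivative whose time averages converge form a Cauchy sequence. -/
theorem exists_lintegral_sub_sq_le_of_timeDeriv {T P : ℝ} (hT : 0 < T) (hP : 0 < P)
    {v S : ℕ → ℝ × E3 → ℝ} (hv : ∀ n, Measurable (v n)) (hS : ∀ n, Measurable (S n)) {V B : ℝ}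
    (hV0 : 0 ≤ V) (hB0 : 0 ≤ B) (hV : ∀ n, ∀ᵐ z ∂(cylMeasure T P), ‖v n z‖ ≤ V)
    (hvF : ∀ n, ∀ᵐ x ∂(cellMeasure P), IntegrableOn (fun t => v n (t, x)) (Ioo 0 T) ∧
      IntegrableOn (fun t => S n (t, x)) (Ioo 0 T) ∧ ∃ c : ℝ,
        ∀ᵐ t ∂(volume.restrict (Ioo 0 T)), v n (t, x) = c + ∫ s in (0 : ℝ)..t, S n (s, x))
    (hB : ∀ n, ∫⁻ z, ‖S n z‖ₑ ∂(cylMeasure T P) ≤ ENNReal.ofReal B)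
    (hlim : ∀ a b, 0 ≤ a → b ≤ T → ∀ x ∈ cell P, ∃ ℓ,
      Tendsto (fun n => ∫ s in Ioo a b, v n (s, x)) atTop (𝓝 ℓ)) {δ : ℝ} (hδ : 0 < δ) :
    ∃ N, ∀ n ≥ N, ∀ m ≥ N, ∫⁻ z, ‖v n z - v m z‖ₑ ^ 2 ∂(cylMeasure T P) ≤ ENNReal.ofReal δ := by
  -- The final error is hK + 2Vη. The first part of K comes from the two comparisons with window
  -- averages, the second from the last time strip of length h where no window fits; h and η are
  -- chosen to make each contribution at most δ/2.
  set K : ℝ := 2 * V * (2 * B) + 4 * V ^ 2 * P ^ 3 with hK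
  have hK0 : 0 ≤ K := by positivity
  set h : ℝ := min (T / 2) (δ / (2 * (K + 1))) with hhdef
  have hh : 0 < h := lt_min (by linarith) (by positivity)
  have hhT : h < T := (min_le_left _ _).trans_lt (by linarith)
  have hhK : h * K ≤ δ / 2 := by
    have h1 : h ≤ δ / (2 * (K + 1)) := min_le_right _ _
    calc h * K ≤ δ / (2 * (K + 1)) * (K + 1) := by gcongr; linarith
      _ = δ / 2 := by field_simp
  set η : ℝ := δ / (4 * V + 1) with hη
  have hη0 : 0 < η := by positivity
  have hηV : 2 * V * η ≤ δ / 2 := by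
    rw [hη, mul_div_assoc', div_le_div_iff₀ (by positivity) (by norm_num)]
    nlinarith
  have hle : cylMeasure (T - h) P ≤ cylMeasure T P :=
    Measure.restrict_mono (prod_mono_left (Ioo_subset_Ioo_right (by linarith))) le_rfl
  set a : ℕ → ℝ × E3 → ℝ := fun n => timeAvg h (v n) with ha
  have hma : ∀ n, Measurable (a n) := fun n => measurable_timeAvg hh (hv n)
  have hL : ∀ z : ℝ × E3, ∃ ℓ, z ∈ Ioo 0 (T - h) ×ˢ cell P →
      Tendsto (fun n => a n z) atTop (𝓝 ℓ) := by
    intro z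
    by_cases hz : z ∈ Ioo 0 (T - h) ×ˢ cell P
    · obtain ⟨ℓ, hℓ⟩ := hlim z.1 (z.1 + h) hz.1.1.le (by linarith [hz.1.2]) z.2 hz.2
      exact ⟨h⁻¹ * ℓ, fun _ => hℓ.const_mul _⟩
    · exact ⟨0, fun h => absurd h hz⟩
  choose L hL using hL
  have hae : ∀ᵐ z ∂(cylMeasure (T - h) P), Tendsto (fun n => a n z) atTop (𝓝 (L z)) :=
    ae_restrict_of_forall_mem (measurableSet_Ioo.prod (measurableSet_cell P)) hL
  -- A uniform bound on the averages upgrades their pointwise convergence to L¹ convergence by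
  -- dominated convergence.
  have haV : ∀ n, ∀ᵐ z ∂(cylMeasure (T - h) P), ‖a n z‖ ≤ V := by
    intro n
    have hms : MeasurableSet {z : ℝ × E3 | ‖a n z‖ ≤ V} :=
      measurableSet_le (hma n).norm measurable_const
    have h1 := hV n
    have hms1 : MeasurableSet {z : ℝ × E3 | ‖v n z‖ ≤ V} :=
      measurableSet_le (hv n).norm measurable_const
    rw [cylMeasure_eq_prod, Measure.ae_prod_iff_ae_ae hms1, Measure.ae_ae_comm hms1] at h1
    rw [cylMeasure_eq_prod, Measure.ae_prod_iff_ae_ae hms, Measure.ae_ae_comm hms]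
    filter_upwards [h1] with x hx
    filter_upwards [ae_restrict_mem measurableSet_Ioo] with t ht
    have hsub2 : Ioo t (t + h) ⊆ Ioo 0 T := Ioo_subset_Ioo ht.1.le (by linarith [ht.2])
    have h2 := norm_integral_le_of_norm_le_const (ae_restrict_of_ae_restrict_of_subset hsub2 hx)
    have hvol : (volume.restrict (Ioo t (t + h))).real univ = h := by simp [hh.le]
    rw [hvol] at h2
    simp only [ha, timeAvg]
    rw [norm_mul, norm_inv, Real.norm_of_nonneg hh.le, inv_mul_le_iff₀ hh, mul_comm h]
    exact h2
  have hconv := tendsto_lintegral_norm_of_dominated_convergence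
    (fun n => (hma n).aestronglyMeasurable (μ := cylMeasure (T - h) P))
    (integrable_const V).hasFiniteIntegral haV hae
  have hLm : AEStronglyMeasurable L (cylMeasure (T - h) P) :=
    aestronglyMeasurable_of_tendsto_ae atTop (fun n => (hma n).aestronglyMeasurable) hae
  simp only [ofReal_norm] at hconv
  have hev : ∀ᶠ n in atTop, ∫⁻ z, ‖a n z - L z‖ₑ ∂(cylMeasure (T - h) P) ≤
      ENNReal.ofReal (η / 2) :=
    (hconv.eventually (gt_mem_nhds (ENNReal.ofReal_pos.2 (half_pos hη0)))).mono fun n hn => hn.le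
  obtain ⟨N, hN⟩ := eventually_atTop.1 hev
  refine ⟨N, fun n hn m hm => ?_⟩
  have hvn := hv n
  have hvm := hv m
  have hSn : ∀ n, ∫⁻ z, ‖v n z - a n z‖ₑ ∂(cylMeasure (T - h) P) ≤ ENNReal.ofReal (h * B) :=
    fun n => (lintegral_sub_timeAvg_le hh (hv n) (hS n) (hvF n)).trans (by
      rw [ENNReal.ofReal_mul hh.le]
      gcongr
      exact hB n)
  have haa : ∫⁻ z, ‖a n z - a m z‖ₑ ∂(cylMeasure (T - h) P) ≤ ENNReal.ofReal η := by
    calc ∫⁻ z, ‖a n z - a m z‖ₑ ∂(cylMeasure (T - h) P)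
        ≤ ∫⁻ z, (‖a n z - L z‖ₑ + ‖a m z - L z‖ₑ) ∂(cylMeasure (T - h) P) := by
          refine lintegral_mono fun z => ?_
          rw [← sub_sub_sub_cancel_right (a n z) (a m z) (L z)]
          exact enorm_sub_le
      _ = (∫⁻ z, ‖a n z - L z‖ₑ ∂(cylMeasure (T - h) P)) +
          ∫⁻ z, ‖a m z - L z‖ₑ ∂(cylMeasure (T - h) P) :=
          lintegral_add_left' ((hma n).aestronglyMeasurable.sub hLm).enorm _
      _ ≤ ENNReal.ofReal (η / 2) + ENNReal.ofReal (η / 2) := add_le_add (hN n hn) (hN m hm)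
      _ = ENNReal.ofReal η := by
          rw [← ENNReal.ofReal_add (by positivity) (by positivity), add_halves]
  have hmn := hma n
  have hmm := hma m
  have h1 : ∫⁻ z, ‖v n z - v m z‖ₑ ∂(cylMeasure (T - h) P) ≤
      ENNReal.ofReal (h * B + η + h * B) := by
    calc ∫⁻ z, ‖v n z - v m z‖ₑ ∂(cylMeasure (T - h) P)
        ≤ ∫⁻ z, (‖v n z - a n z‖ₑ + ‖a n z - a m z‖ₑ + ‖v m z - a m z‖ₑ)
            ∂(cylMeasure (T - h) P) := by
          refine lintegral_mono fun z => ?_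
          rw [show v n z - v m z = (v n z - a n z) + (a n z - a m z) - (v m z - a m z) by ring]
          exact enorm_sub_le.trans (add_le_add_left (enorm_add_le _ _) _)
      _ = (∫⁻ z, ‖v n z - a n z‖ₑ ∂(cylMeasure (T - h) P)) +
          (∫⁻ z, ‖a n z - a m z‖ₑ ∂(cylMeasure (T - h) P)) +
          ∫⁻ z, ‖v m z - a m z‖ₑ ∂(cylMeasure (T - h) P) := by
          rw [lintegral_add_left (by fun_prop), lintegral_add_left (by fun_prop)]
      _ ≤ ENNReal.ofReal (h * B) + ENNReal.ofReal η + ENNReal.ofReal (h * B) :=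
          add_le_add (add_le_add (hSn n) haa) (hSn m)
      _ = _ := by
          rw [← ENNReal.ofReal_add (by positivity) (by positivity),
            ← ENNReal.ofReal_add (by positivity) (by positivity)]
  -- The uniform bound converts the L¹ estimate into an L² one at the price of the factor 2V.
  have hV2 : ∀ᵐ z ∂(cylMeasure T P), ‖v n z - v m z‖ₑ ≤ ENNReal.ofReal (2 * V) := by
    filter_upwards [hV n, hV m] with z h1 h2
    rw [← ofReal_norm]
    exact ENNReal.ofReal_le_ofReal ((norm_sub_le _ _).trans (by linarith))
  have hcov : Ioo 0 T ×ˢ cell P ⊆ (Ioo 0 (T - h) ×ˢ cell P) ∪ (Ico (T - h) T ×ˢ cell P) := by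
    rintro ⟨t, x⟩ ⟨ht, hx⟩
    rcases lt_or_ge t (T - h) with hc | hc
    · exact Or.inl ⟨⟨ht.1, hc⟩, hx⟩
    · exact Or.inr ⟨⟨hc, ht.2⟩, hx⟩
  calc ∫⁻ z, ‖v n z - v m z‖ₑ ^ 2 ∂(cylMeasure T P)
      ≤ ∫⁻ z, ENNReal.ofReal (2 * V) * ‖v n z - v m z‖ₑ ∂(cylMeasure T P) :=
        lintegral_mono_ae (hV2.mono fun z hz => by rw [sq]; gcongr)
    _ = ENNReal.ofReal (2 * V) * ∫⁻ z, ‖v n z - v m z‖ₑ ∂(cylMeasure T P) :=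
        lintegral_const_mul _ (by fun_prop)
    _ ≤ ENNReal.ofReal (2 * V) * (ENNReal.ofReal (h * B + η + h * B) +
          ENNReal.ofReal (2 * V * (h * P ^ 3))) := by
        gcongr
        refine (lintegral_mono_set hcov).trans ((lintegral_union_le _ _ _).trans
          (add_le_add h1 ?_))
        have hsub : Ico (T - h) T ×ˢ cell P ⊆ Ioo 0 T ×ˢ cell P :=
          prod_mono_left fun t ht => ⟨by linarith [ht.1], ht.2⟩
        calc ∫⁻ z in Ico (T - h) T ×ˢ cell P, ‖v n z - v m z‖ₑ
            ≤ ∫⁻ _z in Ico (T - h) T ×ˢ cell P, ENNReal.ofReal (2 * V) :=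
              lintegral_mono_ae (ae_restrict_of_ae_restrict_of_subset hsub hV2)
          _ = ENNReal.ofReal (2 * V * (h * P ^ 3)) := by
              rw [setLIntegral_const, Measure.volume_eq_prod, Measure.prod_prod, Real.volume_Ico,
                volume_cell hP, ← ENNReal.ofReal_mul (by linarith),
                ← ENNReal.ofReal_mul (by positivity)]
              congr 3; ring
    _ ≤ ENNReal.ofReal δ := by
        rw [← ENNReal.ofReal_add (by positivity) (by positivity),
          ← ENNReal.ofReal_mul (by positivity)]
        refine ENNReal.ofReal_le_ofReal ?_
        have : 2 * V * (h * B + η + h * B + 2 * V * (h * P ^ 3)) = h * K + 2 * V * η := by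
          rw [hK]; ring
        linarith

/-! ### Mollification in space -/

lemma exists_mollifier : ∃ ρ : E3 → ℝ, ContDiff ℝ ∞ ρ ∧ (∀ y, 1 < ‖y‖ → ρ y = 0) ∧
    (∀ y, 0 ≤ ρ y) ∧ ∫ y, ρ y = 1 := by
  let b : ContDiffBump (0 : E3) := ⟨1 / 2, 1, by norm_num, by norm_num⟩
  refine ⟨b.normed volume, b.contDiff_normed, fun y hy => ?_, b.nonneg_normed, b.integral_normed⟩
  have h1 : y ∉ Function.support (b.normed volume) := by
    rw [b.support_normed_eq]
    simpa [b] using hy.le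
  simpa using h1

lemma sq_lintegral_mul_le {α : Type*} [MeasurableSpace α] {m : Measure α} {a b : α → ℝ≥0∞}
    (ha : Measurable a) (hb : Measurable b) :
    (∫⁻ y, a y * b y ∂m) ^ 2 ≤ (∫⁻ y, a y ^ 2 ∂m) * ∫⁻ y, b y ^ 2 ∂m := by
  have h := ENNReal.lintegral_mul_le_Lp_mul_Lq m Real.HolderConjugate.two_two ha.aemeasurable
    hb.aemeasurable
  have h2 := pow_le_pow_left' h 2
  have hh : ∀ x : ℝ≥0∞, (x ^ (1 / 2 : ℝ)) ^ 2 = x := fun x => by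
    rw [← ENNReal.rpow_natCast, ← ENNReal.rpow_mul]; norm_num
  rw [mul_pow, hh, hh] at h2
  simpa using h2

/-- Cauchy-Schwarz against the constant 1 for the measure of density κ. -/
lemma sq_lintegral_mul_le_of_weight {α : Type*} [MeasurableSpace α] {m : Measure α}
    {a κ : α → ℝ≥0∞} (ha : Measurable a) (hκ : Measurable κ) :
    (∫⁻ y, a y * κ y ∂m) ^ 2 ≤ (∫⁻ y, a y ^ 2 * κ y ∂m) * ∫⁻ y, κ y ∂m := by
  have h := sq_lintegral_mul_le (m := m.withDensity κ) ha measurable_const (b := fun _ => 1)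
  rw [lintegral_withDensity_eq_lintegral_mul _ hκ (by fun_prop),
    lintegral_withDensity_eq_lintegral_mul _ hκ (by fun_prop),
    lintegral_withDensity_eq_lintegral_mul _ hκ (by fun_prop)] at h
  simpa [mul_comm] using h

lemma lintegral_enorm_eq_one {k : E3 → ℝ} (hc : Continuous k) (hs : HasCompactSupport k)
    (h0 : ∀ y, 0 ≤ k y) (h1 : ∫ y, k y = 1) : ∫⁻ y, ‖k y‖ₑ = 1 := by
  rw [← ofReal_integral_norm_eq_lintegral_enorm (hc.integrable_of_hasCompactSupport hs)]
  simp [Real.norm_of_nonneg (h0 _), h1]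

lemma scl_nonneg {ε : ℝ} (hε : 0 < ε) {k : E3 → ℝ} (h0 : ∀ y, 0 ≤ k y) (y : E3) :
    0 ≤ scl ε k y := mul_nonneg (by positivity) (h0 _)

/-- Since k is a probability density, Jensen bounds the squared mollification error by the average
of the squared increments over shifts in the support of k. -/
lemma lintegral_conv_sub_sq_le {T P : ℝ} (hP : 0 < P) {g : ℝ × E3 → ℝ} (hg : Measurable g)
    (hper : PeriodicTX P g) (hi : Integrable g (cylMeasure T P)) {k : E3 → ℝ}
    (hc : Continuous k) {r : ℝ} (hr : ∀ y, r < ‖y‖ → k y = 0) (h0 : ∀ y, 0 ≤ k y)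
    (h1 : ∫ y, k y = 1) {W : ℝ≥0∞}
    (hW : ∀ y, ‖y‖ ≤ r → ∫⁻ z, ‖g (z.1, z.2 + y) - g z‖ₑ ^ 2 ∂(cylMeasure T P) ≤ W) :
    ∫⁻ z, ‖conv g k z - g z‖ₑ ^ 2 ∂(cylMeasure T P) ≤ W := by
  have hs := hasCompactSupport_of_norm hr
  have hkm := hc.measurable
  have hk1 := lintegral_enorm_eq_one hc hs h0 h1
  have hpt : ∀ᵐ z ∂(cylMeasure T P), ‖conv g k z - g z‖ₑ ^ 2 ≤
      ∫⁻ y, ‖g (z.1, z.2 - y) - g z‖ₑ ^ 2 * ‖k y‖ₑ := by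
    filter_upwards [ae_integrable_conv_integrand hP hg hper hi hc hs] with z hz
    have h2 : conv g k z - g z = ∫ y, (g (z.1, z.2 - y) - g z) * k y := by
      simp only [sub_mul]
      rw [integral_sub hz ((hc.integrable_of_hasCompactSupport hs).const_mul _),
        integral_const_mul, h1, mul_one, conv]
    calc ‖conv g k z - g z‖ₑ ^ 2
        ≤ (∫⁻ y, ‖g (z.1, z.2 - y) - g z‖ₑ * ‖k y‖ₑ) ^ 2 := by
          gcongr
          rw [h2]
          simpa only [enorm_mul] using enorm_integral_le_lintegral_enorm
            (fun y => (g (z.1, z.2 - y) - g z) * k y)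
      _ ≤ _ := by
          have := sq_lintegral_mul_le_of_weight (m := (volume : Measure E3))
            (a := fun y => ‖g (z.1, z.2 - y) - g z‖ₑ) (κ := fun y => ‖k y‖ₑ) (by fun_prop)
            (by fun_prop)
          rwa [hk1, mul_one] at this
  calc ∫⁻ z, ‖conv g k z - g z‖ₑ ^ 2 ∂(cylMeasure T P)
      ≤ ∫⁻ z, ∫⁻ y, ‖g (z.1, z.2 - y) - g z‖ₑ ^ 2 * ‖k y‖ₑ ∂volume ∂(cylMeasure T P) :=
        lintegral_mono_ae hpt
    _ = ∫⁻ y, ∫⁻ z, ‖g (z.1, z.2 - y) - g z‖ₑ ^ 2 * ‖k y‖ₑ ∂(cylMeasure T P) :=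
        lintegral_lintegral_swap (Measurable.aemeasurable (by fun_prop))
    _ ≤ ∫⁻ y, W * ‖k y‖ₑ := by
        refine lintegral_mono fun y => ?_
        rw [lintegral_mul_const _ (by fun_prop)]
        rcases le_or_gt ‖y‖ r with hy | hy
        · gcongr
          simpa [sub_eq_add_neg] using hW (-y) (by simpa using hy)
        · simp [hr y hy]
    _ = W := by rw [lintegral_const_mul _ (by fun_prop), hk1, mul_one]

lemma lintegral_cell_sub_left {P : ℝ} (hP : 0 < P) {g : E3 → ℝ≥0∞} (hg : Measurable g)
    (hper : PeriodicX P g) (x : E3) :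
    ∫⁻ y, g (x - y) ∂(cellMeasure P) = ∫⁻ y, g y ∂(cellMeasure P) := by
  have h1 := (measurePreserving_neg_cell P).lintegral_comp
    (by fun_prop : Measurable fun y => g (y + x))
  simp only [neg_add_eq_sub] at h1
  rw [h1, lintegral_cell_add hP hper x]

/-- Pointwise bound for the mollification of a periodic square-integrable function. -/
lemma exists_sq_conv_le {P : ℝ} (hP : 0 < P) {ρ : E3 → ℝ} (hc : Continuous ρ)
    (hr : ∀ y, 1 < ‖y‖ → ρ y = 0) (h0 : ∀ y, 0 ≤ ρ y) (h1 : ∫ y, ρ y = 1) :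
    ∃ K : ℝ, 0 ≤ K ∧ ∀ (ε M t : ℝ) (g : ℝ × E3 → ℝ), 0 < ε → ε ≤ 1 → 0 ≤ M → Measurable g →
      PeriodicTX P g → ∫⁻ x, ‖g (t, x)‖ₑ ^ 2 ∂(cellMeasure P) ≤ ENNReal.ofReal M →
      ∀ x, ‖conv g (scl ε ρ) (t, x)‖ ^ 2 ≤ K * M / ε ^ 3 := by
  have hs := hasCompactSupport_of_norm hr
  obtain ⟨S, hS⟩ := hs.exists_bound_of_continuous hc
  have hS0 : 0 ≤ S := (norm_nonneg _).trans (hS 0)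
  obtain ⟨C, hC, hCg⟩ := exists_setLIntegral_le_cell hP
    (Metric.isBounded_closedBall (x := (0 : E3)) (r := 1))
  refine ⟨S * C.toReal, by positivity, fun ε M t g hε hε1 hM hg hper hgM x => ?_⟩
  have hkc : Continuous (scl ε ρ) := by unfold scl; fun_prop
  have hkm := hkc.measurable
  have hk1 : ∫⁻ y, ‖scl ε ρ y‖ₑ = 1 := by
    rw [lintegral_scl hε hc hs, lintegral_enorm_eq_one hc hs h0 h1]
  have hper2 : PeriodicX P fun y => ‖g (t, y)‖ₑ ^ 2 := fun y i => by
    have := hper t y i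
    simp only at this ⊢
    rw [this]
  have key : ‖conv g (scl ε ρ) (t, x)‖ₑ ^ 2 ≤ ENNReal.ofReal (S * C.toReal * M / ε ^ 3) := by
    calc ‖conv g (scl ε ρ) (t, x)‖ₑ ^ 2
        ≤ (∫⁻ y, ‖g (t, x - y)‖ₑ * ‖scl ε ρ y‖ₑ) ^ 2 := by
          gcongr
          simpa only [enorm_mul, conv] using enorm_integral_le_lintegral_enorm
            (fun y => g (t, x - y) * scl ε ρ y)
      _ ≤ ∫⁻ y, ‖g (t, x - y)‖ₑ ^ 2 * ‖scl ε ρ y‖ₑ := by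
          have := sq_lintegral_mul_le_of_weight (m := (volume : Measure E3))
            (a := fun y => ‖g (t, x - y)‖ₑ) (κ := fun y => ‖scl ε ρ y‖ₑ) (by fun_prop)
            (by fun_prop)
          rwa [hk1, mul_one] at this
      _ ≤ ∫⁻ y, (Metric.closedBall (0 : E3) 1).indicator
            (fun y => ENNReal.ofReal (S / ε ^ 3) * ‖g (t, x - y)‖ₑ ^ 2) y := by
          refine lintegral_mono fun y => ?_
          rcases le_or_gt ‖y‖ 1 with hy | hy
          · rw [indicator_of_mem (by simpa using hy), mul_comm]
            gcongr
            rw [← ofReal_norm]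
            refine ENNReal.ofReal_le_ofReal ?_
            rw [scl, norm_mul, norm_inv, Real.norm_of_nonneg (by positivity), inv_mul_eq_div]
            gcongr
            -- The supremum of the rescaled kernel is at most S/ε³, and ε ≤ 1 keeps its support in
            -- the unit ball; hence the loss ε⁻³ in the squared bound.
            exact hS _
          · rw [scl_eq_zero hε hr y (by linarith)]
            simp
      _ = ENNReal.ofReal (S / ε ^ 3) * ∫⁻ y in Metric.closedBall (0 : E3) 1,
            ‖g (t, x - y)‖ₑ ^ 2 := by
          rw [lintegral_indicator Metric.isClosed_closedBall.measurableSet,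
            lintegral_const_mul _ (by fun_prop)]
      _ ≤ ENNReal.ofReal (S / ε ^ 3) * (C * ENNReal.ofReal M) := by
          gcongr
          refine (hCg _ (by fun_prop) (periodicX_sub_left hper2 x)).trans ?_
          rw [lintegral_cell_sub_left hP (g := fun y => ‖g (t, y)‖ₑ ^ 2) (by fun_prop) hper2 x]
          gcongr
      _ = ENNReal.ofReal (S * C.toReal * M / ε ^ 3) := by
          rw [← ENNReal.ofReal_toReal hC, ← ENNReal.ofReal_mul (by positivity),
            ← ENNReal.ofReal_mul (by positivity), ENNReal.toReal_ofReal (by positivity)]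
          congr 1; ring
  rw [← ofReal_norm, ← ENNReal.ofReal_pow (norm_nonneg _)] at key
  exact (ENNReal.ofReal_le_ofReal_iff (by positivity)).1 key

lemma pair_neg (g : ℝ × E3 → ℝ) (k : E3 → ℝ) (t : ℝ) :
    pair g (fun y => -k y) t = -pair g k t := by
  simp only [pair, mul_neg, integral_neg]

/-- The time derivative of the mollified velocity. -/
def mollRate (ν : ℝ) (f u : ℝ × E3 → E3) (p : ℝ × E3 → ℝ) (j : Fin 3) (k : E3 → ℝ)
    (z : ℝ × E3) : ℝ :=
  -(∑ i, conv (fun z => u z i * u z j) (pd i k) z) - conv p (pd j k) z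
    + ν * conv (fun z => u z j) (lapX k) z + conv (fun z => f z j) k z

/-- Mollification at x is pairing with the reflected kernel centred at x. First derivatives change
sign under reflection and second derivatives do not. -/
lemma rate_comp_sub_left {k : E3 → ℝ} (hk : ContDiff ℝ ∞ k) (ν : ℝ) (f u : ℝ × E3 → E3)
    (p : ℝ × E3 → ℝ) (j : Fin 3) (t : ℝ) (x : E3) :
    rate ν f u p j (fun y => k (x - y)) t = mollRate ν f u p j k (t, x) := by
  simp only [rate, mollRate, pd_comp_sub_left hk, lapX_comp_sub_left hk, conv_eq_pair]
  simp only [fun g i => pair_neg g (fun y => pd i k (x - y)), Finset.sum_neg_distrib]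
  ring

lemma measurable_mollRate {ν : ℝ} {f u : ℝ × E3 → E3} {p : ℝ × E3 → ℝ} (hf : Measurable f)
    (hu : Measurable u) (hp : Measurable p) (j : Fin 3) {k : E3 → ℝ} (hk : ContDiff ℝ ∞ k) :
    Measurable (mollRate ν f u p j k) := by
  have h1 : ∀ i, Measurable (conv (fun z => u z i * u z j) (pd i k)) := fun i =>
    measurable_conv (by fun_prop) (contDiff_pd hk).continuous.measurable
  have h2 : Measurable (conv p (pd j k)) :=
    measurable_conv hp (contDiff_pd hk).continuous.measurable
  have h3 : Measurable (conv (fun z => u z j) (lapX k)) :=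
    measurable_conv (by fun_prop) (contDiff_lapX hk).continuous.measurable
  have h4 : Measurable (conv (fun z => f z j) k) :=
    measurable_conv (by fun_prop) hk.continuous.measurable
  exact (((Finset.measurable_sum _ fun i _ => h1 i).neg.sub h2).add (h3.const_mul ν)).add h4

lemma enorm_coord_le (v : E3) (j : Fin 3) : ‖v j‖ₑ ≤ ‖v‖ₑ := by
  rw [← ofReal_norm, ← ofReal_norm]
  exact ENNReal.ofReal_le_ofReal (PiLp.norm_apply_le v j)

lemma ENNReal_le_one_add_sq (a : ℝ≥0∞) : a ≤ 1 + a ^ 2 := by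
  rcases le_total a 1 with h | h
  · exact h.trans le_self_add
  · calc a = a * 1 := (mul_one a).symm
      _ ≤ a * a := by gcongr
      _ = a ^ 2 := (sq a).symm
      _ ≤ 1 + a ^ 2 := le_add_self

/-- The mollified time derivative is bounded in `L¹` in terms of the natural quantities. -/
lemma exists_lintegral_mollRate_le {T P : ℝ} (hP : 0 < P) {f : ℝ × E3 → E3} {u₀ : E3 → E3}
    (hd : IsFlowData T P f u₀) {k : E3 → ℝ} (hk : ContDiff ℝ ∞ k) (hs : HasCompactSupport k)
    {U Q N : ℝ≥0∞} (hU : U ≠ ⊤) (hQ : Q ≠ ⊤) (hN : N ≠ ⊤) :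
    ∃ B : ℝ, 0 ≤ B ∧ ∀ (ν : ℝ) (u : ℝ × E3 → E3) (p : ℝ × E3 → ℝ) (j : Fin 3),
      IsFlow T P ν f u₀ u p → ‖ν‖ₑ ≤ N → ∫⁻ z, ‖u z‖ₑ ^ 2 ∂(cylMeasure T P) ≤ U →
      ∫⁻ z, ‖p z‖ₑ ∂(cylMeasure T P) ≤ Q →
      ∫⁻ z, ‖mollRate ν f u p j k z‖ₑ ∂(cylMeasure T P) ≤ ENNReal.ofReal B := by
  have hfin : ∀ {l : E3 → ℝ}, ContDiff ℝ ∞ l → HasCompactSupport l → ∫⁻ y, ‖l y‖ₑ ≠ ⊤ :=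
    fun h1 h2 => (h1.continuous.integrable_of_hasCompactSupport h2).hasFiniteIntegral.ne
  set A : ℝ≥0∞ := (∑ i, ∫⁻ y, ‖pd i k y‖ₑ) with hA
  have hAi : ∀ i, ∫⁻ y, ‖pd i k y‖ₑ ≤ A := fun i =>
    Finset.single_le_sum (f := fun i => ∫⁻ y, ‖pd i k y‖ₑ) (fun _ _ => zero_le)
      (Finset.mem_univ i)
  have hAtop : A ≠ ⊤ := (ENNReal.sum_lt_top.2 fun i _ =>
    (hfin (contDiff_pd hk) (hasCompactSupport_pd hs)).lt_top).ne
  set m1 : ℝ≥0∞ := cylMeasure T P univ with hm1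
  set F : ℝ≥0∞ := ∫⁻ z, ‖f z‖ₑ ∂(cylMeasure T P) with hF
  have hFtop : F ≠ ⊤ := (hd.force_memLp.integrable (by norm_num)).hasFiniteIntegral.ne
  set Btot : ℝ≥0∞ := A * U + A * Q + N * ((∫⁻ y, ‖lapX k y‖ₑ) * (m1 + U)) + (∫⁻ y, ‖k y‖ₑ) * F
    with hBtot
  have hBtop : Btot ≠ ⊤ := by
    have h1 := hfin (contDiff_lapX hk) (hasCompactSupport_lapX hs)
    have h2 := hfin hk hs
    have h3 : m1 ≠ ⊤ := measure_ne_top _ _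
    finiteness
  refine ⟨Btot.toReal, by positivity, fun ν u p j h hν hu2 hp1 => ?_⟩
  rw [ENNReal.ofReal_toReal hBtop]
  have hu := h.vel_meas
  have hf := hd.force_meas
  have h1 : ∀ i, Measurable (conv (fun z => u z i * u z j) (pd i k)) := fun i =>
    measurable_conv (by fun_prop) (contDiff_pd hk).continuous.measurable
  have h2 : Measurable (conv p (pd j k)) :=
    measurable_conv h.pr_meas (contDiff_pd hk).continuous.measurable
  have h3 : Measurable (conv (fun z => u z j) (lapX k)) :=
    measurable_conv (by fun_prop) (contDiff_lapX hk).continuous.measurable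
  have b1 : ∀ i, ∫⁻ z, ‖conv (fun z => u z i * u z j) (pd i k) z‖ₑ ∂(cylMeasure T P) ≤
      (∫⁻ y, ‖pd i k y‖ₑ) * U := fun i => by
    refine (lintegral_conv_le hP (by fun_prop) (h.vel_per.coord_mul i j)
      (contDiff_pd hk).continuous.measurable).trans ?_
    gcongr
    refine (lintegral_mono fun z => ?_).trans hu2
    rw [enorm_mul, sq]
    exact mul_le_mul' (enorm_coord_le _ _) (enorm_coord_le _ _)
  have b2 : ∫⁻ z, ‖conv p (pd j k) z‖ₑ ∂(cylMeasure T P) ≤ A * Q := by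
    refine (lintegral_conv_le hP h.pr_meas h.pr_per
      (contDiff_pd hk).continuous.measurable).trans ?_
    gcongr
    exact hAi j
  have b3 : ∫⁻ z, ‖conv (fun z => u z j) (lapX k) z‖ₑ ∂(cylMeasure T P) ≤
      (∫⁻ y, ‖lapX k y‖ₑ) * (m1 + U) := by
    refine (lintegral_conv_le hP (by fun_prop) (h.vel_per.coord j)
      (contDiff_lapX hk).continuous.measurable).trans ?_
    gcongr
    calc ∫⁻ z, ‖u z j‖ₑ ∂(cylMeasure T P) ≤ ∫⁻ z, (1 + ‖u z‖ₑ ^ 2) ∂(cylMeasure T P) :=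
          lintegral_mono fun z => (enorm_coord_le _ _).trans (ENNReal_le_one_add_sq _)
      _ = m1 + ∫⁻ z, ‖u z‖ₑ ^ 2 ∂(cylMeasure T P) := by
          rw [lintegral_add_left measurable_const, lintegral_one]
      _ ≤ m1 + U := by gcongr
  have b4 : ∫⁻ z, ‖conv (fun z => f z j) k z‖ₑ ∂(cylMeasure T P) ≤ (∫⁻ y, ‖k y‖ₑ) * F := by
    refine (lintegral_conv_le hP (by fun_prop) (hd.force_per.coord j)
      hk.continuous.measurable).trans ?_
    gcongr
    exact lintegral_mono fun z => enorm_coord_le _ _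
  calc ∫⁻ z, ‖mollRate ν f u p j k z‖ₑ ∂(cylMeasure T P)
      ≤ ∫⁻ z, ((∑ i, ‖conv (fun z => u z i * u z j) (pd i k) z‖ₑ) + ‖conv p (pd j k) z‖ₑ
          + ‖ν‖ₑ * ‖conv (fun z => u z j) (lapX k) z‖ₑ + ‖conv (fun z => f z j) k z‖ₑ)
          ∂(cylMeasure T P) := by
        refine lintegral_mono fun z => ?_
        rw [mollRate]
        refine (enorm_add_le _ _).trans (add_le_add_left ?_ _)
        refine (enorm_add_le _ _).trans (add_le_add ?_ (enorm_mul _ _).le)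
        refine enorm_sub_le.trans (add_le_add_left ?_ _)
        rw [enorm_neg]
        exact enorm_sum_le _ _
    _ = (∑ i, ∫⁻ z, ‖conv (fun z => u z i * u z j) (pd i k) z‖ₑ ∂(cylMeasure T P))
          + (∫⁻ z, ‖conv p (pd j k) z‖ₑ ∂(cylMeasure T P))
          + ‖ν‖ₑ * (∫⁻ z, ‖conv (fun z => u z j) (lapX k) z‖ₑ ∂(cylMeasure T P))
          + ∫⁻ z, ‖conv (fun z => f z j) k z‖ₑ ∂(cylMeasure T P) := by
        have hs1 : Measurable fun z => ∑ i, ‖conv (fun z => u z i * u z j) (pd i k) z‖ₑ :=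
          Finset.measurable_sum _ fun i _ => (h1 i).enorm
        rw [lintegral_add_left (by fun_prop), lintegral_add_left (by fun_prop),
          lintegral_add_left hs1,
          lintegral_finsetSum _ fun i _ => (h1 i).enorm, lintegral_const_mul _ h3.enorm]
    _ ≤ Btot := by
        rw [hBtot]
        refine add_le_add (add_le_add (add_le_add ?_ b2) (mul_le_mul' hν b3)) b4
        rw [hA, Finset.sum_mul]
        exact Finset.sum_le_sum fun i _ => b1 i

/-! ### Strong compactness of the velocities -/

lemma lintegral_cyl_sq_le {T P M : ℝ} (hT : 0 < T) {u : ℝ × E3 → E3} (hu : Measurable u)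
    (h : ∀ᵐ t ∂(volume.restrict (Ioo 0 T)),
      ∫⁻ x, ‖u (t, x)‖ₑ ^ 2 ∂(cellMeasure P) ≤ ENNReal.ofReal M) :
    ∫⁻ z, ‖u z‖ₑ ^ 2 ∂(cylMeasure T P) ≤ ENNReal.ofReal (T * M) := by
  rw [lintegral_cyl_eq (by fun_prop)]
  calc _ ≤ ∫⁻ _t in Ioo 0 T, ENNReal.ofReal M := lintegral_mono_ae h
    _ = _ := by
      rw [setLIntegral_const, Real.volume_Ioo, sub_zero, ENNReal.ofReal_mul hT.le, mul_comm]

/-- A subsequence along which all time averages of pairings with kernels supported in a fixed ball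
converge. -/
lemma exists_subseq_tendsto_pair {T P : ℝ} (hP : 0 < P) {u : ℕ → ℝ × E3 → E3}
    (hu : ∀ n, Measurable (u n)) (hup : ∀ n, PeriodicTX P (u n)) {U : ℝ≥0∞} (hU : U ≠ ⊤)
    (hbU : ∀ n, ∫⁻ z, ‖u n z‖ₑ ^ 2 ∂(cylMeasure T P) ≤ U) (R : ℝ) :
    ∃ σ : ℕ → ℕ, StrictMono σ ∧ ∀ (j : Fin 3) (k : E3 → ℝ), Continuous k →
      (∀ y, R < ‖y‖ → k y = 0) → ∀ a b, 0 ≤ a → b ≤ T → ∃ ℓ, Tendsto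
        (fun n => ∫ s in Ioo a b, pair (fun z => u (σ n) z j) k s) atTop (𝓝 ℓ) := by
  obtain ⟨C, hC, hCg⟩ := exists_setLIntegral_le_cyl hP
    (Metric.isBounded_closedBall (x := (0 : E3)) (r := R))
  -- The kernels reach outside the cell, so weak compactness is used on a bounded slab containing
  -- all their supports; its L² space is separable, as sequential weak compactness requires.
  set m : Measure (ℝ × E3) := (slabMeasure T).restrict (univ ×ˢ Metric.closedBall (0 : E3) R)
    with hm
  have hmprod : m = (volume.restrict (Ioo 0 T)).prod
      (volume.restrict (Metric.closedBall (0 : E3) R)) := by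
    rw [hm, slabMeasure_eq_prod, ← Measure.prod_restrict, Measure.restrict_univ]
  have : IsFiniteMeasure (volume.restrict (Metric.closedBall (0 : E3) R)) :=
    ⟨by rw [Measure.restrict_apply_univ]; exact measure_closedBall_lt_top⟩
  have hfin : IsFiniteMeasure m := by rw [hmprod]; infer_instance
  have hsq : ∀ n, ∫⁻ z, ‖u n z‖ₑ ^ 2 ∂m ≤ C * U := fun n => by
    have := hu n
    refine (hCg T (fun z => ‖u n z‖ₑ ^ 2) (by fun_prop) fun t x i => ?_).trans ?_
    · have := hup n t x i
      simp only at this ⊢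
      rw [this]
    · gcongr
      exact hbU n
  have heL : ∀ n, eLpNorm (u n) 2 m ≤ (C * U) ^ (1 / 2 : ℝ) := fun n => by
    rw [eLpNorm_eq_lintegral_rpow_enorm_toReal (by simp) (by simp)]
    simp only [ENNReal.toReal_ofNat, ENNReal.rpow_ofNat]
    exact ENNReal.rpow_le_rpow (hsq n) (by norm_num)
  have htop : (C * U) ^ (1 / 2 : ℝ) ≠ ⊤ := by finiteness
  have hmem : ∀ n, MemLp (u n) 2 m := fun n =>
    ⟨(hu n).aestronglyMeasurable, (heL n).trans_lt htop.lt_top⟩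
  have : Fact ((2 : ℝ≥0∞) ≠ ⊤) := ⟨by simp⟩
  have : SecondCountableTopology (Lp E3 2 m) := Lp.SecondCountableTopology
  obtain ⟨σ, hσ, w, hw⟩ := exists_weakly_convergent_subseq (H := Lp E3 2 m)
    (x := fun n => (hmem n).toLp) (M := ((C * U) ^ (1 / 2 : ℝ)).toReal) fun n => by
      rw [Lp.norm_toLp]
      exact ENNReal.toReal_mono htop (heL n)
  refine ⟨σ, hσ, fun j k hk hkR a b ha hb => ?_⟩
  have hks := hasCompactSupport_of_norm hkR
  obtain ⟨M, hM⟩ := hks.exists_bound_of_continuous hk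
  set ψ : ℝ → ℝ := (Ioo a b).indicator fun _ => 1 with hψ
  have hψm : Measurable ψ := measurable_const.indicator measurableSet_Ioo
  have hψ1 : ∀ t, ‖ψ t‖ ≤ 1 := fun t => by
    simp only [hψ, indicator]; split_ifs <;> simp
  have hkm := hk.measurable
  -- One weak limit serves all kernels and all time windows at once: the time average of a pairing
  -- is the inner product with this bounded function.
  set h : ℝ × E3 → E3 := fun z => (ψ z.1 * k z.2) • e j with hh
  have hhm : Measurable h := by fun_prop
  have hhb : ∀ z, ‖h z‖ ≤ M := fun z => by
    have h1 : ‖e j‖ = 1 := by simp [e]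
    simp only [hh]
    rw [norm_smul, h1, mul_one, norm_mul]
    calc ‖ψ z.1‖ * ‖k z.2‖ ≤ 1 * M := mul_le_mul (hψ1 _) (hM _) (norm_nonneg _) (by norm_num)
      _ = M := one_mul M
  have hhmem : MemLp h 2 m := MemLp.of_bound hhm.aestronglyMeasurable M (Eventually.of_forall hhb)
  refine ⟨_, (hw hhmem.toLp).congr fun n => ?_⟩
  rw [L2.inner_def]
  have hsub : Ioo a b ⊆ Ioo 0 T := Ioo_subset_Ioo ha hb
  have h1 : ∀ z, inner ℝ (u (σ n) z) (h z) = u (σ n) z j * (ψ z.1 * k z.2) := fun z => by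
    simp only [hh]
    rw [inner_smul_right, e, EuclideanSpace.inner_single_right]
    simp [mul_comm]
  have huj : Measurable fun z => u (σ n) z j := by have := hu (σ n); fun_prop
  have hInt : Integrable (fun z => u (σ n) z j) (cylMeasure T P) := by
    refine ⟨huj.aestronglyMeasurable, ?_⟩
    rw [hasFiniteIntegral_iff_enorm]
    calc ∫⁻ z, ‖u (σ n) z j‖ₑ ∂(cylMeasure T P)
        ≤ ∫⁻ z, (1 + ‖u (σ n) z‖ₑ ^ 2) ∂(cylMeasure T P) :=
          lintegral_mono fun z => (enorm_coord_le _ _).trans (ENNReal_le_one_add_sq _)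
      _ = cylMeasure T P univ + ∫⁻ z, ‖u (σ n) z‖ₑ ^ 2 ∂(cylMeasure T P) := by
          rw [lintegral_add_left measurable_const, lintegral_one]
      _ < ⊤ := ENNReal.add_lt_top.2 ⟨measure_lt_top _ _, (hbU (σ n)).trans_lt hU.lt_top⟩
  have hi1 := integrable_prod_mul hP huj ((hup (σ n)).coord j) hInt hk hks
  have hi2 : Integrable (fun z => u (σ n) z j * (ψ z.1 * k z.2)) (slabMeasure T) := by
    refine (hi1.bdd_mul (c := 1) (f := fun z : ℝ × E3 => ψ z.1)
      (by fun_prop : Measurable fun z : ℝ × E3 => ψ z.1).aestronglyMeasurable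
      (Eventually.of_forall fun z => hψ1 _)).congr (Eventually.of_forall fun z => ?_)
    simp only
    ring
  calc ∫ z, inner ℝ (((hmem (σ n)).toLp (u (σ n)) : ℝ × E3 → E3) z)
        ((hhmem.toLp h : ℝ × E3 → E3) z) ∂m
      = ∫ z, u (σ n) z j * (ψ z.1 * k z.2) ∂m := by
        refine integral_congr_ae ?_
        filter_upwards [(hmem (σ n)).coeFn_toLp, hhmem.coeFn_toLp] with z hz1 hz2
        rw [hz1, hz2, h1]
    _ = ∫ z, u (σ n) z j * (ψ z.1 * k z.2) ∂(slabMeasure T) := by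
        rw [hm]
        refine setIntegral_eq_integral_of_forall_compl_eq_zero fun z hz => ?_
        rw [hkR z.2, mul_zero, mul_zero]
        simpa using hz
    _ = ∫ t in Ioo 0 T, ψ t * pair (fun z => u (σ n) z j) k t := by
        rw [slabMeasure_eq_prod] at hi2 ⊢
        rw [integral_prod _ hi2]
        refine integral_congr_ae (Eventually.of_forall fun t => ?_)
        simp only [pair]
        rw [← integral_const_mul]
        congr 1; ext x; ring
    _ = ∫ s in Ioo a b, pair (fun z => u (σ n) z j) k s := by
        have h2 : ∀ t, ψ t * pair (fun z => u (σ n) z j) k t =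
            (Ioo a b).indicator (pair (fun z => u (σ n) z j) k) t := fun t => by
          simp only [hψ, indicator]; split_ifs <;> simp
        simp only [h2]
        rw [integral_indicator measurableSet_Ioo, Measure.restrict_restrict measurableSet_Ioo,
          inter_eq_left.2 hsub]

lemma enorm_add_add_sq_le (x y z : ℝ) :
    ‖x + y + z‖ₑ ^ 2 ≤ 3 * (‖x‖ₑ ^ 2 + ‖y‖ₑ ^ 2 + ‖z‖ₑ ^ 2) := by
  have h : ∀ w : ℝ, ‖w‖ₑ ^ 2 = ENNReal.ofReal (w ^ 2) := fun w => by
    rw [← ofReal_norm, ← ENNReal.ofReal_pow (norm_nonneg _), Real.norm_eq_abs, sq_abs]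
  rw [h, h, h, h, ← ENNReal.ofReal_add (by positivity) (by positivity),
    ← ENNReal.ofReal_add (by positivity) (by positivity),
    show (3 : ℝ≥0∞) = ENNReal.ofReal 3 by simp, ← ENNReal.ofReal_mul (by norm_num)]
  refine ENNReal.ofReal_le_ofReal ?_
  nlinarith [sq_nonneg (x - y), sq_nonneg (y - z), sq_nonneg (x - z)]

lemma lintegral_sub_sq_le_three {α : Type*} [MeasurableSpace α] (m : Measure α) {a b c d : α → ℝ}
    (ha : Measurable a) (hb : Measurable b) (hc : Measurable c) (hd : Measurable d) :
    ∫⁻ z, ‖a z - d z‖ₑ ^ 2 ∂m ≤ 3 * (∫⁻ z, ‖b z - a z‖ₑ ^ 2 ∂m + ∫⁻ z, ‖b z - c z‖ₑ ^ 2 ∂m +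
      ∫⁻ z, ‖c z - d z‖ₑ ^ 2 ∂m) := by
  rw [← lintegral_add_left (by fun_prop), ← lintegral_add_left (by fun_prop),
    ← lintegral_const_mul _ (by fun_prop)]
  refine lintegral_mono fun z => ?_
  have := enorm_add_add_sq_le (-(b z - a z)) (b z - c z) (c z - d z)
  rw [enorm_neg] at this
  refine le_trans (le_of_eq ?_) this
  congr 2; ring

/-- Velocities with a uniform spatial modulus of continuity in `L²`, bounded energy and bounded
pressure have a subsequence which is Cauchy in `L²`. -/
theorem exists_subseq_cauchy {T P : ℝ} (hT : 0 < T) (hP : 0 < P) {f : ℝ × E3 → E3}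
    {u₀ : E3 → E3} (hd : IsFlowData T P f u₀) {ν : ℕ → ℝ} {u : ℕ → ℝ × E3 → E3}
    {p : ℕ → ℝ × E3 → ℝ} (h : ∀ n, IsFlow T P (ν n) f u₀ (u n) (p n)) {N Q : ℝ≥0∞} (hN : N ≠ ⊤)
    (hQ : Q ≠ ⊤) (hν : ∀ n, ‖ν n‖ₑ ≤ N) (hp : ∀ n, ∫⁻ z, ‖p n z‖ₑ ∂(cylMeasure T P) ≤ Q)
    {M : ℝ} (hM0 : 0 ≤ M) (hM : ∀ n, ∀ᵐ t ∂(volume.restrict (Ioo 0 T)),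
      ∫⁻ x, ‖u n (t, x)‖ₑ ^ 2 ∂(cellMeasure P) ≤ ENNReal.ofReal M)
    {s C : ℝ} (hs : 0 < s) (hC : 0 ≤ C) (hmod : ∀ n j y,
      ∫⁻ z, ‖u n (z.1, z.2 + y) j - u n z j‖ₑ ^ 2 ∂(cylMeasure T P) ≤
        ENNReal.ofReal (C * ‖y‖ ^ (2 * s))) :
    ∃ σ : ℕ → ℕ, StrictMono σ ∧ ∀ δ : ℝ, 0 < δ → ∃ n₀, ∀ n ≥ n₀, ∀ m ≥ n₀, ∀ j,
      ∫⁻ z, ‖u (σ n) z j - u (σ m) z j‖ₑ ^ 2 ∂(cylMeasure T P) ≤ ENNReal.ofReal δ := by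
  have hU : ∀ n, ∫⁻ z, ‖u n z‖ₑ ^ 2 ∂(cylMeasure T P) ≤ ENNReal.ofReal (T * M) := fun n =>
    lintegral_cyl_sq_le hT (h n).vel_meas (hM n)
  obtain ⟨d, hd0⟩ := (isCompact_cell P).isBounded.exists_norm_le
  -- The subsequence is fixed before the mollification scale. Kernels of radius ε ≤ 1 centred in the
  -- cell, which lies in the ball of radius d, vanish beyond radius d + 1.
  obtain ⟨σ, hσ, hlim⟩ := exists_subseq_tendsto_pair hP (fun n => (h n).vel_meas)
    (fun n => (h n).vel_per) ENNReal.ofReal_ne_top hU (d + 1)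
  obtain ⟨ρ, hρ, hρ0, hρpos, hρ1⟩ := exists_mollifier
  have hρs := hasCompactSupport_of_norm hρ0
  obtain ⟨K, hK0, hK⟩ := exists_sq_conv_le hP hρ.continuous hρ0 hρpos hρ1
  refine ⟨σ, hσ, fun δ hδ => ?_⟩
  -- Budget: the three-term inequality for squares has constant 3, and 3(δ/12 + δ/6 + δ/12) = δ.
  obtain ⟨ε, hε, hε1, hεδ⟩ : ∃ ε : ℝ, 0 < ε ∧ ε ≤ 1 ∧ C * ε ^ (2 * s) ≤ δ / 12 := by
    have h1 : Tendsto (fun ε : ℝ => C * ε ^ (2 * s)) (𝓝[>] 0) (𝓝 0) := by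
      have h2 : ContinuousAt (fun ε : ℝ => C * ε ^ (2 * s)) 0 :=
        continuousAt_const.mul (Real.continuousAt_rpow_const _ _ (Or.inr (by positivity)))
      have h3 := h2.tendsto
      simp only [Real.zero_rpow (by positivity : 2 * s ≠ 0), mul_zero] at h3
      exact h3.mono_left nhdsWithin_le_nhds
    have h4 := (h1.eventually (gt_mem_nhds (by positivity : (0 : ℝ) < δ / 12))).and
      (Ioo_mem_nhdsGT (zero_lt_one : (0 : ℝ) < 1))
    obtain ⟨ε, h5, h6⟩ := h4.exists
    exact ⟨ε, h6.1, h6.2.le, h5.le⟩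
  set k : E3 → ℝ := scl ε ρ with hk
  have hkc : ContDiff ℝ ∞ k := contDiff_scl hρ
  have hk0 : ∀ y, ε < ‖y‖ → k y = 0 := fun y hy => scl_eq_zero hε hρ0 y (by linarith)
  have hks := hasCompactSupport_of_norm hk0
  have hkpos := scl_nonneg hε hρpos
  have hk1 : ∫ y, k y = 1 := (integral_scl hε ρ).trans hρ1
  obtain ⟨B, hB0, hB⟩ := exists_lintegral_mollRate_le hP hd hkc hks
    (ENNReal.ofReal_ne_top (r := T * M)) hQ hN
  have huj : ∀ n j, Measurable fun z => u n z j := fun n j => by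
    have := (h n).vel_meas; fun_prop
  have herr : ∀ n j, ∫⁻ z, ‖conv (fun z => u n z j) k z - u n z j‖ₑ ^ 2 ∂(cylMeasure T P) ≤
      ENNReal.ofReal (δ / 12) := fun n j => by
    refine lintegral_conv_sub_sq_le hP (huj n j) ((h n).vel_per.coord j)
      (integrable_coord (h n).vel_memLp j) hkc.continuous hk0 hkpos hk1 fun y hy => ?_
    refine (hmod n j y).trans (ENNReal.ofReal_le_ofReal (le_trans ?_ hεδ))
    gcongr
  set V : ℝ := Real.sqrt (K * M / ε ^ 3) with hV
  have hcau : ∀ j, ∃ n₀, ∀ n ≥ n₀, ∀ m ≥ n₀, ∫⁻ z, ‖conv (fun z => u (σ n) z j) k z -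
      conv (fun z => u (σ m) z j) k z‖ₑ ^ 2 ∂(cylMeasure T P) ≤ ENNReal.ofReal (δ / 6) := by
    intro j
    refine exists_lintegral_sub_sq_le_of_timeDeriv hT hP
      (v := fun n => conv (fun z => u (σ n) z j) k)
      (S := fun n => mollRate (ν (σ n)) f (u (σ n)) (p (σ n)) j k) (V := V) (B := B)
      (fun n => measurable_conv (huj _ j) hkc.continuous.measurable)
      (fun n => measurable_mollRate hd.force_meas (h _).vel_meas (h _).pr_meas j hkc)
      (Real.sqrt_nonneg _) hB0 (fun n => ?_) (fun n => ?_)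
      (fun n => hB _ _ _ j (h (σ n)) (hν _) (hU _) (hp _)) (fun a b ha hb x hx => ?_)
      (by positivity)
    · rw [cylMeasure_eq_prod]
      refine (Measure.quasiMeasurePreserving_fst (μ := volume.restrict (Ioo 0 T))
        (ν := cellMeasure P)).ae (p := fun t => ∀ x, ‖conv (fun z => u (σ n) z j) k (t, x)‖ ≤ V)
        ?_ |>.mono fun z hz => hz z.2
      filter_upwards [hM (σ n)] with t ht x
      refine Real.le_sqrt_of_sq_le (hK ε M t _ hε hε1 hM0 (huj _ j) ((h _).vel_per.coord j) ?_ x)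
      refine (lintegral_mono fun x => ?_).trans ht
      gcongr
      exact enorm_coord_le _ _
    · refine Eventually.of_forall fun x => ?_
      have hkx : ContDiff ℝ ∞ fun y => k (x - y) := hkc.comp (contDiff_const.sub contDiff_id)
      have hkxs := hasCompactSupport_comp_sub_left hks x
      have h1 := (h (σ n)).ae_pair_eq hP hd j hkx hkxs
      have h2 := (h (σ n)).integrable_rate hP hd j hkx hkxs
      have h3 := integrable_pair hP (huj (σ n) j) ((h (σ n)).vel_per.coord j)
        (integrable_coord (h (σ n)).vel_memLp j) hkx.continuous hkxs
      simp only [rate_comp_sub_left hkc] at h1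
      refine ⟨?_, ?_, ∫ y, u₀ y j * k (x - y), ?_⟩
      · simp only [conv_eq_pair]; exact h3
      · exact h2.congr (Eventually.of_forall fun t => rate_comp_sub_left hkc _ _ _ _ j t x)
      · simpa only [conv_eq_pair] using h1
    · simp only [conv_eq_pair]
      refine hlim j (fun y => k (x - y)) (by have := hkc.continuous; fun_prop) (fun y hy => ?_)
        a b ha hb
      refine hk0 _ ?_
      have h1 := norm_sub_norm_le y x
      rw [norm_sub_rev] at h1
      linarith [hd0 x hx]
  choose n₀ hn₀ using hcau
  refine ⟨Finset.univ.sup n₀, fun n hn m hm j => ?_⟩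
  have hle : n₀ j ≤ Finset.univ.sup n₀ := Finset.le_sup (Finset.mem_univ j)
  have h1 := hn₀ j n (hle.trans hn) m (hle.trans hm)
  have hcm : ∀ n, Measurable (conv (fun z => u n z j) k) := fun n =>
    measurable_conv (huj _ j) hkc.continuous.measurable
  refine (lintegral_sub_sq_le_three _ (huj (σ n) j) (hcm (σ n)) (hcm (σ m)) (huj (σ m) j)).trans ?_
  calc _ ≤ 3 * (ENNReal.ofReal (δ / 12) + ENNReal.ofReal (δ / 6) + ENNReal.ofReal (δ / 12)) := by
        exact mul_le_mul_right (add_le_add (add_le_add (herr _ j) h1) (herr _ j)) 3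
    _ = ENNReal.ofReal δ := by
        rw [← ENNReal.ofReal_add (by positivity) (by positivity),
          ← ENNReal.ofReal_add (by positivity) (by positivity),
          show (3 : ℝ≥0∞) = ENNReal.ofReal 3 by simp, ← ENNReal.ofReal_mul (by norm_num)]
        congr 1; ring

/-! ### Limits of the velocities and of the pressures -/

lemma eLpNorm_two_le_of_lintegral_le {α F : Type*} [MeasurableSpace α] [NormedAddCommGroup F]
    {m : Measure α} {g : α → F} {W : ℝ≥0∞} (h : ∫⁻ z, ‖g z‖ₑ ^ 2 ∂m ≤ W) :
    eLpNorm g 2 m ≤ W ^ (1 / 2 : ℝ) := by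
  rw [eLpNorm_eq_lintegral_rpow_enorm_toReal (by simp) (by simp)]
  simp only [ENNReal.toReal_ofNat, ENNReal.rpow_ofNat]
  exact ENNReal.rpow_le_rpow h (by norm_num)

lemma enorm_sq_eq_sum (v : E3) : ‖v‖ₑ ^ 2 = ∑ j, ‖v j‖ₑ ^ 2 := by
  have h : ∀ {F : Type} [NormedAddCommGroup F] (w : F), ‖w‖ₑ ^ 2 = ENNReal.ofReal (‖w‖ ^ 2) :=
    fun w => by rw [← ofReal_norm, ← ENNReal.ofReal_pow (norm_nonneg _)]
  simp only [h]
  rw [EuclideanSpace.norm_sq_eq, ENNReal.ofReal_sum_of_nonneg fun i _ => by positivity]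

/-- Completeness of `L^q` of the cylinder, with a measurable periodic limit. -/
lemma exists_periodic_limit {T P : ℝ} (hP : 0 < P) {F : Type*} [NormedAddCommGroup F]
    [CompleteSpace F] [MeasurableSpace F] [BorelSpace F] {q : ℝ≥0∞} (hq : 1 ≤ q)
    {g : ℕ → ℝ × E3 → F} (hg : ∀ n, MemLp (g n) q (cylMeasure T P))
    (hc : ∀ δ : ℝ≥0∞, 0 < δ → ∃ n₀, ∀ n ≥ n₀, ∀ m ≥ n₀,
      eLpNorm (g n - g m) q (cylMeasure T P) ≤ δ) :
    ∃ g' : ℝ × E3 → F, Measurable g' ∧ PeriodicTX P g' ∧ MemLp g' q (cylMeasure T P) ∧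
      Tendsto (fun n => eLpNorm (g n - g') q (cylMeasure T P)) atTop (𝓝 0) := by
  have : Fact (1 ≤ q) := ⟨hq⟩
  have hcs : CauchySeq fun n => (hg n).toLp := by
    rw [Lp.cauchySeq_Lp_iff_cauchySeq_eLpNorm, ENNReal.tendsto_nhds_zero]
    intro δ hδ
    obtain ⟨n₀, hn₀⟩ := hc δ hδ
    filter_upwards [eventually_ge_atTop (n₀, n₀)] with x hx
    refine le_trans (le_of_eq (eLpNorm_congr_ae ?_)) (hn₀ x.1 hx.1 x.2 hx.2)
    exact (hg x.1).coeFn_toLp.sub (hg x.2).coeFn_toLp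
  obtain ⟨G, hG⟩ := cauchySeq_tendsto_of_complete hcs
  rw [Lp.tendsto_Lp_iff_tendsto_eLpNorm'] at hG
  have hr : Measurable fun z : ℝ × E3 => (z.1, red P z.2) :=
    measurable_fst.prodMk ((measurable_red P).comp measurable_snd)
  have hae : (fun z : ℝ × E3 => (G : ℝ × E3 → F) (z.1, red P z.2)) =ᵐ[cylMeasure T P] G := by
    filter_upwards [ae_cyl_mem_halfCell T P] with z hz
    simp only [red_eq_self hP hz]
  refine ⟨fun z => (G : ℝ × E3 → F) (z.1, red P z.2),
    (Lp.stronglyMeasurable G).measurable.comp hr,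
    fun t x i => by simp [red_periodic hP x i], (Lp.memLp G).ae_eq hae.symm, ?_⟩
  refine hG.congr fun n => eLpNorm_congr_ae ?_
  exact (hg n).coeFn_toLp.sub hae.symm

lemma ae_lintegral_sq_le {T P M : ℝ} {u : ℝ × E3 → E3}
    (h2 : MemLp u 2 (cylMeasure T P)) (h : ∀ᵐ t ∂(volume.restrict (Ioo 0 T)),
      ∫ x, ‖u (t, x)‖ ^ 2 ∂(cellMeasure P) ≤ M) :
    ∀ᵐ t ∂(volume.restrict (Ioo 0 T)),
      ∫⁻ x, ‖u (t, x)‖ₑ ^ 2 ∂(cellMeasure P) ≤ ENNReal.ofReal M := by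
  have hi : Integrable (fun z => ‖u z‖ ^ 2) (cylMeasure T P) := h2.integrable_norm_pow (by norm_num)
  rw [cylMeasure_eq_prod] at hi
  filter_upwards [h, hi.prod_right_ae] with t ht hit
  refine le_trans (le_of_eq ?_) (ENNReal.ofReal_le_ofReal ht)
  rw [ofReal_integral_eq_lintegral_ofReal hit (Eventually.of_forall fun x => by positivity)]
  congr 1; ext x
  rw [← ofReal_norm, ← ENNReal.ofReal_pow (norm_nonneg _)]

/-- A power modulus sampled at dyadic scales is a geometric series of ratio 2^(-s): this is the Dini
condition used for the pressure. -/
lemma tsum_dyadic_modulus_ne_top {C R s : ℝ} (hC : 0 ≤ C) (hR : 0 < R) (hs : 0 < s) :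
    ∑' i : ℕ, ENNReal.ofReal (C * (R * (1 / 2) ^ i) ^ (2 * s)) ^ (1 / 2 : ℝ) ≠ ⊤ := by
  have h1 : ∀ i : ℕ, ENNReal.ofReal (C * (R * (1 / 2) ^ i) ^ (2 * s)) ^ (1 / 2 : ℝ) =
      ENNReal.ofReal (C ^ (1 / 2 : ℝ) * R ^ s * ((1 / 2) ^ s) ^ i) := fun i => by
    rw [ENNReal.ofReal_rpow_of_nonneg (by positivity) (by norm_num),
      Real.mul_rpow hC (by positivity), ← Real.rpow_mul (by positivity),
      show 2 * s * (1 / 2) = s by ring, Real.mul_rpow hR.le (by positivity),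
      ← Real.rpow_natCast, ← Real.rpow_natCast, ← Real.rpow_mul (by norm_num),
      ← Real.rpow_mul (by norm_num), mul_comm s, mul_assoc]
  simp only [h1]
  have hsum : Summable fun i : ℕ => C ^ (1 / 2 : ℝ) * R ^ s * ((1 / 2 : ℝ) ^ s) ^ i :=
    (summable_geometric_of_lt_one (by positivity)
      (Real.rpow_lt_one (by norm_num) (by norm_num) hs)).mul_left _
  rw [← ENNReal.ofReal_tsum_of_nonneg (fun i => by positivity) hsum]
  exact ENNReal.ofReal_ne_top

lemma eLpNorm_sub_le_of_coord {α : Type*} [MeasurableSpace α] {m : Measure α} {a b : α → E3}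
    (ha : Measurable a) (hb : Measurable b) {d : ℝ} (hd : 0 ≤ d)
    (h : ∀ j, ∫⁻ z, ‖a z j - b z j‖ₑ ^ 2 ∂m ≤ ENNReal.ofReal (d ^ 2 / 3)) :
    eLpNorm (a - b) 2 m ≤ ENNReal.ofReal d := by
  have h0 : ∫⁻ z, ‖(a - b) z‖ₑ ^ 2 ∂m ≤ ENNReal.ofReal d ^ 2 :=
    calc ∫⁻ z, ‖(a - b) z‖ₑ ^ 2 ∂m
        = ∑ j, ∫⁻ z, ‖a z j - b z j‖ₑ ^ 2 ∂m := by
          rw [← lintegral_finsetSum _ fun j _ => by fun_prop]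
          simp only [enorm_sq_eq_sum, Pi.sub_apply, PiLp.sub_apply]
      _ ≤ ∑ _j : Fin 3, ENNReal.ofReal (d ^ 2 / 3) := Finset.sum_le_sum fun j _ => h j
      _ = ENNReal.ofReal d ^ 2 := by
          rw [Finset.sum_const, Finset.card_univ, Fintype.card_fin, ← ENNReal.ofReal_nsmul,
            show 3 • (d ^ 2 / 3) = d ^ 2 by rw [nsmul_eq_mul]; push_cast; ring,
            ENNReal.ofReal_pow hd]
  refine (eLpNorm_two_le_of_lintegral_le h0).trans (le_of_eq ?_)
  rw [← ENNReal.rpow_ofNat, ← ENNReal.rpow_mul]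
  simp

/-- Choose J so that the tail of the summable series is below δ/2, then D so small that the first J
terms are too. -/
lemma exists_tsum_min_le {K A : ℝ≥0∞} (hK : K ≠ ⊤) (hA : A ≠ ⊤) {w : ℕ → ℝ≥0∞}
    (hw : ∑' i, w i ≠ ⊤) {δ : ℝ≥0∞} (hδ : 0 < δ) :
    ∃ D : ℝ≥0∞, 0 < D ∧ D ≠ ⊤ ∧ K * ∑' i, min (w i) (A * D) ≤ δ := by
  have hlim := (ENNReal.Tendsto.const_mul (a := K)
    (ENNReal.tendsto_sum_nat_add w hw) (Or.inr hK))
  rw [mul_zero] at hlim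
  have hδ2 : 0 < δ / 2 := ENNReal.div_pos hδ.ne' (by simp)
  obtain ⟨J, hJ⟩ := ((ENNReal.tendsto_nhds_zero.1 hlim) _ hδ2).exists
  have hlim2 : Tendsto (fun D : ℝ≥0∞ => K * (J * (A * D))) (𝓝 0) (𝓝 0) := by
    have : Tendsto (fun D : ℝ≥0∞ => K * (J * (A * D))) (𝓝 0) (𝓝 (K * (J * (A * 0)))) :=
      ENNReal.Tendsto.const_mul (ENNReal.Tendsto.const_mul (ENNReal.Tendsto.const_mul
        tendsto_id (Or.inr hA)) (Or.inr (by finiteness))) (Or.inr hK)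
    simpa using this
  have hlim3 := (hlim2.eventually (ge_mem_nhds hδ2)).filter_mono
    (nhdsWithin_le_nhds (s := Ioi 0))
  obtain ⟨D, hD, hD0⟩ := (hlim3.and (Ioo_mem_nhdsGT (zero_lt_one' ℝ≥0∞))).exists
  refine ⟨D, hD0.1, (hD0.2.trans ENNReal.one_lt_top).ne, ?_⟩
  refine (mul_le_mul_right (tsum_min_le _ _ J) K).trans ?_
  rw [mul_add, ← ENNReal.add_halves δ]
  exact add_le_add hD hJ

/-- Flows with bounded energy and a uniform modulus of continuity have a subsequence along which
the velocities converge in `L²` and the mean-zero pressures in `L¹`. -/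
theorem exists_subseq_tendsto_flow {T P : ℝ} (hT : 0 < T) (hP : 0 < P) {f : ℝ × E3 → E3}
    {u₀ : E3 → E3} (hd : IsFlowData T P f u₀) {ν : ℕ → ℝ} {u : ℕ → ℝ × E3 → E3}
    {p : ℕ → ℝ × E3 → ℝ} (h : ∀ n, IsFlow T P (ν n) f u₀ (u n) (p n)) {N : ℝ≥0∞} (hN : N ≠ ⊤)
    (hν : ∀ n, ‖ν n‖ₑ ≤ N)
    (hp : ∀ n, ∀ᵐ t ∂(volume.restrict (Ioo 0 T)), ∫ x, p n (t, x) ∂(cellMeasure P) = 0)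
    {M : ℝ} (hM0 : 0 ≤ M) (hM : ∀ n, ∀ᵐ t ∂(volume.restrict (Ioo 0 T)),
      ∫⁻ x, ‖u n (t, x)‖ₑ ^ 2 ∂(cellMeasure P) ≤ ENNReal.ofReal M)
    {s C : ℝ} (hs : 0 < s) (hC : 0 ≤ C) (hmod : ∀ n j y,
      ∫⁻ z, ‖u n (z.1, z.2 + y) j - u n z j‖ₑ ^ 2 ∂(cylMeasure T P) ≤
        ENNReal.ofReal (C * ‖y‖ ^ (2 * s))) :
    ∃ σ : ℕ → ℕ, StrictMono σ ∧ ∃ (v : ℝ × E3 → E3) (q : ℝ × E3 → ℝ),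
      (Measurable v ∧ PeriodicTX P v ∧ MemLp v 2 (cylMeasure T P) ∧
        Tendsto (fun n => eLpNorm (u (σ n) - v) 2 (cylMeasure T P)) atTop (𝓝 0)) ∧
      Measurable q ∧ PeriodicTX P q ∧ MemLp q 1 (cylMeasure T P) ∧
        Tendsto (fun n => eLpNorm (p (σ n) - q) 1 (cylMeasure T P)) atTop (𝓝 0) := by
  have hU : ∀ n, ∫⁻ z, ‖u n z‖ₑ ^ 2 ∂(cylMeasure T P) ≤ ENNReal.ofReal (T * M) := fun n =>
    lintegral_cyl_sq_le hT (h n).vel_meas (hM n)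
  obtain ⟨K, hK, R, hR, hpr⟩ := exists_lintegral_pressure_sub_le hP
  set A : ℝ≥0∞ := ENNReal.ofReal (T * M) ^ (1 / 2 : ℝ) with hA
  have hAt : A ≠ ⊤ := by rw [hA]; finiteness
  set w : ℕ → ℝ≥0∞ := fun i => ENNReal.ofReal (C * (R * (1 / 2) ^ i) ^ (2 * s)) ^ (1 / 2 : ℝ)
    with hw
  have hwt : ∑' i, 4 * A * w i ≠ ⊤ := by
    rw [ENNReal.tsum_mul_left]
    exact ENNReal.mul_ne_top (by finiteness) (tsum_dyadic_modulus_ne_top hC hR hs)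
  have hA' : ∀ n j, eLpNorm (fun z => u n z j) 2 (cylMeasure T P) ≤ A := fun n j =>
    eLpNorm_two_le_of_lintegral_le ((lintegral_mono fun z => by
      gcongr; exact enorm_coord_le _ _).trans (hU n))
  have hw' : ∀ n i j y, ‖y‖ ≤ R * (1 / 2) ^ i →
      eLpNorm (fun z => u n (z.1, z.2 + y) j - u n z j) 2 (cylMeasure T P) ≤ w i :=
    fun n i j y hy => eLpNorm_two_le_of_lintegral_le ((hmod n j y).trans
      (ENNReal.ofReal_le_ofReal (by gcongr)))
  have huj : ∀ n j, Measurable fun z => u n z j := fun n j => by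
    have := (h n).vel_meas; fun_prop
  have hdiff : ∀ n m D, (∀ j, eLpNorm (fun z => u n z j - u m z j) 2 (cylMeasure T P) ≤ D) →
      ∫⁻ z, ‖p n z - p m z‖ₑ ∂(cylMeasure T P) ≤
        K * ∑' i, min (4 * A * w i) (4 * A * D) := fun n m D hD =>
    hpr T _ _ f u₀ _ _ _ _ A D w hd (h n) (h m) (hp n) (hp m) (hA' n) (hA' m) hD (hw' n) (hw' m)
  have hQ : ∀ n, ∫⁻ z, ‖p n z‖ₑ ∂(cylMeasure T P) ≤
      K * ∑' i, 4 * A * w i + ∫⁻ z, ‖p 0 z‖ₑ ∂(cylMeasure T P) := fun n => by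
    have hpm := (h n).pr_meas
    have hpm0 := (h 0).pr_meas
    -- With no information on the distance of the velocities, the modulus alone bounds the pressures
    -- around the first one; this uniform L¹ bound is needed before any convergence is known.
    have h1 := hdiff n 0 ⊤ fun j => le_top
    calc ∫⁻ z, ‖p n z‖ₑ ∂(cylMeasure T P)
        ≤ ∫⁻ z, (‖p n z - p 0 z‖ₑ + ‖p 0 z‖ₑ) ∂(cylMeasure T P) := lintegral_mono fun z => by
          simpa using enorm_add_le (p n z - p 0 z) (p 0 z)
      _ = ∫⁻ z, ‖p n z - p 0 z‖ₑ ∂(cylMeasure T P) + ∫⁻ z, ‖p 0 z‖ₑ ∂(cylMeasure T P) :=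
          lintegral_add_left (by fun_prop) _
      _ ≤ _ := by
          gcongr
          refine h1.trans ?_
          gcongr
          exact min_le_left _ _
  obtain ⟨σ, hσ, hcau⟩ := exists_subseq_cauchy hT hP hd h hN
    (Q := K * ∑' i, 4 * A * w i + ∫⁻ z, ‖p 0 z‖ₑ ∂(cylMeasure T P))
    (ENNReal.add_ne_top.2 ⟨ENNReal.mul_ne_top hK hwt, (hasFiniteIntegral_iff_enorm.1
      (h 0).pr_int.2).ne⟩) hν hQ hM0 hM hs hC hmod
  obtain ⟨v, hv1, hv2, hv3, hv4⟩ := exists_periodic_limit (P := P) (T := T) hP (q := 2)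
    (by norm_num) (g := fun n => u (σ n)) (fun n => (h (σ n)).vel_memLp) (fun δ hδ => by
      by_cases hδt : δ = ⊤
      · exact ⟨0, fun n _ m _ => by simp [hδt]⟩
      have hδ' : 0 < δ.toReal := ENNReal.toReal_pos hδ.ne' hδt
      obtain ⟨n₀, hn₀⟩ := hcau (δ.toReal ^ 2 / 3) (by positivity)
      refine ⟨n₀, fun n hn m hm => ?_⟩
      refine (eLpNorm_sub_le_of_coord (h _).vel_meas (h _).vel_meas hδ'.le
        (hn₀ n hn m hm)).trans (le_of_eq (ENNReal.ofReal_toReal hδt)))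
  obtain ⟨q, hq1, hq2, hq3, hq4⟩ := exists_periodic_limit (P := P) (T := T) hP (q := 1)
    le_rfl (g := fun n => p (σ n)) (fun n => memLp_one_iff_integrable.2 (h (σ n)).pr_int)
    (fun δ hδ => by
      obtain ⟨D, hD0, hDt, hD⟩ := exists_tsum_min_le (A := 4 * A) hK (by finiteness) hwt hδ
      obtain ⟨n₀, hn₀⟩ := hcau (D.toReal ^ 2) (pow_pos (ENNReal.toReal_pos hD0.ne' hDt) 2)
      refine ⟨n₀, fun n hn m hm => ?_⟩
      rw [eLpNorm_one_eq_lintegral_enorm]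
      refine (hdiff (σ n) (σ m) D fun j => ?_).trans hD
      refine (eLpNorm_two_le_of_lintegral_le (hn₀ n hn m hm j)).trans (le_of_eq ?_)
      rw [ENNReal.ofReal_pow ENNReal.toReal_nonneg, ENNReal.ofReal_toReal hDt,
        ← ENNReal.rpow_ofNat, ← ENNReal.rpow_mul]
      simp)
  exact ⟨σ, hσ, v, q, ⟨hv1, hv2, hv3, hv4⟩, hq1, hq2, hq3, hq4⟩

/-! ### Higher integrability of the velocities -/

/-- Where |g| is at least twice |v|, the distance |v - g| is at least |g|/2. So |g|² is paid by the
squared mollification error, and the extra power |g|^s is bounded by the upper end of the layer. -/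
lemma rpow_le_of_layer {g v s L : ℝ} (hs : 0 < s) (hg : L ≤ |g|) (hg' : |g| ≤ 8 * L)
    (hv : |v| ≤ L / 2) : |g| ^ (2 + s) ≤ 4 * (8 * L) ^ s * (v - g) ^ 2 := by
  have h1 : |g| ≤ 2 * |v - g| := by
    have := abs_sub_abs_le_abs_sub g v
    rw [abs_sub_comm] at this
    linarith
  rcases eq_or_lt_of_le (abs_nonneg g) with h0 | h0
  · rw [← h0, Real.zero_rpow (by linarith)]
    have : 0 ≤ L := by linarith [abs_nonneg v]
    positivity
  · rw [Real.rpow_add h0, Real.rpow_two]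
    have h2 : |g| ^ 2 ≤ 4 * (v - g) ^ 2 := by
      rw [← sq_abs (v - g)]
      nlinarith
    have h3 : |g| ^ s ≤ (8 * L) ^ s := Real.rpow_le_rpow h0.le hg' hs.le
    calc |g| ^ 2 * |g| ^ s ≤ (4 * (v - g) ^ 2) * (8 * L) ^ s :=
          mul_le_mul h2 h3 (by positivity) (by positivity)
      _ = _ := by ring

/-- A bound for `|g|^(2+s)` in terms of the distances to the mollifications at dyadic scales. -/
lemma enorm_rpow_le_tsum {g Λ s : ℝ} (hs : 0 < s) (hΛ : 1 ≤ Λ) {v : ℕ → ℝ}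
    (hv : ∀ j, |v j| ≤ Λ * 8 ^ j / 2) :
    ‖g‖ₑ ^ (2 + s) ≤ ENNReal.ofReal (Λ ^ (2 + s)) +
      ∑' j, ENNReal.ofReal (4 * (8 * (Λ * 8 ^ j)) ^ s) * ‖v j - g‖ₑ ^ 2 := by
  have h0 : ‖g‖ₑ ^ (2 + s) = ENNReal.ofReal (|g| ^ (2 + s)) := by
    rw [← ofReal_norm, ENNReal.ofReal_rpow_of_nonneg (norm_nonneg _) (by linarith),
      Real.norm_eq_abs]
  rw [h0]
  rcases le_total |g| Λ with h | h
  · exact (ENNReal.ofReal_le_ofReal (Real.rpow_le_rpow (abs_nonneg _) h (by linarith))).trans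
      le_self_add
  · have hΛ0 : 0 < Λ := by linarith
    -- This selects the layer Λ8^j ≤ |g| < Λ8^(j+1); a single term of the series then suffices.
    obtain ⟨j, hj1, hj2⟩ := exists_nat_pow_near ((one_le_div hΛ0).2 h) (by norm_num : (1 : ℝ) < 8)
    rw [le_div_iff₀ hΛ0] at hj1
    rw [div_lt_iff₀ hΛ0] at hj2
    refine le_trans ?_ ((ENNReal.le_tsum j).trans le_add_self)
    have h1 : ‖v j - g‖ₑ ^ 2 = ENNReal.ofReal ((v j - g) ^ 2) := by
      rw [← ofReal_norm, ← ENNReal.ofReal_pow (norm_nonneg _), Real.norm_eq_abs, sq_abs]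
    rw [h1, ← ENNReal.ofReal_mul (by positivity)]
    refine ENNReal.ofReal_le_ofReal (rpow_le_of_layer hs (L := Λ * 8 ^ j) ?_ ?_ (hv j))
    · linarith
    · rw [pow_succ] at hj2; linarith

/-- Functions with bounded energy and a modulus of continuity are bounded in `L^(2+s)`. -/
lemma exists_lintegral_rpow_le {T P : ℝ} (hP : 0 < P) {M : ℝ} (hM0 : 0 ≤ M)
    {s C : ℝ} (hs : 0 < s) (hC : 0 ≤ C) :
    ∃ B : ℝ≥0∞, B ≠ ⊤ ∧ ∀ g : ℝ × E3 → ℝ, Measurable g → PeriodicTX P g →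
      MemLp g 2 (cylMeasure T P) →
      (∀ᵐ t ∂(volume.restrict (Ioo 0 T)),
        ∫⁻ x, ‖g (t, x)‖ₑ ^ 2 ∂(cellMeasure P) ≤ ENNReal.ofReal M) →
      (∀ y, ∫⁻ z, ‖g (z.1, z.2 + y) - g z‖ₑ ^ 2 ∂(cylMeasure T P) ≤
        ENNReal.ofReal (C * ‖y‖ ^ (2 * s))) →
      ∫⁻ z, ‖g z‖ₑ ^ (2 + s) ∂(cylMeasure T P) ≤ B := by
  obtain ⟨ρ, hρ, hρ0, hρpos, hρ1⟩ := exists_mollifier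
  obtain ⟨K, hK0, hK⟩ := exists_sq_conv_le hP hρ.continuous hρ0 hρpos hρ1
  -- The mollification at scale 4^(-j) is bounded by √(KM·64^j) = √(KM)·8^j, which this choice keeps
  -- below half of the level Λ8^j.
  set Λ : ℝ := 1 + 2 * Real.sqrt (K * M) with hΛ
  have hΛ1 : 1 ≤ Λ := by have := Real.sqrt_nonneg (K * M); linarith
  have hΛ0 : 0 < Λ := by linarith
  -- The weight grows like 8^(js) while the squared mollification error at scale 4^(-j) decays like
  -- 16^(-js); the product is geometric of ratio 2^(-s).
  have hterm : ∀ j : ℕ, ENNReal.ofReal (4 * (8 * (Λ * 8 ^ j)) ^ s) *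
      ENNReal.ofReal (C * ((1 / 4) ^ j) ^ (2 * s)) =
      ENNReal.ofReal (4 * (8 * Λ) ^ s * C * ((1 / 2) ^ s) ^ j) := fun j => by
    rw [← ENNReal.ofReal_mul (by positivity)]
    congr 1
    have h1 : (8 * (Λ * 8 ^ j)) ^ s = (8 * Λ) ^ s * ((8 : ℝ) ^ s) ^ j := by
      rw [← mul_assoc, Real.mul_rpow (by positivity) (by positivity), ← Real.rpow_natCast,
        ← Real.rpow_natCast, ← Real.rpow_mul (by norm_num), ← Real.rpow_mul (by norm_num),
        mul_comm (j : ℝ)]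
    have h2 : ((1 / 4 : ℝ) ^ j) ^ (2 * s) = ((1 / 16 : ℝ) ^ s) ^ j := by
      rw [show (1 / 16 : ℝ) = (1 / 4) ^ (2 : ℝ) by norm_num, ← Real.rpow_mul (by norm_num),
        ← Real.rpow_natCast, ← Real.rpow_natCast, ← Real.rpow_mul (by norm_num),
        ← Real.rpow_mul (by norm_num)]
      congr 1; ring
    have h3 : (1 / 2 : ℝ) ^ s = 8 ^ s * (1 / 16) ^ s := by
      rw [← Real.mul_rpow (by norm_num) (by norm_num)]; norm_num
    rw [h1, h2, h3, mul_pow]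
    ring
  have hsum : Summable fun j : ℕ => 4 * (8 * Λ) ^ s * C * ((1 / 2 : ℝ) ^ s) ^ j :=
    (summable_geometric_of_lt_one (by positivity)
      (Real.rpow_lt_one (by norm_num) (by norm_num) hs)).mul_left _
  refine ⟨ENNReal.ofReal (Λ ^ (2 + s)) * cylMeasure T P univ +
    ∑' j : ℕ, ENNReal.ofReal (4 * (8 * Λ) ^ s * C * ((1 / 2) ^ s) ^ j), ?_,
    fun g hg hper hg2 hE hmod => ?_⟩
  · rw [← ENNReal.ofReal_tsum_of_nonneg (fun i => by positivity) hsum]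
    finiteness
  have hε : ∀ j : ℕ, (0 : ℝ) < (1 / 4) ^ j := fun j => by positivity
  have hε1 : ∀ j : ℕ, (1 / 4 : ℝ) ^ j ≤ 1 := fun j => pow_le_one₀ (by norm_num) (by norm_num)
  have hcm : ∀ j : ℕ, Measurable (conv g (scl ((1 / 4) ^ j) ρ)) := fun j =>
    measurable_conv hg (contDiff_scl hρ).continuous.measurable
  have hpt : ∀ᵐ z ∂(cylMeasure T P), ‖g z‖ₑ ^ (2 + s) ≤ ENNReal.ofReal (Λ ^ (2 + s)) +
      ∑' j : ℕ, ENNReal.ofReal (4 * (8 * (Λ * 8 ^ j)) ^ s) *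
        ‖conv g (scl ((1 / 4) ^ j) ρ) z - g z‖ₑ ^ 2 := by
    have h1 : ∀ᵐ z ∂(cylMeasure T P), ∀ (j : ℕ) x,
        |conv g (scl ((1 / 4) ^ j) ρ) (z.1, x)| ≤ Λ * 8 ^ j / 2 := by
      rw [cylMeasure_eq_prod]
      refine (Measure.quasiMeasurePreserving_fst (μ := volume.restrict (Ioo 0 T))
        (ν := cellMeasure P)).ae (p := fun t => ∀ (j : ℕ) x,
          |conv g (scl ((1 / 4) ^ j) ρ) (t, x)| ≤ Λ * 8 ^ j / 2) ?_
      filter_upwards [hE] with t ht j x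
      have h2 := hK _ M t g (hε j) (hε1 j) hM0 hg hper ht x
      have h3 : K * M / ((1 / 4) ^ j) ^ 3 = (Real.sqrt (K * M) * 8 ^ j) ^ 2 := by
        rw [mul_pow, Real.sq_sqrt (by positivity), ← pow_mul, ← pow_mul, mul_comm j 3,
          mul_comm j 2, pow_mul, pow_mul, div_eq_mul_inv, ← inv_pow]
        norm_num
      rw [h3, Real.norm_eq_abs] at h2
      have h4 := abs_le_of_sq_le_sq h2 (by positivity)
      rw [abs_abs] at h4
      refine h4.trans ?_
      rw [hΛ]
      have : (0 : ℝ) < 8 ^ j := by positivity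
      nlinarith
    filter_upwards [h1] with z hz
    exact enorm_rpow_le_tsum hs hΛ1 fun j => hz j z.2
  refine (lintegral_mono_ae hpt).trans ?_
  rw [lintegral_add_left measurable_const, lintegral_const, lintegral_tsum fun j => by
    have := hcm j; exact Measurable.aemeasurable (by fun_prop)]
  gcongr with j
  have := hcm j
  rw [lintegral_const_mul _ (by fun_prop), ← hterm j]
  gcongr
  refine lintegral_conv_sub_sq_le hP hg hper (hg2.integrable (by norm_num))
    (contDiff_scl hρ).continuous (r := (1 / 4) ^ j)
    (fun y hy => scl_eq_zero (hε j) hρ0 y (by linarith))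
    (scl_nonneg (hε j) hρpos) ((integral_scl (hε j) ρ).trans hρ1) fun y hy => ?_
  refine (hmod y).trans (ENNReal.ofReal_le_ofReal ?_)
  gcongr

lemma eLpNorm_le_sum_coord {α : Type*} [MeasurableSpace α] {m : Measure α} {q : ℝ≥0∞} (hq : 1 ≤ q)
    {u : α → E3} (hu : Measurable u) : eLpNorm u q m ≤ ∑ j, eLpNorm (fun z => u z j) q m := by
  have h1 : eLpNorm u q m ≤ eLpNorm (∑ j, fun z => |u z j|) q m := by
    refine eLpNorm_mono fun z => ?_
    rw [Finset.sum_apply, Real.norm_of_nonneg (by positivity), EuclideanSpace.norm_eq]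
    refine Real.sqrt_le_iff.2 ⟨by positivity, ?_⟩
    simp only [Fin.sum_univ_three, Real.norm_eq_abs]
    nlinarith [abs_nonneg (u z 0), abs_nonneg (u z 1), abs_nonneg (u z 2),
      mul_nonneg (abs_nonneg (u z 0)) (abs_nonneg (u z 1)),
      mul_nonneg (abs_nonneg (u z 0)) (abs_nonneg (u z 2)),
      mul_nonneg (abs_nonneg (u z 1)) (abs_nonneg (u z 2))]
  refine h1.trans ((eLpNorm_sum_le (fun j _ => ?_) hq).trans (le_of_eq ?_))
  · exact Measurable.aestronglyMeasurable (by fun_prop)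
  · refine Finset.sum_congr rfl fun j _ => eLpNorm_congr_norm_ae (Eventually.of_forall fun z => ?_)
    simp

/-- Convergence in `L²` and boundedness in `L^r` give convergence in between. -/
lemma tendsto_eLpNorm_interp {α : Type*} [MeasurableSpace α] {m : Measure α} {u : ℕ → α → E3}
    {v : α → E3} (hu : ∀ n, Measurable (u n)) (hv : Measurable v) (hv2 : MemLp v 2 m)
    (h2 : Tendsto (fun n => eLpNorm (u n - v) 2 m) atTop (𝓝 0)) {r : ℝ} (hr : 2 < r) {B : ℝ≥0∞}
    (hB : B ≠ ⊤) (hb : ∀ n, eLpNorm (u n) (ENNReal.ofReal r) m ≤ B) :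
    MemLp v (ENNReal.ofReal ((2 + r) / 2)) m ∧
      Tendsto (fun n => eLpNorm (u n - v) (ENNReal.ofReal ((2 + r) / 2)) m) atTop (𝓝 0) := by
  have hr0 : 0 < r := by linarith
  have hq0 : 0 < (2 + r) / 2 := by linarith
  -- The bound in the higher norm passes to the limit by Fatou along an almost everywhere convergent
  -- subsequence.
  have hvr : eLpNorm v (ENNReal.ofReal r) m ≤ B := by
    obtain ⟨ns, -, hns⟩ := (tendstoInMeasure_of_tendsto_eLpNorm (by norm_num)
      (fun n => (hu n).aestronglyMeasurable) hv.aestronglyMeasurable h2).exists_seq_tendsto_ae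
    refine (Lp.eLpNorm_lim_le_liminf_eLpNorm (f := fun n => u (ns n))
      (fun n => (hu _).aestronglyMeasurable) v hns).trans ?_
    refine (liminf_le_liminf (v := fun _ => B) (Eventually.of_forall fun n => hb _)).trans ?_
    simp
  -- Cauchy-Schwarz on |w|·|w|^(r/2), whose exponent is 1 + r/2 = (2 + r)/2.
  have key : ∀ w : α → E3, Measurable w →
      eLpNorm w (ENNReal.ofReal ((2 + r) / 2)) m ^ ((2 + r) / 2) ≤
        eLpNorm w 2 m * eLpNorm w (ENNReal.ofReal r) m ^ (r / 2) := fun w hw => by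
    rw [eLpNorm_eq_lintegral_rpow_enorm_toReal (p := ENNReal.ofReal ((2 + r) / 2)) (by simp; linarith)
        (by simp),
      eLpNorm_eq_lintegral_rpow_enorm_toReal (p := 2) (by simp) (by simp),
      eLpNorm_eq_lintegral_rpow_enorm_toReal (p := ENNReal.ofReal r) (by simpa) (by simp),
      ENNReal.toReal_ofReal hq0.le, ENNReal.toReal_ofReal hr0.le, ← ENNReal.rpow_mul,
      ← ENNReal.rpow_mul, one_div_mul_cancel hq0.ne', ENNReal.rpow_one,
      show 1 / r * (r / 2) = 1 / 2 by field_simp]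
    have h := ENNReal.lintegral_mul_le_Lp_mul_Lq m (Real.HolderConjugate.two_two)
      (f := fun z => ‖w z‖ₑ) (g := fun z => ‖w z‖ₑ ^ (r / 2)) (by fun_prop) (by fun_prop)
    refine le_trans (le_of_eq ?_) (h.trans (le_of_eq ?_))
    · refine lintegral_congr fun z => ?_
      simp only [Pi.mul_apply]
      nth_rewrite 2 [← ENNReal.rpow_one ‖w z‖ₑ]
      rw [← ENNReal.rpow_add_of_nonneg _ _ (by norm_num) (by positivity)]
      congr 1; ring
    · simp only [← ENNReal.rpow_mul, ENNReal.toReal_ofNat]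
      rw [show r / 2 * 2 = r by ring]
  have hB2 : (B + B) ^ (r / 2) ≠ ⊤ := by finiteness
  have hone : 1 ≤ ENNReal.ofReal r := by rw [ENNReal.one_le_ofReal]; linarith
  refine ⟨⟨hv.aestronglyMeasurable, ?_⟩, ?_⟩
  · have h1 := (key v hv).trans_lt (ENNReal.mul_lt_top hv2.2
      (ENNReal.rpow_lt_top_of_nonneg (by positivity) (hvr.trans_lt hB.lt_top).ne))
    by_contra hcon
    rw [not_lt, top_le_iff] at hcon
    rw [hcon, ENNReal.top_rpow_of_pos hq0] at h1
    exact h1.ne rfl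
  · have h1 : Tendsto (fun n => (eLpNorm (u n - v) 2 m * (B + B) ^ (r / 2)) ^ (1 / ((2 + r) / 2)))
        atTop (𝓝 0) := by
      have h3 := ENNReal.Tendsto.mul_const (b := (B + B) ^ (r / 2)) h2 (Or.inr hB2)
      rw [zero_mul] at h3
      have h4 := ((ENNReal.continuous_rpow_const (y := 1 / ((2 + r) / 2))).tendsto 0).comp h3
      rw [ENNReal.zero_rpow_of_pos (by positivity)] at h4
      exact h4
    refine tendsto_of_tendsto_of_tendsto_of_le_of_le tendsto_const_nhds h1 (fun _ => zero_le)
      fun n => ?_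
    have h3 := key (u n - v) ((hu n).sub hv)
    have h4 : eLpNorm (u n - v) (ENNReal.ofReal r) m ≤ B + B :=
      (eLpNorm_sub_le (hu n).aestronglyMeasurable hv.aestronglyMeasurable hone).trans
        (add_le_add (hb n) hvr)
    have h5 := ENNReal.rpow_le_rpow (h3.trans (mul_le_mul_right
      (ENNReal.rpow_le_rpow h4 (by positivity : 0 ≤ r / 2)) _))
      (by positivity : 0 ≤ 1 / ((2 + r) / 2))
    rwa [← ENNReal.rpow_mul, mul_one_div_cancel hq0.ne', ENNReal.rpow_one] at h5

/-- Convergence in some `L^q` with `q > 2`. -/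
theorem exists_tendsto_eLpNorm {T P : ℝ} (hP : 0 < P) {u : ℕ → ℝ × E3 → E3}
    {v : ℝ × E3 → E3} (hu : ∀ n, Measurable (u n)) (hup : ∀ n, PeriodicTX P (u n))
    (hu2 : ∀ n, MemLp (u n) 2 (cylMeasure T P)) (hv : Measurable v)
    (hv2 : MemLp v 2 (cylMeasure T P))
    (h2 : Tendsto (fun n => eLpNorm (u n - v) 2 (cylMeasure T P)) atTop (𝓝 0))
    {M : ℝ} (hM0 : 0 ≤ M) (hM : ∀ n, ∀ᵐ t ∂(volume.restrict (Ioo 0 T)),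
      ∫⁻ x, ‖u n (t, x)‖ₑ ^ 2 ∂(cellMeasure P) ≤ ENNReal.ofReal M)
    {s C : ℝ} (hs : 0 < s) (hC : 0 ≤ C) (hmod : ∀ n j y,
      ∫⁻ z, ‖u n (z.1, z.2 + y) j - u n z j‖ₑ ^ 2 ∂(cylMeasure T P) ≤
        ENNReal.ofReal (C * ‖y‖ ^ (2 * s))) :
    ∃ q : ℝ, 2 < q ∧ MemLp v (ENNReal.ofReal q) (cylMeasure T P) ∧
      Tendsto (fun n => eLpNorm (u n - v) (ENNReal.ofReal q) (cylMeasure T P)) atTop (𝓝 0) := by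
  obtain ⟨B, hB, hb⟩ := exists_lintegral_rpow_le (T := T) hP hM0 hs hC
  have hone : 1 ≤ ENNReal.ofReal (2 + s) := by rw [ENNReal.one_le_ofReal]; linarith
  refine ⟨(2 + (2 + s)) / 2, by linarith, tendsto_eLpNorm_interp hu hv hv2 h2 (by linarith)
    (B := ∑ _j : Fin 3, B ^ (1 / (2 + s))) (by
      rw [ENNReal.sum_ne_top]
      intro j _
      exact ENNReal.rpow_ne_top_of_nonneg (by positivity) hB) fun n => ?_⟩
  refine (eLpNorm_le_sum_coord hone (hu n)).trans (Finset.sum_le_sum fun j _ => ?_)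
  rw [eLpNorm_eq_lintegral_rpow_enorm_toReal (by simp; linarith) (by simp),
    ENNReal.toReal_ofReal (by linarith)]
  refine ENNReal.rpow_le_rpow (hb _ (by have := hu n; fun_prop) ((hup n).coord j)
    (memLp_apply (hu2 n) j) ?_ (hmod n j)) (by positivity)
  filter_upwards [hM n] with t ht
  refine (lintegral_mono fun x => ?_).trans ht
  gcongr
  exact enorm_coord_le _ _

/-! ### Young measures -/

/-- Truncation to the unit interval. -/
def clamp (s : ℝ) : ℝ := max 0 (min 1 s)

lemma continuous_clamp : Continuous clamp := by unfold clamp; fun_prop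

lemma clamp_mem (s : ℝ) : clamp s ∈ Icc (0 : ℝ) 1 :=
  ⟨le_max_left _ _, max_le zero_le_one (min_le_left _ _)⟩

lemma clamp_eq_self {s : ℝ} (hs : s ∈ Icc (0 : ℝ) 1) : clamp s = s := by
  rw [clamp, min_eq_right hs.2, max_eq_right hs.1]

lemma exists_bound_comp_clamp {β : ℝ → ℝ} (hβ : Continuous β) : ∃ B, 0 ≤ B ∧ ∀ s, ‖β (clamp s)‖ ≤ B := by
  obtain ⟨B, hB⟩ := (isCompact_Icc (a := (0 : ℝ)) (b := 1)).exists_bound_of_continuousOn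
    hβ.continuousOn
  exact ⟨B, (norm_nonneg _).trans (hB _ (clamp_mem 0)), fun s => hB _ (clamp_mem s)⟩

/-- For bounded sequences weak-star convergence can be tested on bounded continuous functions. -/
lemma tendstoWeakStar_of_boundedContinuous {m : Measure (ℝ × E3)} [IsFiniteMeasure m]
    {g : ℕ → ℝ × E3 → ℝ} {g' : ℝ × E3 → ℝ} (hg : ∀ n, AEStronglyMeasurable (g n) m)
    (hg' : AEStronglyMeasurable g' m) {B : ℝ} (hB0 : 0 ≤ B) (hB : ∀ n z, ‖g n z‖ ≤ B)
    (hB' : ∀ z, ‖g' z‖ ≤ B)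
    (h : ∀ k : BoundedContinuousFunction (ℝ × E3) ℝ,
      Tendsto (fun n => ∫ z, g n z * k z ∂m) atTop (𝓝 (∫ z, g' z * k z ∂m))) :
    TendstoWeakStar m g g' := by
  intro h₀ hi
  have key : ∀ (w : ℝ × E3 → ℝ), AEStronglyMeasurable w m → (∀ z, ‖w z‖ ≤ B) →
      ∀ k : BoundedContinuousFunction (ℝ × E3) ℝ, Integrable k m →
      |∫ z, w z * h₀ z ∂m - ∫ z, w z * k z ∂m| ≤ B * ∫ z, ‖h₀ z - k z‖ ∂m := by
    intro w hw hwB k hk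
    have i1 : Integrable (fun z => w z * h₀ z) m := hi.bdd_mul (c := B) hw
      (Eventually.of_forall hwB)
    have i2 : Integrable (fun z => w z * k z) m := hk.bdd_mul (c := B) hw
      (Eventually.of_forall hwB)
    rw [← integral_sub i1 i2, ← integral_const_mul]
    rw [← Real.norm_eq_abs]
    refine (norm_integral_le_integral_norm _).trans (integral_mono_of_nonneg
      (Eventually.of_forall fun z => norm_nonneg (w z * h₀ z - w z * k z)) ((integrable_fun_sub hi hk).norm.const_mul B)
      (Eventually.of_forall fun z => ?_))
    simp only
    rw [← mul_sub, norm_mul]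
    exact mul_le_mul_of_nonneg_right (hwB z) (norm_nonneg _)
  rw [Metric.tendsto_atTop]
  -- Density of bounded continuous functions in L¹ and the uniform bound B reduce the claim to the
  -- tested case, with an error of at most ε/4 on each side.
  intro ε hε
  obtain ⟨k, hk, hki⟩ := hi.exists_boundedContinuous_integral_sub_le
    (ε := ε / (4 * (B + 1))) (by positivity)
  obtain ⟨N, hN⟩ := Metric.tendsto_atTop.1 (h k) (ε / 4) (by positivity)
  refine ⟨N, fun n hn => ?_⟩
  have h1 := key (g n) (hg n) (hB n) k hki
  have h2 := key g' hg' hB' k hki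
  have h3 := hN n hn
  rw [Real.dist_eq] at h3 ⊢
  have h4 : B * ∫ z, ‖h₀ z - k z‖ ∂m ≤ ε / 4 := by
    calc B * ∫ z, ‖h₀ z - k z‖ ∂m ≤ B * (ε / (4 * (B + 1))) := by gcongr
      _ ≤ (B + 1) * (ε / (4 * (B + 1))) := by gcongr; linarith
      _ = ε / 4 := by field_simp
  rw [abs_lt] at h3 ⊢
  rw [abs_le] at h1 h2
  constructor <;> linarith [h1.1, h1.2, h2.1, h2.2, h3.1, h3.2]

lemma measurable_integral_kernel {ν : Kernel (ℝ × E3) ℝ} [IsMarkovKernel ν] {β : ℝ → ℝ}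
    (hβ : Continuous β) : Measurable fun z => ∫ s, β s ∂(ν z) :=
  (MeasureTheory.StronglyMeasurable.integral_kernel (κ := ν)
    hβ.measurable.stronglyMeasurable).measurable

lemma ae_mem_Icc_of_carried {ν : Kernel (ℝ × E3) ℝ} (hν : ∀ z, ν z (Icc 0 1)ᶜ = 0) (z : ℝ × E3) :
    ∀ᵐ s ∂(ν z), s ∈ Icc (0 : ℝ) 1 := by
  rw [ae_iff]; exact hν z

lemma integral_kernel_eq_clamp {ν : Kernel (ℝ × E3) ℝ} (hν : ∀ z, ν z (Icc 0 1)ᶜ = 0)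
    (β : ℝ → ℝ) (z : ℝ × E3) : ∫ s, β s ∂(ν z) = ∫ s, β (clamp s) ∂(ν z) := by
  refine integral_congr_ae ?_
  filter_upwards [ae_mem_Icc_of_carried hν z] with s hs
  rw [clamp_eq_self hs]

lemma norm_integral_kernel_le {ν : Kernel (ℝ × E3) ℝ} [IsMarkovKernel ν] {β : ℝ → ℝ} {B : ℝ}
    (hβ : ∀ s, ‖β s‖ ≤ B) (z : ℝ × E3) : ‖∫ s, β s ∂(ν z)‖ ≤ B := by
  have := norm_integral_le_of_norm_le_const (μ := ν z) (Eventually.of_forall hβ)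
  simpa using this

/-- A kernel which is carried by the unit interval almost everywhere can be replaced by a periodic
one which is so everywhere. -/
lemma exists_periodic_kernel {T P : ℝ} (hP : 0 < P) (κ : Kernel (ℝ × E3) ℝ) [IsMarkovKernel κ]
    (h : ∀ᵐ z ∂(cylMeasure T P), κ z (Icc 0 1)ᶜ = 0) :
    ∃ ν : Kernel (ℝ × E3) ℝ, IsMarkovKernel ν ∧ PeriodicTX P (fun z => ν z) ∧
      (∀ z, ν z (Icc 0 1)ᶜ = 0) ∧ ∀ᵐ z ∂(cylMeasure T P), ν z = κ z := by
  classical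
  have hr : Measurable fun z : ℝ × E3 => (z.1, red P z.2) :=
    measurable_fst.prodMk ((measurable_red P).comp measurable_snd)
  have hs : MeasurableSet {z | κ z (Icc (0 : ℝ) 1)ᶜ = 0} :=
    (κ.measurable_coe measurableSet_Icc.compl) (measurableSet_singleton 0)
  -- On the null set where the kernel charges the outside of [0,1] it is replaced by a point mass at
  -- 0, and composing with the reduction to the cell makes it periodic.
  refine ⟨(Kernel.piecewise hs κ (Kernel.const _ (Measure.dirac 0))).comap _ hr, inferInstance,
    fun t x i => ?_, fun z => ?_, ?_⟩
  · simp only [Kernel.comap_apply, red_periodic hP x i]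
  · rw [Kernel.comap_apply, Kernel.piecewise_apply]
    split_ifs with hz
    · exact hz
    · rw [Kernel.const_apply, Measure.dirac_apply' _ measurableSet_Icc.compl]
      simp
  · filter_upwards [h, ae_cyl_mem_halfCell T P] with z hz hz2
    rw [Kernel.comap_apply, Kernel.piecewise_apply]
    simp only [red_eq_self hP hz2]
    rw [if_pos]
    exact hz

lemma cylMeasure_ne_zero {T P : ℝ} (hT : 0 < T) (hP : 0 < P) : NeZero (cylMeasure T P) := by
  refine ⟨fun h => ?_⟩
  have h1 : cylMeasure T P univ = 0 := by rw [h]; simp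
  rw [cylMeasure_eq_prod, ← univ_prod_univ, Measure.prod_prod, Measure.restrict_apply_univ,
    Real.volume_Ioo, cellMeasure, Measure.restrict_apply_univ, volume_cell hP,
    mul_eq_zero, ENNReal.ofReal_eq_zero, ENNReal.ofReal_eq_zero] at h1
  have : 0 < P ^ 3 := by positivity
  rcases h1 with h1 | h1 <;> linarith

/-- Sequences with values in a cube have a subsequence generating a Young measure. -/
lemma exists_subseq_kernel {T P : ℝ} (hT : 0 < T) (hP : 0 < P) {I : ℕ}
    {v : ℕ → ℝ × E3 → Fin I → ℝ} (hv : ∀ n, Measurable (v n))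
    (hv1 : ∀ n z i, v n z i ∈ Icc (0 : ℝ) 1) :
    ∃ σ : ℕ → ℕ, StrictMono σ ∧ ∃ κ : Kernel (ℝ × E3) (Fin I → ℝ), IsMarkovKernel κ ∧
      (∀ᵐ z ∂(cylMeasure T P), ∀ᵐ y ∂(κ z), ∀ i, y i ∈ Icc (0 : ℝ) 1) ∧
      ∀ (k : BoundedContinuousFunction (ℝ × E3) ℝ)
        (b : BoundedContinuousFunction (Fin I → ℝ) ℝ),
        Tendsto (fun n => ∫ z, b (v (σ n) z) * k z ∂(cylMeasure T P)) atTop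
          (𝓝 (∫ z, (∫ y, b y ∂(κ z)) * k z ∂(cylMeasure T P))) := by
  have hne := cylMeasure_ne_zero hT hP
  set m := cylMeasure T P with hm
  -- The cylinder measure is normalized so that the graphs carry probability measures; the factor is
  -- removed at the end.
  set c : ℝ≥0∞ := (m univ)⁻¹ with hc
  have hc0 : c ≠ 0 := by simp [hc]
  have hct : c ≠ ⊤ := by simp [hc, NeZero.ne]
  have hpm : IsProbabilityMeasure (c • m) := isProbabilityMeasureSMul
  have hg : ∀ n, Measurable fun z => (z, v n z) := fun n => measurable_id.prodMk (hv n)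
  let π : ℕ → ProbabilityMeasure ((ℝ × E3) × (Fin I → ℝ)) := fun n =>
    ⟨(c • m).map fun z => (z, v n z), Measure.isProbabilityMeasure_map (hg n).aemeasurable⟩
  set K : Set ((ℝ × E3) × (Fin I → ℝ)) := (Icc 0 T ×ˢ cell P) ×ˢ Icc 0 1 with hK
  have hKc : IsCompact K := (isCompact_Icc.prod (isCompact_cell P)).prod isCompact_Icc
  have hmc : m (Icc 0 T ×ˢ cell P)ᶜ = 0 := by
    rw [hm, cylMeasure, Measure.restrict_apply
      (measurableSet_Icc.prod (measurableSet_cell P)).compl]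
    refine measure_mono_null (t := ∅) ?_ measure_empty
    rintro z ⟨hz1, hz2⟩
    exact hz1 ⟨Ioo_subset_Icc_self hz2.1, hz2.2⟩
  -- All graph measures live on the single compact set K, so tightness is immediate and Prokhorov
  -- gives a limit, which is also carried by K.
  have hcomp := isCompact_setOfPred_probabilityMeasure_mass_eq_compl_isCompact_le
    (E := (ℝ × E3) × (Fin I → ℝ)) (u := fun _ => 0) (K := fun _ => K) tendsto_const_nhds
    (fun _ => hKc) (Or.inl inferInstance)
  have hmem : ∀ n, π n ∈ {μ : ProbabilityMeasure ((ℝ × E3) × (Fin I → ℝ)) |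
      ∀ _n : ℕ, μ Kᶜ ≤ 0} := fun n _ => by
    rw [nonpos_iff_eq_zero, ProbabilityMeasure.null_iff_toMeasure_null]
    change ((c • m).map fun z => (z, v n z)) Kᶜ = 0
    rw [Measure.map_apply (hg n) hKc.measurableSet.compl, Measure.smul_apply, smul_eq_mul,
      mul_eq_zero]
    refine Or.inr (measure_mono_null (fun z hz => ?_) hmc)
    intro hz2
    exact hz ⟨hz2, fun i => (hv1 n z i).1, fun i => (hv1 n z i).2⟩
  obtain ⟨θ, hθ, σ, hσ, hlim⟩ := hcomp.tendsto_subseq hmem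
  rw [ProbabilityMeasure.tendsto_iff_forall_integral_tendsto] at hlim
  have hθ0 : (θ : Measure ((ℝ × E3) × (Fin I → ℝ))) Kᶜ = 0 := by
    rw [← ProbabilityMeasure.null_iff_toMeasure_null]
    exact nonpos_iff_eq_zero.1 (hθ 0)
  have hmap : ∀ n (F : BoundedContinuousFunction ((ℝ × E3) × (Fin I → ℝ)) ℝ),
      ∫ x, F x ∂(π n : Measure _) = c.toReal * ∫ z, F (z, v n z) ∂m := fun n F => by
    change ∫ x, F x ∂((c • m).map fun z => (z, v n z)) = _
    rw [integral_map (hg n).aemeasurable F.continuous.aestronglyMeasurable, integral_smul_measure,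
      smul_eq_mul]
  -- Every graph measure has the same first marginal, hence so does the limit; disintegrating over
  -- it produces the kernel.
  have hfst : (θ : Measure ((ℝ × E3) × (Fin I → ℝ))).fst = c • m := by
    refine ext_of_forall_integral_eq_of_IsFiniteMeasure fun k => ?_
    have h1 := hlim (k.compContinuous ⟨Prod.fst, continuous_fst⟩)
    have h2 : ∀ n, ∫ x, (k.compContinuous ⟨Prod.fst, continuous_fst⟩) x
        ∂((π ∘ σ) n : Measure ((ℝ × E3) × (Fin I → ℝ))) = ∫ z, k z ∂(c • m) := fun n => by
      rw [Function.comp_apply, hmap, integral_smul_measure, smul_eq_mul]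
      rfl
    simp only [h2] at h1
    rw [Measure.fst, integral_map measurable_fst.aemeasurable k.continuous.aestronglyMeasurable]
    exact (tendsto_nhds_unique h1 tendsto_const_nhds)
  have hdis := Measure.disintegrate (θ : Measure ((ℝ × E3) × (Fin I → ℝ)))
    (θ : Measure ((ℝ × E3) × (Fin I → ℝ))).condKernel
  rw [hfst] at hdis
  set κ := (θ : Measure ((ℝ × E3) × (Fin I → ℝ))).condKernel with hκ
  refine ⟨σ, hσ, κ, inferInstance, ?_, fun k b => ?_⟩
  · have h1 : ∀ᵐ x ∂((c • m) ⊗ₘ κ), x ∈ K := by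
      rw [hdis, ae_iff]; exact hθ0
    have h2 := Measure.ae_ae_of_ae_compProd h1
    rw [Measure.ae_ennreal_smul_measure_iff hc0] at h2
    filter_upwards [h2] with z hz
    filter_upwards [hz] with y hy i
    exact ⟨hy.2.1 i, hy.2.2 i⟩
  · set F : BoundedContinuousFunction ((ℝ × E3) × (Fin I → ℝ)) ℝ :=
      (b.compContinuous ⟨Prod.snd, continuous_snd⟩) * (k.compContinuous ⟨Prod.fst, continuous_fst⟩)
      with hF
    have hFa : ∀ z y, F (z, y) = b y * k z := fun z y => rfl
    have h1 := hlim F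
    have h2 : ∫ x, F x ∂(θ : Measure ((ℝ × E3) × (Fin I → ℝ))) =
        c.toReal * ∫ z, (∫ y, b y ∂(κ z)) * k z ∂m := by
      rw [← hdis, Measure.integral_compProd (F.integrable _), integral_smul_measure, smul_eq_mul]
      simp only [hFa, integral_mul_const]
    simp only [Function.comp_apply] at h1
    rw [h2] at h1
    simp only [hmap] at h1
    simp only [hFa] at h1
    have hc' : c.toReal ≠ 0 := (ENNReal.toReal_pos hc0 hct).ne'
    have h3 := h1.const_mul c.toReal⁻¹
    simpa only [← mul_assoc, inv_mul_cancel₀ hc', one_mul] using h3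

/-- Existence of Young measures for finitely many sequences at once. -/
theorem exists_youngMeasure {T P : ℝ} (hT : 0 < T) (hP : 0 < P) {I : ℕ}
    {v : ℕ → Fin I → ℝ × E3 → ℝ} (hv : ∀ n i, Measurable (v n i))
    (hv1 : ∀ n i z, v n i z ∈ Icc (0 : ℝ) 1) :
    ∃ σ : ℕ → ℕ, StrictMono σ ∧ ∃ ν : Fin I → Kernel (ℝ × E3) ℝ,
      ∀ i, IsYoungMeasure T P (fun n => v (σ n) i) (ν i) := by
  obtain ⟨σ, hσ, κ, hκ, hcar, hlim⟩ := exists_subseq_kernel hT hP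
    (v := fun n z i => v n i z) (fun n => measurable_pi_lambda _ fun i => hv n i)
    fun n z i => hv1 n i z
  have hmk : ∀ i, IsMarkovKernel (κ.map fun y => y i) := fun i =>
    Kernel.IsMarkovKernel.map _ (measurable_pi_apply i)
  have hex : ∀ i, ∃ ν : Kernel (ℝ × E3) ℝ, IsMarkovKernel ν ∧ PeriodicTX P (fun z => ν z) ∧
      (∀ z, ν z (Icc 0 1)ᶜ = 0) ∧
      ∀ᵐ z ∂(cylMeasure T P), ν z = (κ.map fun y => y i) z := fun i => by
    refine exists_periodic_kernel hP _ ?_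
    filter_upwards [hcar] with z hz
    rw [Kernel.map_apply _ (measurable_pi_apply i),
      Measure.map_apply (measurable_pi_apply i) measurableSet_Icc.compl]
    rw [ae_iff] at hz
    refine measure_mono_null (fun y (hy : y i ∈ (Icc (0 : ℝ) 1)ᶜ) => ?_) hz
    exact fun hy2 => hy (hy2 i)
  choose ν hν1 hν2 hν3 hν4 using hex
  refine ⟨σ, hσ, ν, fun i => ⟨hν1 i, hν2 i, hν3 i, fun β hβ => ?_⟩⟩
  obtain ⟨B, hB0, hB⟩ := exists_bound_comp_clamp hβ
  have hβc : Continuous fun s => β (clamp s) := hβ.comp continuous_clamp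
  simp only [integral_kernel_eq_clamp (hν3 i) β]
  have := hν1 i
  refine tendstoWeakStar_of_boundedContinuous
    (fun n => (hβ.measurable.comp (hv (σ n) i)).aestronglyMeasurable)
    (measurable_integral_kernel hβc).aestronglyMeasurable hB0 (fun n z => ?_)
    (norm_integral_kernel_le hB) fun k => ?_
  · rw [← clamp_eq_self (hv1 (σ n) i z)]; exact hB _
  -- A continuous β may be unbounded on the line. Truncating its argument to [0,1] makes it a
  -- legitimate test and changes nothing, since the sequence and the limit kernel both stay in
  -- [0,1].
  · have h1 := hlim k (BoundedContinuousFunction.ofNormedAddCommGroup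
      (fun y : Fin I → ℝ => β (clamp (y i))) (hβc.comp (continuous_apply i)) B fun y => hB _)
    simp only [BoundedContinuousFunction.coe_ofNormedAddCommGroup] at h1
    have h2 : ∫ z, (∫ y, β (clamp (y i)) ∂(κ z)) * k z ∂(cylMeasure T P) =
        ∫ z, (∫ s, β (clamp s) ∂(ν i z)) * k z ∂(cylMeasure T P) := by
      refine integral_congr_ae ?_
      filter_upwards [hν4 i] with z hz
      rw [hz, Kernel.map_apply _ (measurable_pi_apply i),
        integral_map (measurable_pi_apply i).aemeasurable hβc.aestronglyMeasurable]
    rw [h2] at h1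
    refine h1.congr fun n => ?_
    congr 1; ext z
    rw [clamp_eq_self (hv1 (σ n) i z)]

/-! ### Passage to the limit in the weak formulations -/

/-- Pairings of periodic functions with a compactly supported function are integrals over the
cylinder against the periodization of that function. -/
lemma exists_periodization {P : ℝ} (hP : 0 < P) {φ : ℝ × E3 → ℝ} (hc : Continuous φ)
    (hs : HasCompactSupport φ) :
    ∃ Φ : ℝ × E3 → ℝ, Continuous Φ ∧ (∃ B, 0 ≤ B ∧ ∀ z, ‖Φ z‖ ≤ B) ∧
      ∀ (T : ℝ) (g : ℝ × E3 → ℝ), PeriodicTX P g → Integrable g (cylMeasure T P) →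
        ∫ z, g z * φ z ∂(slabMeasure T) = ∫ z, g z * Φ z ∂(cylMeasure T P) := by
  obtain ⟨R, hR⟩ := (hs.isCompact.image continuous_snd).isBounded.subset_closedBall 0
  obtain ⟨R', hR'⟩ := (isCompact_cell P).isBounded.subset_closedBall 0
  -- Only finitely many lattice translates of the cell meet the spatial support, so the
  -- periodization is a finite sum. It is used only on the cell, where omitted terms vanish.
  have hfin : (Metric.closedBall (0 : E3) (R + R') ∩ (lattice hP : Set E3)).Finite :=
    ZSpan.setFinite_inter (latticeBasis hP) Metric.isBounded_closedBall
  have hfin' : {ℓ : lattice hP | (ℓ : E3) ∈ Metric.closedBall (0 : E3) (R + R')}.Finite :=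
    Set.Finite.of_finite_image (f := Subtype.val) (hfin.subset (by
      rintro _ ⟨ℓ, hℓ, rfl⟩
      exact ⟨hℓ, ℓ.2⟩)) Subtype.val_injective.injOn
  set S := hfin'.toFinset with hS
  have hzero : ∀ ℓ : lattice hP, ℓ ∉ S → ∀ t, ∀ x ∈ cell P, φ (t, ℓ +ᵥ x) = 0 := by
    intro ℓ hℓ t x hx
    by_contra hne
    have h1 : (ℓ +ᵥ x : E3) ∈ Metric.closedBall (0 : E3) R :=
      hR ⟨(t, ℓ +ᵥ x), subset_tsupport φ hne, rfl⟩
    have h2 := hR' hx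
    rw [mem_closedBall_zero_iff] at h1 h2
    refine hℓ (hfin'.mem_toFinset.2 ?_)
    change (ℓ : E3) ∈ Metric.closedBall (0 : E3) (R + R')
    rw [mem_closedBall_zero_iff]
    calc ‖(ℓ : E3)‖ = ‖(ℓ +ᵥ x : E3) - x‖ := by
          rw [AddSubgroup.vadd_def, vadd_eq_add, add_sub_cancel_right]
      _ ≤ ‖(ℓ +ᵥ x : E3)‖ + ‖x‖ := norm_sub_le _ _
      _ ≤ R + R' := add_le_add h1 h2
  obtain ⟨M, hM⟩ := hs.exists_bound_of_continuous hc
  have hM0 : 0 ≤ M := (norm_nonneg _).trans (hM 0)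
  have hΦc : Continuous fun z : ℝ × E3 => ∑ ℓ ∈ S, φ (z.1, (ℓ : E3) + z.2) :=
    continuous_finsetSum _ fun ℓ _ => hc.comp (by fun_prop)
  have hΦb : ∀ z : ℝ × E3, ‖∑ ℓ ∈ S, φ (z.1, (ℓ : E3) + z.2)‖ ≤ ∑ _ℓ ∈ S, M := fun z =>
    (norm_sum_le _ _).trans (Finset.sum_le_sum fun ℓ _ => hM _)
  refine ⟨fun z => ∑ ℓ ∈ S, φ (z.1, (ℓ : E3) + z.2), hΦc,
    ⟨_, Finset.sum_nonneg fun _ _ => hM0, hΦb⟩, fun T g hg hi => ?_⟩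
  have hi1 := integrable_slab_mul_of_integrable hP hg hi hc hs
  have hi2 : Integrable (fun z : ℝ × E3 => g z * ∑ ℓ ∈ S, φ (z.1, (ℓ : E3) + z.2))
      (cylMeasure T P) :=
    hi.mul_bdd (c := ∑ _ℓ ∈ S, M) hΦc.aestronglyMeasurable (Eventually.of_forall hΦb)
  rw [integral_cyl_eq hi2]
  rw [slabMeasure_eq_prod] at hi1 ⊢
  rw [integral_prod _ hi1]
  rw [cylMeasure_eq_prod] at hi
  refine integral_congr_ae ?_
  filter_upwards [hi1.prod_right_ae, hi.prod_right_ae] with t ht ht2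
  rw [(isAddFundamentalDomain_cell hP).integral_eq_tsum'' _ ht, tsum_eq_sum (s := S)]
  · simp only [Finset.mul_sum]
    rw [integral_finsetSum]
    · refine Finset.sum_congr rfl fun ℓ _ => ?_
      simp only [(hg t).vadd hP ℓ]
      rfl
    · intro ℓ _
      exact ht2.mul_bdd (c := M) (Continuous.aestronglyMeasurable (hc.comp (by fun_prop)))
        (Eventually.of_forall fun x => hM _)
  · intro ℓ hℓ
    refine setIntegral_eq_zero_of_forall_eq_zero fun x hx => ?_
    rw [hzero ℓ hℓ t x hx, mul_zero]

/-- Product of a bounded weak-star convergent factor with one converging strongly in L¹. After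
periodization of the test function, the limit of the second factor times the test function is a
fixed L¹ function for the weak-star limit, and the remainder is bounded in L¹ uniformly in the first
factor. -/
lemma tendsto_integral_slab_mul {T P : ℝ} (hP : 0 < P) {c : ℕ → ℝ × E3 → ℝ} {c' : ℝ × E3 → ℝ}
    {w : ℕ → ℝ × E3 → ℝ} {w' : ℝ × E3 → ℝ} (hc : ∀ n, Measurable (c n)) (hc' : Measurable c')
    {B : ℝ} (hB : ∀ n z, ‖c n z‖ ≤ B) (hB' : ∀ z, ‖c' z‖ ≤ B) (hcp : ∀ n, PeriodicTX P (c n))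
    (hcp' : PeriodicTX P c') (hw : ∀ n, Integrable (w n) (cylMeasure T P))
    (hw' : Integrable w' (cylMeasure T P)) (hwp : ∀ n, PeriodicTX P (w n))
    (hwp' : PeriodicTX P w') (hcw : TendstoWeakStar (cylMeasure T P) c c')
    (hww : Tendsto (fun n => eLpNorm (w n - w') 1 (cylMeasure T P)) atTop (𝓝 0))
    {φ : ℝ × E3 → ℝ} (hφ : Continuous φ) (hφs : HasCompactSupport φ) :
    Tendsto (fun n => ∫ z, c n z * w n z * φ z ∂(slabMeasure T)) atTop
      (𝓝 (∫ z, c' z * w' z * φ z ∂(slabMeasure T))) := by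
  obtain ⟨Φ, hΦ, ⟨A, hA0, hA⟩, hInt⟩ := exists_periodization hP hφ hφs
  have hB0 : 0 ≤ B := (norm_nonneg _).trans (hB' 0)
  have i1 : ∀ n, Integrable (fun z => c n z * w n z) (cylMeasure T P) := fun n =>
    (hw n).bdd_mul (c := B) (hc n).aestronglyMeasurable (Eventually.of_forall (hB n))
  have i2 : Integrable (fun z => c' z * w' z) (cylMeasure T P) :=
    hw'.bdd_mul (c := B) hc'.aestronglyMeasurable (Eventually.of_forall hB')
  have e1 : ∀ n, ∫ z, c n z * w n z * φ z ∂(slabMeasure T) =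
      ∫ z, c n z * w n z * Φ z ∂(cylMeasure T P) := fun n => by
    refine hInt T (fun z => c n z * w n z) (fun t x i => ?_) (i1 n)
    have h1 := hcp n t x i
    have h2 := hwp n t x i
    simp only at h1 h2 ⊢
    rw [h1, h2]
  have e2 : ∫ z, c' z * w' z * φ z ∂(slabMeasure T) =
      ∫ z, c' z * w' z * Φ z ∂(cylMeasure T P) := by
    refine hInt T (fun z => c' z * w' z) (fun t x i => ?_) i2
    have h1 := hcp' t x i
    have h2 := hwp' t x i
    simp only at h1 h2 ⊢
    rw [h1, h2]
  simp only [e1, e2]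
  have i3 : Integrable (fun z => w' z * Φ z) (cylMeasure T P) :=
    hw'.mul_bdd (c := A) hΦ.aestronglyMeasurable (Eventually.of_forall hA)
  have h1 := hcw (fun z => w' z * Φ z) i3
  have h2 : Tendsto (fun n => ∫ z, c n z * ((w n z - w' z) * Φ z) ∂(cylMeasure T P)) atTop
      (𝓝 0) := by
    rw [tendsto_zero_iff_norm_tendsto_zero]
    have h3 := (ENNReal.tendsto_toReal ENNReal.zero_ne_top).comp hww
    have h4 := h3.const_mul (B * A)
    rw [ENNReal.toReal_zero, mul_zero] at h4
    refine squeeze_zero (fun n => norm_nonneg _) (fun n => ?_) h4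
    have i4 : Integrable (fun z => w n z - w' z) (cylMeasure T P) := (hw n).sub hw'
    have h5 : (eLpNorm (w n - w') 1 (cylMeasure T P)).toReal =
        ∫ z, ‖w n z - w' z‖ ∂(cylMeasure T P) := by
      rw [eLpNorm_one_eq_lintegral_enorm, integral_norm_eq_lintegral_enorm i4.aestronglyMeasurable]
      rfl
    simp only [Function.comp_apply]
    rw [h5, ← integral_const_mul]
    refine (norm_integral_le_integral_norm _).trans (integral_mono_of_nonneg
      (Eventually.of_forall fun z => norm_nonneg (c n z * ((w n z - w' z) * Φ z)))
      (i4.norm.const_mul (B * A)) (Eventually.of_forall fun z => ?_))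
    simp only
    rw [norm_mul, norm_mul]
    calc ‖c n z‖ * (‖w n z - w' z‖ * ‖Φ z‖) ≤ B * (‖w n z - w' z‖ * A) :=
          mul_le_mul (hB n z) (mul_le_mul_of_nonneg_left (hA z) (norm_nonneg _)) (by positivity) hB0
      _ = B * A * ‖w n z - w' z‖ := by ring
  have h3 := h1.add h2
  rw [add_zero] at h3
  have h4 : ∫ z, c' z * w' z * Φ z ∂(cylMeasure T P) = ∫ z, c' z * (w' z * Φ z) ∂(cylMeasure T P) := by
    simp only [mul_assoc]
  rw [h4]
  refine h3.congr fun n => ?_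
  have i5 : Integrable (fun z => c n z * (w' z * Φ z)) (cylMeasure T P) :=
    i3.bdd_mul (c := B) (hc n).aestronglyMeasurable (Eventually.of_forall (hB n))
  have i6 : Integrable (fun z => c n z * ((w n z - w' z) * Φ z)) (cylMeasure T P) :=
    ((integrable_fun_sub (hw n) hw').mul_bdd (c := A) hΦ.aestronglyMeasurable
      (Eventually.of_forall hA)).bdd_mul (c := B) (hc n).aestronglyMeasurable
        (Eventually.of_forall (hB n))
  rw [← integral_add i5 i6]
  congr 1; ext z; ring

lemma tendsto_integral_slab {T P : ℝ} (hP : 0 < P)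
    {w : ℕ → ℝ × E3 → ℝ} {w' : ℝ × E3 → ℝ} (hw : ∀ n, Integrable (w n) (cylMeasure T P))
    (hw' : Integrable w' (cylMeasure T P)) (hwp : ∀ n, PeriodicTX P (w n))
    (hwp' : PeriodicTX P w')
    (hww : Tendsto (fun n => eLpNorm (w n - w') 1 (cylMeasure T P)) atTop (𝓝 0))
    {φ : ℝ × E3 → ℝ} (hφ : Continuous φ) (hφs : HasCompactSupport φ) :
    Tendsto (fun n => ∫ z, w n z * φ z ∂(slabMeasure T)) atTop
      (𝓝 (∫ z, w' z * φ z ∂(slabMeasure T))) := by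
  have := tendsto_integral_slab_mul hP (c := fun _ _ => 1) (c' := fun _ => 1) (B := 1)
    (fun _ => measurable_const) measurable_const (fun _ _ => by simp) (fun _ => by simp)
    (fun _ _ _ _ => rfl) (fun _ _ _ => rfl) hw hw' hwp hwp' (fun h _ => tendsto_const_nhds) hww
    hφ hφs
  simpa only [one_mul] using this

lemma tendsto_eLpNorm_coord {m : Measure (ℝ × E3)} {u : ℕ → ℝ × E3 → E3} {u' : ℝ × E3 → E3}
    {q : ℝ≥0∞} (h : Tendsto (fun n => eLpNorm (u n - u') q m) atTop (𝓝 0)) (j : Fin 3) :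
    Tendsto (fun n => eLpNorm ((fun z => u n z j) - fun z => u' z j) q m) atTop (𝓝 0) :=
  tendsto_of_tendsto_of_tendsto_of_le_of_le tendsto_const_nhds h (fun _ => zero_le)
    fun n => eLpNorm_mono fun z => by
      simpa using PiLp.norm_apply_le (u n z - u' z) j

lemma tendsto_eLpNorm_one_of_two {m : Measure (ℝ × E3)} [IsFiniteMeasure m]
    {w : ℕ → ℝ × E3 → ℝ} {w' : ℝ × E3 → ℝ} (hw : ∀ n, Measurable (w n)) (hw' : Measurable w')
    (h : Tendsto (fun n => eLpNorm (w n - w') 2 m) atTop (𝓝 0)) :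
    Tendsto (fun n => eLpNorm (w n - w') 1 m) atTop (𝓝 0) := by
  have h1 := ENNReal.Tendsto.mul_const (b := m univ ^ (1 / (1 : ℝ≥0∞).toReal - 1 / (2 : ℝ≥0∞).toReal))
    h (Or.inr (ENNReal.rpow_ne_top_of_nonneg (by norm_num) (measure_ne_top _ _)))
  rw [zero_mul] at h1
  exact tendsto_of_tendsto_of_tendsto_of_le_of_le tendsto_const_nhds h1 (fun _ => zero_le)
    fun n => eLpNorm_le_eLpNorm_mul_rpow_measure_univ (by norm_num)
      ((hw n).sub hw').aestronglyMeasurable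

/-- The telescoped product difference is estimated by Cauchy-Schwarz, and the norm of b n is bounded
by that of its limit plus a vanishing error. -/
lemma tendsto_eLpNorm_mul {m : Measure (ℝ × E3)} {a b : ℕ → ℝ × E3 → ℝ} {a' b' : ℝ × E3 → ℝ}
    (ha : ∀ n, Measurable (a n)) (hb : ∀ n, Measurable (b n)) (ha' : Measurable a')
    (hb' : Measurable b') (ha2 : MemLp a' 2 m) (hb2 : MemLp b' 2 m)
    (hla : Tendsto (fun n => eLpNorm (a n - a') 2 m) atTop (𝓝 0))
    (hlb : Tendsto (fun n => eLpNorm (b n - b') 2 m) atTop (𝓝 0)) :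
    Tendsto (fun n => eLpNorm ((fun z => a n z * b n z) - fun z => a' z * b' z) 1 m) atTop
      (𝓝 0) := by
  have h1 : Tendsto (fun n => eLpNorm (a n - a') 2 m * (eLpNorm (b n - b') 2 m + eLpNorm b' 2 m) +
      eLpNorm a' 2 m * eLpNorm (b n - b') 2 m) atTop (𝓝 0) := by
    have h2 := ENNReal.Tendsto.mul hla (Or.inr (by
      rw [zero_add]; exact hb2.2.ne)) (hlb.add_const (eLpNorm b' 2 m)) (Or.inr (by simp))
    have h3 := h2.add (ENNReal.Tendsto.const_mul (a := eLpNorm a' 2 m) hlb (Or.inr ha2.2.ne))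
    simpa using h3
  refine tendsto_of_tendsto_of_tendsto_of_le_of_le tendsto_const_nhds h1 (fun _ => zero_le)
    fun n => ?_
  rw [eLpNorm_one_eq_lintegral_enorm]
  refine (lintegral_mul_sub_mul_le (ha n) (hb n) ha' hb').trans ?_
  refine add_le_add (mul_le_mul_right ?_ _) le_rfl
  have h4 := eLpNorm_add_le (μ := m) (p := 2) ((hb n).sub hb').aestronglyMeasurable
    hb'.aestronglyMeasurable (by norm_num)
  rwa [sub_add_cancel] at h4

lemma integral_momentum_eq {T P ν : ℝ} (hP : 0 < P) {f u : ℝ × E3 → E3} {p : ℝ × E3 → ℝ}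
    (hf : PeriodicTX P f) (hf2 : MemLp f 2 (cylMeasure T P)) (hu : PeriodicTX P u)
    (hu2 : MemLp u 2 (cylMeasure T P)) (hp : PeriodicTX P p) (hp1 : Integrable p (cylMeasure T P))
    (j : Fin 3) {φ : ℝ × E3 → ℝ} (hφ : IsTest T φ) :
    ∫ z, (u z j * dt φ z + (∑ i, u z i * u z j * dx i φ z) + p z * dx j φ z
        + ν * (u z j * lap φ z) + f z j * φ z) ∂(slabMeasure T) =
      ∫ z, u z j * dt φ z ∂(slabMeasure T) +
        (∑ i, ∫ z, u z i * u z j * dx i φ z ∂(slabMeasure T)) +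
        ∫ z, p z * dx j φ z ∂(slabMeasure T) + ν * ∫ z, u z j * lap φ z ∂(slabMeasure T) +
        ∫ z, f z j * φ z ∂(slabMeasure T) := by
  have key : ∀ {g : ℝ × E3 → ℝ} {ψ : ℝ × E3 → ℝ}, PeriodicTX P g → Integrable g (cylMeasure T P) →
      IsTest T ψ → Integrable (fun z => g z * ψ z) (slabMeasure T) := fun hg hi hψ =>
    integrable_slab_mul_of_integrable hP hg hi hψ.smooth.continuous hψ.compact
  have i1 := key (hu.coord j) (integrable_coord hu2 j) hφ.dt
  have i2 : ∀ i ∈ Finset.univ, Integrable (fun z => u z i * u z j * dx i φ z) (slabMeasure T) :=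
    fun i _ => key (hu.coord_mul i j) (integrable_coord_mul hu2 i j) (hφ.dx i)
  have i3 := key hp hp1 (hφ.dx j)
  have i4 := (key (hu.coord j) (integrable_coord hu2 j) hφ.lap).const_mul ν
  have i5 := key (hf.coord j) (integrable_coord hf2 j) hφ
  rw [integral_add (((i1.fun_add (integrable_finsetSum _ i2)).fun_add i3).fun_add i4) i5,
    integral_add ((i1.fun_add (integrable_finsetSum _ i2)).fun_add i3) i4,
    integral_add (i1.fun_add (integrable_finsetSum _ i2)) i3,
    integral_add i1 (integrable_finsetSum _ i2), integral_finsetSum _ i2, integral_const_mul]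

/-- Strong L² convergence makes the quadratic term converge in L¹, the pressure converges in L¹ by
hypothesis, and the viscous term is a convergent integral times a vanishing coefficient. -/
lemma tendsto_momentum {T P : ℝ} (hP : 0 < P) {f : ℝ × E3 → E3}
    {u₀ : E3 → E3} (hd : IsFlowData T P f u₀) {ν : ℕ → ℝ} (hν : Tendsto ν atTop (𝓝 0))
    {u : ℕ → ℝ × E3 → E3} {p : ℕ → ℝ × E3 → ℝ}
    (h : ∀ n, IsFlow T P (ν n) f u₀ (u n) (p n)) {v : ℝ × E3 → E3} {q : ℝ × E3 → ℝ}
    (hv : Measurable v) (hvp : PeriodicTX P v) (hv2 : MemLp v 2 (cylMeasure T P))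
    (hlim : Tendsto (fun n => eLpNorm (u n - v) 2 (cylMeasure T P)) atTop (𝓝 0))
    (hqp : PeriodicTX P q) (hq1 : Integrable q (cylMeasure T P))
    (hlimp : Tendsto (fun n => eLpNorm (p n - q) 1 (cylMeasure T P)) atTop (𝓝 0)) :
    MomentumEq T 0 f u₀ v q ∧ DivFree T v := by
  have hum : ∀ n j, Measurable fun z => u n z j := fun n j => by
    have := (h n).vel_meas; fun_prop
  have hvm : ∀ j, Measurable fun z => v z j := fun j => by fun_prop
  have h2 := tendsto_eLpNorm_coord hlim
  have h1 := fun j => tendsto_eLpNorm_one_of_two (hum · j) (hvm j) (h2 j)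
  have hlin : ∀ (j : Fin 3) {ψ : ℝ × E3 → ℝ}, IsTest T ψ →
      Tendsto (fun n => ∫ z, u n z j * ψ z ∂(slabMeasure T)) atTop
        (𝓝 (∫ z, v z j * ψ z ∂(slabMeasure T))) := fun j ψ hψ =>
    tendsto_integral_slab hP (fun n => integrable_coord (h n).vel_memLp j)
      (integrable_coord hv2 j) (fun n => (h n).vel_per.coord j) (hvp.coord j) (h1 j)
      hψ.smooth.continuous hψ.compact
  constructor
  · intro j φ hφ
    rw [integral_momentum_eq hP hd.force_per hd.force_memLp hvp hv2 hqp hq1 j hφ]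
    have hE : ∀ n, _ := fun n => (h n).momentum j φ hφ
    simp only [fun n => integral_momentum_eq (ν := ν n) hP hd.force_per hd.force_memLp
      (h n).vel_per (h n).vel_memLp (h n).pr_per (h n).pr_int j hφ] at hE
    have hquad : ∀ i, Tendsto (fun n => ∫ z, u n z i * u n z j * dx i φ z ∂(slabMeasure T)) atTop
        (𝓝 (∫ z, v z i * v z j * dx i φ z ∂(slabMeasure T))) := fun i =>
      tendsto_integral_slab hP (fun n => integrable_coord_mul (h n).vel_memLp i j)
        (integrable_coord_mul hv2 i j) (fun n => (h n).vel_per.coord_mul i j) (hvp.coord_mul i j)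
        (tendsto_eLpNorm_mul (hum · i) (hum · j) (hvm i) (hvm j) (memLp_apply hv2 i)
          (memLp_apply hv2 j) (h2 i) (h2 j)) (hφ.dx i).smooth.continuous (hφ.dx i).compact
    have hpr : Tendsto (fun n => ∫ z, p n z * dx j φ z ∂(slabMeasure T)) atTop
        (𝓝 (∫ z, q z * dx j φ z ∂(slabMeasure T))) :=
      tendsto_integral_slab hP (fun n => (h n).pr_int) hq1 (fun n => (h n).pr_per) hqp hlimp
        (hφ.dx j).smooth.continuous (hφ.dx j).compact
    have hall := (((((hlin j hφ.dt).add (tendsto_finsetSum Finset.univ fun i _ => hquad i)).add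
      hpr).add (hν.mul (hlin j hφ.lap))).add
        (tendsto_const_nhds (x := ∫ z, f z j * φ z ∂(slabMeasure T)))).add
        (tendsto_const_nhds (x := ∫ x, u₀ x j * φ (0, x)))
    exact tendsto_nhds_unique hall (by simp only [hE]; exact tendsto_const_nhds)
  · intro φ hφ
    have hsum : ∀ w : ℝ × E3 → E3, PeriodicTX P w → MemLp w 2 (cylMeasure T P) →
        ∫ z, (∑ i, w z i * dx i φ z) ∂(slabMeasure T) =
          ∑ i, ∫ z, w z i * dx i φ z ∂(slabMeasure T) := fun w hw hw2 =>
      integral_finsetSum _ fun i _ => integrable_slab_mul_of_integrable hP (hw.coord i)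
        (integrable_coord hw2 i) (hφ.dx i).smooth.continuous (hφ.dx i).compact
    rw [hsum v hvp hv2]
    have hE : ∀ n, _ := fun n => (h n).divFree φ hφ
    simp only [fun n => hsum (u n) (h n).vel_per (h n).vel_memLp] at hE
    refine tendsto_nhds_unique (tendsto_finsetSum Finset.univ fun i _ => hlin i (hφ.dx i)) ?_
    simp only [hE]
    exact tendsto_const_nhds

lemma integral_scalar_eq {T P κ : ℝ} (hP : 0 < P) {u : ℝ × E3 → E3} {c : ℝ × E3 → ℝ}
    (hu : PeriodicTX P u) (hu2 : MemLp u 2 (cylMeasure T P)) (hc : Measurable c)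
    (hcp : PeriodicTX P c) {B : ℝ} (hB : ∀ z, ‖c z‖ ≤ B) {φ : ℝ × E3 → ℝ} (hφ : IsTest T φ) :
    ∫ z, (c z * dt φ z + (∑ j, c z * u z j * dx j φ z) + κ * (c z * lap φ z)) ∂(slabMeasure T) =
      ∫ z, c z * 1 * dt φ z ∂(slabMeasure T) +
        (∑ j, ∫ z, c z * u z j * dx j φ z ∂(slabMeasure T)) +
        κ * ∫ z, c z * 1 * lap φ z ∂(slabMeasure T) := by
  have key : ∀ {g : ℝ × E3 → ℝ} {ψ : ℝ × E3 → ℝ}, PeriodicTX P g → Integrable g (cylMeasure T P) →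
      IsTest T ψ → Integrable (fun z => g z * ψ z) (slabMeasure T) := fun hg hi hψ =>
    integrable_slab_mul_of_integrable hP hg hi hψ.smooth.continuous hψ.compact
  have hci : Integrable c (cylMeasure T P) :=
    Integrable.of_bound hc.aestronglyMeasurable B (Eventually.of_forall hB)
  have i1 := key hcp hci hφ.dt
  have i2 : ∀ j ∈ Finset.univ, Integrable (fun z => c z * u z j * dx j φ z) (slabMeasure T) :=
    fun j _ => key (g := fun z => c z * u z j) (fun t x i => by
      have h1 := hcp t x i
      have h2 := hu t x i
      simp only at h1 h2 ⊢
      rw [h1, h2]) ((integrable_coord hu2 j).bdd_mul (c := B) hc.aestronglyMeasurable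
        (Eventually.of_forall hB)) (hφ.dx j)
  have i3 := (key hcp hci hφ.lap).const_mul κ
  simp only [mul_one]
  rw [integral_add (i1.fun_add (integrable_finsetSum _ i2)) i3,
    integral_add i1 (integrable_finsetSum _ i2), integral_finsetSum _ i2, integral_const_mul]

/-- The weak formulation of an advection-diffusion equation passes to the limit of vanishing
diffusivity, for strongly convergent velocities and weakly convergent scalars. -/
lemma tendsto_scalar {T P : ℝ} (hP : 0 < P) {u : ℕ → ℝ × E3 → E3} {v : ℝ × E3 → E3}
    (hu : ∀ n, Measurable (u n)) (hup : ∀ n, PeriodicTX P (u n))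
    (hu2 : ∀ n, MemLp (u n) 2 (cylMeasure T P))
    (hv : Measurable v) (hvp : PeriodicTX P v) (hv2 : MemLp v 2 (cylMeasure T P))
    (hlim : Tendsto (fun n => eLpNorm (u n - v) 2 (cylMeasure T P)) atTop (𝓝 0))
    {c : ℕ → ℝ × E3 → ℝ} {c' : ℝ × E3 → ℝ} (hc : ∀ n, Measurable (c n)) (hc' : Measurable c')
    (hcp : ∀ n, PeriodicTX P (c n)) (hcp' : PeriodicTX P c') {B : ℝ} (hB : ∀ n z, ‖c n z‖ ≤ B)
    (hB' : ∀ z, ‖c' z‖ ≤ B) (hcw : TendstoWeakStar (cylMeasure T P) c c') {κ : ℕ → ℝ}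
    (hκ : Tendsto κ atTop (𝓝 0)) {φ : ℝ × E3 → ℝ} (hφ : IsTest T φ) :
    Tendsto (fun n => ∫ z, (c n z * dt φ z + (∑ j, c n z * u n z j * dx j φ z)
        + κ n * (c n z * lap φ z)) ∂(slabMeasure T)) atTop
      (𝓝 (∫ z, (c' z * dt φ z + (∑ j, c' z * v z j * dx j φ z)
        + 0 * (c' z * lap φ z)) ∂(slabMeasure T))) := by
  rw [integral_scalar_eq hP hvp hv2 hc' hcp' hB' hφ]
  simp only [fun n => integral_scalar_eq (κ := κ n) hP (hup n) (hu2 n) (hc n) (hcp n) (hB n) hφ]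
  -- Terms without velocity are treated as products with the constant 1, which is why the factor 1
  -- was kept in the splitting.
  have hone : ∀ {ψ : ℝ × E3 → ℝ}, IsTest T ψ →
      Tendsto (fun n => ∫ z, c n z * 1 * ψ z ∂(slabMeasure T)) atTop
        (𝓝 (∫ z, c' z * 1 * ψ z ∂(slabMeasure T))) := fun hψ =>
    tendsto_integral_slab_mul hP (w := fun _ _ => 1) (w' := fun _ => 1) hc hc' hB hB' hcp hcp'
      (fun _ => integrable_const _) (integrable_const _) (fun _ _ _ _ => rfl) (fun _ _ _ => rfl)
      hcw (by simp) hψ.smooth.continuous hψ.compact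
  have hvel : ∀ j, Tendsto (fun n => ∫ z, c n z * u n z j * dx j φ z ∂(slabMeasure T)) atTop
      (𝓝 (∫ z, c' z * v z j * dx j φ z ∂(slabMeasure T))) := fun j =>
    tendsto_integral_slab_mul hP (w := fun n z => u n z j) (w' := fun z => v z j) hc hc' hB hB' hcp
      hcp' (fun n => integrable_coord (hu2 n) j) (integrable_coord hv2 j)
      (fun n => (hup n).coord j) (hvp.coord j) hcw
      (tendsto_eLpNorm_one_of_two (fun n => by have := hu n; fun_prop) (by fun_prop)
        (tendsto_eLpNorm_coord hlim j))
      (hφ.dx j).smooth.continuous (hφ.dx j).compact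
  exact ((hone hφ.dt).add (tendsto_finsetSum Finset.univ fun j _ => hvel j)).add
    (hκ.mul (hone hφ.lap))

/-! ### The energy inequality in the limit -/

lemma tendsto_eLpNorm_cell_integral {T P : ℝ} {g : ℕ → ℝ × E3 → ℝ} {g' : ℝ × E3 → ℝ}
    (hg : ∀ n, Measurable (g n)) (hg' : Measurable g')
    (hi : ∀ n, Integrable (g n) (cylMeasure T P)) (hi' : Integrable g' (cylMeasure T P))
    (h : Tendsto (fun n => eLpNorm (g n - g') 1 (cylMeasure T P)) atTop (𝓝 0)) :
    Tendsto (fun n => eLpNorm ((fun t => ∫ x, g n (t, x) ∂(cellMeasure P)) -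
      fun t => ∫ x, g' (t, x) ∂(cellMeasure P)) 1 (volume.restrict (Ioo 0 T))) atTop (𝓝 0) := by
  refine tendsto_of_tendsto_of_tendsto_of_le_of_le tendsto_const_nhds h (fun _ => zero_le)
    fun n => ?_
  have hgn := hg n
  rw [eLpNorm_one_eq_lintegral_enorm, eLpNorm_one_eq_lintegral_enorm]
  simp only [Pi.sub_apply]
  rw [lintegral_cyl_eq (by fun_prop)]
  refine lintegral_mono_ae ?_
  filter_upwards [ae_integrable_section (hi n), ae_integrable_section hi'] with t h1 h2
  rw [← integral_sub h1 h2]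
  exact enorm_integral_le_lintegral_enorm _

lemma tendsto_eLpNorm_norm {m : Measure (ℝ × E3)} {u : ℕ → ℝ × E3 → E3} {v : ℝ × E3 → E3}
    {q : ℝ≥0∞} (h : Tendsto (fun n => eLpNorm (u n - v) q m) atTop (𝓝 0)) :
    Tendsto (fun n => eLpNorm ((fun z => ‖u n z‖) - fun z => ‖v z‖) q m) atTop (𝓝 0) :=
  tendsto_of_tendsto_of_tendsto_of_le_of_le tendsto_const_nhds h (fun _ => zero_le)
    fun n => eLpNorm_mono fun z => by simpa using abs_norm_sub_norm_le (u n z) (v z)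

lemma tendsto_eLpNorm_inner {m : Measure (ℝ × E3)} {u : ℕ → ℝ × E3 → E3} {v f : ℝ × E3 → E3}
    (hu : ∀ n, Measurable (u n)) (hv : Measurable v) (hf : Measurable f) (hf2 : MemLp f 2 m)
    (h : Tendsto (fun n => eLpNorm (u n - v) 2 m) atTop (𝓝 0)) :
    Tendsto (fun n => eLpNorm ((fun z => inner ℝ (u n z) (f z)) - fun z => inner ℝ (v z) (f z)) 1 m)
      atTop (𝓝 0) := by
  have h1 := ENNReal.Tendsto.mul_const (b := eLpNorm f 2 m) h (Or.inr hf2.2.ne)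
  rw [zero_mul] at h1
  refine tendsto_of_tendsto_of_tendsto_of_le_of_le tendsto_const_nhds h1 (fun _ => zero_le)
    fun n => ?_
  have hun := hu n
  have h2 := lintegral_mul_le_eLpNorm (m := m) (g := fun z => ‖u n z - v z‖) (h := fun z => ‖f z‖)
    (by fun_prop) (by fun_prop)
  rw [eLpNorm_norm, eLpNorm_norm] at h2
  refine le_trans ?_ h2
  rw [eLpNorm_one_eq_lintegral_enorm]
  refine lintegral_mono fun z => ?_
  simp only [Pi.sub_apply]
  rw [← inner_sub_left, ← ofReal_norm, ← ofReal_norm, norm_mul, norm_norm, norm_norm]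
  exact ENNReal.ofReal_le_ofReal (norm_inner_le_norm _ _)

/-- The energy inequality is stable under strong convergence. -/
lemma ae_energy_le_of_tendsto {T P : ℝ} {f : ℝ × E3 → E3} (hf : Measurable f)
    (hf2 : MemLp f 2 (cylMeasure T P)) {u : ℕ → ℝ × E3 → E3} {v : ℝ × E3 → E3}
    (hu : ∀ n, Measurable (u n)) (hu2 : ∀ n, MemLp (u n) 2 (cylMeasure T P)) (hv : Measurable v)
    (hv2 : MemLp v 2 (cylMeasure T P))
    (hlim : Tendsto (fun n => eLpNorm (u n - v) 2 (cylMeasure T P)) atTop (𝓝 0)) {y₀ : ℝ}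
    (h : ∀ n, ∀ᵐ t ∂(volume.restrict (Ioo 0 T)), ∫ x, ‖u n (t, x)‖ ^ 2 ∂(cellMeasure P) ≤
      y₀ + 2 * ∫ s in (0 : ℝ)..t, ∫ x, inner ℝ (u n (s, x)) (f (s, x)) ∂(cellMeasure P)) :
    ∀ᵐ t ∂(volume.restrict (Ioo 0 T)), ∫ x, ‖v (t, x)‖ ^ 2 ∂(cellMeasure P) ≤
      y₀ + 2 * ∫ s in (0 : ℝ)..t, ∫ x, inner ℝ (v (s, x)) (f (s, x)) ∂(cellMeasure P) := by
  have hsq : ∀ {w : ℝ × E3 → E3}, MemLp w 2 (cylMeasure T P) →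
      Integrable (fun z => ‖w z‖ * ‖w z‖) (cylMeasure T P) := fun hw => by
    simpa only [pow_two] using hw.integrable_norm_pow (by norm_num)
  have l1 := tendsto_eLpNorm_cell_integral (fun n => by have := hu n; fun_prop) (by fun_prop)
    (fun n => hsq (hu2 n)) (hsq hv2) (tendsto_eLpNorm_mul (a := fun n z => ‖u n z‖)
      (b := fun n z => ‖u n z‖) (fun n => (hu n).norm) (fun n => (hu n).norm) hv.norm hv.norm
      hv2.norm hv2.norm (tendsto_eLpNorm_norm hlim) (tendsto_eLpNorm_norm hlim))
  have l2 := tendsto_eLpNorm_cell_integral (fun n => by have := hu n; fun_prop) (by fun_prop)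
    (fun n => integrable_inner hf2 (hu2 n)) (integrable_inner hf2 hv2)
    (tendsto_eLpNorm_inner hu hv hf hf2 hlim)
  -- The energies converge only in L¹ in time; a subsequence converges at almost every time, while
  -- the work of the force converges at every time along the whole sequence.
  obtain ⟨ns, hns, hae⟩ := (tendstoInMeasure_of_tendsto_eLpNorm (by norm_num)
    (fun n => (integrable_cell_integral (hsq (hu2 n))).aestronglyMeasurable)
    (integrable_cell_integral (hsq hv2)).aestronglyMeasurable l1).exists_seq_tendsto_ae
  filter_upwards [hae, ae_all_iff.2 h, ae_restrict_mem measurableSet_Ioo] with t ht1 ht2 ht3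
  have l3 : Tendsto (fun n => ∫ s in (0 : ℝ)..t, ∫ x, inner ℝ (u n (s, x)) (f (s, x))
      ∂(cellMeasure P)) atTop (𝓝 (∫ s in (0 : ℝ)..t, ∫ x, inner ℝ (v (s, x)) (f (s, x))
      ∂(cellMeasure P))) := by
    have l4 := tendsto_setIntegral_of_L1' _
      (integrable_cell_integral (integrable_inner hf2 hv2)).aestronglyMeasurable
      (Eventually.of_forall fun n => integrable_cell_integral (integrable_inner hf2 (hu2 n))) l2
      (Ioc 0 t)
    have hsub : Ioc 0 t ⊆ Ioo 0 T := fun s hs => ⟨hs.1, hs.2.trans_lt ht3.2⟩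
    rw [Measure.restrict_restrict measurableSet_Ioc, inter_eq_left.2 hsub] at l4
    simpa only [intervalIntegral.integral_of_le ht3.1.le] using l4
  simp only [← pow_two] at ht1
  exact le_of_tendsto_of_tendsto ht1 (((l3.comp hns.tendsto_atTop).const_mul 2).const_add y₀)
    (Eventually.of_forall fun n => ht2 (ns n))

/-- A negative value would persist on an interval to the right of t, which has positive length.
Approaching from the right includes t = 0. -/
lemma nonneg_of_ae_nonneg_of_continuousOn {T : ℝ} {H : ℝ → ℝ} (hH : ContinuousOn H (Icc 0 T))
    (h : ∀ᵐ t ∂(volume.restrict (Ioo 0 T)), 0 ≤ H t) {t : ℝ} (ht : t ∈ Ico 0 T) : 0 ≤ H t := by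
  have h1 : Tendsto H (𝓝[>] t) (𝓝 (H t)) :=
    (hH t (Ico_subset_Icc_self ht)).tendsto.mono_left
      (nhdsWithin_le_iff.2 (Icc_mem_nhdsGT_of_mem ht))
  refine ge_of_tendsto_of_frequently h1 fun hev => ?_
  obtain ⟨b, hb, hsub⟩ := (mem_nhdsGT_iff_exists_Ioo_subset' ht.2).1 hev
  have h2 : volume (Ioo t (min b T)) = 0 := by
    rw [ae_restrict_iff' measurableSet_Ioo, ae_iff] at h
    refine measure_mono_null (fun s hs => ?_) h
    have h3 := hsub ⟨hs.1, hs.2.trans_le (min_le_left _ _)⟩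
    exact fun h4 => h3 (h4 ⟨ht.1.trans_lt hs.1, hs.2.trans_le (min_le_right _ _)⟩)
  rw [Real.volume_Ioo, ENNReal.ofReal_eq_zero] at h2
  have := lt_min (mem_Ioi.1 hb) ht.2
  linarith

/-- A representative for which the energy inequality holds at every time. -/
lemma exists_energy_representative {T P : ℝ} (hT : 0 < T) {f : ℝ × E3 → E3}
    (hf2 : MemLp f 2 (cylMeasure T P)) {v : ℝ × E3 → E3} (hvp : PeriodicTX P v)
    (hv2 : MemLp v 2 (cylMeasure T P)) {y₀ : ℝ}
    (h : ∀ᵐ t ∂(volume.restrict (Ioo 0 T)), ∫ x, ‖v (t, x)‖ ^ 2 ∂(cellMeasure P) ≤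
      y₀ + 2 * ∫ s in (0 : ℝ)..t, ∫ x, inner ℝ (v (s, x)) (f (s, x)) ∂(cellMeasure P)) :
    ∃ w : ℝ × E3 → E3, PeriodicTX P w ∧ v =ᵐ[slabMeasure T] w ∧
      ∀ t ∈ Ico 0 T, MemLp (fun x => w (t, x)) 2 (cellMeasure P) ∧
        ∫ x, ‖w (t, x)‖ ^ 2 ∂(cellMeasure P) ≤
          y₀ + 2 * ∫ s in (0 : ℝ)..t, ∫ x, inner ℝ (w (s, x)) (f (s, x)) ∂(cellMeasure P) := by
  classical
  set A : Set ℝ := {t | MemLp (fun x => v (t, x)) 2 (cellMeasure P) ∧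
    ∫ x, ‖v (t, x)‖ ^ 2 ∂(cellMeasure P) ≤
      y₀ + 2 * ∫ s in (0 : ℝ)..t, ∫ x, inner ℝ (v (s, x)) (f (s, x)) ∂(cellMeasure P)} with hA
  have hAae : ∀ᵐ t ∂(volume.restrict (Ioo 0 T)), t ∈ A := by
    have hv2' := hv2
    rw [cylMeasure_eq_prod] at hv2'
    have h1 := hv2'.1.prodMk_left
    have h2 : Integrable (fun z => ‖v z‖ ^ 2) ((volume.restrict (Ioo 0 T)).prod (cellMeasure P)) :=
      hv2'.integrable_norm_pow (by norm_num)
    filter_upwards [h, h1, h2.prod_right_ae] with t ht ht1 ht2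
    exact ⟨(memLp_two_iff_integrable_sq_norm ht1).2 ht2, ht⟩
  -- At the exceptional times the section is put to zero: it is then square integrable, and the
  -- inequality reduces to nonnegativity of the right-hand side, which is continuous in time and
  -- nonnegative almost everywhere.
  set w : ℝ × E3 → E3 := fun z => if z.1 ∈ A then v z else 0 with hw
  have hInt : ∀ t ∈ Ico 0 T,
      ∫ s in (0 : ℝ)..t, ∫ x, inner ℝ (w (s, x)) (f (s, x)) ∂(cellMeasure P) =
        ∫ s in (0 : ℝ)..t, ∫ x, inner ℝ (v (s, x)) (f (s, x)) ∂(cellMeasure P) := by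
    intro t ht
    refine intervalIntegral.integral_congr_ae ?_
    rw [ae_restrict_iff' measurableSet_Ioo] at hAae
    filter_upwards [hAae] with s hs hst
    rw [uIoc_of_le ht.1] at hst
    simp only [hw, if_pos (hs ⟨hst.1, hst.2.trans_lt ht.2⟩)]
  refine ⟨w, fun t x i => ?_, ?_, fun t ht => ?_⟩
  · simp only [hw]
    split_ifs
    · exact hvp t x i
    · rfl
  · rw [slabMeasure_eq_prod]
    filter_upwards [Measure.quasiMeasurePreserving_fst.ae hAae] with z hz
    simp only [hw, if_pos hz]
  · rw [hInt t ht]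
    by_cases htA : t ∈ A
    · simp only [hw, if_pos htA]
      exact htA
    · simp only [hw, if_neg htA]
      refine ⟨MemLp.zero, ?_⟩
      simp only [norm_zero, ne_eq, OfNat.ofNat_ne_zero, not_false_eq_true, zero_pow,
        integral_zero]
      refine nonneg_of_ae_nonneg_of_continuousOn (T := T) (H := fun t => y₀ + 2 *
        ∫ s in (0 : ℝ)..t, ∫ x, inner ℝ (v (s, x)) (f (s, x)) ∂(cellMeasure P)) ?_ ?_ ht
      · have hG := integrable_cell_integral (integrable_inner hf2 hv2)
        have hII : IntervalIntegrable (fun s => ∫ x, inner ℝ (v (s, x)) (f (s, x))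
            ∂(cellMeasure P)) volume 0 T :=
          (intervalIntegrable_iff_integrableOn_Ioo_of_le hT.le).2 hG
        have hcont := intervalIntegral.continuousOn_primitive_interval' hII left_mem_uIcc
        rw [uIcc_of_le hT.le] at hcont
        exact continuousOn_const.add (continuousOn_const.mul hcont)
      · filter_upwards [h] with s hs
        exact le_trans (integral_nonneg fun x => by positivity) hs

/-! ### Change of representatives -/

lemma ae_cyl_of_ae_slab {T P : ℝ} {p : ℝ × E3 → Prop} (h : ∀ᵐ z ∂(slabMeasure T), p z) :
    ∀ᵐ z ∂(cylMeasure T P), p z := h.filter_mono (ae_mono (cylMeasure_le_slab T P))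

lemma ae_cell_of_ae_volume {P : ℝ} {p : E3 → Prop} (h : ∀ᵐ x, p x) :
    ∀ᵐ x ∂(cellMeasure P), p x := h.filter_mono (ae_mono (cellMeasure_le P))

lemma MomentumEq.congr {T ν : ℝ} {f f' : ℝ × E3 → E3} {u₀ u₀' : E3 → E3} {u u' : ℝ × E3 → E3}
    {p p' : ℝ × E3 → ℝ} (h : MomentumEq T ν f u₀ u p) (hf : f =ᵐ[slabMeasure T] f')
    (hu₀ : u₀ =ᵐ[volume] u₀') (hu : u =ᵐ[slabMeasure T] u') (hp : p =ᵐ[slabMeasure T] p') :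
    MomentumEq T ν f' u₀' u' p' := by
  intro j φ hφ
  refine Eq.trans ?_ (h j φ hφ)
  congr 1
  · refine integral_congr_ae ?_
    filter_upwards [hf, hu, hp] with z h1 h2 h3
    rw [h1, h2, h3]
  · refine integral_congr_ae ?_
    filter_upwards [hu₀] with x h1
    rw [h1]

lemma DivFree.congr {T : ℝ} {u u' : ℝ × E3 → E3} (h : DivFree T u)
    (hu : u =ᵐ[slabMeasure T] u') : DivFree T u' := by
  intro φ hφ
  refine Eq.trans ?_ (h φ hφ)
  refine integral_congr_ae ?_
  filter_upwards [hu] with z h1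
  rw [h1]

lemma ScalarEq.congr {T κ : ℝ} {u u' : ℝ × E3 → E3} {c₀ c₀' : E3 → ℝ} {c c' : ℝ × E3 → ℝ}
    (h : ScalarEq T κ u c₀ c) (hu : u =ᵐ[slabMeasure T] u') (hc₀ : c₀ =ᵐ[volume] c₀')
    (hc : c =ᵐ[slabMeasure T] c') : ScalarEq T κ u' c₀' c' := by
  intro φ hφ
  refine Eq.trans ?_ (h φ hφ)
  congr 1
  · refine integral_congr_ae ?_
    filter_upwards [hu, hc] with z h1 h2
    rw [h1, h2]
  · refine integral_congr_ae ?_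
    filter_upwards [hc₀] with x h1
    rw [h1]

lemma ScalarIneq.congr {T κ : ℝ} {u u' : ℝ × E3 → E3} {c₀ c₀' : E3 → ℝ} {c c' : ℝ × E3 → ℝ}
    (h : ScalarIneq T κ u c₀ c) (hu : u =ᵐ[slabMeasure T] u') (hc₀ : c₀ =ᵐ[volume] c₀')
    (hc : c =ᵐ[slabMeasure T] c') : ScalarIneq T κ u' c₀' c' := by
  intro φ hφ hφ0
  refine (h φ hφ hφ0).trans_eq ?_
  congr 1
  · refine integral_congr_ae ?_
    filter_upwards [hu, hc] with z h1 h2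
    rw [h1, h2]
  · refine integral_congr_ae ?_
    filter_upwards [hc₀] with x h1
    rw [h1]

lemma LocalEnergyIneq.congr {T ν : ℝ} {f f' : ℝ × E3 → E3} {u₀ u₀' : E3 → E3}
    {u u' : ℝ × E3 → E3} {D : Fin 3 → Fin 3 → ℝ × E3 → ℝ} {p p' : ℝ × E3 → ℝ}
    (h : LocalEnergyIneq T ν f u₀ u D p) (hf : f =ᵐ[slabMeasure T] f')
    (hu₀ : u₀ =ᵐ[volume] u₀') (hu : u =ᵐ[slabMeasure T] u') (hp : p =ᵐ[slabMeasure T] p') :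
    LocalEnergyIneq T ν f' u₀' u' D p' := by
  intro φ hφ hφ0
  refine (h φ hφ hφ0).trans_eq ?_
  congr 1
  · refine integral_congr_ae ?_
    filter_upwards [hf, hu, hp] with z h1 h2 h3
    rw [h1, h2, h3]
  · refine integral_congr_ae ?_
    filter_upwards [hu₀] with x h1
    rw [h1]

lemma HasL2Gradient.congr {T P : ℝ} {g g' : ℝ × E3 → ℝ} {G : Fin 3 → ℝ × E3 → ℝ}
    (h : HasL2Gradient T P g G) (hg : g =ᵐ[slabMeasure T] g') : HasL2Gradient T P g' G where
  periodic := h.periodic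
  memLp := h.memLp
  weak i φ hφ := by
    rw [← h.weak i φ hφ]
    refine integral_congr_ae ?_
    filter_upwards [hg] with z h1
    rw [h1]

lemma IsWeakSolution.congr {T P : ℝ} {I : ℕ} {μ : Fin (I + 1) → ℝ} {f f' : ℝ × E3 → E3}
    {u₀ u₀' : E3 → E3} {χ₀ χ₀' : Fin I → E3 → ℝ} {u u' : ℝ × E3 → E3} {p p' : ℝ × E3 → ℝ}
    {χ χ' : Fin I → ℝ × E3 → ℝ} (h : IsWeakSolution T P μ f u₀ χ₀ u p χ)
    (hf : f =ᵐ[slabMeasure T] f') (hu₀ : u₀ =ᵐ[volume] u₀') (hχ₀ : ∀ i, χ₀ i =ᵐ[volume] χ₀' i)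
    (hup : PeriodicTX P u') (hpp : PeriodicTX P p') (hχp : ∀ i, PeriodicTX P (χ' i))
    (hu : u =ᵐ[slabMeasure T] u') (hp : p =ᵐ[slabMeasure T] p')
    (hχ : ∀ i, χ i =ᵐ[slabMeasure T] χ' i) : IsWeakSolution T P μ f' u₀' χ₀' u' p' χ' where
  vel_periodic := hup
  vel_memLp := h.vel_memLp.ae_eq (ae_cyl_of_ae_slab hu)
  pressure_periodic := hpp
  pressure_integrable := h.pressure_integrable.congr (ae_cyl_of_ae_slab hp)
  scalar_periodic := hχp
  scalar_memLp i := (h.scalar_memLp i).ae_eq (ae_cyl_of_ae_slab (hχ i))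
  momentum := h.momentum.congr hf hu₀ hu hp
  divFree := h.divFree.congr hu
  scalar i := (h.scalar i).congr hu (hχ₀ i) (hχ i)

lemma IsViscousSolution.congr {T P : ℝ} {I : ℕ} {μ : Fin (I + 1) → ℝ} {f f' : ℝ × E3 → E3}
    {u₀ u₀' : E3 → E3} {χ₀ χ₀' : Fin I → E3 → ℝ} {u u' : ℝ × E3 → E3} {p p' : ℝ × E3 → ℝ}
    {χ χ' : Fin I → ℝ × E3 → ℝ} (h : IsViscousSolution T P μ f u₀ χ₀ u p χ)
    (hf : f =ᵐ[slabMeasure T] f') (hu₀ : u₀ =ᵐ[volume] u₀') (hχ₀ : ∀ i, χ₀ i =ᵐ[volume] χ₀' i)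
    (hup : PeriodicTX P u') (hpp : PeriodicTX P p') (hχp : ∀ i, PeriodicTX P (χ' i))
    (hu : u =ᵐ[slabMeasure T] u') (hp : p =ᵐ[slabMeasure T] p')
    (hχ : ∀ i, χ i =ᵐ[slabMeasure T] χ' i) : IsViscousSolution T P μ f' u₀' χ₀' u' p' χ' where
  toIsWeakSolution := h.toIsWeakSolution.congr hf hu₀ hχ₀ hup hpp hχp hu hp hχ
  scalar_gradient i := by
    obtain ⟨G, hG⟩ := h.scalar_gradient i
    exact ⟨G, hG.congr (hχ i)⟩
  flux_integrable i := by
    refine (h.flux_integrable i).congr ?_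
    filter_upwards [ae_cyl_of_ae_slab (P := P) hu, ae_cyl_of_ae_slab (P := P) hp] with z h1 h2
    rw [h1, h2]
  energy := by
    obtain ⟨D, hD, hE⟩ := h.energy
    refine ⟨D, fun j => (hD j).congr ?_, hE.congr hf hu₀ hu hp⟩
    filter_upwards [hu] with z h1
    rw [h1]
  entropy i β hβ hβ2 hi1 hi2 := by
    have hβχ : (fun z => β (χ i z)) =ᵐ[slabMeasure T] fun z => β (χ' i z) := by
      filter_upwards [hχ i] with z h1
      rw [h1]
    refine (h.entropy i β hβ hβ2 (hi1.congr (EventuallyEq.symm (ae_cyl_of_ae_slab hβχ))) fun j =>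
      (hi2 j).congr ?_).congr hu ?_ hβχ
    · filter_upwards [ae_cyl_of_ae_slab (P := P) hβχ, ae_cyl_of_ae_slab (P := P) hu] with z h1 h2
      rw [h1, h2]
    · filter_upwards [hχ₀ i] with x h1
      rw [h1]

lemma K41w.congr {T P : ℝ} {u u' : ℕ → ℝ × E3 → E3} (h : K41w T P u)
    (hu : ∀ n, u n =ᵐ[slabMeasure T] u' n) : K41w T P u' := by
  obtain ⟨β, hβ, C, hC, k, hk⟩ := h
  refine ⟨β, hβ, C, hC, k, fun n m hm => ?_⟩
  refine le_trans (le_of_eq ?_) (hk n m hm)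
  congr 1
  refine integral_congr_ae ?_
  have h1 := ae_cyl_of_ae_slab (P := P) (hu n)
  rw [cylMeasure_eq_prod] at h1
  filter_upwards [Measure.ae_ae_of_ae_prod h1] with t ht
  simp only [modeEnergy]
  refine Finset.sum_congr rfl fun j _ => ?_
  congr 2
  simp only [fourierCoef]
  congr 1
  refine integral_congr_ae ?_
  filter_upwards [ht] with x hx
  rw [hx]

lemma TendstoWeakStar.congr {m : Measure (ℝ × E3)} {g g₁ : ℕ → ℝ × E3 → ℝ} {g' : ℝ × E3 → ℝ}
    (h : TendstoWeakStar m g g') (hg : ∀ n, g n =ᵐ[m] g₁ n) : TendstoWeakStar m g₁ g' := by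
  intro k hk
  refine (h k hk).congr fun n => integral_congr_ae ?_
  filter_upwards [hg n] with z hz
  rw [hz]

lemma IsYoungMeasure.congr {T P : ℝ} {v v' : ℕ → ℝ × E3 → ℝ} {ν : Kernel (ℝ × E3) ℝ}
    (h : IsYoungMeasure T P v ν) (hv : ∀ n, v n =ᵐ[cylMeasure T P] v' n) :
    IsYoungMeasure T P v' ν where
  markov := h.markov
  periodic := h.periodic
  carried := h.carried
  tendsto β hβ := (h.tendsto β hβ).congr fun n => by
    filter_upwards [hv n] with z hz
    rw [hz]

/-! ### The vanishing viscosity limit -/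

lemma integral_kernel_mem_Icc {ν : Kernel (ℝ × E3) ℝ} [IsMarkovKernel ν]
    (hν : ∀ z, ν z (Icc 0 1)ᶜ = 0) (z : ℝ × E3) : ∫ s, s ∂(ν z) ∈ Icc (0 : ℝ) 1 := by
  have h := ae_mem_Icc_of_carried hν z
  refine ⟨integral_nonneg_of_ae (h.mono fun s hs => hs.1), ?_⟩
  have h1 : ∫ s, s ∂(ν z) ≤ ∫ _s, (1 : ℝ) ∂(ν z) :=
    integral_mono_of_nonneg (h.mono fun s hs => hs.1) (integrable_const _)
      (h.mono fun s hs => hs.2)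
  simpa using h1

/-- Measurable admissible solutions with concentrations between `0` and `1`. -/
structure IsRegularSolution (T P : ℝ) {I : ℕ} (μ : Fin (I + 1) → ℝ) (f : ℝ × E3 → E3)
    (u₀ : E3 → E3) (χ₀ : Fin I → E3 → ℝ)
    (u : ℝ × E3 → E3) (p : ℝ × E3 → ℝ) (χ : Fin I → ℝ × E3 → ℝ) : Prop
    extends IsViscousSolution T P μ f u₀ χ₀ u p χ where
  vel_meas : Measurable u
  pr_meas : Measurable p
  scalar_meas : ∀ i, Measurable (χ i)
  scalar_mem : ∀ i z, χ i z ∈ Icc (0 : ℝ) 1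

lemma IsRegularSolution.isFlow {T P : ℝ} {I : ℕ} {μ : Fin (I + 1) → ℝ} {f : ℝ × E3 → E3}
    {u₀ : E3 → E3} {χ₀ : Fin I → E3 → ℝ} {u : ℝ × E3 → E3} {p : ℝ × E3 → ℝ}
    {χ : Fin I → ℝ × E3 → ℝ} (h : IsRegularSolution T P μ f u₀ χ₀ u p χ) :
    IsFlow T P (μ 0) f u₀ u p where
  vel_meas := h.vel_meas
  vel_per := h.vel_periodic
  vel_memLp := h.vel_memLp
  pr_meas := h.pr_meas
  pr_per := h.pressure_periodic
  pr_int := h.pressure_integrable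
  momentum := h.momentum
  divFree := h.divFree

lemma IsRegularSolution.ae_energy_le {T P : ℝ} (hP : 0 < P) {I : ℕ} {μ : Fin (I + 1) → ℝ}
    (hμ : 0 ≤ μ 0) {f : ℝ × E3 → E3} {u₀ : E3 → E3} (hd : IsFlowData T P f u₀)
    {χ₀ : Fin I → E3 → ℝ} {u : ℝ × E3 → E3} {p : ℝ × E3 → ℝ}
    {χ : Fin I → ℝ × E3 → ℝ} (h : IsRegularSolution T P μ f u₀ χ₀ u p χ) :
    ∀ᵐ t ∂(volume.restrict (Ioo 0 T)), ∫ x, ‖u (t, x)‖ ^ 2 ∂(cellMeasure P) ≤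
      ∫ x, ‖u₀ x‖ ^ 2 ∂(cellMeasure P)
        + 2 * ∫ s in (0 : ℝ)..t, ∫ x, inner ℝ (u (s, x)) (f (s, x)) ∂(cellMeasure P) := by
  obtain ⟨D, hD, hE⟩ := h.energy
  exact hE.ae_energy_le hP hμ hd.force_meas hd.force_per hd.force_memLp h.vel_meas h.vel_periodic
    h.vel_memLp h.pr_meas h.pressure_periodic h.flux_integrable hD hd.vel_meas hd.vel_per
    hd.vel_memLp

/-- The transport inequality for convex functions of bounded concentrations. -/
lemma IsRegularSolution.scalarIneq {T P : ℝ} {I : ℕ} {μ : Fin (I + 1) → ℝ} {f : ℝ × E3 → E3}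
    {u₀ : E3 → E3} {χ₀ : Fin I → E3 → ℝ} {u : ℝ × E3 → E3} {p : ℝ × E3 → ℝ}
    {χ : Fin I → ℝ × E3 → ℝ} (h : IsRegularSolution T P μ f u₀ χ₀ u p χ) (i : Fin I)
    {β : ℝ → ℝ} (hβ : ContDiff ℝ 2 β) (hβ2 : ∀ s, 0 ≤ iteratedDeriv 2 β s) :
    ScalarIneq T (μ i.succ) u (fun x => β (χ₀ i x)) (fun z => β (χ i z)) := by
  obtain ⟨B, -, hB⟩ := exists_bound_comp_clamp hβ.continuous
  have hb : ∀ z, ‖β (χ i z)‖ ≤ B := fun z => by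
    rw [← clamp_eq_self (h.scalar_mem i z)]; exact hB _
  have hm : Measurable fun z => β (χ i z) := hβ.continuous.measurable.comp (h.scalar_meas i)
  exact h.entropy i β hβ hβ2
    (Integrable.of_bound hm.aestronglyMeasurable B (Eventually.of_forall hb)) fun j =>
      (integrable_coord h.vel_memLp j).bdd_mul (c := B) hm.aestronglyMeasurable
        (Eventually.of_forall hb)

/-- Compactness of the velocities and the pressures of a sequence of solutions. -/
lemma exists_subseq_velocity {T P : ℝ} (hT : 0 < T) (hP : 0 < P) {I : ℕ} {f : ℝ × E3 → E3}
    {u₀ : E3 → E3} (hd : IsFlowData T P f u₀) {χ₀ : Fin I → E3 → ℝ} {μ : ℕ → Fin (I + 1) → ℝ}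
    (hμ : ∀ n, 0 ≤ μ n 0) (hμ0 : Tendsto (fun n => μ n 0) atTop (𝓝 0))
    {u : ℕ → ℝ × E3 → E3} {p : ℕ → ℝ × E3 → ℝ} {χ : ℕ → Fin I → ℝ × E3 → ℝ}
    (h : ∀ n, IsRegularSolution T P (μ n) f u₀ χ₀ (u n) (p n) (χ n)) (hK : K41w T P u) :
    ∃ (q : ℝ) (σ : ℕ → ℕ) (v : ℝ × E3 → E3) (r : ℝ × E3 → ℝ), 2 < q ∧ StrictMono σ ∧
      Measurable v ∧ PeriodicTX P v ∧ MemLp v 2 (cylMeasure T P) ∧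
      MemLp v (ENNReal.ofReal q) (cylMeasure T P) ∧
      Tendsto (fun n => eLpNorm (u (σ n) - v) 2 (cylMeasure T P)) atTop (𝓝 0) ∧
      Tendsto (fun n => eLpNorm (u (σ n) - v) (ENNReal.ofReal q) (cylMeasure T P)) atTop (𝓝 0) ∧
      PeriodicTX P r ∧ Integrable r (cylMeasure T P) ∧ MomentumEq T 0 f u₀ v r ∧ DivFree T v := by
  have hflow := fun n => (h n).isFlow.meanZero hP hd
  set M : ℝ := 2 * (∫ x, ‖u₀ x‖ ^ 2 ∂(cellMeasure P)) + 4 * T * ∫ z, ‖f z‖ ^ 2 ∂(cylMeasure T P)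
    with hMdef
  have hM0 : 0 ≤ M := by
    have h1 : 0 ≤ ∫ x, ‖u₀ x‖ ^ 2 ∂(cellMeasure P) := integral_nonneg fun x => by positivity
    have h2 : 0 ≤ ∫ z, ‖f z‖ ^ 2 ∂(cylMeasure T P) := integral_nonneg fun x => by positivity
    positivity
  have hM : ∀ n, ∀ᵐ t ∂(volume.restrict (Ioo 0 T)),
      ∫⁻ x, ‖u n (t, x)‖ₑ ^ 2 ∂(cellMeasure P) ≤ ENNReal.ofReal M := fun n =>
    ae_lintegral_sq_le (h n).vel_memLp (ae_energy_le_of_ae_le hT (h n).vel_memLp hd.force_memLp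
      ((h n).ae_energy_le hP (hμ n) hd))
  obtain ⟨s, hs, C, hC, hmod⟩ := hK.exists_translate_le hP (fun n => (h n).vel_meas)
    (fun n => (h n).vel_periodic) (ENNReal.ofReal_ne_top (r := T * M)) fun n j =>
      (lintegral_mono fun z => by gcongr; exact enorm_coord_le _ _).trans
        (lintegral_cyl_sq_le hT (h n).vel_meas (hM n))
  obtain ⟨N, hN⟩ := (Metric.isBounded_range_of_tendsto _ hμ0).exists_norm_le
  obtain ⟨σ, hσ, v, r, ⟨hv, hvp, hv2, hlim⟩, -, hrp, hr1, hlimr⟩ :=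
    exists_subseq_tendsto_flow hT hP hd hflow (ENNReal.ofReal_ne_top (r := N)) (fun n => by
      -- A convergent sequence of viscosities is bounded, which gives the constant N.
      rw [← ofReal_norm]
      exact ENNReal.ofReal_le_ofReal (hN _ (mem_range_self n)))
      (fun n => ae_integral_meanZero hP (h n).pressure_integrable) hM0 hM hs hC hmod
  rw [memLp_one_iff_integrable] at hr1
  obtain ⟨q, hq, hvq, hlimq⟩ := exists_tendsto_eLpNorm hP (fun n => (h (σ n)).vel_meas)
    (fun n => (h (σ n)).vel_periodic) (fun n => (h (σ n)).vel_memLp) hv hv2 hlim hM0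
    (fun n => hM (σ n)) hs hC fun n => hmod (σ n)
  obtain ⟨hmom, hdiv⟩ := tendsto_momentum hP hd (hμ0.comp hσ.tendsto_atTop)
    (fun n => hflow (σ n)) hv hvp hv2 hlim hrp hr1 hlimr
  exact ⟨q, σ, v, r, hq, hσ, hv, hvp, hv2, hvq, hlim, hlimq, hrp, hr1, hmom, hdiv⟩

/-- The vanishing viscosity limit for measurable data and solutions. -/
theorem exists_inviscid_limit {T P : ℝ} (hT : 0 < T) (hP : 0 < P) {I : ℕ} {f : ℝ × E3 → E3}
    {u₀ : E3 → E3} (hd : IsFlowData T P f u₀) {χ₀ : Fin I → E3 → ℝ} {μ : ℕ → Fin (I + 1) → ℝ}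
    (hμ : ∀ n, 0 ≤ μ n 0) (hμ0 : Tendsto μ atTop (𝓝 0))
    {u : ℕ → ℝ × E3 → E3} {p : ℕ → ℝ × E3 → ℝ} {χ : ℕ → Fin I → ℝ × E3 → ℝ}
    (h : ∀ n, IsRegularSolution T P (μ n) f u₀ χ₀ (u n) (p n) (χ n)) (hK : K41w T P u) :
    ∃ (q : ℝ) (σ : ℕ → ℕ) (w : ℝ × E3 → E3) (r : ℝ × E3 → ℝ) (χ' : Fin I → ℝ × E3 → ℝ)
      (ν : Fin I → Kernel (ℝ × E3) ℝ),
      2 < q ∧ StrictMono σ ∧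
      MemLp w 2 (cylMeasure T P) ∧ MemLp w (ENNReal.ofReal q) (cylMeasure T P) ∧
      Tendsto (fun n => eLpNorm (u (σ n) - w) 2 (cylMeasure T P)) atTop (𝓝 0) ∧
      Tendsto (fun n => eLpNorm (u (σ n) - w) (ENNReal.ofReal q) (cylMeasure T P))
        atTop (𝓝 0) ∧
      (∀ i, (∀ᵐ z ∂(cylMeasure T P), χ' i z ∈ Icc (0 : ℝ) 1) ∧
        TendstoWeakStar (cylMeasure T P) (fun n => χ (σ n) i) (χ' i)) ∧
      IsWeakSolution T P 0 f u₀ χ₀ w r χ' ∧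
      (∀ t ∈ Ico 0 T, MemLp (fun x => w (t, x)) 2 (cellMeasure P) ∧
        ∫ x, ‖w (t, x)‖ ^ 2 ∂(cellMeasure P) ≤ ∫ x, ‖u₀ x‖ ^ 2 ∂(cellMeasure P)
          + 2 * ∫ s in (0 : ℝ)..t, ∫ x, inner ℝ (w (s, x)) (f (s, x)) ∂(cellMeasure P)) ∧
      (∀ i, IsYoungMeasure T P (fun n => χ (σ n) i) (ν i) ∧
        ∀ β : ℝ → ℝ, ContDiff ℝ 2 β → (∀ s, 0 ≤ iteratedDeriv 2 β s) →
          ScalarIneq T 0 w (fun x => β (χ₀ i x)) (fun z => ∫ s, β s ∂(ν i z))) := by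
  have hμj : ∀ j, Tendsto (fun n => μ n j) atTop (𝓝 0) := fun j => tendsto_pi_nhds.1 hμ0 j
  obtain ⟨q, σ₁, v, r, hq, hσ₁, hv, hvp, hv2, hvq, hlim, hlimq, hrp, hr1, hmom, hdiv⟩ :=
    exists_subseq_velocity hT hP hd hμ (hμj 0) h hK
  -- Extracting after the velocities have converged gives one subsequence for everything. The limit
  -- concentrations are then the barycentres of the Young measures, the case of the identity β, and
  -- need no separate extraction.
  obtain ⟨σ₂, hσ₂, ν, hY⟩ := exists_youngMeasure hT hP (v := fun n => χ (σ₁ n))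
    (fun n i => (h (σ₁ n)).scalar_meas i) fun n i z => (h (σ₁ n)).scalar_mem i z
  obtain ⟨w, hwp, hvw, hwE⟩ := exists_energy_representative hT hd.force_memLp hvp hv2
    (ae_energy_le_of_tendsto hd.force_meas hd.force_memLp (fun n => (h (σ₁ n)).vel_meas)
      (fun n => (h (σ₁ n)).vel_memLp) hv hv2 hlim fun n => (h (σ₁ n)).ae_energy_le hP (hμ _) hd)
  have hvw' : v =ᵐ[cylMeasure T P] w := ae_cyl_of_ae_slab hvw
  have hconv : ∀ {a : ℝ≥0∞},
      Tendsto (fun n => eLpNorm (u (σ₁ n) - v) a (cylMeasure T P)) atTop (𝓝 0) →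
      Tendsto (fun n => eLpNorm (u (σ₁ (σ₂ n)) - w) a (cylMeasure T P)) atTop (𝓝 0) :=
    fun ha => (ha.comp hσ₂.tendsto_atTop).congr fun n =>
      eLpNorm_congr_ae ((EventuallyEq.refl _ _).sub hvw')
  have hmk : ∀ i, IsMarkovKernel (ν i) := fun i => (hY i).markov
  have hscal : ∀ (i : Fin I) {β : ℝ → ℝ}, Continuous β → ∀ {φ : ℝ × E3 → ℝ}, IsTest T φ →
      Tendsto (fun n => ∫ z, (β (χ (σ₁ (σ₂ n)) i z) * dt φ z
        + (∑ j, β (χ (σ₁ (σ₂ n)) i z) * u (σ₁ (σ₂ n)) z j * dx j φ z)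
        + μ (σ₁ (σ₂ n)) i.succ * (β (χ (σ₁ (σ₂ n)) i z) * lap φ z)) ∂(slabMeasure T)) atTop
      (𝓝 (∫ z, ((∫ s, β s ∂(ν i z)) * dt φ z + (∑ j, (∫ s, β s ∂(ν i z)) * v z j * dx j φ z)
        + 0 * ((∫ s, β s ∂(ν i z)) * lap φ z)) ∂(slabMeasure T))) := by
    intro i β hβ φ hφ
    obtain ⟨B, -, hB⟩ := exists_bound_comp_clamp hβ
    refine tendsto_scalar hP (u := fun n => u (σ₁ (σ₂ n))) (c := fun n z => β (χ (σ₁ (σ₂ n)) i z))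
      (c' := fun z => ∫ s, β s ∂(ν i z)) (B := B) (κ := fun n => μ (σ₁ (σ₂ n)) i.succ)
      (fun n => (h _).vel_meas) (fun n => (h _).vel_periodic) (fun n => (h _).vel_memLp)
      hv hvp hv2 (hlim.comp hσ₂.tendsto_atTop)
      (fun n => hβ.measurable.comp ((h _).scalar_meas i)) (measurable_integral_kernel hβ)
      (fun n t x j => ?_) (fun t x j => ?_) (fun n z => ?_) (fun z => ?_) ((hY i).tendsto β hβ)
      ((hμj i.succ).comp (hσ₁.comp hσ₂).tendsto_atTop) hφ
    · have := (h (σ₁ (σ₂ n))).scalar_periodic i t x j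
      simp only at this ⊢
      rw [this]
    · have := (hY i).periodic t x j
      simp only at this ⊢
      rw [this]
    · rw [← clamp_eq_self ((h (σ₁ (σ₂ n))).scalar_mem i z)]; exact hB _
    · rw [integral_kernel_eq_clamp (hY i).carried]
      exact norm_integral_kernel_le hB z
  have hmem : ∀ i z, ∫ s, s ∂(ν i z) ∈ Icc (0 : ℝ) 1 := fun i z =>
    integral_kernel_mem_Icc (hY i).carried z
  refine ⟨q, fun n => σ₁ (σ₂ n), w, r, fun i z => ∫ s, s ∂(ν i z), ν, hq, hσ₁.comp hσ₂,
    hv2.ae_eq hvw', hvq.ae_eq hvw', hconv hlim, hconv hlimq,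
    fun i => ⟨Eventually.of_forall (hmem i), (hY i).tendsto id continuous_id⟩, ?_, hwE,
    fun i => ⟨hY i, fun β hβ hβ2 => ?_⟩⟩
  -- The equations are verified for the measurable limit v and transferred to w, which agrees with
  -- it almost everywhere and carries the energy inequality at every time.
  · have hsol : IsWeakSolution T P 0 f u₀ χ₀ v r fun i z => ∫ s, s ∂(ν i z) :=
      { vel_periodic := hvp
        vel_memLp := hv2
        pressure_periodic := hrp
        pressure_integrable := hr1
        scalar_periodic := fun i t x j => by
          have := (hY i).periodic t x j
          simp only at this ⊢
          rw [this]
        scalar_memLp := fun i => MemLp.of_bound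
          (measurable_integral_kernel continuous_id).aestronglyMeasurable 1
          (Eventually.of_forall fun z => by
            rw [Real.norm_of_nonneg (hmem i z).1]; exact (hmem i z).2)
        momentum := hmom
        divFree := hdiv
        scalar := fun i φ hφ => by
          have h1 := (hscal i continuous_id hφ).add_const (∫ x, χ₀ i x * φ (0, x))
          refine tendsto_nhds_unique h1 ?_
          have h2 : ∀ n, _ := fun n => (h (σ₁ (σ₂ n))).scalar i φ hφ
          simp only [id, h2]
          exact tendsto_const_nhds }
    exact hsol.congr (EventuallyEq.refl _ _) (EventuallyEq.refl _ _)
      (fun i => EventuallyEq.refl _ _) hwp hrp hsol.scalar_periodic hvw (EventuallyEq.refl _ _)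
      fun i => EventuallyEq.refl _ _
  · have hineq : ScalarIneq T 0 v (fun x => β (χ₀ i x)) fun z => ∫ s, β s ∂(ν i z) := by
      intro φ hφ hφ0
      exact ge_of_tendsto' ((hscal i hβ.continuous hφ).add_const (∫ x, β (χ₀ i x) * φ (0, x)))
        fun n => (h (σ₁ (σ₂ n))).scalarIneq i hβ hβ2 φ hφ hφ0
    exact hineq.congr hvw (EventuallyEq.refl _ _) (EventuallyEq.refl _ _)

/-- Measurable representatives of a solution, with concentrations between `0` and `1`. -/
lemma IsViscousSolution.exists_regular {T P : ℝ} (hP : 0 < P) {I : ℕ} {μ : Fin (I + 1) → ℝ}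
    {f f' : ℝ × E3 → E3} {u₀ u₀' : E3 → E3} {χ₀ : Fin I → E3 → ℝ} {u : ℝ × E3 → E3}
    {p : ℝ × E3 → ℝ} {χ : Fin I → ℝ × E3 → ℝ} (hdata : IsData T P f u₀ χ₀)
    (h : IsViscousSolution T P μ f u₀ χ₀ u p χ) (hf : f =ᵐ[slabMeasure T] f')
    (hu₀ : u₀ =ᵐ[volume] u₀') :
    ∃ (u' : ℝ × E3 → E3) (p' : ℝ × E3 → ℝ) (χ' : Fin I → ℝ × E3 → ℝ),
      IsRegularSolution T P μ f' u₀' χ₀ u' p' χ' ∧ u =ᵐ[slabMeasure T] u' ∧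
        ∀ i, χ i =ᵐ[slabMeasure T] χ' i := by
  obtain ⟨u', hum, hup, hu⟩ := exists_measurable_periodicTX hP h.vel_periodic h.vel_memLp.1
  obtain ⟨p', hpm, hpp, hp⟩ := exists_measurable_periodicTX hP h.pressure_periodic
    h.pressure_integrable.1
  choose c hcm hcp hc using fun i => exists_measurable_periodicTX hP (h.scalar_periodic i)
    (h.scalar_memLp i).1
  have h1 := h.congr (EventuallyEq.refl _ _) (EventuallyEq.refl _ _)
    (fun i => EventuallyEq.refl _ _) hup hpp hcp hu hp hc
  -- The maximum principle holds almost everywhere; truncation makes the bounds hold at every point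
  -- without changing the class.
  have hcl : ∀ i, χ i =ᵐ[slabMeasure T] fun z => clamp (c i z) := fun i => by
    have h2 : ∀ᵐ z ∂(slabMeasure T), c i z ∈ Icc (0 : ℝ) 1 := by
      refine ae_slab_of_ae_cyl hP (fun t x j => ?_) (h1.mem_Icc hP hdata hum hcm i)
      have := hcp i t x j
      simp only at this ⊢
      rw [this]
    filter_upwards [hc i, h2] with z hz1 hz2
    rw [hz1, clamp_eq_self hz2]
  refine ⟨u', p', fun i z => clamp (c i z), ⟨?_, hum, hpm,
    fun i => continuous_clamp.measurable.comp (hcm i), fun i z => clamp_mem _⟩, hu, hcl⟩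
  refine h.congr hf hu₀ (fun i => EventuallyEq.refl _ _) hup hpp (fun i t x j => ?_) hu hp hcl
  have := hcp i t x j
  simp only at this ⊢
  rw [this]

end PassiveScalar

end

/-! ### The main theorem for arbitrary representatives of data and solutions -/

open PassiveScalar

theorem theorem6p1
    (T P : ℝ) (hT : 0 < T) (hP : 0 < P) (I : ℕ)
    (f : ℝ × E3 → E3) (u₀ : E3 → E3) (χ₀ : Fin I → E3 → ℝ) (hdata : IsData T P f u₀ χ₀)
    (μ : ℕ → Fin (I + 1) → ℝ) (hμ : ∀ n j, 0 < μ n j) (hμ0 : Tendsto μ atTop (𝓝 0))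
    (uμ : ℕ → ℝ × E3 → E3) (pμ : ℕ → ℝ × E3 → ℝ) (χμ : ℕ → Fin I → ℝ × E3 → ℝ)
    (hsol : ∀ n, IsViscousSolution T P (μ n) f u₀ χ₀ (uμ n) (pμ n) (χμ n))
    (hK : K41w T P uμ) :
    (∀ n i, ∀ᵐ z ∂(cylMeasure T P), χμ n i z ∈ Icc (0 : ℝ) 1) ∧
    ∃ (q : ℝ) (σ : ℕ → ℕ) (u : ℝ × E3 → E3) (p : ℝ × E3 → ℝ) (χ : Fin I → ℝ × E3 → ℝ)
      (ν : Fin I → Kernel (ℝ × E3) ℝ),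
      2 < q ∧ StrictMono σ ∧
      -- strong convergence of the velocities in `L² ∩ L^q`
      MemLp u 2 (cylMeasure T P) ∧ MemLp u (ENNReal.ofReal q) (cylMeasure T P) ∧
      Tendsto (fun n => eLpNorm (uμ (σ n) - u) 2 (cylMeasure T P)) atTop (𝓝 0) ∧
      Tendsto (fun n => eLpNorm (uμ (σ n) - u) (ENNReal.ofReal q) (cylMeasure T P))
        atTop (𝓝 0) ∧
      -- weak-star convergence of the scalars
      (∀ i, (∀ᵐ z ∂(cylMeasure T P), χ i z ∈ Icc (0 : ℝ) 1) ∧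
        TendstoWeakStar (cylMeasure T P) (fun n => χμ (σ n) i) (χ i)) ∧
      -- the limit solves the inviscid system with the same data
      IsWeakSolution T P 0 f u₀ χ₀ u p χ ∧
      -- energy inequality
      (∀ t ∈ Ico 0 T, MemLp (fun x => u (t, x)) 2 (cellMeasure P) ∧
        ∫ x, ‖u (t, x)‖ ^ 2 ∂(cellMeasure P) ≤ ∫ x, ‖u₀ x‖ ^ 2 ∂(cellMeasure P)
          + 2 * ∫ s in (0 : ℝ)..t, ∫ x, inner ℝ (u (s, x)) (f (s, x)) ∂(cellMeasure P)) ∧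
      -- Young measures, and the inequality for convex functions of the scalars
      (∀ i, IsYoungMeasure T P (fun n => χμ (σ n) i) (ν i) ∧
        ∀ β : ℝ → ℝ, ContDiff ℝ 2 β → (∀ s, 0 ≤ iteratedDeriv 2 β s) →
          ScalarIneq T 0 u (fun x => β (χ₀ i x)) (fun z => ∫ s, β s ∂(ν i z))) := by
  obtain ⟨f', hfm, hfp, hf⟩ := exists_measurable_periodicTX hP hdata.force_periodic
    hdata.force_memLp.1
  obtain ⟨u₀', hu₀m, hu₀p, hu₀⟩ := exists_measurable_periodicX hP hdata.vel_periodic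
    hdata.vel_memLp.1
  have hd : IsFlowData T P f' u₀' := ⟨hfm, hfp, hdata.force_memLp.ae_eq (ae_cyl_of_ae_slab hf),
    hu₀m, hu₀p, hdata.vel_memLp.ae_eq (ae_cell_of_ae_volume hu₀)⟩
  -- The limit is taken for Borel representatives; each conclusion depends only on almost-everywhere
  -- classes of the data and of the approximating solutions, and is transferred back.
  choose u' p' χ' hreg hu hχ using fun n => (hsol n).exists_regular hP hdata hf hu₀
  have hχ' : ∀ n i, χ' n i =ᵐ[cylMeasure T P] χμ n i := fun n i =>
    EventuallyEq.symm (ae_cyl_of_ae_slab (hχ n i))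
  refine ⟨fun n i => ?_, ?_⟩
  · filter_upwards [hχ' n i] with z hz
    rw [← hz]
    exact (hreg n).scalar_mem i z
  obtain ⟨q, σ, w, r, c, ν, hq, hσ, hw2, hwq, hl2, hlq, hc, hws, hE, hY⟩ :=
    exists_inviscid_limit hT hP hd (fun n => (hμ n 0).le) hμ0 hreg (hK.congr hu)
  have hconv : ∀ {a : ENNReal},
      Tendsto (fun n => eLpNorm (u' (σ n) - w) a (cylMeasure T P)) atTop (𝓝 0) →
      Tendsto (fun n => eLpNorm (uμ (σ n) - w) a (cylMeasure T P)) atTop (𝓝 0) :=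
    fun ha => ha.congr fun n => eLpNorm_congr_ae
      ((EventuallyEq.symm (ae_cyl_of_ae_slab (hu (σ n)))).sub (EventuallyEq.refl _ _))
  refine ⟨q, σ, w, r, c, ν, hq, hσ, hw2, hwq, hconv hl2, hconv hlq,
    fun i => ⟨(hc i).1, (hc i).2.congr fun n => hχ' (σ n) i⟩,
    hws.congr hf.symm hu₀.symm (fun i => EventuallyEq.refl _ _) hws.vel_periodic
      hws.pressure_periodic hws.scalar_periodic (EventuallyEq.refl _ _) (EventuallyEq.refl _ _)
      fun i => EventuallyEq.refl _ _,
    fun t ht => ⟨(hE t ht).1, (hE t ht).2.trans_eq ?_⟩,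
    fun i => ⟨(hY i).1.congr fun n => hχ' (σ n) i, (hY i).2⟩⟩
  have h1 : ∫ x, ‖u₀' x‖ ^ 2 ∂(cellMeasure P) = ∫ x, ‖u₀ x‖ ^ 2 ∂(cellMeasure P) := by
    refine integral_congr_ae ?_
    filter_upwards [ae_cell_of_ae_volume (P := P) hu₀] with x hx
    rw [hx]
  have h2 : ∫ s in (0 : ℝ)..t, ∫ x, inner ℝ (w (s, x)) (f' (s, x)) ∂(cellMeasure P) =
      ∫ s in (0 : ℝ)..t, ∫ x, inner ℝ (w (s, x)) (f (s, x)) ∂(cellMeasure P) := by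
    refine intervalIntegral.integral_congr_ae ?_
    have h3 := ae_cyl_of_ae_slab (P := P) hf
    rw [cylMeasure_eq_prod] at h3
    have h4 := Measure.ae_ae_of_ae_prod h3
    rw [ae_restrict_iff' measurableSet_Ioo] at h4
    filter_upwards [h4] with s hs hst
    rw [uIoc_of_le ht.1] at hst
    refine integral_congr_ae ?_
    filter_upwards [hs ⟨hst.1, hst.2.trans_lt ht.2⟩] with x hx
    rw [hx]
  rw [h1, h2]
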